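/- Let $n\ge 2$, let $(M,g)$ be a compact connected smooth $n$-dimensional Riemannian manifold with boundary, and let $T>0$. Let $L^2\Omega^1(M)$ and $H^1\Omega^1(M)$ be the completions of the smooth 1-forms on $M$ for the norms given by $\|u\|_{L^2}^2=\int_M |u|_g^2\,dV_g$ and $\|u\|_{H^1}^2=\int_M(|u|_g^2+|\nabla u|_g^2)\,dV_g$, where $\nabla$ is the Levi-Civita connection, and let $H^1_0\Omega^1(M)$ be the closure in $H^1\Omega^1(M)$ of the set $C_0^\infty\Omega^1(M)$ of smooth 1-forms with compact support in the interior of $M$. Let $d$ be the exterior derivative, $d^*=-{\ast}\,d\,{\ast}$ the codifferential on 1-forms, $\langle\cdot,\cdot\rangle$ the $L^2$ inner product of forms, and set $$W=\{u\in C_0^\infty\Omega^1(M): d^*u=0\},\qquad V=\{v\in H^1_0\Omega^1(M): d^*v=0\},\qquad H=\overline{W}^{\,L^2\Omega^1(M)} .$$ Elements of $V$ are regarded as elements of the dual $V'$ through $u\mapsto\langle u,\cdot\rangle$. Let $-\Delta_H=dd^*+d^*d$ act weakly on $V$, $\langle-\Delta_H u,v\rangle=\langle du,dv\rangle+\langle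 d^*u,d^*v\rangle$ (the last term vanishes for $u,v\in V$). **Theorem.** Let $f\in L^2([0,T];L^2\Omega^1(M))$, $u_0\in V$ and $u_1\in H$. Then there is a unique $$u\in C([0,T];V)\cap C^1([0,T];H)\cap H^2([0,T];V')$$ such that for almost every $t\in(0,T)$ $$\langle(\partial_t^2-\Delta_H)u(t),v\rangle=\langle f(t),v\rangle\qquad\text{for all } v\in V,$$ and $u(0)=u_0$, $\partial_tu(0)=u_1$. -/

import Mathlib

open scoped Manifold ContDiff InnerProductSpace Matrix
open MeasureTheory Set Bundle

namespace HypStokes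

/-- `Ω¹(M)`: the 1-forms on `M` that are smooth up to the boundary. -/
abbrev OneForm (n : ℕ) [NeZero n] (M : Type*) [TopologicalSpace M]
    [ChartedSpace (EuclideanHalfSpace n) M] [IsManifold (𝓡∂ n) ∞ M] : Type _ :=
  ContMDiffSection (𝓡∂ n) (EuclideanSpace ℝ (Fin n) →L[ℝ] ℝ) ∞
    (fun x : M => TangentSpace (𝓡∂ n) x →L[ℝ] ℝ)

/-- Smooth Riemannian metrics on the manifold with boundary `M`. -/
abbrev Metric (n : ℕ) [NeZero n] (M : Type*) [TopologicalSpace M]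
    [ChartedSpace (EuclideanHalfSpace n) M] [IsManifold (𝓡∂ n) ∞ M] : Type _ :=
  ContMDiffRiemannianMetric (𝓡∂ n) ∞ (EuclideanSpace ℝ (Fin n))
    (fun x : M => TangentSpace (𝓡∂ n) x)

/-- A finite smooth atlas of `M` with a subordinate smooth partition of unity; integrals over `M` are
computed with it. -/
structure FiniteAtlas (n : ℕ) [NeZero n] (M : Type*) [TopologicalSpace M]
    [ChartedSpace (EuclideanHalfSpace n) M] [IsManifold (𝓡∂ n) ∞ M] where
  /-- the number of charts -/
  N : ℕ
  /-- the charts -/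
  chart : Fin N → OpenPartialHomeomorph M (EuclideanHalfSpace n)
  chart_mem : ∀ i, chart i ∈ IsManifold.maximalAtlas (𝓡∂ n) ∞ M
  /-- the partition of unity -/
  ρ : SmoothPartitionOfUnity (Fin N) (𝓡∂ n) M univ
  subordinate : ρ.IsSubordinate fun i => (chart i).source

section
variable {E H M : Type*} [NormedAddCommGroup E] [NormedSpace ℝ E] [TopologicalSpace H]
  [TopologicalSpace M] [ChartedSpace H M]

/-- The tangent vector `(Dψ)_y v` of `M`, for a parametrization `ψ` defined on `s ⊆ E`. -/
noncomputable def pushVector (I : ModelWithCorners ℝ E H) (ψ : E → M) (s : Set E) (v y : E) :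
    TangentSpace I (ψ y) :=
  mfderivWithin 𝓘(ℝ, E) I ψ s y v

theorem pushVector_sum {ι : Type*} [Fintype ι] {I : ModelWithCorners ℝ E H} (ψ : E → M) (s : Set E)
    (c : ι → ℝ) (v : ι → E) (y : E) :
    pushVector I ψ s (∑ a, c a • v a) y = ∑ a, c a • pushVector I ψ s (v a) y := by
  let L : E →L[ℝ] TangentSpace I (ψ y) := mfderivWithin 𝓘(ℝ, E) I ψ s y
  change L (∑ a, c a • v a) = ∑ a, c a • L (v a)
  rw [map_sum]
  exact Finset.sum_congr rfl fun a _ => map_smul L _ _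

theorem contMDiffOn_pushVector {I : ModelWithCorners ℝ E H} [IsManifold I ∞ M] {ψ : E → M}
    {s : Set E} (hψ : ContMDiffOn 𝓘(ℝ, E) I ∞ ψ s) (hs : UniqueDiffOn ℝ s) (v : E) :
    ContMDiffOn 𝓘(ℝ, E) I.tangent ∞
      (fun y => TotalSpace.mk' E (E := fun x : M => TangentSpace I x) (ψ y) (pushVector I ψ s v y))
      s := by
  have h1 := hψ.contMDiffOn_tangentMapWithin (m := ∞) (by simp) hs.uniqueMDiffOn
  have h2 : ContMDiff 𝓘(ℝ, E) 𝓘(ℝ, E).tangent ∞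
      (fun y : E => (⟨y, v⟩ : TangentBundle 𝓘(ℝ, E) E)) :=
    (contMDiff_vectorSpace_iff_contDiff (V := fun _ : E => v)).2 contDiff_const
  exact h1.comp h2.contMDiffOn (fun y hy => hy)

theorem contDiffOn_form_pushVector {I : ModelWithCorners ℝ E H} [IsManifold I ∞ M] {ψ : E → M}
    {s : Set E} (hψ : ContMDiffOn 𝓘(ℝ, E) I ∞ ψ s) (hs : UniqueDiffOn ℝ s) (v : E)
    (u : ContMDiffSection I (E →L[ℝ] ℝ) ∞ (fun x : M => TangentSpace I x →L[ℝ] ℝ)) :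
    ContDiffOn ℝ ∞ (fun y => u (ψ y) (pushVector I ψ s v y)) s := by
  rw [← contMDiffOn_iff_contDiffOn]
  have h := u.contMDiff.comp_contMDiffOn hψ
  have := ContMDiffOn.clm_bundle_apply (F₂ := ℝ) (E₂ := Bundle.Trivial M ℝ) h
    (contMDiffOn_pushVector hψ hs v)
  intro y hy
  have := this y hy
  rw [contMDiffWithinAt_totalSpace] at this
  simpa using this.2

theorem contDiffOn_metric_pushVector {I : ModelWithCorners ℝ E H} [IsManifold I ∞ M] {ψ : E → M}
    {s : Set E} (hψ : ContMDiffOn 𝓘(ℝ, E) I ∞ ψ s) (hs : UniqueDiffOn ℝ s) (v w : E)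
    (g : ContMDiffRiemannianMetric I ∞ E (fun x : M => TangentSpace I x)) :
    ContDiffOn ℝ ∞ (fun y => g.inner (ψ y) (pushVector I ψ s v y) (pushVector I ψ s w y)) s := by
  rw [← contMDiffOn_iff_contDiffOn]
  have h := g.contMDiff.comp_contMDiffOn hψ
  have := ContMDiffOn.clm_bundle_apply₂ (F₃ := ℝ) (E₃ := Bundle.Trivial M ℝ) h
    (contMDiffOn_pushVector hψ hs v) (contMDiffOn_pushVector hψ hs w)
  intro y hy
  have := this y hy
  rw [contMDiffWithinAt_totalSpace] at this
  simpa using this.2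

/-- The coordinate vectors are independent. -/
theorem pushVector_injective {I : ModelWithCorners ℝ E H} [IsManifold I ∞ M]
    {e : OpenPartialHomeomorph M H} (he : e ∈ IsManifold.maximalAtlas I ∞ M) {v y : E}
    (hy : y ∈ (e.extend I).target)
    (h : pushVector I (e.extend I).symm (e.extend I).target v y = 0) : v = 0 := by
  have hu : UniqueDiffOn ℝ (e.extend I).target := by
    rw [OpenPartialHomeomorph.extend_target]
    exact I.uniqueDiffOn_preimage e.open_target
  have hs : MDifferentiableWithinAt 𝓘(ℝ, E) I (e.extend I).symm (e.extend I).target y := by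
    have h := contMDiffOn_extend_symm he
    rw [← OpenPartialHomeomorph.extend_target'] at h
    exact (h y hy).mdifferentiableWithinAt (by simp)
  have hx : (e.extend I).symm y ∈ e.source := by
    simpa using (e.extend I).map_target hy
  have he' : MDifferentiableAt I 𝓘(ℝ, E) (e.extend I) ((e.extend I).symm y) :=
    (e.contMDiffAt_extend he hx).mdifferentiableAt (by simp)
  have hc := mfderiv_comp_mfderivWithin y he' hs (hu.uniqueMDiffOn y hy)
  have hid : mfderivWithin 𝓘(ℝ, E) 𝓘(ℝ, E) ((e.extend I) ∘ (e.extend I).symm)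
      (e.extend I).target y = mfderivWithin 𝓘(ℝ, E) 𝓘(ℝ, E) id (e.extend I).target y :=
    mfderivWithin_congr (fun z hz => (e.extend I).right_inv hz) ((e.extend I).right_inv hy)
  rw [hid, mfderivWithin_id (hu.uniqueMDiffOn y hy)] at hc
  have h1 : v = mfderiv I 𝓘(ℝ, E) (e.extend I) ((e.extend I).symm y)
      (mfderivWithin 𝓘(ℝ, E) I (e.extend I).symm (e.extend I).target y v) :=
    congrArg (fun L : E →L[ℝ] E => L v) hc
  exact h1.trans ((congrArg _ h).trans (map_zero _))
end

section

/-- The inner product `G^{ab} p_a q_b` of covectors, for the Gram matrix `G = (g_{ab})`. -/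
noncomputable def formInner {n : ℕ} (G : Matrix (Fin n) (Fin n) ℝ) (p q : Fin n → ℝ) : ℝ :=
  p ⬝ᵥ (G⁻¹ *ᵥ q)

/-- The inner product `G^{ac} G^{bd} A_{ab} B_{cd}` of covariant 2-tensors. -/
noncomputable def tensorInner {n : ℕ} (G A B : Matrix (Fin n) (Fin n) ℝ) : ℝ :=
  (G⁻¹ * A * G⁻¹ * Bᵀ).trace

theorem tensorInner_eq_sum {n : ℕ} {G : Matrix (Fin n) (Fin n) ℝ} (hG : G.IsSymm)
    (A B : Matrix (Fin n) (Fin n) ℝ) :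
    tensorInner G A B = ∑ a, ∑ b, ∑ c, ∑ d, G⁻¹ a c * G⁻¹ b d * A a b * B c d := by
  have hs : ∀ a c, G⁻¹ a c = G⁻¹ c a := fun a c => by
    have : (G⁻¹)ᵀ = G⁻¹ := by rw [Matrix.transpose_nonsing_inv, hG.eq]
    exact congrFun (congrFun this c) a
  simp only [tensorInner, Matrix.trace, Matrix.diag, Matrix.mul_apply, Matrix.transpose_apply,
    Finset.sum_mul]
  calc _ = ∑ c, ∑ d, ∑ b, ∑ a, G⁻¹ a c * G⁻¹ b d * A a b * B c d := by
        refine Finset.sum_congr rfl fun c _ => Finset.sum_congr rfl fun d _ =>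
          Finset.sum_congr rfl fun b _ => Finset.sum_congr rfl fun a _ => ?_
        rw [hs c a]; ring
    _ = _ := by
        simp only [← Finset.sum_product']
        refine Finset.sum_bij' (fun x _ => (x.2.2.2, x.2.2.1, x.1, x.2.1))
          (fun x _ => (x.2.2.1, x.2.2.2, x.2.1, x.1)) ?_ ?_ ?_ ?_ ?_ <;> simp

variable {n : ℕ} {G : Matrix (Fin n) (Fin n) ℝ}

theorem formInner_comm (hG : G.PosDef) (p q : Fin n → ℝ) : formInner G p q = formInner G q p := by
  have : (G⁻¹)ᵀ = G⁻¹ := by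
    simpa using hG.inv.isHermitian.eq
  rw [formInner, formInner, Matrix.dotProduct_mulVec, ← Matrix.mulVec_transpose, this,
    dotProduct_comm]

theorem formInner_nonneg (hG : G.PosDef) (p : Fin n → ℝ) : 0 ≤ formInner G p p := by
  simpa [formInner] using hG.inv.posSemidef.dotProduct_mulVec_nonneg p

theorem tensorInner_comm (hG : G.PosDef) (A B : Matrix (Fin n) (Fin n) ℝ) :
    tensorInner G A B = tensorInner G B A := by
  have : (G⁻¹)ᵀ = G⁻¹ := by
    simpa using hG.inv.isHermitian.eq
  rw [tensorInner, ← Matrix.trace_transpose]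
  simp only [Matrix.transpose_mul, Matrix.transpose_transpose, this, tensorInner]
  rw [← Matrix.mul_assoc, ← Matrix.mul_assoc, Matrix.trace_mul_comm]
  simp only [Matrix.mul_assoc]

theorem tensorInner_transpose (hG : G.PosDef) (A B : Matrix (Fin n) (Fin n) ℝ) :
    tensorInner G Aᵀ Bᵀ = tensorInner G A B := by
  rw [tensorInner_comm hG A, tensorInner, tensorInner, Matrix.transpose_transpose,
    Matrix.mul_assoc, Matrix.trace_mul_comm]
  simp only [Matrix.mul_assoc]

open scoped MatrixOrder Matrix.Norms.L2Operator in
theorem tensorInner_nonneg (hG : G.PosDef) (A : Matrix (Fin n) (Fin n) ℝ) :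
    0 ≤ tensorInner G A A := by
  obtain ⟨S, hS⟩ := (CStarAlgebra.nonneg_iff_eq_star_mul_self).1 hG.inv.posSemidef.nonneg
  have : tensorInner G A A = ((S * A * Sᵀ) * (S * A * Sᵀ)ᵀ).trace := by
    rw [tensorInner, hS]
    simp only [Matrix.transpose_mul, Matrix.transpose_transpose, Matrix.mul_assoc,
      Matrix.star_eq_conjTranspose, Matrix.conjTranspose_eq_transpose_of_trivial]
    rw [Matrix.trace_mul_comm]
    simp only [Matrix.mul_assoc]
  rw [this]
  simpa using (Matrix.posSemidef_self_mul_conjTranspose (S * A * Sᵀ)).trace_nonneg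

theorem tensorInner_add (A B C : Matrix (Fin n) (Fin n) ℝ) :
    tensorInner G (A + B) C = tensorInner G A C + tensorInner G B C := by
  simp [tensorInner, Matrix.mul_add, Matrix.add_mul]

theorem tensorInner_smul (r : ℝ) (A C : Matrix (Fin n) (Fin n) ℝ) :
    tensorInner G (r • A) C = r * tensorInner G A C := by
  simp [tensorInner]

theorem formInner_add (A B C : Fin n → ℝ) :
    formInner G (A + B) C = formInner G A C + formInner G B C := by
  simp [formInner, add_dotProduct]

theorem formInner_smul (r : ℝ) (A C : Fin n → ℝ) :
    formInner G (r • A) C = r * formInner G A C := by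
  simp [formInner]

/-- The Cauchy-Schwarz inequality for a positive semidefinite symmetric form. -/
theorem cauchySchwarz {X : Type*} [AddCommGroup X] [Module ℝ X] (B : X → X → ℝ)
    (hadd : ∀ x y z, B (x + y) z = B x z + B y z) (hsmul : ∀ (r : ℝ) x y, B (r • x) y = r * B x y)
    (hsymm : ∀ x y, B x y = B y x) (hpos : ∀ x, 0 ≤ B x x) (x y : X) :
    B x y ^ 2 ≤ B x x * B y y := by
  have key : ∀ t : ℝ, 0 ≤ B x x * (t * t) + 2 * B x y * t + B y y := fun t => by
    have h := hpos (t • x + y)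
    rw [hadd, hsmul, hsymm x, hsymm y, hadd, hadd, hsmul, hsmul, hsymm y x] at h
    linarith
  have := discrim_le_zero key
  rw [discrim] at this
  nlinarith

theorem sq_trace_le (hG : G.PosDef) (A : Matrix (Fin n) (Fin n) ℝ) :
    (G⁻¹ * A).trace ^ 2 ≤ n * tensorInner G A A := by
  have hdet : IsUnit G.det := hG.det_pos.ne'.isUnit
  have hGt : Gᵀ = G := by simpa using hG.isHermitian.eq
  have h1 : tensorInner G A G = (G⁻¹ * A).trace := by
    rw [tensorInner, hGt, Matrix.mul_assoc, Matrix.nonsing_inv_mul _ hdet, Matrix.mul_one]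
  have h2 : tensorInner G G G = n := by
    rw [tensorInner, hGt, Matrix.mul_assoc, Matrix.nonsing_inv_mul _ hdet]
    simp
  have := cauchySchwarz (tensorInner G) tensorInner_add tensorInner_smul (tensorInner_comm hG)
    (tensorInner_nonneg hG) A G
  rw [h1, h2] at this
  linarith

theorem sq_dotProduct_le (hG : G.PosDef) (p e : Fin n → ℝ) :
    (p ⬝ᵥ e) ^ 2 ≤ formInner G p p * (e ⬝ᵥ (G *ᵥ e)) := by
  have hdet : IsUnit G.det := hG.det_pos.ne'.isUnit
  have h1 : formInner G p (G *ᵥ e) = p ⬝ᵥ e := by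
    rw [formInner, Matrix.mulVec_mulVec, Matrix.nonsing_inv_mul _ hdet, Matrix.one_mulVec]
  have h2 : formInner G (G *ᵥ e) (G *ᵥ e) = e ⬝ᵥ (G *ᵥ e) := by
    rw [formInner, Matrix.mulVec_mulVec, Matrix.nonsing_inv_mul _ hdet, Matrix.one_mulVec,
      dotProduct_comm]
  have := cauchySchwarz (formInner G) formInner_add formInner_smul (formInner_comm hG)
    (formInner_nonneg hG) p (G *ᵥ e)
  rwa [h1, h2] at this

theorem tensorInner_sub_transpose_le (hG : G.PosDef) (A : Matrix (Fin n) (Fin n) ℝ) :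
    tensorInner G (A - Aᵀ) (A - Aᵀ) ≤ 4 * tensorInner G A A := by
  have h := tensorInner_nonneg hG (A + Aᵀ)
  have h1 := tensorInner_transpose hG A A
  have h2 := tensorInner_comm hG A Aᵀ
  have hneg : A - Aᵀ = A + (-1 : ℝ) • Aᵀ := by simp [sub_eq_add_neg]
  rw [hneg]
  simp only [tensorInner_add, tensorInner_smul, tensorInner_comm hG _ (_ + _)] at h ⊢
  rw [tensorInner_comm hG _ ((-1 : ℝ) • Aᵀ), tensorInner_smul,
    tensorInner_comm hG _ ((-1 : ℝ) • Aᵀ), tensorInner_smul]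
  linarith
end

section
variable {n : ℕ} [NeZero n] {M : Type*} [TopologicalSpace M]
  [ChartedSpace (EuclideanHalfSpace n) M] [IsManifold (𝓡∂ n) ∞ M]

theorem FiniteAtlas.nonempty [T2Space M] [CompactSpace M] : Nonempty (FiniteAtlas n M) := by
  obtain ⟨s, hs⟩ := isCompact_univ.elim_nhds_subcover
    (fun x : M => (chartAt (EuclideanHalfSpace n) x).source)
    (fun x _ => (chartAt (EuclideanHalfSpace n) x).open_source.mem_nhds (mem_chart_source _ x))
  let e := s.equivFin
  let c : Fin s.card → OpenPartialHomeomorph M (EuclideanHalfSpace n) :=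
    fun i => chartAt (EuclideanHalfSpace n) ((e.symm i : s) : M)
  obtain ⟨ρ, hρ⟩ := SmoothPartitionOfUnity.exists_isSubordinate (𝓡∂ n) (s := (univ : Set M))
    isClosed_univ (fun i => (c i).source) (fun i => (c i).open_source) (by
      intro x hx
      obtain ⟨y, hy, hxy⟩ := mem_iUnion₂.1 (hs.2 hx)
      exact mem_iUnion.2 ⟨e ⟨y, hy⟩, by simpa [c] using hxy⟩)
  exact ⟨⟨s.card, c, fun i => IsManifold.chart_mem_maximalAtlas _, ρ, hρ⟩⟩


namespace FiniteAtlas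
variable (A : FiniteAtlas n M) (g : Metric n M)

/-- The image of the `i`-th chart, a relatively open subset of the closed half-space. -/
def target (i : Fin A.N) : Set (EuclideanSpace ℝ (Fin n)) := ((A.chart i).extend (𝓡∂ n)).target

/-- The inverse of the `i`-th chart. -/
noncomputable def inv (i : Fin A.N) : EuclideanSpace ℝ (Fin n) → M :=
  ((A.chart i).extend (𝓡∂ n)).symm

/-- The coordinate vector field `∂/∂x^a` of the `i`-th chart, at the point with coordinates `y`. -/
noncomputable def frame (i : Fin A.N) (a : Fin n) (y : EuclideanSpace ℝ (Fin n)) :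
    TangentSpace (𝓡∂ n) (A.inv i y) :=
  pushVector (𝓡∂ n) (A.inv i) (A.target i) (EuclideanSpace.single a (1 : ℝ)) y

/-- The partial derivative `∂h/∂x^a` (one-sided at boundary points) of a function `h` of the
coordinates of the `i`-th chart. -/
noncomputable def pd (i : Fin A.N) (a : Fin n) (h : EuclideanSpace ℝ (Fin n) → ℝ)
    (y : EuclideanSpace ℝ (Fin n)) : ℝ :=
  fderivWithin ℝ h (A.target i) y (EuclideanSpace.single a (1 : ℝ))

/-- The Gram matrix `g_{ab}` of the metric in the `i`-th chart. -/
noncomputable def gram (i : Fin A.N) (y : EuclideanSpace ℝ (Fin n)) : Matrix (Fin n) (Fin n) ℝ :=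
  Matrix.of fun a b => g.inner (A.inv i y) (A.frame i a y) (A.frame i b y)

/-- The Riemannian density `√det(g_{ab})`. -/
noncomputable def density (i : Fin A.N) (y : EuclideanSpace ℝ (Fin n)) : ℝ :=
  Real.sqrt (A.gram g i y).det

/-- The Christoffel symbol `Γ^k_{ab}` of the Levi-Civita connection. -/
noncomputable def christoffel (i : Fin A.N) (k a b : Fin n) (y : EuclideanSpace ℝ (Fin n)) : ℝ :=
  (1 / 2) * ∑ l, (A.gram g i y)⁻¹ k l *
    (A.pd i a (fun z => A.gram g i z b l) y + A.pd i b (fun z => A.gram g i z a l) y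
      - A.pd i l (fun z => A.gram g i z a b) y)

/-- The components `u_b` of a 1-form `u = u_b dx^b` in the `i`-th chart. -/
noncomputable def comp (u : OneForm n M) (i : Fin A.N) (y : EuclideanSpace ℝ (Fin n)) :
    Fin n → ℝ :=
  fun b => u (A.inv i y) (A.frame i b y)

/-- The components `∇_a u_b = ∂_a u_b - Γ^k_{ab} u_k` of the covariant derivative of a 1-form. -/
noncomputable def covDeriv (u : OneForm n M) (i : Fin A.N) (y : EuclideanSpace ℝ (Fin n)) :
    Matrix (Fin n) (Fin n) ℝ :=
  Matrix.of fun a b => A.pd i a (fun z => A.comp u i z b) y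
    - ∑ k, A.christoffel g i k a b y * A.comp u i y k

/-- The components `∂_a u_b - ∂_b u_a` of the exterior derivative of a 1-form. -/
noncomputable def extDeriv (u : OneForm n M) (i : Fin A.N) (y : EuclideanSpace ℝ (Fin n)) :
    Matrix (Fin n) (Fin n) ℝ :=
  Matrix.of fun a b => A.pd i a (fun z => A.comp u i z b) y
    - A.pd i b (fun z => A.comp u i z a) y

/-- The codifferential `d^*u = -*d*u = -(√det g)⁻¹ ∂_a (√det g g^{ab} u_b)` of a 1-form. -/
noncomputable def codiff (u : OneForm n M) (i : Fin A.N) (y : EuclideanSpace ℝ (Fin n)) : ℝ :=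
  -((A.density g i y)⁻¹ * ∑ a, A.pd i a
    (fun z => A.density g i z * ∑ b, (A.gram g i z)⁻¹ a b * A.comp u i z b) y)

/-- The integral over `M`, with respect to the Riemannian volume, of the function that is `h i` in
the coordinates of the `i`-th chart: `∑_i ∫ ρ_i h_i √det(g) dx`. -/
noncomputable def integral (h : Fin A.N → EuclideanSpace ℝ (Fin n) → ℝ) : ℝ :=
  ∑ i, ∫ y in A.target i, A.ρ i (A.inv i y) * A.density g i y * h i y

theorem contMDiffOn_inv (i : Fin A.N) :
    ContMDiffOn 𝓘(ℝ, EuclideanSpace ℝ (Fin n)) (𝓡∂ n) ∞ (A.inv i) (A.target i) := by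
  have := contMDiffOn_extend_symm (A.chart_mem i)
  rwa [← OpenPartialHomeomorph.extend_target'] at this

theorem uniqueDiffOn_target (i : Fin A.N) : UniqueDiffOn ℝ (A.target i) := by
  rw [target, OpenPartialHomeomorph.extend_target]
  exact (𝓡∂ n).uniqueDiffOn_preimage (A.chart i).open_target

theorem contDiffOn_comp (u : OneForm n M) (i : Fin A.N) (b : Fin n) :
    ContDiffOn ℝ ∞ (fun y => A.comp u i y b) (A.target i) :=
  contDiffOn_form_pushVector (by exact A.contMDiffOn_inv i) (A.uniqueDiffOn_target i) _ u

theorem contDiffOn_gram (i : Fin A.N) (a b : Fin n) :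
    ContDiffOn ℝ ∞ (fun y => A.gram g i y a b) (A.target i) :=
  contDiffOn_metric_pushVector (by exact A.contMDiffOn_inv i) (A.uniqueDiffOn_target i) _ _ g

theorem contDiffOn_pd (i : Fin A.N) (a : Fin n) {h : EuclideanSpace ℝ (Fin n) → ℝ}
    (hh : ContDiffOn ℝ ∞ h (A.target i)) : ContDiffOn ℝ ∞ (A.pd i a h) (A.target i) :=
  (hh.fderivWithin (A.uniqueDiffOn_target i) (m := ∞) (by simp)).clm_apply contDiffOn_const

theorem posDef_gram (i : Fin A.N) {y : EuclideanSpace ℝ (Fin n)} (hy : y ∈ A.target i) :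
    (A.gram g i y).PosDef := by
  refine Matrix.PosDef.of_dotProduct_mulVec_pos ?_ fun v hv => ?_
  · ext a b
    simp [gram, g.symm (A.inv i y) (A.frame i b y)]
  · have hne : pushVector (𝓡∂ n) (A.inv i) (A.target i)
        (∑ a, v a • EuclideanSpace.single a (1 : ℝ)) y ≠ 0 := by
      intro h
      have := pushVector_injective (A.chart_mem i) hy h
      apply hv
      ext b
      have hb := congrArg (fun w : EuclideanSpace ℝ (Fin n) => w b) this
      simpa [Finset.sum_apply, Pi.single_apply] using hb
    have hsum : pushVector (𝓡∂ n) (A.inv i) (A.target i)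
        (∑ a, v a • EuclideanSpace.single a (1 : ℝ)) y = ∑ a, v a • A.frame i a y :=
      pushVector_sum _ _ _ _ _
    have := g.pos _ _ hne
    rw [hsum] at this
    simp only [map_sum, map_smul, _root_.sum_apply, _root_.smul_apply,
      smul_eq_mul, Finset.mul_sum] at this
    simp only [dotProduct, Matrix.mulVec, gram, Matrix.of_apply, star_trivial, Finset.mul_sum]
    exact this.trans_eq (Finset.sum_congr rfl fun a _ =>
      Finset.sum_congr rfl fun b _ => by rw [g.symm]; ring)

theorem contDiffOn_det (i : Fin A.N) :
    ContDiffOn ℝ ∞ (fun y => (A.gram g i y).det) (A.target i) := by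
  simp only [Matrix.det_apply']
  exact ContDiffOn.sum fun σ _ => contDiffOn_const.mul
    (contDiffOn_prod fun j _ => A.contDiffOn_gram g i _ _)

theorem contDiffOn_density (i : Fin A.N) :
    ContDiffOn ℝ ∞ (A.density g i) (A.target i) :=
  (A.contDiffOn_det g i).sqrt fun _ hy => (A.posDef_gram g i hy).det_pos.ne'

theorem density_pos (i : Fin A.N) {y : EuclideanSpace ℝ (Fin n)} (hy : y ∈ A.target i) :
    0 < A.density g i y :=
  Real.sqrt_pos.2 (A.posDef_gram g i hy).det_pos

theorem contDiffOn_gramInv (i : Fin A.N) (a b : Fin n) :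
    ContDiffOn ℝ ∞ (fun y => (A.gram g i y)⁻¹ a b) (A.target i) := by
  simp only [Matrix.inv_def, Ring.inverse_eq_inv', Matrix.smul_apply, smul_eq_mul,
    Matrix.adjugate_apply, Matrix.det_apply']
  refine ((A.contDiffOn_det g i).inv fun y hy => (A.posDef_gram g i hy).det_pos.ne').congr
    (fun y hy => by rw [← Matrix.det_apply']; rfl) |>.mul ?_
  refine ContDiffOn.sum fun σ _ => contDiffOn_const.mul (contDiffOn_prod fun j _ => ?_)
  by_cases h : σ j = b
  · simp only [Matrix.updateRow_apply, h, if_true]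
    exact contDiffOn_const
  · simp only [Matrix.updateRow_apply, h, if_false]
    exact A.contDiffOn_gram g i _ _

theorem contDiffOn_christoffel (i : Fin A.N) (k a b : Fin n) :
    ContDiffOn ℝ ∞ (A.christoffel g i k a b) (A.target i) :=
  contDiffOn_const.mul (ContDiffOn.sum fun l _ => (A.contDiffOn_gramInv g i k l).mul
    (((A.contDiffOn_pd i a (A.contDiffOn_gram g i b l)).add
      (A.contDiffOn_pd i b (A.contDiffOn_gram g i a l))).sub
      (A.contDiffOn_pd i l (A.contDiffOn_gram g i a b))))

theorem contDiffOn_covDeriv (u : OneForm n M) (i : Fin A.N) (a b : Fin n) :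
    ContDiffOn ℝ ∞ (fun y => A.covDeriv g u i y a b) (A.target i) :=
  (A.contDiffOn_pd i a (A.contDiffOn_comp u i b)).sub (ContDiffOn.sum fun k _ =>
    (A.contDiffOn_christoffel g i k a b).mul (A.contDiffOn_comp u i k))

theorem contDiffOn_extDeriv (u : OneForm n M) (i : Fin A.N) (a b : Fin n) :
    ContDiffOn ℝ ∞ (fun y => A.extDeriv u i y a b) (A.target i) :=
  (A.contDiffOn_pd i a (A.contDiffOn_comp u i b)).sub (A.contDiffOn_pd i b (A.contDiffOn_comp u i a))

theorem contDiffOn_codiff (u : OneForm n M) (i : Fin A.N) :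
    ContDiffOn ℝ ∞ (A.codiff g u i) (A.target i) :=
  (((A.contDiffOn_density g i).inv fun _ hy => (A.density_pos g i hy).ne').mul
    (ContDiffOn.sum fun a _ => A.contDiffOn_pd i a ((A.contDiffOn_density g i).mul
      (ContDiffOn.sum fun b _ => (A.contDiffOn_gramInv g i a b).mul (A.contDiffOn_comp u i b))))).neg

theorem gram_comm (i : Fin A.N) (y : EuclideanSpace ℝ (Fin n)) (a b : Fin n) :
    A.gram g i y a b = A.gram g i y b a := g.symm _ _ _

theorem christoffel_comm (i : Fin A.N) (k a b : Fin n) (y : EuclideanSpace ℝ (Fin n)) :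
    A.christoffel g i k a b y = A.christoffel g i k b a y := by
  simp only [christoffel, A.gram_comm g i _ a b, add_comm]

theorem extDeriv_eq (u : OneForm n M) (i : Fin A.N) (y : EuclideanSpace ℝ (Fin n)) :
    A.extDeriv u i y = A.covDeriv g u i y - (A.covDeriv g u i y)ᵀ := by
  ext a b
  simp [extDeriv, covDeriv, A.christoffel_comm g i _ b a]

theorem pd_add (i : Fin A.N) (a : Fin n) {h k : EuclideanSpace ℝ (Fin n) → ℝ}
    (hh : ContDiffOn ℝ ∞ h (A.target i)) (hk : ContDiffOn ℝ ∞ k (A.target i))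
    {y : EuclideanSpace ℝ (Fin n)} (hy : y ∈ A.target i) :
    A.pd i a (fun z => h z + k z) y = A.pd i a h y + A.pd i a k y := by
  rw [pd, fderivWithin_fun_add (A.uniqueDiffOn_target i y hy)
    (hh.differentiableOn (by simp) y hy) (hk.differentiableOn (by simp) y hy)]
  rfl

theorem pd_mul (i : Fin A.N) (a : Fin n) {h k : EuclideanSpace ℝ (Fin n) → ℝ}
    (hh : ContDiffOn ℝ ∞ h (A.target i)) (hk : ContDiffOn ℝ ∞ k (A.target i))
    {y : EuclideanSpace ℝ (Fin n)} (hy : y ∈ A.target i) :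
    A.pd i a (fun z => h z * k z) y = h y * A.pd i a k y + A.pd i a h y * k y := by
  rw [pd, fderivWithin_fun_mul (A.uniqueDiffOn_target i y hy)
    (hh.differentiableOn (by simp) y hy) (hk.differentiableOn (by simp) y hy)]
  simp [pd, mul_comm]

theorem pd_sum (i : Fin A.N) (a : Fin n) {h : Fin n → EuclideanSpace ℝ (Fin n) → ℝ}
    (hh : ∀ b, ContDiffOn ℝ ∞ (h b) (A.target i))
    {y : EuclideanSpace ℝ (Fin n)} (hy : y ∈ A.target i) :
    A.pd i a (fun z => ∑ b, h b z) y = ∑ b, A.pd i a (h b) y := by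
  rw [pd, fderivWithin_fun_sum (A.uniqueDiffOn_target i y hy)
    (fun b _ => (hh b).differentiableOn (by simp) y hy)]
  simp [pd]

/-- `d^*u` as a first-order expression in the components of `u`. -/
noncomputable def codiffCoeff (i : Fin A.N) (y : EuclideanSpace ℝ (Fin n)) : Fin n → ℝ := fun b =>
  -((A.density g i y)⁻¹ * (∑ a, A.pd i a (fun z => A.density g i z * (A.gram g i z)⁻¹ a b) y)
    + ∑ a, ∑ c, (A.gram g i y)⁻¹ a c * A.christoffel g i b a c y)

theorem codiff_eq (u : OneForm n M) (i : Fin A.N) {y : EuclideanSpace ℝ (Fin n)}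
    (hy : y ∈ A.target i) :
    A.codiff g u i y = -((A.gram g i y)⁻¹ * A.covDeriv g u i y).trace
      + A.comp u i y ⬝ᵥ A.codiffCoeff g i y := by
  have hd := A.density_pos g i hy
  have h1 : ∀ a, A.pd i a
      (fun z => A.density g i z * ∑ b, (A.gram g i z)⁻¹ a b * A.comp u i z b) y
      = ∑ b, (A.density g i y * (A.gram g i y)⁻¹ a b * A.pd i a (fun z => A.comp u i z b) y
        + A.pd i a (fun z => A.density g i z * (A.gram g i z)⁻¹ a b) y * A.comp u i y b) := by
    intro a
    rw [← Finset.sum_congr rfl fun b _ => A.pd_mul i a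
      ((A.contDiffOn_density g i).mul (A.contDiffOn_gramInv g i a b)) (A.contDiffOn_comp u i b) hy,
      ← A.pd_sum i a (fun b => ((A.contDiffOn_density g i).mul
        (A.contDiffOn_gramInv g i a b)).mul (A.contDiffOn_comp u i b)) hy]
    simp only [Finset.mul_sum, mul_assoc]
  have hs : ∀ a c, (A.gram g i y)⁻¹ a c = (A.gram g i y)⁻¹ c a := fun a c => by
    have := (A.posDef_gram g i hy).inv.isHermitian.eq
    simpa using (congrFun (congrFun this a) c).symm
  have h2 : ((A.gram g i y)⁻¹ * A.covDeriv g u i y).trace =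
      (∑ a, ∑ b, (A.gram g i y)⁻¹ a b * A.pd i a (fun z => A.comp u i z b) y)
      - ∑ k, A.comp u i y k * ∑ a, ∑ b, (A.gram g i y)⁻¹ a b * A.christoffel g i k a b y := by
    simp only [Matrix.trace, Matrix.diag, Matrix.mul_apply, covDeriv, Matrix.of_apply, mul_sub,
      Finset.sum_sub_distrib, Finset.mul_sum]
    congr 1
    · rw [Finset.sum_comm]
      exact Finset.sum_congr rfl fun a _ => Finset.sum_congr rfl fun b _ => by rw [hs]
    · rw [Finset.sum_comm, Finset.sum_congr rfl fun a _ => Finset.sum_comm, Finset.sum_comm]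
      exact Finset.sum_congr rfl fun k _ => Finset.sum_congr rfl fun a _ =>
        Finset.sum_congr rfl fun b _ => by rw [hs]; ring
  rw [codiff, Finset.sum_congr rfl fun a _ => h1 a, h2]
  simp only [Finset.sum_add_distrib, dotProduct, codiffCoeff, mul_neg, mul_add,
    Finset.sum_neg_distrib]
  have h3 : (A.density g i y)⁻¹ * ∑ a, ∑ b, A.density g i y * (A.gram g i y)⁻¹ a b *
        A.pd i a (fun z => A.comp u i z b) y
      = ∑ a, ∑ b, (A.gram g i y)⁻¹ a b * A.pd i a (fun z => A.comp u i z b) y := by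
    simp only [Finset.mul_sum]
    exact Finset.sum_congr rfl fun a _ => Finset.sum_congr rfl fun b _ => by field_simp
  have h4 : (A.density g i y)⁻¹ * ∑ a, ∑ b,
        A.pd i a (fun z => A.density g i z * (A.gram g i z)⁻¹ a b) y * A.comp u i y b
      = ∑ b, A.comp u i y b * ((A.density g i y)⁻¹ *
        ∑ a, A.pd i a (fun z => A.density g i z * (A.gram g i z)⁻¹ a b) y) := by
    rw [Finset.sum_comm]
    simp only [Finset.mul_sum]
    exact Finset.sum_congr rfl fun a _ => Finset.sum_congr rfl fun b _ => by ring
  rw [h3, h4]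
  ring

theorem contDiffOn_codiffCoeff (i : Fin A.N) (b : Fin n) :
    ContDiffOn ℝ ∞ (fun y => A.codiffCoeff g i y b) (A.target i) :=
  ((((A.contDiffOn_density g i).inv fun _ hy => (A.density_pos g i hy).ne').mul
    (ContDiffOn.sum fun a _ => A.contDiffOn_pd i a ((A.contDiffOn_density g i).mul
      (A.contDiffOn_gramInv g i a b)))).add
    (ContDiffOn.sum fun a _ => ContDiffOn.sum fun c _ => (A.contDiffOn_gramInv g i a c).mul
      (A.contDiffOn_christoffel g i b a c))).neg


theorem integrableOn [CompactSpace M] (i : Fin A.N) {h : EuclideanSpace ℝ (Fin n) → ℝ}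
    (hh : ContinuousOn h (A.target i)) :
    IntegrableOn (fun y => A.ρ i (A.inv i y) * A.density g i y * h y) (A.target i) := by
  set K : Set (EuclideanSpace ℝ (Fin n)) :=
    ((A.chart i).extend (𝓡∂ n)) '' tsupport (A.ρ i) with hK
  have hKc : IsCompact K :=
    (isClosed_tsupport _).isCompact.image_of_continuousOn
      (((A.chart i).continuousOn_extend).mono (by
        rw [OpenPartialHomeomorph.extend_source]; exact A.subordinate i))
  have hKt : K ⊆ A.target i := by
    rintro _ ⟨x, hx, rfl⟩
    exact ((A.chart i).extend (𝓡∂ n)).map_source (by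
      rw [OpenPartialHomeomorph.extend_source]; exact A.subordinate i hx)
  have hc : ContinuousOn (fun y => A.ρ i (A.inv i y) * A.density g i y * h y) (A.target i) :=
    (((A.ρ i).contMDiff.continuous.comp_continuousOn (A.contMDiffOn_inv i).continuousOn).mul
      (A.contDiffOn_density g i).continuousOn).mul hh
  have hm : MeasurableSet (A.target i) := by
    rw [target, OpenPartialHomeomorph.extend_target]
    exact ((A.chart i).open_target.preimage (𝓡∂ n).continuous_symm).measurableSet.inter
      (𝓡∂ n).isClosed_range.measurableSet
  refine ((hc.mono hKt).integrableOn_compact hKc).of_forall_sdiff_eq_zero hm fun y hy => ?_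
  have : A.ρ i (A.inv i y) = 0 := by
    by_contra hne
    refine hy.2 ⟨A.inv i y, subset_tsupport _ hne, ?_⟩
    exact ((A.chart i).extend (𝓡∂ n)).right_inv hy.1
  simp [this]

theorem measurableSet_target (i : Fin A.N) : MeasurableSet (A.target i) := by
  rw [target, OpenPartialHomeomorph.extend_target]
  exact ((A.chart i).open_target.preimage (𝓡∂ n).continuous_symm).measurableSet.inter
    (𝓡∂ n).isClosed_range.measurableSet

theorem integral_congr {h k : Fin A.N → EuclideanSpace ℝ (Fin n) → ℝ}
    (hhk : ∀ i, ∀ y ∈ A.target i, h i y = k i y) : A.integral g h = A.integral g k :=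
  Finset.sum_congr rfl fun i _ => setIntegral_congr_fun (A.measurableSet_target i)
    fun y hy => by simp only [hhk i y hy]

theorem integral_add [CompactSpace M] {h k : Fin A.N → EuclideanSpace ℝ (Fin n) → ℝ}
    (hh : ∀ i, ContinuousOn (h i) (A.target i)) (hk : ∀ i, ContinuousOn (k i) (A.target i)) :
    A.integral g (fun i y => h i y + k i y) = A.integral g h + A.integral g k := by
  simp only [integral, ← Finset.sum_add_distrib]
  refine Finset.sum_congr rfl fun i _ => ?_
  rw [← MeasureTheory.integral_add (A.integrableOn g i (hh i)) (A.integrableOn g i (hk i))]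
  simp only [mul_add]

theorem integral_smul (r : ℝ) (h : Fin A.N → EuclideanSpace ℝ (Fin n) → ℝ) :
    A.integral g (fun i y => r * h i y) = r * A.integral g h := by
  simp only [integral, Finset.mul_sum]
  refine Finset.sum_congr rfl fun i _ => ?_
  rw [← MeasureTheory.integral_const_mul]
  exact setIntegral_congr_fun (A.measurableSet_target i) fun y _ => by ring

theorem integral_nonneg {h : Fin A.N → EuclideanSpace ℝ (Fin n) → ℝ}
    (hh : ∀ i, ∀ y ∈ A.target i, 0 ≤ h i y) : 0 ≤ A.integral g h :=
  Finset.sum_nonneg fun i _ => setIntegral_nonneg (A.measurableSet_target i) fun y hy =>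
    mul_nonneg (mul_nonneg (A.ρ.nonneg i _) (A.density_pos g i hy).le) (hh i y hy)

theorem integral_mono [CompactSpace M] {h k : Fin A.N → EuclideanSpace ℝ (Fin n) → ℝ}
    (hh : ∀ i, ContinuousOn (h i) (A.target i)) (hk : ∀ i, ContinuousOn (k i) (A.target i))
    (hhk : ∀ i, ∀ y ∈ A.target i, h i y ≤ k i y) : A.integral g h ≤ A.integral g k :=
  Finset.sum_le_sum fun i _ => setIntegral_mono_on (A.integrableOn g i (hh i))
    (A.integrableOn g i (hk i)) (A.measurableSet_target i) fun y hy =>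
    mul_le_mul_of_nonneg_left (hhk i y hy)
      (mul_nonneg (A.ρ.nonneg i _) (A.density_pos g i hy).le)

/-- A continuous family is bounded on the supports of the partition of unity. -/
theorem exists_integral_le [CompactSpace M] {c : Fin A.N → EuclideanSpace ℝ (Fin n) → ℝ}
    (hc : ∀ i, ContinuousOn (c i) (A.target i)) :
    ∃ κ : ℝ, 0 ≤ κ ∧ ∀ h : Fin A.N → EuclideanSpace ℝ (Fin n) → ℝ,
      (∀ i, ContinuousOn (h i) (A.target i)) → (∀ i, ∀ y ∈ A.target i, 0 ≤ h i y) →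
      A.integral g (fun i y => c i y * h i y) ≤ κ * A.integral g h := by
  have hb : ∀ i, ∃ κ : ℝ, ∀ y ∈ A.target i, A.ρ i (A.inv i y) ≠ 0 → c i y ≤ κ := by
    intro i
    have hKc : IsCompact (((A.chart i).extend (𝓡∂ n)) '' tsupport (A.ρ i)) :=
      (isClosed_tsupport _).isCompact.image_of_continuousOn
        (((A.chart i).continuousOn_extend).mono (by
          rw [OpenPartialHomeomorph.extend_source]; exact A.subordinate i))
    have hKt : ((A.chart i).extend (𝓡∂ n)) '' tsupport (A.ρ i) ⊆ A.target i := by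
      rintro _ ⟨x, hx, rfl⟩
      exact ((A.chart i).extend (𝓡∂ n)).map_source (by
        rw [OpenPartialHomeomorph.extend_source]; exact A.subordinate i hx)
    obtain ⟨κ, hκ⟩ := hKc.bddAbove_image ((hc i).mono hKt)
    refine ⟨κ, fun y hy hne => hκ ⟨y, ⟨A.inv i y, subset_tsupport _ hne, ?_⟩, rfl⟩⟩
    exact ((A.chart i).extend (𝓡∂ n)).right_inv hy
  choose κ hκ using hb
  refine ⟨∑ i, |κ i|, Finset.sum_nonneg fun i _ => abs_nonneg _, fun h hh hpos => ?_⟩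
  rw [← integral_smul]
  refine Finset.sum_le_sum fun i _ => setIntegral_mono_on
    (A.integrableOn g i ((hc i).mul (hh i)))
    (A.integrableOn g i (continuousOn_const.mul (hh i))) (A.measurableSet_target i) fun y hy => ?_
  by_cases hne : A.ρ i (A.inv i y) = 0
  · simp [hne]
  · have h1 : c i y ≤ ∑ i, |κ i| := ((hκ i y hy hne).trans (le_abs_self _)).trans
      (Finset.single_le_sum (f := fun i => |κ i|) (fun j _ => abs_nonneg _) (Finset.mem_univ i))
    exact mul_le_mul_of_nonneg_left (mul_le_mul_of_nonneg_right h1 (hpos i y hy))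
      (mul_nonneg (A.ρ.nonneg i _) (A.density_pos g i hy).le)

/-- `⟨u, v⟩ = ∫_M (u, v)` on smooth 1-forms. -/
noncomputable def l2Form (u v : OneForm n M) : ℝ :=
  A.integral g fun i y => formInner (A.gram g i y) (A.comp u i y) (A.comp v i y)

/-- `⟨∇u, ∇v⟩ = ∫_M (∇u, ∇v)` on smooth 1-forms. -/
noncomputable def gradForm (u v : OneForm n M) : ℝ :=
  A.integral g fun i y => tensorInner (A.gram g i y) (A.covDeriv g u i y) (A.covDeriv g v i y)

/-- `⟨du, dv⟩ = ∫_M (du, dv)` on smooth 1-forms; the inner product of 2-forms is half of that of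
2-tensors (`dx^1 ∧ dx^2` has norm one in the Euclidean metric). -/
noncomputable def dForm (u v : OneForm n M) : ℝ :=
  A.integral g fun i y => (1 / 2) *
    tensorInner (A.gram g i y) (A.extDeriv u i y) (A.extDeriv v i y)

/-- `⟨d^*u, d^*v⟩ = ∫_M d^*u d^*v` on smooth 1-forms. -/
noncomputable def codForm (u v : OneForm n M) : ℝ :=
  A.integral g fun i y => A.codiff g u i y * A.codiff g v i y

theorem comp_add (u v : OneForm n M) (i : Fin A.N) (y : EuclideanSpace ℝ (Fin n)) :
    A.comp (u + v) i y = A.comp u i y + A.comp v i y := rfl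

theorem comp_smul (r : ℝ) (u : OneForm n M) (i : Fin A.N) (y : EuclideanSpace ℝ (Fin n)) :
    A.comp (r • u) i y = r • A.comp u i y := rfl

theorem pd_const_mul (i : Fin A.N) (a : Fin n) (r : ℝ) {h : EuclideanSpace ℝ (Fin n) → ℝ}
    (hh : ContDiffOn ℝ ∞ h (A.target i))
    {y : EuclideanSpace ℝ (Fin n)} (hy : y ∈ A.target i) :
    A.pd i a (fun z => r * h z) y = r * A.pd i a h y := by
  rw [pd, fderivWithin_const_mul (A.uniqueDiffOn_target i y hy) (hh.differentiableOn (by simp) y hy)]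
  simp [pd]

theorem covDeriv_add (u v : OneForm n M) (i : Fin A.N) {y : EuclideanSpace ℝ (Fin n)}
    (hy : y ∈ A.target i) :
    A.covDeriv g (u + v) i y = A.covDeriv g u i y + A.covDeriv g v i y := by
  ext a b
  have := A.pd_add i a (A.contDiffOn_comp u i b) (A.contDiffOn_comp v i b) hy
  simp only [covDeriv, comp_add, Matrix.of_apply, Matrix.add_apply, Pi.add_apply, this, mul_add,
    Finset.sum_add_distrib]
  ring

theorem covDeriv_smul (r : ℝ) (u : OneForm n M) (i : Fin A.N) {y : EuclideanSpace ℝ (Fin n)}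
    (hy : y ∈ A.target i) :
    A.covDeriv g (r • u) i y = r • A.covDeriv g u i y := by
  ext a b
  have := A.pd_const_mul i a r (A.contDiffOn_comp u i b) hy
  simp only [covDeriv, comp_smul, Matrix.of_apply, Matrix.smul_apply, Pi.smul_apply, smul_eq_mul,
    this, mul_sub, Finset.mul_sum]
  congr 1
  exact Finset.sum_congr rfl fun k _ => by ring

theorem extDeriv_add (u v : OneForm n M) (i : Fin A.N) {y : EuclideanSpace ℝ (Fin n)}
    (hy : y ∈ A.target i) :
    A.extDeriv (u + v) i y = A.extDeriv u i y + A.extDeriv v i y := by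
  ext a b
  have h1 := A.pd_add i a (A.contDiffOn_comp u i b) (A.contDiffOn_comp v i b) hy
  have h2 := A.pd_add i b (A.contDiffOn_comp u i a) (A.contDiffOn_comp v i a) hy
  simp only [extDeriv, comp_add, Matrix.of_apply, Matrix.add_apply, Pi.add_apply, h1, h2]
  ring

theorem extDeriv_smul (r : ℝ) (u : OneForm n M) (i : Fin A.N) {y : EuclideanSpace ℝ (Fin n)}
    (hy : y ∈ A.target i) :
    A.extDeriv (r • u) i y = r • A.extDeriv u i y := by
  ext a b
  have h1 := A.pd_const_mul i a r (A.contDiffOn_comp u i b) hy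
  have h2 := A.pd_const_mul i b r (A.contDiffOn_comp u i a) hy
  simp only [extDeriv, comp_smul, Matrix.of_apply, Matrix.smul_apply, Pi.smul_apply, smul_eq_mul,
    h1, h2]
  ring

theorem codiff_add (u v : OneForm n M) (i : Fin A.N) {y : EuclideanSpace ℝ (Fin n)}
    (hy : y ∈ A.target i) :
    A.codiff g (u + v) i y = A.codiff g u i y + A.codiff g v i y := by
  rw [A.codiff_eq g _ i hy, A.codiff_eq g _ i hy, A.codiff_eq g _ i hy, A.covDeriv_add g u v i hy,
    comp_add, Matrix.mul_add, Matrix.trace_add, add_dotProduct]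
  ring

theorem codiff_smul (r : ℝ) (u : OneForm n M) (i : Fin A.N) {y : EuclideanSpace ℝ (Fin n)}
    (hy : y ∈ A.target i) :
    A.codiff g (r • u) i y = r * A.codiff g u i y := by
  rw [A.codiff_eq g _ i hy, A.codiff_eq g _ i hy, A.covDeriv_smul g r u i hy,
    comp_smul, Matrix.mul_smul, Matrix.trace_smul, smul_dotProduct, smul_eq_mul, smul_eq_mul]
  ring

theorem continuousOn_formInner (i : Fin A.N) {p q : EuclideanSpace ℝ (Fin n) → Fin n → ℝ}
    (hp : ∀ a, ContinuousOn (fun y => p y a) (A.target i))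
    (hq : ∀ a, ContinuousOn (fun y => q y a) (A.target i)) :
    ContinuousOn (fun y => formInner (A.gram g i y) (p y) (q y)) (A.target i) := by
  simp only [formInner, dotProduct, Matrix.mulVec]
  exact continuousOn_finsetSum _ fun a _ => (hp a).mul (continuousOn_finsetSum _ fun b _ =>
    (A.contDiffOn_gramInv g i a b).continuousOn.mul (hq b))

theorem continuousOn_tensorInner (i : Fin A.N)
    {P Q : EuclideanSpace ℝ (Fin n) → Matrix (Fin n) (Fin n) ℝ}
    (hP : ∀ a b, ContinuousOn (fun y => P y a b) (A.target i))
    (hQ : ∀ a b, ContinuousOn (fun y => Q y a b) (A.target i)) :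
    ContinuousOn (fun y => tensorInner (A.gram g i y) (P y) (Q y)) (A.target i) := by
  simp only [tensorInner, Matrix.trace, Matrix.diag, Matrix.mul_apply, Matrix.transpose_apply]
  exact continuousOn_finsetSum _ fun a _ => continuousOn_finsetSum _ fun b _ =>
    (continuousOn_finsetSum _ fun c _ => (continuousOn_finsetSum _ fun d _ =>
      (A.contDiffOn_gramInv g i a d).continuousOn.mul (hP d c)).mul
        (A.contDiffOn_gramInv g i c b).continuousOn).mul (hQ a b)

theorem continuousOn_l2 (u v : OneForm n M) (i : Fin A.N) : ContinuousOn
    (fun y => formInner (A.gram g i y) (A.comp u i y) (A.comp v i y)) (A.target i) :=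
  A.continuousOn_formInner g i (fun a => (A.contDiffOn_comp u i a).continuousOn)
    (fun a => (A.contDiffOn_comp v i a).continuousOn)

theorem continuousOn_grad (u v : OneForm n M) (i : Fin A.N) : ContinuousOn
    (fun y => tensorInner (A.gram g i y) (A.covDeriv g u i y) (A.covDeriv g v i y))
    (A.target i) :=
  A.continuousOn_tensorInner g i (fun a b => (A.contDiffOn_covDeriv g u i a b).continuousOn)
    (fun a b => (A.contDiffOn_covDeriv g v i a b).continuousOn)

theorem continuousOn_d (u v : OneForm n M) (i : Fin A.N) : ContinuousOn
    (fun y => (1 / 2) * tensorInner (A.gram g i y) (A.extDeriv u i y) (A.extDeriv v i y))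
    (A.target i) :=
  continuousOn_const.mul
    (A.continuousOn_tensorInner g i (fun a b => (A.contDiffOn_extDeriv u i a b).continuousOn)
      (fun a b => (A.contDiffOn_extDeriv v i a b).continuousOn))

theorem continuousOn_cod (u v : OneForm n M) (i : Fin A.N) : ContinuousOn
    (fun y => A.codiff g u i y * A.codiff g v i y) (A.target i) :=
  (A.contDiffOn_codiff g u i).continuousOn.mul (A.contDiffOn_codiff g v i).continuousOn

section forms
variable [CompactSpace M] (u v w : OneForm n M) (r : ℝ)

theorem l2Form_add : A.l2Form g (u + v) w = A.l2Form g u w + A.l2Form g v w := by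
  rw [l2Form, l2Form, l2Form,
    ← A.integral_add g (A.continuousOn_l2 g u w) (A.continuousOn_l2 g v w)]
  exact A.integral_congr g fun i y _ => by rw [comp_add, formInner_add]

theorem gradForm_add : A.gradForm g (u + v) w = A.gradForm g u w + A.gradForm g v w := by
  rw [gradForm, gradForm, gradForm,
    ← A.integral_add g (A.continuousOn_grad g u w) (A.continuousOn_grad g v w)]
  exact A.integral_congr g fun i y hy => by rw [A.covDeriv_add g u v i hy, tensorInner_add]

theorem dForm_add : A.dForm g (u + v) w = A.dForm g u w + A.dForm g v w := by
  rw [dForm, dForm, dForm,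
    ← A.integral_add g (A.continuousOn_d g u w) (A.continuousOn_d g v w)]
  exact A.integral_congr g fun i y hy => by
    rw [A.extDeriv_add u v i hy, tensorInner_add, mul_add]

theorem codForm_add : A.codForm g (u + v) w = A.codForm g u w + A.codForm g v w := by
  rw [codForm, codForm, codForm,
    ← A.integral_add g (A.continuousOn_cod g u w) (A.continuousOn_cod g v w)]
  exact A.integral_congr g fun i y hy => by rw [A.codiff_add g u v i hy, add_mul]


end forms

section forms
variable (u v w : OneForm n M) (r : ℝ)

theorem l2Form_smul : A.l2Form g (r • u) w = r * A.l2Form g u w := by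
  rw [l2Form, l2Form, ← integral_smul]
  exact A.integral_congr g fun i y _ => by rw [comp_smul, formInner_smul]

theorem gradForm_smul : A.gradForm g (r • u) w = r * A.gradForm g u w := by
  rw [gradForm, gradForm, ← integral_smul]
  exact A.integral_congr g fun i y hy => by rw [A.covDeriv_smul g r u i hy, tensorInner_smul]

theorem dForm_smul : A.dForm g (r • u) w = r * A.dForm g u w := by
  rw [dForm, dForm, ← integral_smul]
  exact A.integral_congr g fun i y hy => by
    rw [A.extDeriv_smul r u i hy, tensorInner_smul]; ring

theorem codForm_smul : A.codForm g (r • u) w = r * A.codForm g u w := by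
  rw [codForm, codForm, ← integral_smul]
  exact A.integral_congr g fun i y hy => by rw [A.codiff_smul g r u i hy]; ring

theorem l2Form_comm : A.l2Form g u v = A.l2Form g v u :=
  A.integral_congr g fun i _ hy => formInner_comm (A.posDef_gram g i hy) _ _

theorem gradForm_comm : A.gradForm g u v = A.gradForm g v u :=
  A.integral_congr g fun i _ hy => tensorInner_comm (A.posDef_gram g i hy) _ _

theorem dForm_comm : A.dForm g u v = A.dForm g v u :=
  A.integral_congr g fun i _ hy => by rw [tensorInner_comm (A.posDef_gram g i hy)]

theorem codForm_comm : A.codForm g u v = A.codForm g v u :=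
  A.integral_congr g fun _ _ _ => mul_comm _ _

theorem l2Form_nonneg : 0 ≤ A.l2Form g u u :=
  A.integral_nonneg g fun i _ hy => formInner_nonneg (A.posDef_gram g i hy) _

theorem gradForm_nonneg : 0 ≤ A.gradForm g u u :=
  A.integral_nonneg g fun i _ hy => tensorInner_nonneg (A.posDef_gram g i hy) _

theorem dForm_nonneg : 0 ≤ A.dForm g u u :=
  A.integral_nonneg g fun i _ hy =>
    mul_nonneg (by norm_num) (tensorInner_nonneg (A.posDef_gram g i hy) _)

theorem codForm_nonneg : 0 ≤ A.codForm g u u :=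
  A.integral_nonneg g fun _ _ _ => mul_self_nonneg _

theorem dForm_add_right [CompactSpace M] :
    A.dForm g w (u + v) = A.dForm g w u + A.dForm g w v := by
  rw [A.dForm_comm g w u, A.dForm_comm g w v, A.dForm_comm g w, dForm_add]

theorem dForm_smul_right : A.dForm g w (r • u) = r * A.dForm g w u := by
  rw [A.dForm_comm g w u, A.dForm_comm g w, dForm_smul]

theorem codForm_add_right [CompactSpace M] :
    A.codForm g w (u + v) = A.codForm g w u + A.codForm g w v := by
  rw [A.codForm_comm g w u, A.codForm_comm g w v, A.codForm_comm g w, codForm_add]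

theorem codForm_smul_right : A.codForm g w (r • u) = r * A.codForm g w u := by
  rw [A.codForm_comm g w u, A.codForm_comm g w, codForm_smul]

end forms

theorem dForm_le [CompactSpace M] (u : OneForm n M) :
    A.dForm g u u ≤ 2 * (A.l2Form g u u + A.gradForm g u u) := by
  have h1 : A.dForm g u u ≤ 2 * A.gradForm g u u := by
    rw [gradForm, ← integral_smul]
    refine A.integral_mono g (A.continuousOn_d g u u)
      (fun i => continuousOn_const.mul (A.continuousOn_grad g u u i)) fun i y hy => ?_
    have := tensorInner_sub_transpose_le (A.posDef_gram g i hy) (A.covDeriv g u i y)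
    rw [A.extDeriv_eq g u i y]
    linarith
  have := A.l2Form_nonneg g u
  linarith

theorem exists_codForm_le [CompactSpace M] : ∃ κ : ℝ, 0 ≤ κ ∧ ∀ u : OneForm n M,
    A.codForm g u u ≤ κ * (A.l2Form g u u + A.gradForm g u u) := by
  have hcc : ∀ i, ContinuousOn (fun y => (2 * n : ℝ) +
      2 * (A.codiffCoeff g i y ⬝ᵥ (A.gram g i y *ᵥ A.codiffCoeff g i y))) (A.target i) :=
    fun i => continuousOn_const.add (continuousOn_const.mul (by
      simp only [dotProduct, Matrix.mulVec]
      exact continuousOn_finsetSum _ fun a _ => (A.contDiffOn_codiffCoeff g i a).continuousOn.mul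
        (continuousOn_finsetSum _ fun b _ => (A.contDiffOn_gram g i a b).continuousOn.mul
          (A.contDiffOn_codiffCoeff g i b).continuousOn)))
  obtain ⟨κ, hκ, h⟩ := A.exists_integral_le g hcc
  refine ⟨κ, hκ, fun u => ?_⟩
  have hc := fun i => (A.continuousOn_l2 g u u i).add (A.continuousOn_grad g u u i)
  rw [l2Form, gradForm, ← A.integral_add g (A.continuousOn_l2 g u u) (A.continuousOn_grad g u u)]
  refine le_trans ?_ (h _ hc fun i y hy => add_nonneg (formInner_nonneg (A.posDef_gram g i hy) _)
    (tensorInner_nonneg (A.posDef_gram g i hy) _))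
  refine A.integral_mono g (A.continuousOn_cod g u u) (fun i => (hcc i).mul (hc i))
    fun i y hy => ?_
  have hG := A.posDef_gram g i hy
  have h1 := sq_trace_le hG (A.covDeriv g u i y)
  have h2 := sq_dotProduct_le hG (A.comp u i y) (A.codiffCoeff g i y)
  have h3 := formInner_nonneg hG (A.comp u i y)
  have h4 := tensorInner_nonneg hG (A.covDeriv g u i y)
  have h5 : 0 ≤ A.codiffCoeff g i y ⬝ᵥ (A.gram g i y *ᵥ A.codiffCoeff g i y) := by
    simpa using hG.posSemidef.dotProduct_mulVec_nonneg (A.codiffCoeff g i y)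
  rw [A.codiff_eq g u i hy]
  set t := ((A.gram g i y)⁻¹ * A.covDeriv g u i y).trace
  set s := A.comp u i y ⬝ᵥ A.codiffCoeff g i y
  have h6 : (0 : ℝ) ≤ n := Nat.cast_nonneg n
  nlinarith [sq_nonneg (t + s), mul_nonneg h6 h3, mul_nonneg h5 h4]

end FiniteAtlas
end

section
variable {n : ℕ} [NeZero n] {M : Type*} [TopologicalSpace M]
  [ChartedSpace (EuclideanHalfSpace n) M] [IsManifold (𝓡∂ n) ∞ M]

/-- Smooth 1-forms on `M`, normed by the `L²` norm. -/
def PreL2 (_A : FiniteAtlas n M) (_g : Metric n M) : Type _ := OneForm n M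

/-- Smooth 1-forms on `M`, normed by the `H¹` norm. -/
def PreH1 (_A : FiniteAtlas n M) (_g : Metric n M) : Type _ := OneForm n M

variable (A : FiniteAtlas n M) (g : Metric n M)

noncomputable instance : AddCommGroup (PreL2 A g) := inferInstanceAs (AddCommGroup (OneForm n M))
noncomputable instance : Module ℝ (PreL2 A g) := inferInstanceAs (Module ℝ (OneForm n M))
noncomputable instance : AddCommGroup (PreH1 A g) := inferInstanceAs (AddCommGroup (OneForm n M))
noncomputable instance : Module ℝ (PreH1 A g) := inferInstanceAs (Module ℝ (OneForm n M))

variable [CompactSpace M]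

/-- The inner product `⟨u, v⟩`. -/
@[reducible] noncomputable def preL2Core : PreInnerProductSpace.Core ℝ (PreL2 A g) where
  inner u v := A.l2Form g u v
  conj_inner_symm u v := A.l2Form_comm g v u
  re_inner_nonneg u := A.l2Form_nonneg g u
  add_left u v w := A.l2Form_add g u v w
  smul_left u w r := A.l2Form_smul g u w r

/-- The inner product `⟨u, v⟩ + ⟨∇u, ∇v⟩`. -/
@[reducible] noncomputable def preH1Core : PreInnerProductSpace.Core ℝ (PreH1 A g) where
  inner u v := A.l2Form g u v + A.gradForm g u v
  conj_inner_symm u v := congrArg₂ (· + ·) (A.l2Form_comm g v u) (A.gradForm_comm g v u)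
  re_inner_nonneg u := add_nonneg (A.l2Form_nonneg g u) (A.gradForm_nonneg g u)
  add_left u v w := by
    have h1 := A.l2Form_add g u v w
    have h2 := A.gradForm_add g u v w
    exact (congrArg₂ (· + ·) h1 h2).trans (add_add_add_comm _ _ _ _)
  smul_left u w r := by
    have h1 := A.l2Form_smul g u w r
    have h2 := A.gradForm_smul g u w r
    exact (congrArg₂ (· + ·) h1 h2).trans (mul_add _ _ _).symm

noncomputable instance : SeminormedAddCommGroup (PreL2 A g) :=
  letI := preL2Core A g
  InnerProductSpace.Core.toSeminormedAddCommGroup (𝕜 := ℝ)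
noncomputable instance : InnerProductSpace ℝ (PreL2 A g) :=
  InnerProductSpace.ofCore (preL2Core A g)
noncomputable instance : SeminormedAddCommGroup (PreH1 A g) :=
  letI := preH1Core A g
  InnerProductSpace.Core.toSeminormedAddCommGroup (𝕜 := ℝ)
noncomputable instance : InnerProductSpace ℝ (PreH1 A g) :=
  InnerProductSpace.ofCore (preH1Core A g)

/-- `L²Ω¹(M)`, the completion of the smooth 1-forms in the `L²` norm. -/
abbrev L2 : Type _ := UniformSpace.Completion (PreL2 A g)

/-- `H¹Ω¹(M)`, the completion of the smooth 1-forms in the `H¹` norm. -/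
abbrev H1 : Type _ := UniformSpace.Completion (PreH1 A g)

/-- A smooth 1-form as an element of `L²Ω¹(M)`. -/
noncomputable def formL2 (u : OneForm n M) : L2 A g :=
  UniformSpace.Completion.coe' (α := PreL2 A g) u

/-- A smooth 1-form as an element of `H¹Ω¹(M)`. -/
noncomputable def formH1 (u : OneForm n M) : H1 A g :=
  UniformSpace.Completion.coe' (α := PreH1 A g) u

theorem norm_sq_preL2 (u : PreL2 A g) : ‖u‖ ^ 2 = A.l2Form g u u :=
  (real_inner_self_eq_norm_sq u).symm

theorem norm_sq_preH1 (u : PreH1 A g) : ‖u‖ ^ 2 = A.l2Form g u u + A.gradForm g u u :=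
  (real_inner_self_eq_norm_sq u).symm

/-- The identity of smooth 1-forms, from the `H¹` norm to the `L²` norm. -/
noncomputable def preIncl : PreH1 A g →L[ℝ] PreL2 A g :=
  LinearMap.mkContinuous
    { toFun := fun u => (u : OneForm n M), map_add' := fun _ _ => rfl, map_smul' := fun _ _ => rfl }
    1 fun u => by
      rw [one_mul]
      refine abs_le_of_sq_le_sq' ?_ (norm_nonneg _) |>.2
      rw [norm_sq_preH1, norm_sq_preL2]
      exact le_add_of_nonneg_right (A.gradForm_nonneg g _)

/-- The canonical map `H¹Ω¹(M) → L²Ω¹(M)`, the continuous extension of the identity. -/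
noncomputable def incl : H1 A g →L[ℝ] L2 A g :=
  (UniformSpace.Completion.toComplL.comp (preIncl A g)).extend
    (UniformSpace.Completion.toComplL (𝕜 := ℝ) (E := PreH1 A g))

theorem denseRange_toComplL : DenseRange (UniformSpace.Completion.toComplL (𝕜 := ℝ)
    (E := PreH1 A g)) := UniformSpace.Completion.denseRange_coe

theorem isUniformInducing_toComplL : IsUniformInducing (UniformSpace.Completion.toComplL (𝕜 := ℝ)
    (E := PreH1 A g)) := UniformSpace.Completion.isUniformInducing_coe _

theorem incl_formH1 (u : OneForm n M) : incl A g (formH1 A g u) = formL2 A g u :=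
  ContinuousLinearMap.extend_eq (UniformSpace.Completion.toComplL.comp (preIncl A g))
    (denseRange_toComplL A g) (isUniformInducing_toComplL A g) u

/-- The continuous extension to `H¹Ω¹(M)` of a bounded bilinear form on smooth 1-forms. -/
noncomputable def extendForm (b : PreH1 A g →L[ℝ] PreH1 A g →L[ℝ] ℝ) :
    H1 A g →L[ℝ] H1 A g →L[ℝ] ℝ :=
  (b.extend (UniformSpace.Completion.toComplL (𝕜 := ℝ) (E := PreH1 A g))).flip.extend
    (UniformSpace.Completion.toComplL (𝕜 := ℝ) (E := PreH1 A g)) |>.flip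

theorem extendForm_formH1 (b : PreH1 A g →L[ℝ] PreH1 A g →L[ℝ] ℝ) (u v : OneForm n M) :
    extendForm A g b (formH1 A g u) (formH1 A g v) = b u v := by
  have h1 := ContinuousLinearMap.extend_eq
    (b.extend (UniformSpace.Completion.toComplL (𝕜 := ℝ) (E := PreH1 A g))).flip
    (denseRange_toComplL A g) (isUniformInducing_toComplL A g) v
  have h2 := ContinuousLinearMap.extend_eq b
    (denseRange_toComplL A g) (isUniformInducing_toComplL A g) u
  rw [extendForm, ContinuousLinearMap.flip_apply]
  have h1' := congrArg (fun L : H1 A g →L[ℝ] ℝ => L (formH1 A g u)) h1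
  have h2' := congrArg (fun L : PreH1 A g →L[ℝ] ℝ => L v) h2
  exact Eq.trans (by exact h1') h2'

theorem exists_dForm_bound : ∃ C : ℝ, ∀ u v : PreH1 A g, ‖A.dForm g u v‖ ≤ C * ‖u‖ * ‖v‖ := by
  refine ⟨2, fun u v => ?_⟩
  refine abs_le_of_sq_le_sq ?_ (by positivity)
  have h := cauchySchwarz (A.dForm g) (A.dForm_add g) (fun r x y => A.dForm_smul g x y r)
    (A.dForm_comm g) (A.dForm_nonneg g) u v
  have hu := A.dForm_le g u
  have hv := A.dForm_le g v
  rw [← norm_sq_preH1 A g u] at hu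
  rw [← norm_sq_preH1 A g v] at hv
  calc _ ≤ _ := h
    _ ≤ (2 * ‖u‖ ^ 2) * (2 * ‖v‖ ^ 2) :=
      mul_le_mul hu hv (A.dForm_nonneg g v) (by positivity)
    _ = _ := by ring

theorem exists_codForm_bound :
    ∃ C : ℝ, ∀ u v : PreH1 A g, ‖A.codForm g u v‖ ≤ C * ‖u‖ * ‖v‖ := by
  obtain ⟨κ, hκ, hb⟩ := A.exists_codForm_le g
  refine ⟨κ, fun u v => ?_⟩
  refine abs_le_of_sq_le_sq ?_ (by positivity)
  have h := cauchySchwarz (A.codForm g) (A.codForm_add g) (fun r x y => A.codForm_smul g x y r)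
    (A.codForm_comm g) (A.codForm_nonneg g) u v
  have hu := hb u
  have hv := hb v
  rw [← norm_sq_preH1 A g u] at hu
  rw [← norm_sq_preH1 A g v] at hv
  calc _ ≤ _ := h
    _ ≤ (κ * ‖u‖ ^ 2) * (κ * ‖v‖ ^ 2) :=
      mul_le_mul hu hv (A.codForm_nonneg g v) (by positivity)
    _ = _ := by ring

/-- The form `⟨du, dv⟩` on smooth 1-forms as a bounded bilinear form in the `H¹` norm. -/
noncomputable def preD : PreH1 A g →L[ℝ] PreH1 A g →L[ℝ] ℝ :=
  LinearMap.mkContinuous₂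
    (LinearMap.mk₂ ℝ (fun u v : PreH1 A g => A.dForm g u v)
      (fun u v w => A.dForm_add g u v w)
      (fun r u w => A.dForm_smul g u w r)
      (fun w u v => A.dForm_add_right g u v w) (fun r w u => A.dForm_smul_right g u w r))
    (exists_dForm_bound A g).choose (exists_dForm_bound A g).choose_spec

/-- The form `⟨d^*u, d^*v⟩` on smooth 1-forms as a bounded bilinear form in the `H¹` norm. -/
noncomputable def preCod : PreH1 A g →L[ℝ] PreH1 A g →L[ℝ] ℝ :=
  LinearMap.mkContinuous₂
    (LinearMap.mk₂ ℝ (fun u v : PreH1 A g => A.codForm g u v)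
      (fun u v w => A.codForm_add g u v w)
      (fun r u w => A.codForm_smul g u w r)
      (fun w u v => A.codForm_add_right g u v w) (fun r w u => A.codForm_smul_right g u w r))
    (exists_codForm_bound A g).choose (exists_codForm_bound A g).choose_spec

/-- `⟨du, dv⟩_{L²}` for `u, v ∈ H¹Ω¹(M)`. -/
noncomputable def dInner : H1 A g →L[ℝ] H1 A g →L[ℝ] ℝ := extendForm A g (preD A g)

/-- `⟨d^*u, d^*v⟩_{L²}` for `u, v ∈ H¹Ω¹(M)`. -/
noncomputable def codInner : H1 A g →L[ℝ] H1 A g →L[ℝ] ℝ := extendForm A g (preCod A g)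

theorem dInner_formH1 (u v : OneForm n M) :
    dInner A g (formH1 A g u) (formH1 A g v) = A.dForm g u v := extendForm_formH1 A g _ u v

theorem codInner_formH1 (u v : OneForm n M) :
    codInner A g (formH1 A g u) (formH1 A g v) = A.codForm g u v := extendForm_formH1 A g _ u v

end

section
variable {n : ℕ} [NeZero n] {M : Type*} [TopologicalSpace M]
  [ChartedSpace (EuclideanHalfSpace n) M] [IsManifold (𝓡∂ n) ∞ M]

/-- `u ∈ C₀^∞Ω¹(M)`: the support of the smooth 1-form `u` (compact when `M` is) lies in the interior
of `M`. -/
def IsTestForm (u : OneForm n M) : Prop := closure {x | u x ≠ 0} ⊆ (𝓡∂ n).interior M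

variable (A : FiniteAtlas n M) (g : Metric n M)

/-- `W = {u ∈ C₀^∞Ω¹(M) : d^*u = 0}`. -/
def W : Set (OneForm n M) :=
  {u | IsTestForm u ∧ ∀ i, ∀ y ∈ A.target i, A.codiff g u i y = 0}

variable [CompactSpace M]

/-- `H₀¹Ω¹(M)`, the closure of `C₀^∞Ω¹(M)` in `H¹Ω¹(M)`. (The test forms already are a linear
subspace, so that the span adds nothing.) -/
noncomputable def H10 : Submodule ℝ (H1 A g) :=
  (Submodule.span ℝ (formH1 A g '' {u | IsTestForm u})).topologicalClosure

/-- `V = {v ∈ H₀¹Ω¹(M) : d^*v = 0}`; here `d^*v = 0` is `⟨d^*v, d^*w⟩ = 0` for all `w ∈ H¹Ω¹(M)`,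
which for `w = v` says that `‖d^*v‖ = 0`. -/
noncomputable def V : Submodule ℝ (H1 A g) := H10 A g ⊓ (codInner A g).ker

theorem codInner_sq_le (v w : H1 A g) :
    codInner A g v w ^ 2 ≤ codInner A g v v * codInner A g w w := by
  refine UniformSpace.Completion.induction_on₂ v w ?_ fun u z => ?_
  · exact isClosed_le (by fun_prop) (by fun_prop)
  · have := cauchySchwarz (A.codForm g) (A.codForm_add g) (fun r x y => A.codForm_smul g x y r)
      (A.codForm_comm g) (A.codForm_nonneg g) u z
    have e : ∀ a b : PreH1 A g, codInner A g a b = A.codForm g a b :=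
      fun a b => codInner_formH1 A g a b
    rw [e, e, e]
    exact this

theorem mem_V_iff (v : H1 A g) : v ∈ V A g ↔ v ∈ H10 A g ∧ codInner A g v v = 0 := by
  refine and_congr_right fun _ => ⟨fun h => ?_, fun h => ?_⟩
  · have h' : codInner A g v = 0 := h
    rw [h']; rfl
  · change codInner A g v = 0
    ext w
    have := codInner_sq_le A g v w
    rw [h, zero_mul] at this
    exact pow_eq_zero_iff two_ne_zero |>.1 (le_antisymm this (sq_nonneg _))

/-- `H`, the closure of `W` in `L²Ω¹(M)`. (`W` already is a linear subspace.) -/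
noncomputable def H : Submodule ℝ (L2 A g) :=
  (Submodule.span ℝ (formL2 A g '' W A g)).topologicalClosure

/-- The embedding of `V` into its dual `V'`: `u ↦ ⟨u, ·⟩_{L²}`. -/
noncomputable def toDual : V A g →L[ℝ] StrongDual ℝ (V A g) :=
  let ι : V A g →L[ℝ] L2 A g := (incl A g).comp (V A g).subtypeL
  (innerSL ℝ : L2 A g →L[ℝ] L2 A g →L[ℝ] ℝ).bilinearComp ι ι

theorem toDual_apply (u v : V A g) : toDual A g u v = inner ℝ (incl A g u) (incl A g v) := rfl

end

/-- `w'` is the weak derivative of `w` on `(0, T)`. -/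
def HasWeakDeriv {X : Type*} [NormedAddCommGroup X] [NormedSpace ℝ X] (T : ℝ) (w w' : ℝ → X) :
    Prop :=
  ∀ φ : ℝ → ℝ, ContDiff ℝ ∞ φ → HasCompactSupport φ → tsupport φ ⊆ Ioo 0 T →
    ∫ t in Icc 0 T, deriv φ t • w t = -∫ t in Icc 0 T, φ t • w' t

/-- `w ∈ H²([0,T]; X)`, with weak second derivative `w''`. -/
def HasH2Deriv {X : Type*} [NormedAddCommGroup X] [NormedSpace ℝ X] (T : ℝ) (w w'' : ℝ → X) :
    Prop :=
  MemLp w 2 (volume.restrict (Icc 0 T)) ∧ MemLp w'' 2 (volume.restrict (Icc 0 T)) ∧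
    ∃ w' : ℝ → X, MemLp w' 2 (volume.restrict (Icc 0 T)) ∧
      HasWeakDeriv T w w' ∧ HasWeakDeriv T w' w''

section
variable {n : ℕ} [NeZero n] {M : Type*} [TopologicalSpace M]
  [ChartedSpace (EuclideanHalfSpace n) M] [IsManifold (𝓡∂ n) ∞ M] [CompactSpace M]

/-- `u ∈ C([0,T];V) ∩ C¹([0,T];H) ∩ H²([0,T];V')` solves the weak hyperbolic Stokes problem
`⟨(∂_t² - Δ_H)u, v⟩ = ⟨f, v⟩` for all `v ∈ V`, `u(0) = u₀`, `∂_t u(0) = u₁`, where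
`-Δ_H = d^*d + dd^*` acts weakly: `⟨-Δ_H u, v⟩ = ⟨du, dv⟩ + ⟨d^*u, d^*v⟩`. The function `u`
matters on `[0,T]` only. -/
structure IsWeakSolution (A : FiniteAtlas n M) (g : Metric n M) (T : ℝ) (f : ℝ → L2 A g)
    (u₀ : V A g) (u₁ : H A g) (u : ℝ → V A g) : Prop where
  /-- `u ∈ C([0,T];V)` -/
  continuousOn : ContinuousOn u (Icc 0 T)
  /-- `u(0) = u₀` -/
  initial : u 0 = u₀
  /-- `u ∈ C¹([0,T];H)` and `∂_t u(0) = u₁` -/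
  exists_C1 : ∃ w : ℝ → H A g, (∀ t ∈ Icc 0 T, (w t : L2 A g) = incl A g (u t)) ∧
    ContDiffOn ℝ 1 w (Icc 0 T) ∧ derivWithin w (Icc 0 T) 0 = u₁
  /-- `u ∈ H²([0,T];V')`, and the equation holds -/
  exists_H2 : ∃ z : ℝ → StrongDual ℝ (V A g), HasH2Deriv T (fun t => toDual A g (u t)) z ∧
    ∀ᵐ t ∂volume.restrict (Icc 0 T), ∀ v : V A g,
      z t v + (dInner A g (u t) v + codInner A g (u t) v) = inner ℝ (f t) (incl A g v)

end

end HypStokes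

/-!
The problem is an abstract wave equation `u'' + a u = f` for a bounded, symmetric, nonnegative
form `a` on a Hilbert space `V` that lies densely in a Hilbert space `H`, with `a + ⟨·,·⟩_H`
coercive on `V` (`EnergyTriple`).

*The abstract equation.* Let `R` be the inverse of the operator `a + 1`, a bounded symmetric
operator on `H` (`EnergyTriple.res`). Testing the difference `w` of two weak solutions with
vectors `R h` removes all unbounded operators and leaves an integral equation for a `C¹` function
with values in `H`; it conserves the energy `‖(R w)'‖² + ⟨R w, (1 - R) w⟩`, which gives uniqueness
(`EnergyTriple.IsWeakWave.eqOn`). For existence, the data are approximated by data in the range of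
a power of `R`, and the operator of `a` by the bounded operators `(1 - R) (R + ε)⁻¹`; the linear
equation with a bounded operator then gives regular functions that solve the original equation up
to a small error in the right-hand side (`EnergyTriple.exists_isSmoothSolution`). The energy
inequality makes them converge to a solution (`EnergyTriple.exists_isWeakWave`).

*The geometric input* says that `V`, `H` and `a = ⟨d·,d·⟩ + ⟨d^*·,d^*·⟩` are such a triple
(`energyTriple`). There are three points.

* Coercivity is Gaffney's inequality (`exists_gaffney`): for test forms the covariant derivative
  is bounded in `L²` by `du`, `d^*u` and `u` (`FiniteAtlas.exists_gradForm_le`). Pointwise `|∇u|²`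
  is `|du|²/2 + |d^*u|²`, with the norm of `du` as a tensor, plus a null form in the `∂_a u_b`
  (`tensorInner_self_eq`, `nullForm`), up to lower-order terms. When the null form is integrated
  by parts in a chart, the second derivatives cancel and products of `u` and `∇u` remain.

* The map `V → L²` is injective: if `φ_k → v` in `H¹` and `φ_k → 0` in `L²`, then integration by
  parts gives `⟨dv, dψ⟩ = 0` for all smooth `ψ`, up to the boundary since the `φ_k` have support
  in the interior (`FiniteAtlas.exists_abs_dForm_le`), hence `dv = 0`; as `d^*v = 0` too,
  Gaffney's inequality gives `v = 0`.

* `V ⊆ H`, that is, elements of `V` are limits in `L²` of coclosed *test* forms (`incl_mem_H`). If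
  test forms `φ_k` converge to `v ∈ V` in `H¹`, then `d^*φ_k → 0` in `L²`, and it is enough to
  write `d^*φ_k = d^*ζ_k` with test forms `ζ_k` that tend to `0` in `L²`
  (`FiniteAtlas.exists_corrector`). This is a weak form of Bogovskii's theorem: no derivative of
  `ζ_k` has to be controlled, so that explicit integration along coordinate lines does it in a box
  (`exists_div_of_integral_eq_zero`), with a bound that does not deteriorate when the box
  approaches the boundary. A partition of unity reduces the global case to this one, the masses of
  the pieces being moved to a single place along the connected manifold
  (`FiniteAtlas.exists_mass_transfer`); their sum is zero by the divergence theorem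
  (`FiniteAtlas.mean_delta`).

Density of `V` in `H` is clear, and only the projection of `f` to `H` enters the weak equation.
-/

/-! ### Linear algebra of an energy triple -/

/-- A Hilbert space `V` embedded injectively and densely by `j` into a Hilbert space `K`, with a
bounded symmetric nonnegative form `a` on `V` such that `a + ⟪j ·, j ·⟫` is coercive. -/
structure EnergyTriple (V K : Type*) [NormedAddCommGroup V] [InnerProductSpace ℝ V]
    [NormedAddCommGroup K] [InnerProductSpace ℝ K] where
  /-- the embedding -/
  j : V →L[ℝ] K
  /-- the bilinear form -/
  a : V →L[ℝ] V →L[ℝ] ℝ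
  symm : ∀ u v, a u v = a v u
  nonneg : ∀ u, 0 ≤ a u u
  inj : Function.Injective j
  dense : DenseRange j
  coercive : ∃ c : ℝ, 0 < c ∧ ∀ u, c * ‖u‖ ^ 2 ≤ a u u + ‖j u‖ ^ 2

namespace EnergyTriple
variable {V K : Type*} [NormedAddCommGroup V] [InnerProductSpace ℝ V]
  [NormedAddCommGroup K] [InnerProductSpace ℝ K] (S : EnergyTriple V K)

/-- The embedding `h ↦ ⟪h, j ·⟫` of `K` into the dual of `V`. -/
noncomputable def toDualV : K →L[ℝ] StrongDual ℝ V :=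
  (innerSL ℝ : K →L[ℝ] K →L[ℝ] ℝ).bilinearComp (ContinuousLinearMap.id ℝ K) S.j

theorem toDualV_apply (h : K) (v : V) : S.toDualV h v = ⟪h, S.j v⟫_ℝ := rfl

/-- The energy inner product `a + ⟪j ·, j ·⟫` on `V`. -/
noncomputable def energy : V →L[ℝ] V →L[ℝ] ℝ := S.a + S.toDualV.comp S.j

theorem energy_apply (u v : V) : S.energy u v = S.a u v + ⟪S.j u, S.j v⟫_ℝ := rfl

theorem energy_comm (u v : V) : S.energy u v = S.energy v u := by
  rw [energy_apply, energy_apply, S.symm, real_inner_comm]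

theorem isCoercive_energy : IsCoercive S.energy := by
  obtain ⟨c, hc, h⟩ := S.coercive
  refine ⟨c, hc, fun u => ?_⟩
  have := h u
  rw [energy_apply, real_inner_self_eq_norm_sq]
  linarith [sq (‖u‖), this]

variable [CompleteSpace V] [CompleteSpace K]

/-- The adjoint of `j` for the energy inner product: the weak solution operator of
`(L + 1) v = h`, where `L` is the operator of the form `a`. -/
noncomputable def lift : K →L[ℝ] V :=
  (S.isCoercive_energy.continuousLinearEquivOfBilin.symm : V →L[ℝ] V).comp
    (ContinuousLinearMap.adjoint S.j)

theorem energy_lift (h : K) (v : V) : S.energy (S.lift h) v = ⟪h, S.j v⟫_ℝ := by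
  rw [← S.isCoercive_energy.continuousLinearEquivOfBilin_apply]
  simp [lift, ContinuousLinearMap.adjoint_inner_left]

theorem a_lift (h : K) (v : V) : S.a (S.lift h) v = ⟪h - S.j (S.lift h), S.j v⟫_ℝ := by
  have := S.energy_lift h v
  rw [energy_apply] at this
  rw [inner_sub_left]
  linarith

/-- The resolvent `(L + 1)⁻¹` of the operator `L` of the form `a`, as an operator of `K`. -/
noncomputable def res : K →L[ℝ] K := S.j.comp S.lift

theorem res_apply (h : K) : S.res h = S.j (S.lift h) := rfl

theorem inner_res (h k : K) : ⟪S.res h, k⟫_ℝ = S.energy (S.lift h) (S.lift k) := by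
  rw [energy_comm, energy_lift, real_inner_comm]; rfl

theorem res_symm (h k : K) : ⟪S.res h, k⟫_ℝ = ⟪h, S.res k⟫_ℝ := by
  rw [inner_res, energy_lift]; rfl

theorem norm_res_sq_le (h : K) : ‖S.res h‖ ^ 2 ≤ ⟪S.res h, h⟫_ℝ := by
  rw [inner_res, energy_apply, real_inner_self_eq_norm_sq]
  exact le_add_of_nonneg_left (S.nonneg _)

theorem inner_res_nonneg (h : K) : 0 ≤ ⟪S.res h, h⟫_ℝ := (sq_nonneg _).trans (S.norm_res_sq_le h)

theorem norm_res_le (h : K) : ‖S.res h‖ ≤ ‖h‖ := by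
  have h1 := S.norm_res_sq_le h
  have h2 := real_inner_le_norm (S.res h) h
  by_contra hlt
  push Not at hlt
  nlinarith [norm_nonneg h, norm_nonneg (S.res h)]

theorem inner_res_le (h : K) : ⟪S.res h, h⟫_ℝ ≤ ‖h‖ ^ 2 := by
  have h2 := real_inner_le_norm (S.res h) h
  nlinarith [norm_nonneg h, S.norm_res_le h]

theorem norm_sub_res_le (h : K) : ‖h - S.res h‖ ≤ ‖h‖ := by
  have h1 := S.norm_res_sq_le h
  have h2 : ‖h - S.res h‖ ^ 2 ≤ ‖h‖ ^ 2 := by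
    rw [norm_sub_sq_real, real_inner_comm]
    linarith [S.inner_res_nonneg h]
  exact abs_le_of_sq_le_sq' h2 (norm_nonneg _) |>.2

theorem eq_zero_of_res_eq_zero {h : K} (hh : S.res h = 0) : h = 0 := by
  have h0 : S.lift h = 0 := S.inj (by rw [map_zero]; exact hh)
  have h1 : ∀ v, ⟪h, S.j v⟫_ℝ = 0 := fun v => by rw [← energy_lift, h0]; simp
  have h2 : ⟪h, h⟫_ℝ = 0 := by
    refine S.dense.induction_on (p := fun k => ⟪h, k⟫_ℝ = 0) h ?_ h1
    exact isClosed_eq (by fun_prop) continuous_const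
  exact inner_self_eq_zero.1 h2

/-- The range of a symmetric injective operator is dense. -/
theorem denseRange_res_res : DenseRange fun h => S.res (S.res h) := by
  let L : K →L[ℝ] K := S.res.comp S.res
  have : L.range.topologicalClosure = ⊤ := by
    rw [Submodule.topologicalClosure_eq_top_iff, Submodule.eq_bot_iff]
    intro k hk
    have h1 : S.res (S.res k) = 0 := by
      refine ext_inner_left ℝ fun h => ?_
      have := hk (S.res (S.res h)) ⟨h, rfl⟩
      rw [← S.res_symm, ← S.res_symm, this, inner_zero_right]
    exact S.eq_zero_of_res_eq_zero (S.eq_zero_of_res_eq_zero h1)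
  exact (Submodule.dense_iff_topologicalClosure_eq_top.2 this : Dense (L.range : Set K))

theorem denseRange_lift_res_res : DenseRange fun h => S.lift (S.res (S.res h)) := by
  let L : K →L[ℝ] V := S.lift.comp (S.res.comp S.res)
  have : L.range.topologicalClosure = ⊤ := by
    rw [Submodule.topologicalClosure_eq_top_iff, Submodule.eq_bot_iff]
    intro k hk
    -- the `V`-orthogonality of `k` is `energy`-orthogonality of `B⁻¹ k`
    set B := S.isCoercive_energy.continuousLinearEquivOfBilin
    have hB : ∀ w, S.energy (B.symm k) w = ⟪k, w⟫_ℝ := fun w => by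
      rw [← S.isCoercive_energy.continuousLinearEquivOfBilin_apply]
      simp [B]
    have h1 : S.res (S.res (S.j (B.symm k))) = 0 := by
      refine ext_inner_left ℝ fun h => ?_
      have h2 := hk (S.lift (S.res (S.res h))) ⟨h, rfl⟩
      rw [real_inner_comm, ← hB, energy_comm, energy_lift] at h2
      rw [← S.res_symm, ← S.res_symm, h2, inner_zero_right]
    have h2 := S.eq_zero_of_res_eq_zero (S.eq_zero_of_res_eq_zero h1)
    have h3 : B.symm k = 0 := S.inj (by rw [map_zero]; exact h2)
    simpa using h3
  exact (Submodule.dense_iff_topologicalClosure_eq_top.2 this : Dense (L.range : Set V))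

/-- The bounded inverse of `res + ε`. -/
theorem exists_inverse {ε : ℝ} (hε : 0 < ε) : ∃ Q : K →L[ℝ] K,
    (∀ x, S.res (Q x) + ε • Q x = x) ∧ (∀ x, Q (S.res x) = S.res (Q x)) := by
  let b : K →L[ℝ] K →L[ℝ] ℝ :=
    (innerSL ℝ : K →L[ℝ] K →L[ℝ] ℝ).comp (S.res + ε • ContinuousLinearMap.id ℝ K)
  have hb : ∀ x y, b x y = ⟪S.res x + ε • x, y⟫_ℝ := fun x y => rfl
  have hc : IsCoercive b := ⟨ε, hε, fun u => by
    rw [hb, inner_add_left, real_inner_smul_left, real_inner_self_eq_norm_sq]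
    nlinarith [S.inner_res_nonneg u]⟩
  set B := hc.continuousLinearEquivOfBilin
  have hB : ∀ x, B x = S.res x + ε • x := fun x =>
    ext_inner_right ℝ fun y => by rw [hc.continuousLinearEquivOfBilin_apply, hb]
  have h1 : ∀ x, S.res (B.symm x) + ε • B.symm x = x := fun x => by rw [← hB]; simp
  refine ⟨B.symm, h1, fun x => ?_⟩
  apply B.injective
  have := congrArg S.res (h1 x)
  rw [map_add, map_smul] at this
  rw [hB]
  exact (h1 _).trans (this.symm.trans (hB _).symm)

theorem norm_res_inverse_le {ε : ℝ} (hε : 0 < ε) {Q : K →L[ℝ] K}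
    (hQ : ∀ x, S.res (Q x) + ε • Q x = x) (x : K) : ‖S.res (Q x)‖ ≤ ‖x‖ ∧ ε * ‖Q x‖ ≤ ‖x‖ := by
  have h1 : ‖x‖ ^ 2 = ‖S.res (Q x)‖ ^ 2 + 2 * (ε * ⟪S.res (Q x), Q x⟫_ℝ) + (ε * ‖Q x‖) ^ 2 := by
    conv_lhs => rw [← hQ x]
    rw [norm_add_sq_real, real_inner_smul_right, norm_smul, Real.norm_of_nonneg hε.le]
  have h2 := mul_nonneg hε.le (S.inner_res_nonneg (Q x))
  constructor
  · exact (abs_le_of_sq_le_sq' (by nlinarith [sq_nonneg (ε * ‖Q x‖)]) (norm_nonneg _)).2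
  · exact (abs_le_of_sq_le_sq' (by nlinarith [sq_nonneg ‖S.res (Q x)‖]) (norm_nonneg _)).2

theorem inverse_symm {ε : ℝ} {Q : K →L[ℝ] K}
    (hQ : ∀ x, S.res (Q x) + ε • Q x = x) (x y : K) : ⟪Q x, y⟫_ℝ = ⟪x, Q y⟫_ℝ := by
  have h1 : ⟪Q x, y⟫_ℝ = ⟪Q x, S.res (Q y) + ε • Q y⟫_ℝ := by rw [hQ]
  have h2 : ⟪x, Q y⟫_ℝ = ⟪S.res (Q x) + ε • Q x, Q y⟫_ℝ := by rw [hQ]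
  rw [h1, h2, inner_add_left, inner_add_right, S.res_symm, real_inner_smul_left,
    real_inner_smul_right]

theorem yosida_nonneg {ε : ℝ} (hε : 0 < ε) {Q : K →L[ℝ] K}
    (hQ : ∀ x, S.res (Q x) + ε • Q x = x) (x : K) : 0 ≤ ⟪Q x - S.res (Q x), x⟫_ℝ := by
  have h1 : ⟪Q x - S.res (Q x), x⟫_ℝ = ⟪Q x - S.res (Q x), S.res (Q x) + ε • Q x⟫_ℝ := by rw [hQ]
  rw [h1, inner_sub_left, inner_add_right, inner_add_right, real_inner_smul_right,
    real_inner_smul_right, real_inner_self_eq_norm_sq, real_inner_self_eq_norm_sq, real_inner_comm]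
  nlinarith [S.norm_res_sq_le (Q x), S.inner_res_le (Q x)]
end EnergyTriple

/-! ### The wave equation with a bounded operator -/

/-- Duhamel's formula solves a linear differential equation with a bounded operator. -/
theorem exists_hasDerivAt_linear {X : Type*} [NormedAddCommGroup X] [NormedSpace ℝ X]
    [CompleteSpace X] (L : X →L[ℝ] X) (x₀ : X) {F : ℝ → X} (hF : Continuous F) :
    ∃ x : ℝ → X, x 0 = x₀ ∧ ∀ t, HasDerivAt x (L (x t) + F t) t := by
  have hexp : ∀ t : ℝ, HasDerivAt (fun s : ℝ => NormedSpace.exp (s • L))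
      (L * NormedSpace.exp (t • L)) t := fun t => hasDerivAt_exp_smul_const' L t
  have hc : Continuous fun s : ℝ => NormedSpace.exp (s • L) :=
    continuous_iff_continuousAt.2 fun t => (hexp t).continuousAt
  have hinv : ∀ t : ℝ, NormedSpace.exp (t • L) * NormedSpace.exp ((-t) • L) = 1 := fun t => by
    let _ : NormedAlgebra ℚ (X →L[ℝ] X) := NormedAlgebra.restrictScalars ℚ ℝ _
    rw [← NormedSpace.exp_add_of_commute ((Commute.refl L).smul_left t |>.smul_right (-t)),
      ← add_smul, add_neg_cancel, zero_smul, NormedSpace.exp_zero]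
  have hG : Continuous fun s : ℝ => NormedSpace.exp ((-s) • L) (F s) :=
    (hc.comp continuous_neg).clm_apply hF
  refine ⟨fun t => NormedSpace.exp (t • L)
    (x₀ + ∫ s in (0 : ℝ)..t, NormedSpace.exp ((-s) • L) (F s)), by simp, fun t => ?_⟩
  have h1 := (hexp t).clm_apply
    ((intervalIntegral.integral_hasDerivAt_right (hG.intervalIntegrable 0 t)
      (hG.stronglyMeasurableAtFilter _ _) hG.continuousAt).const_add x₀)
  convert h1 using 1
  have h2 := congrArg (fun B : X →L[ℝ] X => B (F t)) (hinv t)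
  congr 1
  exact h2.symm

theorem exists_hasDerivAt_wave {K : Type*} [NormedAddCommGroup K] [NormedSpace ℝ K]
    [CompleteSpace K] (L : K →L[ℝ] K) (y₀ y₁ : K) {F : ℝ → K} (hF : Continuous F) :
    ∃ y y' : ℝ → K, y 0 = y₀ ∧ y' 0 = y₁ ∧ (∀ t, HasDerivAt y (y' t) t) ∧
      ∀ t, HasDerivAt y' (F t - L (y t)) t := by
  let B : K × K →L[ℝ] K × K :=
    (ContinuousLinearMap.snd ℝ K K).prod (-(L.comp (ContinuousLinearMap.fst ℝ K K)))
  obtain ⟨x, hx0, hx⟩ := exists_hasDerivAt_linear B (y₀, y₁) (F := fun t => (0, F t))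
    (continuous_const.prodMk hF)
  refine ⟨fun t => (x t).1, fun t => (x t).2, by simp [hx0], by simp [hx0], fun t => ?_,
    fun t => ?_⟩
  · simpa [B, Function.comp_def] using
      (ContinuousLinearMap.fst ℝ K K).hasFDerivAt.comp_hasDerivAt t (hx t)
  · simpa [B, sub_eq_add_neg, add_comm, Function.comp_def] using
      (ContinuousLinearMap.snd ℝ K K).hasFDerivAt.comp_hasDerivAt t (hx t)

/-- Gronwall's inequality for the energies below. -/
theorem le_of_hasDerivAt_le_two_mul_add {e e' γ : ℝ → ℝ} (he : ∀ t, HasDerivAt e (e' t) t)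
    (hγ : Continuous γ) (h : ∀ t, e' t ≤ 2 * e t + γ t) (hpos : ∀ t, 0 ≤ γ t) {t : ℝ}
    (ht : 0 ≤ t) : e t ≤ Real.exp (2 * t) * (e 0 + ∫ s in (0 : ℝ)..t, γ s) := by
  have hd : ∀ t, HasDerivAt (fun t => Real.exp (-(2 * t)) * e t -
      ∫ s in (0 : ℝ)..t, Real.exp (-(2 * s)) * γ s)
      (Real.exp (-(2 * t)) * (-(2 * 1)) * e t + Real.exp (-(2 * t)) * e' t -
        Real.exp (-(2 * t)) * γ t) t := fun t => by
    have hc : Continuous fun s => Real.exp (-(2 * s)) * γ s := by fun_prop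
    exact ((((hasDerivAt_id t).const_mul 2).neg.exp.mul (he t))).sub
      (intervalIntegral.integral_hasDerivAt_right (hc.intervalIntegrable 0 t)
        (hc.stronglyMeasurableAtFilter _ _) hc.continuousAt)
  have hanti := antitone_of_hasDerivAt_nonpos hd fun t => by
    have := mul_le_mul_of_nonneg_left (h t) (Real.exp_pos (-(2 * t))).le
    simp only [Pi.zero_apply]
    nlinarith
  have h1 := hanti ht
  simp only [mul_zero, neg_zero, Real.exp_zero, one_mul, intervalIntegral.integral_same,
    sub_zero] at h1
  have h2 : ∫ s in (0 : ℝ)..t, Real.exp (-(2 * s)) * γ s ≤ ∫ s in (0 : ℝ)..t, γ s := by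
    refine intervalIntegral.integral_mono_on ht
      (Continuous.intervalIntegrable (by fun_prop) _ _)
      (hγ.intervalIntegrable _ _) fun s hs => ?_
    have : Real.exp (-(2 * s)) ≤ 1 := Real.exp_le_one_iff.2 (by linarith [hs.1])
    nlinarith [hpos s]
  have h3 : Real.exp (-(2 * t)) * e t ≤ e 0 + ∫ s in (0 : ℝ)..t, γ s := by linarith
  calc e t = Real.exp (2 * t) * (Real.exp (-(2 * t)) * e t) := by
        rw [← mul_assoc, ← Real.exp_add]; simp
    _ ≤ _ := mul_le_mul_of_nonneg_left h3 (Real.exp_pos _).le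

namespace EnergyTriple
variable {V K : Type*} [NormedAddCommGroup V] [InnerProductSpace ℝ V] [CompleteSpace V]
  [NormedAddCommGroup K] [InnerProductSpace ℝ K] [CompleteSpace K] (S : EnergyTriple V K)

/-- A smooth solution `u = lift x` of the wave equation with right-hand side `F`: with `R` the
resolvent, the function `R x` solves `(R x)'' + (1 - R) x = F`. -/
structure IsSmoothSolution (x x' x'' F : ℝ → K) : Prop where
  hasDerivAt : ∀ t, HasDerivAt x (x' t) t
  hasDerivAt' : ∀ t, HasDerivAt x' (x'' t) t
  continuous : Continuous F
  eq : ∀ t, S.res (x'' t) + (x t - S.res (x t)) = F t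

variable {S}

theorem IsSmoothSolution.sub {x x' x'' F y y' y'' G : ℝ → K} (hx : S.IsSmoothSolution x x' x'' F)
    (hy : S.IsSmoothSolution y y' y'' G) :
    S.IsSmoothSolution (fun t => x t - y t) (fun t => x' t - y' t) (fun t => x'' t - y'' t)
      (fun t => F t - G t) where
  hasDerivAt t := (hx.hasDerivAt t).sub (hy.hasDerivAt t)
  hasDerivAt' t := (hx.hasDerivAt' t).sub (hy.hasDerivAt' t)
  continuous := hx.continuous.sub hy.continuous
  eq t := by
    rw [← hx.eq, ← hy.eq, map_sub, map_sub]
    abel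

/-- The energy inequality. -/
theorem IsSmoothSolution.energy_le {x x' x'' F : ℝ → K} (hx : S.IsSmoothSolution x x' x'' F)
    {t T : ℝ} (ht : t ∈ Icc 0 T) :
    ‖S.res (x' t)‖ ^ 2 + ⟪S.res (x t), x t⟫_ℝ ≤ Real.exp (2 * T) *
      (‖S.res (x' 0)‖ ^ 2 + ⟪S.res (x 0), x 0⟫_ℝ + ∫ s in (0 : ℝ)..T, ‖F s‖ ^ 2) := by
  have hF2 : Continuous fun s => ‖F s‖ ^ 2 := hx.continuous.norm.pow 2
  have hd : ∀ t, HasDerivAt (fun t => ‖S.res (x' t)‖ ^ 2 + ⟪S.res (x t), x t⟫_ℝ)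
      (2 * ⟪S.res (x' t), F t + S.res (x t)⟫_ℝ) t := fun t => by
    have h1 := (S.res.hasFDerivAt.comp_hasDerivAt t (hx.hasDerivAt' t)).norm_sq
    have h2 := (S.res.hasFDerivAt.comp_hasDerivAt t (hx.hasDerivAt t)).inner ℝ (hx.hasDerivAt t)
    refine (h1.fun_add h2).congr_deriv ?_
    simp only [Function.comp_apply]
    rw [← hx.eq, S.res_symm (x t), real_inner_comm (S.res (x' t)) (x t)]
    simp only [inner_add_right, inner_sub_right]
    ring
  have hle := le_of_hasDerivAt_le_two_mul_add hd hF2 (fun t => ?_) (fun t => sq_nonneg _) ht.1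
  · refine hle.trans (mul_le_mul (Real.exp_le_exp.2 (by linarith [ht.2])) ?_ ?_ (Real.exp_pos _).le)
    · gcongr
      rw [← intervalIntegral.integral_add_adjacent_intervals (hF2.intervalIntegrable 0 t)
        (hF2.intervalIntegrable t T)]
      exact le_add_of_nonneg_right (intervalIntegral.integral_nonneg ht.2 fun _ _ => sq_nonneg _)
    · have := S.inner_res_nonneg (x 0)
      have := intervalIntegral.integral_nonneg (μ := volume) ht.1 fun s _ => sq_nonneg ‖F s‖
      positivity
  · have h1 := real_inner_le_norm (S.res (x' t)) (F t)
    have h2 := real_inner_le_norm (S.res (x' t)) (S.res (x t))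
    have h3 := S.norm_res_sq_le (x t)
    rw [inner_add_right]
    nlinarith [sq_nonneg (‖S.res (x' t)‖ - ‖F t‖), sq_nonneg (‖S.res (x' t)‖ - ‖S.res (x t)‖)]

variable (S)

/-- Solutions with data in the range of powers of the resolvent `R`, up to a small error in the
right-hand side. The operator `L = R⁻¹ - 1` is replaced by the bounded operator `(1 - R)(R + ε)⁻¹`;
for a solution of the form `R y`, with `y` bounded uniformly in `ε`, the error is `O(ε)`. -/
theorem exists_isSmoothSolution (η y₁ : K) {G : ℝ → K} (hG : Continuous G) {T κ : ℝ}
    (hκ : 0 < κ) : ∃ x x' x'' F : ℝ → K, S.IsSmoothSolution x x' x'' F ∧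
      x 0 = S.res (S.res η) ∧ x' 0 = S.res y₁ ∧
      ∀ t ∈ Icc 0 T, ‖F t - S.res (S.res (G t))‖ ≤ κ := by
  set M := Real.exp (2 * T) * (‖y₁‖ ^ 2 + (‖η‖ ^ 2 + ‖η‖ ^ 2) + ∫ s in (0 : ℝ)..T, ‖G s‖ ^ 2)
  obtain ⟨ε, hε, hεM⟩ : ∃ ε : ℝ, 0 < ε ∧ ε * (M + 1) ≤ κ := by
    rcases le_or_gt (M + 1) 1 with h | h
    · exact ⟨κ, hκ, by nlinarith⟩
    · exact ⟨κ / (M + 1), by positivity, by rw [div_mul_cancel₀ _ (by positivity)]⟩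
  obtain ⟨Q, hQ, hcomm⟩ := S.exists_inverse hε
  let L : K →L[ℝ] K := Q - S.res.comp Q
  have hL : ∀ x, L x = Q x - S.res (Q x) := fun x => rfl
  have hLsymm : ∀ x y, ⟪L x, y⟫_ℝ = ⟪x, L y⟫_ℝ := fun x y => by
    rw [hL, hL, inner_sub_left, inner_sub_right, S.inverse_symm hQ, S.res_symm,
      S.inverse_symm hQ, hcomm]
  obtain ⟨y, y', hy0, hy0', hy, hy'⟩ := exists_hasDerivAt_wave L (S.res η) y₁ hG
  have hyc : Continuous y := continuous_iff_continuousAt.2 fun t => (hy t).continuousAt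
  -- the energy of `y` is bounded independently of `ε`
  have hd : ∀ t, HasDerivAt (fun t => ‖y' t‖ ^ 2 + (⟪L (y t), y t⟫_ℝ + ‖y t‖ ^ 2))
      (2 * ⟪y' t, G t + y t⟫_ℝ) t := fun t => by
    have h1 := (hy' t).norm_sq
    have h2 := (L.hasFDerivAt.comp_hasDerivAt t (hy t)).inner ℝ (hy t)
    refine (h1.fun_add (h2.fun_add (hy t).norm_sq)).congr_deriv ?_
    simp only [Function.comp_apply]
    rw [hLsymm (y' t), real_inner_comm (y' t) (y t), real_inner_comm (y' t) (L (y t))]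
    simp only [inner_add_right, inner_sub_right]
    ring
  have hM : ∀ t ∈ Icc 0 T, ‖y t‖ ^ 2 ≤ M := fun t ht => by
    have hG2 : Continuous fun s => ‖G s‖ ^ 2 := hG.norm.pow 2
    have hle := le_of_hasDerivAt_le_two_mul_add hd hG2 (fun t => ?_) (fun t => sq_nonneg _) ht.1
    · have h1 := S.yosida_nonneg hε hQ (y t)
      rw [← hL] at h1
      have h2 : ⟪L (y 0), y 0⟫_ℝ ≤ ‖η‖ ^ 2 := by
        rw [hy0, hL, hcomm]
        have h3 := real_inner_le_norm (S.res (Q η) - S.res (S.res (Q η))) (S.res η)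
        have h4 := (S.norm_sub_res_le (S.res (Q η))).trans (S.norm_res_inverse_le hε hQ η).1
        have h5 := S.norm_res_le η
        nlinarith [norm_nonneg η, norm_nonneg (S.res η)]
      have h3 : ‖y 0‖ ^ 2 ≤ ‖η‖ ^ 2 := by
        rw [hy0]
        exact pow_le_pow_left₀ (norm_nonneg _) (S.norm_res_le η) 2
      refine (?_ : ‖y t‖ ^ 2 ≤ _).trans (hle.trans ?_)
      · nlinarith [sq_nonneg ‖y' t‖]
      · refine mul_le_mul (Real.exp_le_exp.2 (by linarith [ht.2])) ?_ ?_ (Real.exp_pos _).le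
        · rw [hy0']
          gcongr
          rw [← intervalIntegral.integral_add_adjacent_intervals (hG2.intervalIntegrable 0 t)
            (hG2.intervalIntegrable t T)]
          exact le_add_of_nonneg_right
            (intervalIntegral.integral_nonneg ht.2 fun _ _ => sq_nonneg _)
        · have h4 := S.yosida_nonneg hε hQ (y 0)
          rw [← hL] at h4
          have := intervalIntegral.integral_nonneg (μ := volume) ht.1 fun s _ => sq_nonneg ‖G s‖
          positivity
    · have h1 := real_inner_le_norm (y' t) (G t)
      have h2 := real_inner_le_norm (y' t) (y t)
      have h3 := S.yosida_nonneg hε hQ (y t)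
      rw [← hL] at h3
      rw [inner_add_right]
      nlinarith [sq_nonneg (‖y' t‖ - ‖G t‖), sq_nonneg (‖y' t‖ - ‖y t‖)]
  have hR : ∀ {z z' : ℝ → K}, (∀ t, HasDerivAt z (z' t) t) →
      ∀ t, HasDerivAt (fun t => S.res (z t)) (S.res (z' t)) t :=
    fun h t => S.res.hasFDerivAt.comp_hasDerivAt t (h t)
  refine ⟨fun t => S.res (y t), fun t => S.res (y' t), fun t => S.res (G t - L (y t)),
    fun t => S.res (S.res (G t - L (y t))) + (S.res (y t) - S.res (S.res (y t))),
    ⟨hR hy, hR hy', by fun_prop, fun t => rfl⟩, by simp only [hy0], by simp only [hy0'],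
    fun t ht => ?_⟩
  -- the error is `ε (1 - R) Q R y`
  have herr : S.res (S.res (G t - L (y t))) + (S.res (y t) - S.res (S.res (y t)))
      - S.res (S.res (G t)) = ε • (S.res (Q (y t)) - S.res (S.res (Q (y t)))) := by
    have h1 : S.res (y t) = S.res (S.res (Q (y t)) + ε • Q (y t)) := by rw [hQ]
    have h2 : S.res (S.res (y t)) = S.res (S.res (S.res (Q (y t)) + ε • Q (y t))) := by rw [hQ]
    rw [h2, h1, hL]
    simp only [map_sub, map_add, map_smul, smul_sub]
    abel
  rw [herr, norm_smul, Real.norm_of_nonneg hε.le]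
  have h1 := (S.norm_sub_res_le (S.res (Q (y t)))).trans (S.norm_res_inverse_le hε hQ (y t)).1
  have h2 : ‖y t‖ ≤ M + 1 := by nlinarith [hM t ht, sq_nonneg (‖y t‖ - 1), norm_nonneg (y t)]
  exact (mul_le_mul_of_nonneg_left (h1.trans h2) hε.le).trans hεM

end EnergyTriple

/-! ### Weak derivatives on an interval -/

section
theorem ContinuousOn.memLp_Icc {X : Type*} [NormedAddCommGroup X] {T : ℝ} {w : ℝ → X} (hw : ContinuousOn w (Icc 0 T)) (p : ENNReal) :
    MemLp w p (volume.restrict (Icc 0 T)) := by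
  obtain ⟨C, hC⟩ := isCompact_Icc.exists_bound_of_continuousOn hw
  have : IsFiniteMeasure (volume.restrict (Icc (0 : ℝ) T)) := ⟨by simp⟩
  exact MemLp.of_bound (hw.aestronglyMeasurable measurableSet_Icc) C
    ((ae_restrict_iff' measurableSet_Icc).2 (Filter.Eventually.of_forall hC))

namespace HypStokes
variable {X : Type*} [NormedAddCommGroup X] [NormedSpace ℝ X] {T : ℝ}

theorem HasWeakDeriv.congr {w w' v : ℝ → X} (h : HasWeakDeriv T w w')
    (hv : ∀ t ∈ Icc 0 T, v t = w t) : HasWeakDeriv T v w' := fun φ h1 h2 h3 => by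
  rw [← h φ h1 h2 h3]
  exact setIntegral_congr_fun measurableSet_Icc fun t ht => by simp only [hv t ht]

/-- A classical derivative is a weak derivative. -/
theorem hasWeakDeriv_of_hasDerivAt [CompleteSpace X] (hT : 0 ≤ T) {w w' : ℝ → X}
    (hw : ContinuousOn w (Icc 0 T)) (hw' : ContinuousOn w' (Icc 0 T))
    (h : ∀ t ∈ Ioo 0 T, HasDerivAt w (w' t) t) : HasWeakDeriv T w w' := fun φ h1 _ h3 => by
  have hφ : Differentiable ℝ φ := h1.differentiable (by simp)
  have h0 : ∀ t, t ∉ Ioo 0 T → φ t = 0 := fun t ht =>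
    image_eq_zero_of_notMem_tsupport fun h => ht (h3 h)
  have := intervalIntegral.integral_smul_deriv_eq_deriv_smul_of_hasDerivAt (a := 0) (b := T)
    (u := φ) (u' := deriv φ) (v := w) (v' := w') hφ.continuous.continuousOn
    (by rwa [uIcc_of_le hT]) (fun t _ => (hφ t).hasDerivAt)
    (by rw [min_eq_left hT, max_eq_right hT]; exact h)
    ((h1.continuous_deriv (by simp)).intervalIntegrable _ _)
    (by rw [← uIcc_of_le hT] at hw'; exact hw'.intervalIntegrable)
  rw [h0 0 (by simp), h0 T (by simp), zero_smul, zero_smul, sub_zero, zero_sub] at this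
  rw [integral_Icc_eq_integral_Ioc, integral_Icc_eq_integral_Ioc,
    ← intervalIntegral.integral_of_le hT, ← intervalIntegral.integral_of_le hT, this, neg_neg]

/-- Weak derivatives pass to limits in `L²`. -/
theorem hasWeakDeriv_of_tendsto {w w' : ℕ → ℝ → X} {v v' : ℝ → X}
    (h : ∀ m, HasWeakDeriv T (w m) (w' m))
    (hw : ∀ m, MemLp (w m) 2 (volume.restrict (Icc 0 T)))
    (hw' : ∀ m, MemLp (w' m) 2 (volume.restrict (Icc 0 T)))
    (hv : MemLp v 2 (volume.restrict (Icc 0 T))) (hv' : MemLp v' 2 (volume.restrict (Icc 0 T)))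
    (hlim : Filter.Tendsto (fun m => eLpNorm (w m - v) 2 (volume.restrict (Icc 0 T))) Filter.atTop
      (nhds 0))
    (hlim' : Filter.Tendsto (fun m => eLpNorm (w' m - v') 2 (volume.restrict (Icc 0 T)))
      Filter.atTop (nhds 0)) : HasWeakDeriv T v v' := by
  have : IsFiniteMeasure (volume.restrict (Icc (0 : ℝ) T)) := ⟨by simp⟩
  have key : ∀ {φ : ℝ → ℝ} {r : ℕ → ℝ → X} {s : ℝ → X}, Continuous φ → HasCompactSupport φ →
      (∀ m, MemLp (r m) 2 (volume.restrict (Icc 0 T))) → MemLp s 2 (volume.restrict (Icc 0 T)) →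
      Filter.Tendsto (fun m => eLpNorm (r m - s) 2 (volume.restrict (Icc 0 T))) Filter.atTop
        (nhds 0) → Filter.Tendsto (fun m => ∫ t in Icc 0 T, φ t • r m t) Filter.atTop
          (nhds (∫ t in Icc 0 T, φ t • s t)) := by
    intro φ r s hφ hφc hr hs hrs
    obtain ⟨C, hC⟩ := hφc.exists_bound_of_continuous hφ
    have hint : ∀ {s : ℝ → X}, MemLp s 2 (volume.restrict (Icc 0 T)) →
        Integrable (fun t => φ t • s t) (volume.restrict (Icc 0 T)) := fun hs =>
      (hs.integrable (by norm_num)).bdd_smul C hφ.aestronglyMeasurable.restrict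
        (Filter.Eventually.of_forall hC)
    refine tendsto_integral_of_L1' _ (hint hs).aestronglyMeasurable
      (Filter.Eventually.of_forall fun m => hint (hr m)) ?_
    have hle : ∀ m, eLpNorm ((fun t => φ t • r m t) - fun t => φ t • s t) 1
        (volume.restrict (Icc 0 T)) ≤ ENNReal.ofReal C *
          (eLpNorm (r m - s) 2 (volume.restrict (Icc 0 T)) *
            (volume.restrict (Icc (0 : ℝ) T)) univ ^ (1 / (1 : ENNReal).toReal -
              1 / (2 : ENNReal).toReal)) := fun m => by
      refine (eLpNorm_le_mul_eLpNorm_of_ae_le_mul (g := r m - s) (c := C)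
        (Filter.Eventually.of_forall fun t => ?_) 1).trans ?_
      · simp only [Pi.sub_apply, ← smul_sub, norm_smul]
        exact mul_le_mul_of_nonneg_right (hC t) (norm_nonneg _)
      · gcongr
        exact eLpNorm_le_eLpNorm_mul_rpow_measure_univ (by norm_num)
          ((hr m).sub hs).aestronglyMeasurable
    refine tendsto_of_tendsto_of_tendsto_of_le_of_le tendsto_const_nhds ?_ (fun _ => zero_le) hle
    have h1 := ENNReal.Tendsto.mul_const (b := (volume.restrict (Icc (0 : ℝ) T)) univ ^
      (1 / (1 : ENNReal).toReal - 1 / (2 : ENNReal).toReal)) hrs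
      (Or.inr (ENNReal.rpow_ne_top_of_nonneg (by norm_num) (measure_ne_top _ _)))
    have h2 := ENNReal.Tendsto.const_mul (a := ENNReal.ofReal C) h1 (Or.inr ENNReal.ofReal_ne_top)
    simpa using h2
  intro φ h1 h2 h3
  refine tendsto_nhds_unique (key (h1.continuous_deriv (by simp)) h2.deriv hw hv hlim) ?_
  have := (key h1.continuous h2 hw' hv' hlim').neg
  refine this.congr fun m => ?_
  rw [h m φ h1 h2 h3]

/-- The lemma of du Bois-Reymond: a continuous function with vanishing weak derivative is
constant. -/
theorem eq_of_hasWeakDeriv_zero (hT : 0 < T) {r : ℝ → ℝ} (hr : ContinuousOn r (Icc 0 T))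
    (h : HasWeakDeriv T r 0) {t : ℝ} (ht : t ∈ Icc 0 T) : r t = r 0 := by
  let b : ContDiffBump (T / 2) := ⟨T / 8, T / 4, by positivity, by linarith⟩
  set θ : ℝ → ℝ := b.normed volume
  have hθs : tsupport θ ⊆ Ioo 0 T := by
    rw [b.tsupport_normed_eq, Real.closedBall_eq_Icc]
    intro x hx
    simp only [b, mem_Icc] at hx
    exact ⟨by linarith [hx.1], by linarith [hx.2]⟩
  have hθ1 : ∫ x, θ x = 1 := b.integral_normed
  have hθc : ContDiff ℝ ∞ θ := b.contDiff_normed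
  have hθcs : HasCompactSupport θ := b.hasCompactSupport_normed
  set c := ∫ x in Icc 0 T, θ x * r x
  have hint : ∀ {ψ : ℝ → ℝ}, Continuous ψ → IntegrableOn (fun x => ψ x * r x) (Icc 0 T) :=
    fun hψ => (hψ.continuousOn.mul hr).integrableOn_Icc
  have key : ∀ ψ : ℝ → ℝ, ContDiff ℝ ∞ ψ → HasCompactSupport ψ → tsupport ψ ⊆ Ioo 0 T →
      ∫ x, ψ x • (r x - c) = 0 := by
    intro ψ hψ hψc hψs
    set m := ∫ x, ψ x
    -- the primitive of `ψ - (∫ ψ) θ` is a test function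
    set σ : ℝ → ℝ := fun x => ψ x - m * θ x
    have hσ : ContDiff ℝ ∞ σ := hψ.sub (contDiff_const.mul hθc)
    set φ : ℝ → ℝ := fun x => ∫ s in (0 : ℝ)..x, σ s
    have hdφ : ∀ x, HasDerivAt φ (σ x) x := fun x =>
      intervalIntegral.integral_hasDerivAt_right (hσ.continuous.intervalIntegrable _ _)
        (hσ.continuous.stronglyMeasurableAtFilter _ _) hσ.continuous.continuousAt
    have hdφ' : deriv φ = σ := funext fun x => (hdφ x).deriv
    have hφ : ContDiff ℝ ∞ φ := by
      rw [contDiff_infty_iff_deriv]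
      exact ⟨fun x => (hdφ x).differentiableAt, by rw [hdφ']; exact hσ⟩
    have hK : IsCompact (tsupport ψ ∪ tsupport θ) := hψc.union hθcs
    have hKs : tsupport ψ ∪ tsupport θ ⊆ Ioo 0 T := union_subset hψs hθs
    have hne : (tsupport ψ ∪ tsupport θ).Nonempty := by
      by_contra hne
      rw [not_nonempty_iff_eq_empty, union_empty_iff] at hne
      have : θ = 0 := tsupport_eq_empty_iff.1 hne.2
      simp [this] at hθ1
    obtain ⟨a, haK, ha⟩ := hK.exists_isLeast hne
    obtain ⟨d, hdK, hd⟩ := hK.exists_isGreatest hne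
    have hσ0 : ∀ x, x ∉ Icc a d → σ x = 0 := fun x hx => by
      have hx' : x ∉ tsupport ψ ∪ tsupport θ := fun h => hx ⟨ha h, hd h⟩
      simp only [mem_union, not_or] at hx'
      simp [σ, image_eq_zero_of_notMem_tsupport hx'.1, image_eq_zero_of_notMem_tsupport hx'.2]
    have hσint : ∫ x, σ x = 0 := by
      rw [integral_sub (hψ.continuous.integrable_of_hasCompactSupport hψc)
        ((hθc.continuous.integrable_of_hasCompactSupport hθcs).const_mul m),
        integral_const_mul, hθ1, mul_one, sub_self]
    have hφ0 : ∀ x, x ∉ Icc a d → φ x = 0 := fun x hx => by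
      have ha0 := (hKs haK).1
      rcases lt_or_ge x a with hxa | hxa
      · refine intervalIntegral.integral_zero_ae (Filter.Eventually.of_forall fun s hs => hσ0 s ?_)
        intro hs'
        have := hs.2
        exact absurd hs'.1 (not_le.2 (this.trans_lt (max_lt ha0 hxa)))
      · have hxd : d < x := not_le.1 fun h => hx ⟨hxa, h⟩
        have h0x : 0 ≤ x := ha0.le.trans hxa
        change ∫ s in (0 : ℝ)..x, σ s = 0
        rw [intervalIntegral.integral_of_le h0x, setIntegral_eq_integral_of_forall_compl_eq_zero,
          hσint]
        intro s hs
        exact hσ0 s fun h => hs ⟨ha0.trans_le h.1, h.2.trans hxd.le⟩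
    have hφs : tsupport φ ⊆ Icc a d := closure_minimal
      (fun x hx => by by_contra h; exact hx (hφ0 x h)) isClosed_Icc
    have hφs' : tsupport φ ⊆ Ioo 0 T := hφs.trans fun x hx =>
      ⟨(hKs haK).1.trans_le hx.1, hx.2.trans_lt (hKs hdK).2⟩
    have h1 := h φ hφ (isCompact_Icc.of_isClosed_subset (isClosed_tsupport _) hφs) hφs'
    simp only [hdφ', Pi.zero_apply, smul_eq_mul, mul_zero, integral_zero, neg_zero, σ,
      sub_mul, mul_assoc] at h1
    rw [integral_sub (hint hψ.continuous) ((hint hθc.continuous).const_mul m),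
      integral_const_mul] at h1
    have h2 : ∫ x, ψ x • (r x - c) = ∫ x in Icc 0 T, ψ x * (r x - c) := by
      refine (setIntegral_eq_integral_of_forall_compl_eq_zero fun x hx => ?_).symm
      have : ψ x = 0 := image_eq_zero_of_notMem_tsupport fun h => hx (Ioo_subset_Icc_self (hψs h))
      simp [this]
    have h3 : ∫ x in Icc 0 T, ψ x = m :=
      setIntegral_eq_integral_of_forall_compl_eq_zero fun x hx =>
        image_eq_zero_of_notMem_tsupport fun h => hx (Ioo_subset_Icc_self (hψs h))
    rw [h2]
    simp only [mul_sub]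
    have h4 : IntegrableOn (fun x => ψ x * c) (Icc 0 T) :=
      (Continuous.mul hψ.continuous continuous_const).integrableOn_Icc
    rw [integral_sub (hint hψ.continuous) h4,
      integral_mul_const, h3]
    exact h1
  have hae := isOpen_Ioo.ae_eq_zero_of_integral_contDiff_smul_eq_zero (μ := volume)
    (f := fun x => r x - c) (((hr.sub continuousOn_const).mono
      Ioo_subset_Icc_self).locallyIntegrableOn measurableSet_Ioo) key
  have heq : EqOn r (fun _ => c) (Ioo 0 T) := by
    refine Measure.eqOn_open_of_ae_eq (μ := volume) ?_ isOpen_Ioo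
      (hr.mono Ioo_subset_Icc_self) continuousOn_const
    rw [Filter.EventuallyEq, ae_restrict_iff' measurableSet_Ioo]
    filter_upwards [hae] with x hx hx'
    exact sub_eq_zero.1 (hx hx')
  have heq' : EqOn r (fun _ => c) (Icc 0 T) := by
    refine heq.of_subset_closure hr continuousOn_const Ioo_subset_Icc_self ?_
    rw [closure_Ioo hT.ne]
  rw [heq' ht, heq' ⟨le_rfl, hT.le⟩]

end HypStokes
end

/-! ### The abstract wave equation -/

namespace EnergyTriple
variable {V K : Type*} [NormedAddCommGroup V] [InnerProductSpace ℝ V]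
  [NormedAddCommGroup K] [InnerProductSpace ℝ K] {S : EnergyTriple V K}

/-- Weak solutions `u ∈ C([0,T];V) ∩ C¹([0,T];K) ∩ H²([0,T];V')` of `u'' + L u = f`, where `L` is
the operator of the form `a`, with initial data `u₀` and `u₁`. -/
structure IsWeakWave (S : EnergyTriple V K) (T : ℝ) (f : ℝ → K) (u₀ : V) (u₁ : K) (u : ℝ → V) :
    Prop where
  continuousOn : ContinuousOn u (Icc 0 T)
  initial : u 0 = u₀
  exists_C1 : ∃ w : ℝ → K, (∀ t ∈ Icc 0 T, w t = S.j (u t)) ∧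
    ContDiffOn ℝ 1 w (Icc 0 T) ∧ derivWithin w (Icc 0 T) 0 = u₁
  exists_H2 : ∃ z : ℝ → StrongDual ℝ V, HypStokes.HasH2Deriv T (fun t => S.toDualV (S.j (u t))) z ∧
    ∀ᵐ t ∂volume.restrict (Icc 0 T), ∀ v, z t v + S.a (u t) v = ⟪f t, S.j v⟫_ℝ

variable [CompleteSpace V] [CompleteSpace K]

/-- In the difference of two weak solutions the right-hand side cancels; tested with the vectors
`lift h`, the equation becomes an integral equation in `K` for the resolvent `R`. -/
theorem IsWeakWave.integral_eq {T : ℝ} (hT : 0 < T) {f : ℝ → K} {u₀ : V} {u₁ : K} {u v : ℝ → V}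
    (hu : S.IsWeakWave T f u₀ u₁ u) (hv : S.IsWeakWave T f u₀ u₁ v) :
    ∃ w w' : ℝ → K, (∀ t ∈ Icc 0 T, w t = S.j (u t - v t)) ∧ ContinuousOn w' (Icc 0 T) ∧
      (∀ t ∈ Icc 0 T, HasDerivWithinAt w (w' t) (Icc 0 T) t) ∧ ∀ t ∈ Icc 0 T,
        S.res (w' t) = -∫ s in (0 : ℝ)..t, (w s - S.res (w s)) := by
  obtain ⟨w₁, hw₁, hc₁, hd₁⟩ := hu.exists_C1
  obtain ⟨w₂, hw₂, hc₂, hd₂⟩ := hv.exists_C1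
  obtain ⟨z₁, ⟨hm₁, hz₁, p₁, hp₁, hwp₁, hpz₁⟩, he₁⟩ := hu.exists_H2
  obtain ⟨z₂, ⟨hm₂, hz₂, p₂, hp₂, hwp₂, hpz₂⟩, he₂⟩ := hv.exists_H2
  have huniq : UniqueDiffOn ℝ (Icc 0 T) := uniqueDiffOn_Icc hT
  have h0 : (0 : ℝ) ∈ Icc 0 T := ⟨le_rfl, hT.le⟩
  set w : ℝ → K := fun t => w₁ t - w₂ t
  set w' : ℝ → K := fun t => derivWithin w₁ (Icc 0 T) t - derivWithin w₂ (Icc 0 T) t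
  have hw'c : ContinuousOn w' (Icc 0 T) :=
    (hc₁.continuousOn_derivWithin huniq le_rfl).sub (hc₂.continuousOn_derivWithin huniq le_rfl)
  have hww' : ∀ t ∈ Icc 0 T, HasDerivWithinAt w (w' t) (Icc 0 T) t := fun t ht =>
    ((hc₁.differentiableOn (by simp) t ht).hasDerivWithinAt).sub
      ((hc₂.differentiableOn (by simp) t ht).hasDerivWithinAt)
  have hwc : ContinuousOn w (Icc 0 T) := fun t ht => (hww' t ht).continuousWithinAt
  have hw : ∀ t ∈ Icc 0 T, w t = S.j (u t - v t) := fun t ht => by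
    simp only [w, hw₁ t ht, hw₂ t ht, map_sub]
  have hw'0 : w' 0 = 0 := by simp only [w', hd₁, hd₂, sub_self]
  -- the continuous function `w - R w`, extended from `[0,T]`
  set q : ℝ → K := fun t => w (projIcc 0 T hT.le t) - S.res (w (projIcc 0 T hT.le t))
  have hq : Continuous q := by
    have hc : ContinuousOn (fun t => w t - S.res (w t)) (Icc 0 T) := by fun_prop
    exact hc.comp_continuous continuous_projIcc.subtype_val fun t => (projIcc 0 T hT.le t).2
  have hqw : ∀ t ∈ Icc 0 T, q t = w t - S.res (w t) := fun t ht => by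
    simp only [q, projIcc_of_mem hT.le ht]
  set B : ℝ → K := fun t => ∫ s in (0 : ℝ)..t, q s
  have hB : ∀ t, HasDerivAt B (q t) t := fun t =>
    intervalIntegral.integral_hasDerivAt_right (hq.intervalIntegrable _ _)
      (hq.stronglyMeasurableAtFilter _ _) hq.continuousAt
  have hBc : Continuous B := continuous_iff_continuousAt.2 fun t => (hB t).continuousAt
  refine ⟨w, w', hw, hw'c, hww', fun t ht => ?_⟩
  have hBt : ∫ s in (0 : ℝ)..t, (w s - S.res (w s)) = B t := by
    refine intervalIntegral.integral_congr fun s hs => (hqw s ?_).symm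
    rw [uIcc_of_le ht.1] at hs
    exact ⟨hs.1, hs.2.trans ht.2⟩
  rw [hBt, eq_neg_iff_add_eq_zero]
  refine ext_inner_right ℝ fun h => ?_
  rw [inner_zero_left]
  set r : ℝ → ℝ := fun t => ⟪S.res (w' t) + B t, h⟫_ℝ
  have hr : ContinuousOn r (Icc 0 T) := by fun_prop
  have hr0 : r 0 = 0 := by simp [r, hw'0, B]
  rw [← hr0]
  refine HypStokes.eq_of_hasWeakDeriv_zero hT hr (fun φ h1 h2 h3 => ?_) ht
  have hφ' : ContDiff ℝ ∞ (deriv φ) := (contDiff_infty_iff_deriv.1 h1).2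
  have hφ's : tsupport (deriv φ) ⊆ Ioo 0 T := tsupport_deriv_subset.trans h3
  simp only [Pi.zero_apply, smul_zero, integral_zero, neg_zero]
  -- evaluation of a weak derivative at a vector
  have heval : ∀ {y : ℝ → StrongDual ℝ V} {ψ : ℝ → ℝ}, MemLp y 2 (volume.restrict (Icc 0 T)) →
      ContDiff ℝ ∞ ψ → HasCompactSupport ψ → ∀ x : V,
      IntegrableOn (fun t => ψ t * y t x) (Icc 0 T) ∧
      (∫ t in Icc 0 T, ψ t • y t) x = ∫ t in Icc 0 T, ψ t * y t x := by
    intro y ψ hy hψ hψc x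
    have : IsFiniteMeasure (volume.restrict (Icc (0 : ℝ) T)) := ⟨by simp⟩
    obtain ⟨C, hC⟩ := hψc.exists_bound_of_continuous hψ.continuous
    have hint : Integrable (fun t => ψ t • y t) (volume.restrict (Icc 0 T)) :=
      (hy.integrable (by norm_num)).bdd_smul C hψ.continuous.aestronglyMeasurable.restrict
        (Filter.Eventually.of_forall hC)
    refine ⟨by
      simpa [IntegrableOn] using (ContinuousLinearMap.apply ℝ ℝ x).integrable_comp hint, ?_⟩
    have := (ContinuousLinearMap.apply ℝ ℝ x).integral_comp_comm hint
    simpa using this.symm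
  have hpair : ∀ (y y' z : ℝ → StrongDual ℝ V), MemLp y 2 (volume.restrict (Icc 0 T)) →
      MemLp z 2 (volume.restrict (Icc 0 T)) → HypStokes.HasWeakDeriv T y y' →
      HypStokes.HasWeakDeriv T y' z →
      ∫ t in Icc 0 T, deriv (deriv φ) t * y t (S.lift h) =
        ∫ t in Icc 0 T, φ t * z t (S.lift h) := by
    intro y y' z hy hz hyy' hy'z
    have e1 := hyy' _ hφ' h2.deriv hφ's
    have e2 := hy'z _ h1 h2 h3
    have e3 : ∫ t in Icc 0 T, deriv (deriv φ) t • y t = ∫ t in Icc 0 T, φ t • z t := by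
      rw [e1, e2, neg_neg]
    rw [← (heval hy (contDiff_infty_iff_deriv.1 hφ').2 h2.deriv.deriv _).2, e3,
      (heval hz h1 h2 _).2]
  have k1 := hpair _ _ _ hm₁ hz₁ hwp₁ hpz₁
  have k2 := hpair _ _ _ hm₂ hz₂ hwp₂ hpz₂
  -- the weak equation for the difference, tested with `lift h`
  have k3 : ∫ t in Icc 0 T, deriv (deriv φ) t * ⟪S.res (w t), h⟫_ℝ =
      -∫ t in Icc 0 T, φ t * ⟪q t, h⟫_ℝ := by
    have e1 : ∫ t in Icc 0 T, deriv (deriv φ) t * ⟪S.res (w t), h⟫_ℝ =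
        (∫ t in Icc 0 T, deriv (deriv φ) t * S.toDualV (S.j (u t)) (S.lift h)) -
        ∫ t in Icc 0 T, deriv (deriv φ) t * S.toDualV (S.j (v t)) (S.lift h) := by
      have hφ'' := (contDiff_infty_iff_deriv.1 hφ').2
      rw [← integral_sub (heval hm₁ hφ'' h2.deriv.deriv _).1 (heval hm₂ hφ'' h2.deriv.deriv _).1]
      refine setIntegral_congr_fun measurableSet_Icc fun t ht => ?_
      simp only [toDualV_apply, ← mul_sub, ← inner_sub_left, ← map_sub, ← hw t ht, S.res_symm]
      rfl
    rw [e1, k1, k2, ← integral_sub (heval hz₁ h1 h2 _).1 (heval hz₂ h1 h2 _).1, ← integral_neg]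
    refine integral_congr_ae ?_
    filter_upwards [he₁, he₂, ae_restrict_mem measurableSet_Icc] with t ht₁ ht₂ ht
    have e2 := ht₁ (S.lift h)
    have e3 := ht₂ (S.lift h)
    have e4 : S.a (u t - v t) (S.lift h) = ⟪q t, h⟫_ℝ := by
      rw [S.symm, S.a_lift, hqw t ht, ← hw t ht, ← res_apply, inner_sub_left, inner_sub_left,
        S.res_symm, real_inner_comm h, real_inner_comm h]
    rw [← e4, map_sub, sub_apply]
    linear_combination φ t * e2 - φ t * e3
  -- integration by parts, twice
  have k4 := HypStokes.hasWeakDeriv_of_hasDerivAt hT.le (w := fun t => ⟪S.res (w t), h⟫_ℝ)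
    (w' := fun t => ⟪S.res (w' t), h⟫_ℝ) (by fun_prop) (by fun_prop)
    (fun t ht => by
      have h4 := (hww' t (Ioo_subset_Icc_self ht)).hasDerivAt (Icc_mem_nhds ht.1 ht.2)
      simpa using (S.res.hasFDerivAt.comp_hasDerivAt t h4).inner ℝ (hasDerivAt_const t h))
    _ hφ' h2.deriv hφ's
  have k5 := HypStokes.hasWeakDeriv_of_hasDerivAt hT.le (w := fun t => ⟪B t, h⟫_ℝ)
    (w' := fun t => ⟪q t, h⟫_ℝ) (by fun_prop) (by fun_prop)
    (fun t _ => by simpa using (hB t).inner ℝ (hasDerivAt_const t h)) _ h1 h2 h3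
  simp only [smul_eq_mul] at k4 k5 ⊢
  have k6 : ∀ {y : ℝ → ℝ}, ContinuousOn y (Icc 0 T) →
      IntegrableOn (fun t => deriv φ t * y t) (Icc 0 T) := fun hy =>
    (hφ'.continuous.continuousOn.mul hy).integrableOn_Icc
  simp only [r, inner_add_left, mul_add]
  rw [integral_add (k6 (by fun_prop)) (k6 (by fun_prop)), k5, ← k3, k4, add_neg_cancel]

/-- Uniqueness: for the difference `w` of two solutions, `‖(R w)'‖² + ⟪R w, (1 - R) w⟫` is
constant. -/
theorem IsWeakWave.eqOn {T : ℝ} (hT : 0 < T) {f : ℝ → K} {u₀ : V} {u₁ : K} {u v : ℝ → V}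
    (hu : S.IsWeakWave T f u₀ u₁ u) (hv : S.IsWeakWave T f u₀ u₁ v) : EqOn u v (Icc 0 T) := by
  obtain ⟨w, w', hw, hw'c, hww', heq⟩ := hu.integral_eq hT hv
  have hwc : ContinuousOn w (Icc 0 T) := fun t ht => (hww' t ht).continuousWithinAt
  have h0 : (0 : ℝ) ∈ Icc 0 T := ⟨le_rfl, hT.le⟩
  have hw0 : w 0 = 0 := by rw [hw 0 h0, hu.initial, hv.initial, sub_self, map_zero]
  set B : ℝ → K := fun t => ∫ s in (0 : ℝ)..t, (w s - S.res (w s))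
  have hB : ∀ t ∈ Icc 0 T, HasDerivWithinAt B (w t - S.res (w t)) (Icc 0 T) t := fun t ht => by
    have hc : ContinuousOn (fun s => w s - S.res (w s)) (Icc 0 T) := by fun_prop
    have : Fact (t ∈ Icc 0 T) := ⟨ht⟩
    refine intervalIntegral.integral_hasDerivWithinAt_right ?_ ?_ (hc t ht)
    · refine (hc.mono ?_).intervalIntegrable
      rw [uIcc_of_le ht.1]
      exact Icc_subset_Icc_right ht.2
    · exact hc.stronglyMeasurableAtFilter_nhdsWithin measurableSet_Icc t
  have hR : ∀ t ∈ Icc 0 T, HasDerivWithinAt (fun t => S.res (w t)) (S.res (w' t)) (Icc 0 T) t :=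
    fun t ht => S.res.hasFDerivAt.comp_hasDerivWithinAt t (hww' t ht)
  have hd : ∀ t ∈ Icc 0 T, HasDerivWithinAt
      (fun t => ⟪B t, B t⟫_ℝ + ⟪S.res (w t), w t - S.res (w t)⟫_ℝ) 0 (Icc 0 T) t := fun t ht => by
    have h1 := (hB t ht).inner ℝ (hB t ht)
    have h2 := (hR t ht).inner ℝ ((hww' t ht).sub (hR t ht))
    refine (h1.add h2).congr_deriv ?_
    have h3 : B t = -S.res (w' t) := by rw [heq t ht, neg_neg]
    have h4 : ⟪S.res (w t), w' t - S.res (w' t)⟫_ℝ = ⟪S.res (w' t), w t - S.res (w t)⟫_ℝ := by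
      rw [inner_sub_right, inner_sub_right, S.res_symm (w t), real_inner_comm (S.res (w' t)) (w t),
        real_inner_comm (S.res (w' t))]
    rw [h3, h4, inner_neg_left, inner_neg_right, real_inner_comm (S.res (w' t))]
    simp only [Pi.sub_apply]
    ring
  have hconst : ∀ t ∈ Icc 0 T,
      ⟪B t, B t⟫_ℝ + ⟪S.res (w t), w t - S.res (w t)⟫_ℝ = 0 := fun t ht => by
    have := (convex_Icc 0 T).is_const_of_fderivWithin_eq_zero (𝕜 := ℝ)
      (fun s hs => (hd s hs).differentiableWithinAt) (fun s hs => by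
        have := (hd s hs).hasFDerivWithinAt.fderivWithin (uniqueDiffOn_Icc hT s hs)
        rw [this]; ext; simp) ht h0
    rw [this]
    simp [B, hw0]
  have hw'0 : ∀ t ∈ Icc 0 T, w' t = 0 := fun t ht => by
    have h1 := hconst t ht
    have h2 := S.norm_res_sq_le (w t)
    have h3 : 0 ≤ ⟪B t, B t⟫_ℝ := real_inner_self_nonneg
    rw [inner_sub_right, real_inner_self_eq_norm_sq (S.res (w t))] at h1
    have h4 : B t = 0 := inner_self_eq_zero.1 (le_antisymm (by linarith) h3)
    refine S.eq_zero_of_res_eq_zero ?_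
    rw [heq t ht]
    simp only [neg_eq_zero]
    exact h4
  intro t ht
  have h1 := (convex_Icc 0 T).is_const_of_fderivWithin_eq_zero (𝕜 := ℝ)
      (fun s hs => (hww' s hs).differentiableWithinAt) (fun s hs => by
        have := (hww' s hs).hasFDerivWithinAt.fderivWithin (uniqueDiffOn_Icc hT s hs)
        rw [this, hw'0 s hs]; ext; simp) ht h0
  rw [hw0, hw t ht] at h1
  exact sub_eq_zero.1 (S.inj (by rw [h1, map_zero]))

end EnergyTriple

/-! ### Existence by the energy inequality -/

namespace EnergyTriple
variable {V K : Type*} [NormedAddCommGroup V] [InnerProductSpace ℝ V] [CompleteSpace V]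
  [NormedAddCommGroup K] [InnerProductSpace ℝ K] [CompleteSpace K] (S : EnergyTriple V K)

theorem exists_eLpNorm_sub_res_le {μ : Measure ℝ} [IsFiniteMeasure μ] {f : ℝ → K}
    (hf : MemLp f 2 μ) {ε : ENNReal} (hε : ε ≠ 0) :
    ∃ G : ℝ → K, Continuous G ∧ eLpNorm (f - fun t => S.res (S.res (G t))) 2 μ ≤ ε := by
  suffices h : ∃ h : ℝ → K, eLpNorm (f - h) 2 μ ≤ ε ∧
      ∃ G : ℝ → K, Continuous G ∧ h = fun t => S.res (S.res (G t)) by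
    obtain ⟨h, hle, G, hG, rfl⟩ := h
    exact ⟨G, hG, hle⟩
  refine hf.induction_dense (by norm_num)
    (fun h => ∃ G : ℝ → K, Continuous G ∧ h = fun t => S.res (S.res (G t))) ?_ ?_ ?_ hε
  · intro c s hs _ ε hε
    -- `c` is close to `R² k`, and the indicator of `s` times `k` to a continuous function
    have hε2 : ε / 2 ≠ 0 := (ENNReal.half_pos hε).ne'
    obtain ⟨δ, hδ, hδε⟩ : ∃ δ : ℝ, 0 < δ ∧
        μ univ ^ (2 : ENNReal).toReal⁻¹ * ENNReal.ofReal δ ≤ ε / 2 := by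
      rcases eq_or_ne ε ⊤ with rfl | hεt
      · exact ⟨1, one_pos, by simp [ENNReal.top_div]⟩
      set m := (μ univ ^ (2 : ENNReal).toReal⁻¹).toReal
      have hm : μ univ ^ (2 : ENNReal).toReal⁻¹ = ENNReal.ofReal m :=
        (ENNReal.ofReal_toReal (ENNReal.rpow_ne_top_of_nonneg (by norm_num)
          (measure_ne_top _ _))).symm
      have hm0 : 0 ≤ m := ENNReal.toReal_nonneg
      have he : ε / 2 = ENNReal.ofReal (ε / 2).toReal :=
        (ENNReal.ofReal_toReal (ENNReal.div_ne_top hεt (by norm_num))).symm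
      have he0 : 0 < (ε / 2).toReal :=
        ENNReal.toReal_pos hε2 (ENNReal.div_ne_top hεt (by norm_num))
      refine ⟨(ε / 2).toReal / (m + 1), by positivity, ?_⟩
      rw [hm, ← ENNReal.ofReal_mul hm0]
      conv_rhs => rw [he]
      refine ENNReal.ofReal_le_ofReal ?_
      rw [mul_div_assoc', div_le_iff₀ (by positivity)]
      nlinarith
    obtain ⟨k, hk⟩ := S.denseRange_res_res.exists_dist_lt c hδ
    have hind : MemLp (s.indicator fun _ => k) 2 μ :=
      memLp_indicator_const 2 hs k (Or.inr (measure_ne_top _ _))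
    obtain ⟨G, hG, -⟩ := hind.exists_boundedContinuous_eLpNorm_sub_le (by norm_num) hε2
    refine ⟨_, ?_, G, G.continuous, rfl⟩
    have hm1 : AEStronglyMeasurable (fun t => S.res (S.res (G t))) μ :=
      (by fun_prop : Continuous fun t => S.res (S.res (G t))).aestronglyMeasurable
    have hm2 : AEStronglyMeasurable (s.indicator fun _ => S.res (S.res k)) μ :=
      (stronglyMeasurable_const.indicator hs).aestronglyMeasurable
    have hm3 : AEStronglyMeasurable (s.indicator fun _ => c) μ :=
      (stronglyMeasurable_const.indicator hs).aestronglyMeasurable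
    have e : (fun t => S.res (S.res (G t))) - (s.indicator fun _ => c) =
        ((fun t => S.res (S.res (G t))) - s.indicator fun _ => S.res (S.res k)) +
          ((s.indicator fun _ => S.res (S.res k)) - s.indicator fun _ => c) := by abel
    rw [e]
    refine (eLpNorm_add_le (hm1.sub hm2) (hm2.sub hm3) (by norm_num)).trans ?_
    rw [← ENNReal.add_halves ε]
    refine add_le_add ((eLpNorm_mono fun t => ?_).trans hG) ?_
    · have : (s.indicator fun _ => S.res (S.res k)) t =
          S.res (S.res ((s.indicator fun _ => k) t)) := by
        by_cases ht : t ∈ s <;> simp [ht]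
      simp only [Pi.sub_apply]
      rw [this, ← map_sub, ← map_sub, norm_sub_rev]
      exact (S.norm_res_le _).trans ((S.norm_res_le _).trans_eq (by rw [norm_sub_rev]))
    · refine (eLpNorm_le_of_ae_bound (C := δ) (Filter.Eventually.of_forall fun t => ?_)).trans hδε
      by_cases ht : t ∈ s
      · simp only [Pi.sub_apply, indicator_of_mem ht]
        rw [← dist_eq_norm, dist_comm]
        exact hk.le
      · simpa [ht] using hδ.le
  · rintro _ _ ⟨F, hF, rfl⟩ ⟨G, hG, rfl⟩
    exact ⟨fun t => F t + G t, hF.add hG, by ext t; simp⟩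
  · rintro _ ⟨G, hG, rfl⟩
    exact (by fun_prop : Continuous fun t => S.res (S.res (G t))).aestronglyMeasurable

/-- Smooth solutions whose data are arbitrarily close to given ones. -/
theorem exists_isSmoothSolution_near {T : ℝ} {f : ℝ → K}
    (hf : MemLp f 2 (volume.restrict (Icc 0 T))) (u₀ : V) (u₁ : K) {ε : ℝ} (hε : 0 < ε) :
    ∃ x x' x'' F : ℝ → K, S.IsSmoothSolution x x' x'' F ∧ ‖S.lift (x 0) - u₀‖ ≤ ε ∧
      ‖S.res (x' 0) - u₁‖ ≤ ε ∧
      eLpNorm (F - f) 2 (volume.restrict (Icc 0 T)) ≤ ENNReal.ofReal ε := by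
  have : IsFiniteMeasure (volume.restrict (Icc (0 : ℝ) T)) := ⟨by simp⟩
  obtain ⟨η, hη⟩ := S.denseRange_lift_res_res.exists_dist_lt u₀ hε
  obtain ⟨y₁, hy₁⟩ := S.denseRange_res_res.exists_dist_lt u₁ hε
  obtain ⟨G, hG, hGf⟩ := S.exists_eLpNorm_sub_res_le hf (ε := ENNReal.ofReal (ε / 2))
    (by simpa using hε)
  set m := ((volume.restrict (Icc (0 : ℝ) T)) univ ^ (2 : ENNReal).toReal⁻¹).toReal
  have hm : (volume.restrict (Icc (0 : ℝ) T)) univ ^ (2 : ENNReal).toReal⁻¹ = ENNReal.ofReal m :=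
    (ENNReal.ofReal_toReal (ENNReal.rpow_ne_top_of_nonneg (by norm_num)
      (measure_ne_top _ _))).symm
  have hm0 : 0 ≤ m := ENNReal.toReal_nonneg
  obtain ⟨x, x', x'', F, hx, hx0, hx0', hF⟩ := S.exists_isSmoothSolution η y₁ hG (T := T)
    (κ := ε / 2 / (m + 1)) (by positivity)
  refine ⟨x, x', x'', F, hx, ?_, ?_, ?_⟩
  · rw [hx0, ← dist_eq_norm, dist_comm]
    exact hη.le
  · rw [hx0', ← dist_eq_norm, dist_comm]
    exact hy₁.le
  · have e : F - f = (F - fun t => S.res (S.res (G t))) + ((fun t => S.res (S.res (G t))) - f) := by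
      abel
    have hmG : AEStronglyMeasurable (fun t => S.res (S.res (G t))) (volume.restrict (Icc 0 T)) :=
      (by fun_prop : Continuous fun t => S.res (S.res (G t))).aestronglyMeasurable
    rw [e]
    refine (eLpNorm_add_le (hx.continuous.aestronglyMeasurable.sub hmG)
      (hmG.sub hf.aestronglyMeasurable) (by norm_num)).trans ?_
    rw [← add_halves ε, ENNReal.ofReal_add (by positivity) (by positivity)]
    refine add_le_add ?_ ?_
    · refine (eLpNorm_le_of_ae_bound (C := ε / 2 / (m + 1))
        ((ae_restrict_iff' measurableSet_Icc).2 (Filter.Eventually.of_forall hF))).trans ?_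
      rw [hm, ← ENNReal.ofReal_mul hm0]
      refine ENNReal.ofReal_le_ofReal ?_
      rw [mul_div_assoc', div_le_iff₀ (by positivity)]
      nlinarith
    · rwa [← eLpNorm_neg, neg_sub]

variable {S} in
/-- The energy estimate in terms of the norms of the data. -/
theorem IsSmoothSolution.norm_le {T : ℝ} (hT : 0 < T) : ∃ C : ℝ, 0 ≤ C ∧
    ∀ {x x' x'' F : ℝ → K}, S.IsSmoothSolution x x' x'' F → ∀ {ε : ℝ}, 0 ≤ ε →
      ‖S.lift (x 0)‖ ≤ ε → ‖S.res (x' 0)‖ ≤ ε →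
      eLpNorm F 2 (volume.restrict (Icc 0 T)) ≤ ENNReal.ofReal ε →
      ∀ t ∈ Icc 0 T, ‖S.lift (x t)‖ ≤ C * ε ∧ ‖S.res (x' t)‖ ≤ C * ε := by
  obtain ⟨c, hc, hcoer⟩ := S.coercive
  obtain ⟨Λ, hΛ, hΛE⟩ : ∃ Λ : ℝ, 0 ≤ Λ ∧ ∀ u, S.energy u u ≤ Λ * ‖u‖ ^ 2 := by
    let E : V →L[ℝ] V →L[ℝ] ℝ := S.energy
    refine ⟨‖E‖, norm_nonneg E, fun u => (le_abs_self _).trans ((E.le_opNorm₂ u u).trans_eq ?_)⟩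
    ring
  set D := Real.exp (2 * T) * (1 + Λ + 1)
  have hD : 0 ≤ D := by positivity
  refine ⟨√D + √(D / c), by positivity, fun {x x' x'' F} hx ε hε h0 h1 hF t ht => ?_⟩
  have hen := hx.energy_le ht
  have hint : ∫ s in (0 : ℝ)..T, ‖F s‖ ^ 2 ≤ ε ^ 2 := by
    rw [intervalIntegral.integral_of_le hT.le, ← integral_Icc_eq_integral_Ioc]
    have hmem : MemLp F 2 (volume.restrict (Icc 0 T)) := hx.continuous.continuousOn.memLp_Icc 2
    have h2 := hmem.eLpNorm_eq_integral_rpow_norm (by norm_num) (by norm_num)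
    rw [h2] at hF
    have h3 := (ENNReal.ofReal_le_ofReal_iff hε).1 hF
    have h4 : 0 ≤ ∫ s in Icc 0 T, ‖F s‖ ^ 2 := integral_nonneg fun s => sq_nonneg _
    simp only [ENNReal.toReal_ofNat, Real.rpow_ofNat] at h3
    rw [← one_div, ← Real.sqrt_eq_rpow] at h3
    exact (Real.sqrt_le_left hε).1 h3
  have hE : ⟪S.res (x 0), x 0⟫_ℝ ≤ Λ * ε ^ 2 := by
    rw [S.inner_res]
    exact (hΛE _).trans (mul_le_mul_of_nonneg_left (pow_le_pow_left₀ (norm_nonneg _) h0 2) hΛ)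
  have h2 : ‖S.res (x' 0)‖ ^ 2 ≤ ε ^ 2 := pow_le_pow_left₀ (norm_nonneg _) h1 2
  have hen' : ‖S.res (x' t)‖ ^ 2 + ⟪S.res (x t), x t⟫_ℝ ≤ D * ε ^ 2 := by
    refine hen.trans ?_
    rw [mul_assoc]
    exact mul_le_mul_of_nonneg_left (by linarith) (Real.exp_pos _).le
  have h3 := S.inner_res_nonneg (x t)
  constructor
  · have h4 : c * ‖S.lift (x t)‖ ^ 2 ≤ D * ε ^ 2 := by
      have h5 := hcoer (S.lift (x t))
      have h6 := S.inner_res (x t) (x t)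
      rw [energy_apply, real_inner_self_eq_norm_sq] at h6
      nlinarith [sq_nonneg ‖S.res (x' t)‖]
    have h5 : ‖S.lift (x t)‖ ≤ √(D / c) * ε := by
      refine (abs_le_of_sq_le_sq' ?_ (by positivity)).2
      rw [mul_pow, Real.sq_sqrt (by positivity), div_mul_eq_mul_div, le_div_iff₀ hc]
      linarith
    nlinarith [Real.sqrt_nonneg D]
  · have h5 : ‖S.res (x' t)‖ ≤ √D * ε := by
      refine (abs_le_of_sq_le_sq' ?_ (by positivity)).2
      rw [mul_pow, Real.sq_sqrt hD]
      linarith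
    nlinarith [Real.sqrt_nonneg (D / c)]

end EnergyTriple

theorem tendsto_of_norm_sub_le {Y : Type*} [NormedAddCommGroup Y] {y : ℕ → Y} {b : Y} {δ : ℕ → ℝ}
    (hδ : Filter.Tendsto δ Filter.atTop (nhds 0)) (h : ∀ m, ‖y m - b‖ ≤ δ m) :
    Filter.Tendsto y Filter.atTop (nhds b) := by
  rw [tendsto_iff_norm_sub_tendsto_zero]
  exact squeeze_zero (fun _ => norm_nonneg _) h hδ

theorem tendsto_eLpNorm_of_norm_sub_le {Y : Type*} [NormedAddCommGroup Y] {T : ℝ}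
    {y : ℕ → ℝ → Y} {b : ℝ → Y} {δ : ℕ → ℝ} (hδ : Filter.Tendsto δ Filter.atTop (nhds 0))
    (h : ∀ m, ∀ t ∈ Icc 0 T, ‖y m t - b t‖ ≤ δ m) :
    Filter.Tendsto (fun m => eLpNorm (y m - b) 2 (volume.restrict (Icc 0 T))) Filter.atTop
      (nhds 0) := by
  have : IsFiniteMeasure (volume.restrict (Icc (0 : ℝ) T)) := ⟨by simp⟩
  refine tendsto_of_tendsto_of_tendsto_of_le_of_le tendsto_const_nhds ?_ (fun _ => zero_le)
    (fun m => eLpNorm_le_of_ae_bound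
      ((ae_restrict_iff' measurableSet_Icc).2 (Filter.Eventually.of_forall (h m))))
  have h1 := ENNReal.tendsto_ofReal hδ
  have h2 := ENNReal.Tendsto.const_mul (a := (volume.restrict (Icc (0 : ℝ) T)) univ ^
    (2 : ENNReal).toReal⁻¹) h1
    (Or.inr (ENNReal.rpow_ne_top_of_nonneg (by norm_num) (measure_ne_top _ _)))
  simpa using h2

/-- Limits of uniformly Cauchy sequences of continuous functions. -/
theorem exists_continuousOn_norm_sub_le {X : Type*} [NormedAddCommGroup X] [CompleteSpace X]
    {s : Set ℝ} {h : ℕ → ℝ → X} (hc : ∀ m, ContinuousOn (h m) s) {ε : ℕ → ℝ}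
    (hε : Filter.Tendsto ε Filter.atTop (nhds 0))
    (hle : ∀ m l, ∀ t ∈ s, ‖h m t - h l t‖ ≤ ε m + ε l) :
    ∃ v : ℝ → X, ContinuousOn v s ∧ ∀ m, ∀ t ∈ s, ‖h m t - v t‖ ≤ ε m := by
  have hcau : ∀ t ∈ s, ∃ a, Filter.Tendsto (fun m => h m t) Filter.atTop (nhds a) := fun t ht => by
    refine cauchySeq_tendsto_of_complete ?_
    rw [Metric.cauchySeq_iff]
    intro δ hδ
    obtain ⟨N, hN⟩ := Filter.eventually_atTop.1 (hε.eventually (gt_mem_nhds (half_pos hδ)))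
    refine ⟨N, fun m hm l hl => ?_⟩
    rw [dist_eq_norm]
    linarith [hle m l t ht, hN m hm, hN l hl]
  choose! v hv using hcau
  have hv' : ∀ m, ∀ t ∈ s, ‖h m t - v t‖ ≤ ε m := fun m t ht => by
    have h1 : Filter.Tendsto (fun l => ‖h m t - h l t‖) Filter.atTop (nhds ‖h m t - v t‖) :=
      ((tendsto_const_nhds.sub (hv t ht))).norm
    have h2 : Filter.Tendsto (fun l => ε m + ε l) Filter.atTop (nhds (ε m + 0)) :=
      tendsto_const_nhds.add hε
    rw [add_zero] at h2
    exact le_of_tendsto_of_tendsto' h1 h2 fun l => hle m l t ht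
  refine ⟨v, ?_, hv'⟩
  refine TendstoUniformlyOn.continuousOn (F := h) (p := Filter.atTop) ?_
    (Filter.Eventually.of_forall hc).frequently
  rw [Metric.tendstoUniformlyOn_iff]
  intro δ hδ
  filter_upwards [hε.eventually (gt_mem_nhds hδ)] with m hm t ht
  rw [dist_comm, dist_eq_norm]
  exact (hv' m t ht).trans_lt hm

namespace EnergyTriple
variable {V K : Type*} [NormedAddCommGroup V] [InnerProductSpace ℝ V] [CompleteSpace V]
  [NormedAddCommGroup K] [InnerProductSpace ℝ K] [CompleteSpace K] (S : EnergyTriple V K)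

/-- Existence: by the energy estimate, smooth solutions with converging data converge. -/
theorem exists_isWeakWave {T : ℝ} (hT : 0 < T) {f : ℝ → K}
    (hf : MemLp f 2 (volume.restrict (Icc 0 T))) (u₀ : V) (u₁ : K) :
    ∃ u : ℝ → V, S.IsWeakWave T f u₀ u₁ u := by
  have : IsFiniteMeasure (volume.restrict (Icc (0 : ℝ) T)) := ⟨by simp⟩
  have h0 : (0 : ℝ) ∈ Icc 0 T := ⟨le_rfl, hT.le⟩
  set ε : ℕ → ℝ := fun m => 1 / ((m : ℝ) + 1)
  have hε : ∀ m, 0 < ε m := fun m => by positivity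
  have hε0 : Filter.Tendsto ε Filter.atTop (nhds 0) := tendsto_one_div_add_atTop_nhds_zero_nat
  choose x x' x'' F hx hx0 hx0' hF using fun m => S.exists_isSmoothSolution_near hf u₀ u₁ (hε m)
  obtain ⟨C, hC, hest⟩ := IsSmoothSolution.norm_le (S := S) hT
  have hmF : ∀ m, MemLp (F m) 2 (volume.restrict (Icc 0 T)) := fun m =>
    (hx m).continuous.continuousOn.memLp_Icc 2
  have hdiff : ∀ m l, ∀ t ∈ Icc 0 T, ‖S.lift (x m t) - S.lift (x l t)‖ ≤ C * ε m + C * ε l ∧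
      ‖S.res (x' m t) - S.res (x' l t)‖ ≤ C * ε m + C * ε l := by
    intro m l t ht
    have := hest ((hx m).sub (hx l)) (ε := ε m + ε l) (by linarith [hε m, hε l]) ?_ ?_ ?_ t ht
    · simpa only [map_sub, mul_add] using this
    · rw [map_sub, ← sub_sub_sub_cancel_right _ _ u₀]
      exact (norm_sub_le _ _).trans (add_le_add (hx0 m) (hx0 l))
    · rw [map_sub, ← sub_sub_sub_cancel_right _ _ u₁]
      exact (norm_sub_le _ _).trans (add_le_add (hx0' m) (hx0' l))
    · have e : (fun t => F m t - F l t) = (F m - f) - (F l - f) := by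
        ext t; simp
      rw [e, ENNReal.ofReal_add (hε m).le (hε l).le]
      exact (eLpNorm_sub_le ((hmF m).sub hf).aestronglyMeasurable
        ((hmF l).sub hf).aestronglyMeasurable (by norm_num)).trans (add_le_add (hF m) (hF l))
  have hxc : ∀ m, Continuous (x m) := fun m =>
    continuous_iff_continuousAt.2 fun t => ((hx m).hasDerivAt t).continuousAt
  have hxc' : ∀ m, Continuous (x' m) := fun m =>
    continuous_iff_continuousAt.2 fun t => ((hx m).hasDerivAt' t).continuousAt
  have hCε : Filter.Tendsto (fun m => C * ε m) Filter.atTop (nhds 0) := by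
    simpa using hε0.const_mul C
  obtain ⟨u, huc, hu⟩ := exists_continuousOn_norm_sub_le
    (h := fun m t => S.lift (x m t)) (fun m => by have := hxc m; fun_prop) hCε
    fun m l t ht => (hdiff m l t ht).1
  obtain ⟨p, hpc, hp⟩ := exists_continuousOn_norm_sub_le
    (h := fun m t => S.res (x' m t)) (fun m => by have := hxc' m; fun_prop) hCε
    fun m l t ht => (hdiff m l t ht).2
  have hu0 : u 0 = u₀ := tendsto_nhds_unique (tendsto_of_norm_sub_le hCε fun m => hu m 0 h0) (tendsto_of_norm_sub_le hε0 hx0)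
  have hp0 : p 0 = u₁ := tendsto_nhds_unique (tendsto_of_norm_sub_le hCε fun m => hp m 0 h0) (tendsto_of_norm_sub_le hε0 hx0')
  -- the derivative `p`, continuously extended from `[0,T]`, and its primitive
  set q : ℝ → K := fun t => p (projIcc 0 T hT.le t)
  have hq : Continuous q :=
    hpc.comp_continuous continuous_projIcc.subtype_val fun t => (projIcc 0 T hT.le t).2
  have hqp : ∀ t ∈ Icc 0 T, q t = p t := fun t ht => by simp only [q, projIcc_of_mem hT.le ht]
  set w : ℝ → K := fun t => S.j u₀ + ∫ s in (0 : ℝ)..t, q s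
  have hw : ∀ t, HasDerivAt w (q t) t := fun t =>
    (intervalIntegral.integral_hasDerivAt_right (hq.intervalIntegrable _ _)
      (hq.stronglyMeasurableAtFilter _ _) hq.continuousAt).const_add _
  have hwu : ∀ t ∈ Icc 0 T, w t = S.j (u t) := fun t ht => by
    have h1 : Filter.Tendsto (fun m => S.j (S.lift (x m t))) Filter.atTop (nhds (S.j (u t))) :=
      (S.j.continuous.tendsto _).comp (tendsto_of_norm_sub_le hCε fun m => hu m t ht)
    have h2 : Filter.Tendsto (fun m => S.j (S.lift (x m 0))) Filter.atTop (nhds (S.j u₀)) :=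
      (S.j.continuous.tendsto _).comp (tendsto_of_norm_sub_le hε0 hx0)
    have h3 : Filter.Tendsto (fun m => ∫ s in (0 : ℝ)..t, S.res (x' m s)) Filter.atTop
        (nhds (∫ s in (0 : ℝ)..t, q s)) := by
      refine tendsto_of_norm_sub_le (δ := fun m => C * ε m * |t - 0|) (by simpa using hCε.mul_const |t - 0|)
        fun m => ?_
      have hc1 : Continuous fun s => S.res (x' m s) := by have := hxc' m; fun_prop
      rw [← intervalIntegral.integral_sub (hc1.intervalIntegrable _ _) (hq.intervalIntegrable _ _)]
      refine intervalIntegral.norm_integral_le_of_norm_le_const fun s hs => ?_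
      rw [uIoc_of_le ht.1] at hs
      have hs' : s ∈ Icc 0 T := ⟨hs.1.le, hs.2.trans ht.2⟩
      rw [hqp s hs']
      exact hp m s hs'
    refine tendsto_nhds_unique (h2.add h3) (h1.congr fun m => ?_)
    have h4 : ∀ s ∈ uIcc 0 t, HasDerivAt (fun s => S.res (x m s)) (S.res (x' m s)) s := fun s _ =>
      S.res.hasFDerivAt.comp_hasDerivAt s ((hx m).hasDerivAt s)
    have hc1 : Continuous fun s => S.res (x' m s) := by have := hxc' m; fun_prop
    rw [intervalIntegral.integral_eq_sub_of_hasDerivAt h4 (hc1.intervalIntegrable _ _)]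
    simp only [res_apply, add_sub_cancel]
  have hwc : ContDiff ℝ 1 w := by
    rw [contDiff_one_iff_deriv]
    refine ⟨fun t => (hw t).differentiableAt, ?_⟩
    rw [show deriv w = q from funext fun t => (hw t).deriv]
    exact hq
  refine ⟨u, huc, hu0, ⟨w, hwu, hwc.contDiffOn, ?_⟩, fun t => S.toDualV (f t) - S.a (u t),
    ⟨?_, ?_, fun t => S.toDualV (q t), ?_, ?_, ?_⟩, ?_⟩
  · rw [(hw 0).hasDerivWithinAt.derivWithin (uniqueDiffOn_Icc hT 0 h0), hqp 0 h0, hp0]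
  · exact ContinuousOn.memLp_Icc (by fun_prop) 2
  · exact (S.toDualV.comp_memLp' hf).sub (ContinuousOn.memLp_Icc (by fun_prop) 2)
  · exact ContinuousOn.memLp_Icc (by fun_prop) 2
  · have hcw : Continuous w := hwc.continuous
    refine (HypStokes.hasWeakDeriv_of_hasDerivAt hT.le (w := fun t => S.toDualV (w t))
      (by fun_prop) (by fun_prop) fun t _ =>
        S.toDualV.hasFDerivAt.comp_hasDerivAt t (hw t)).congr fun t ht => ?_
    rw [hwu t ht]
  · -- the equation of the smooth solutions passes to the limit
    have hz : ∀ m t, S.toDualV (S.res (x'' m t)) =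
        S.toDualV (F m t) - S.a (S.lift (x m t)) := fun m t => by
      ext v
      rw [sub_apply, S.a_lift, toDualV_apply, toDualV_apply, ← inner_sub_left, ← (hx m).eq,
        ← res_apply, add_sub_cancel_right]
    have hFc : ∀ m, Continuous (F m) := fun m => (hx m).continuous
    have hzc : ∀ m, Continuous fun t => S.toDualV (S.res (x'' m t)) := fun m => by
      simp only [hz]
      have := hxc m; have := hFc m
      fun_prop
    refine HypStokes.hasWeakDeriv_of_tendsto (w := fun m t => S.toDualV (S.res (x' m t)))
      (w' := fun m t => S.toDualV (S.res (x'' m t))) (fun m => ?_)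
      (fun m => ContinuousOn.memLp_Icc (by have := hxc' m; fun_prop) 2)
      (fun m => (hzc m).continuousOn.memLp_Icc 2)
      (ContinuousOn.memLp_Icc (by fun_prop) 2)
      ((S.toDualV.comp_memLp' hf).sub (ContinuousOn.memLp_Icc (by fun_prop) 2)) ?_ ?_
    · refine HypStokes.hasWeakDeriv_of_hasDerivAt hT.le (by have := hxc' m; fun_prop)
        (hzc m).continuousOn fun t _ => ?_
      exact (S.toDualV.comp S.res).hasFDerivAt.comp_hasDerivAt t ((hx m).hasDerivAt' t)
    · refine tendsto_eLpNorm_of_norm_sub_le (by simpa using hCε.const_mul ‖S.toDualV‖)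
        fun m t ht => ?_
      rw [← map_sub, hqp t ht]
      exact (S.toDualV.le_opNorm _).trans
        (mul_le_mul_of_nonneg_left (hp m t ht) (norm_nonneg _))
    · have h1 : Filter.Tendsto (fun m => eLpNorm ((fun t => S.toDualV (F m t)) -
          fun t => S.toDualV (f t)) 2 (volume.restrict (Icc 0 T))) Filter.atTop (nhds 0) := by
        obtain ⟨N, hN⟩ : ∃ N : ℝ, ∀ h, ‖S.toDualV h‖ ≤ N * ‖h‖ := ⟨_, S.toDualV.le_opNorm⟩
        refine tendsto_of_tendsto_of_tendsto_of_le_of_le (h := fun m => ENNReal.ofReal N *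
          ENNReal.ofReal (ε m)) tendsto_const_nhds ?_ (fun _ => zero_le) fun m => ?_
        · simpa using ENNReal.Tendsto.const_mul (a := ENNReal.ofReal N)
            (ENNReal.tendsto_ofReal hε0) (Or.inr ENNReal.ofReal_ne_top)
        · refine (eLpNorm_le_mul_eLpNorm_of_ae_le_mul (g := F m - f) (c := N)
            (Filter.Eventually.of_forall fun t => ?_) 2).trans (mul_le_mul_right (hF m) _)
          simp only [Pi.sub_apply, ← map_sub]
          exact hN _
      have h2 : Filter.Tendsto (fun m => eLpNorm ((fun t => S.a (S.lift (x m t))) -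
          fun t => S.a (u t)) 2 (volume.restrict (Icc 0 T))) Filter.atTop (nhds 0) := by
        refine tendsto_eLpNorm_of_norm_sub_le (by simpa using hCε.const_mul ‖S.a‖) fun m t ht => ?_
        rw [← map_sub]
        exact (S.a.le_opNorm _).trans (mul_le_mul_of_nonneg_left (hu m t ht) (norm_nonneg _))
      refine tendsto_of_tendsto_of_tendsto_of_le_of_le tendsto_const_nhds
        (by simpa using h1.add h2) (fun _ => zero_le) fun m => ?_
      have hxm := hxc m
      have e : ((fun t => S.toDualV (S.res (x'' m t))) - fun t => S.toDualV (f t) - S.a (u t)) =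
          ((fun t => S.toDualV (F m t)) - fun t => S.toDualV (f t)) -
            ((fun t => S.a (S.lift (x m t))) - fun t => S.a (u t)) := by
        ext1 t
        simp only [Pi.sub_apply, hz]
        abel
      simp only [e]
      exact eLpNorm_sub_le
        ((S.toDualV.comp_memLp' (hmF m)).sub (S.toDualV.comp_memLp' hf)).aestronglyMeasurable
        ((ContinuousOn.memLp_Icc (by fun_prop) 2).sub
          (ContinuousOn.memLp_Icc (p := 2) (by fun_prop))).aestronglyMeasurable (by norm_num)
  · refine Filter.Eventually.of_forall fun t v => ?_
    rw [sub_apply, toDualV_apply, sub_add_cancel]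

end EnergyTriple

/-! ### Charts and their transition maps -/

namespace HypStokes

/-- The charts of the maximal atlas agree on which points are interior. -/
theorem mem_interior_extend_target_of_mem_maximalAtlas {E H M : Type*} [NormedAddCommGroup E]
    [NormedSpace ℝ E] [TopologicalSpace H] {I : ModelWithCorners ℝ E H} [TopologicalSpace M]
    [ChartedSpace H M] [IsManifold I ∞ M] {e e' : OpenPartialHomeomorph M H} {x : M}
    (he : e ∈ IsManifold.maximalAtlas I ∞ M) (he' : e' ∈ IsManifold.maximalAtlas I ∞ M)
    (hex : x ∈ e.source) (hex' : x ∈ e'.source)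
    (hx : e.extend I x ∈ interior (e.extend I).target) :
    e'.extend I x ∈ interior (e'.extend I).target := by
  let φ := I.extendCoordChange e e'
  have hφ : ContDiffOn ℝ ∞ φ φ.source := ModelWithCorners.contDiffOn_extendCoordChange he he'
  have hφx' : Function.Surjective (fderivWithin ℝ φ φ.source (e.extend I x)) :=
    (ModelWithCorners.isInvertible_fderivWithin_extendCoordChange (n := ∞) (by simp) he he' <| by
      simp [hex, hex']).surjective
  have hφx : φ.source ∈ nhds (e.extend I x) := by
    simp_rw [φ, ModelWithCorners.extendCoordChange, PartialEquiv.trans_source,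
      PartialEquiv.symm_source, Filter.inter_mem_iff, mem_interior_iff_mem_nhds.1 hx, true_and,
      e'.extend_source]
    exact e.extend_preimage_mem_nhds hex <| e'.open_source.mem_nhds hex'
  rw [fderivWithin_of_mem_nhds <| hφx] at hφx'
  have h := ((hφ.differentiableOn (by simp)).differentiableAt
    hφx).mem_interior_convex_of_surjective_fderiv hφx I.convex_range I.isClosed_range
    I.nonempty_interior (φ.mapsTo.mono_right <| by simp [φ, inter_assoc]) hφx'
  rw [show φ (e.extend I x) = e'.extend I x by simp [φ, hex]] at h
  exact e'.mem_interior_extend_target (by simp [hex']) h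

/-- The pairing `g^{ab} u_a η_b` of covectors does not depend on the chart. -/
theorem formInner_transpose_mulVec {n : ℕ} {G J : Matrix (Fin n) (Fin n) ℝ} (hJ : IsUnit J.det)
    (p q : Fin n → ℝ) :
    formInner (Jᵀ * G * J) (Jᵀ *ᵥ p) (Jᵀ *ᵥ q) = formInner G p q := by
  have hJt : IsUnit Jᵀ.det := by rwa [Matrix.det_transpose]
  rw [formInner, formInner, Matrix.mul_inv_rev, Matrix.mul_inv_rev, Matrix.mulVec_mulVec,
    Matrix.mul_assoc, Matrix.mul_assoc, Matrix.nonsing_inv_mul _ hJt, Matrix.mul_one,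
    Matrix.mulVec_transpose, ← Matrix.dotProduct_mulVec, Matrix.mulVec_mulVec, ← Matrix.mul_assoc,
    Matrix.mul_nonsing_inv _ hJ, Matrix.one_mul]

namespace FiniteAtlas
variable {n : ℕ} [NeZero n] {M : Type*} [TopologicalSpace M]
  [ChartedSpace (EuclideanHalfSpace n) M] [IsManifold (𝓡∂ n) ∞ M] (A : FiniteAtlas n M)

/-- The coordinates of the `i`-th chart. -/
noncomputable def coord (i : Fin A.N) : M → EuclideanSpace ℝ (Fin n) :=
  (A.chart i).extend (𝓡∂ n)

/-- The coordinates of the interior points of the `i`-th chart, an open subset of `ℝⁿ`. -/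
def core (i : Fin A.N) : Set (EuclideanSpace ℝ (Fin n)) := interior (A.target i)

/-- The coordinate change from the `i`-th chart to the `j`-th. -/
noncomputable def trans (i j : Fin A.N) (y : EuclideanSpace ℝ (Fin n)) :
    EuclideanSpace ℝ (Fin n) := A.coord j (A.inv i y)

/-- The domain of `A.trans i j`. -/
def overlap (i j : Fin A.N) : Set (EuclideanSpace ℝ (Fin n)) :=
  {y | y ∈ A.target i ∧ A.inv i y ∈ (A.chart j).source}

/-- The interior points of the domain of `A.trans i j`. -/
def coreOverlap (i j : Fin A.N) : Set (EuclideanSpace ℝ (Fin n)) :=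
  {y | y ∈ A.core i ∧ A.inv i y ∈ (A.chart j).source}

variable {A} {i j : Fin A.N} {x : M} {y : EuclideanSpace ℝ (Fin n)}

theorem inv_mem_source (hy : y ∈ A.target i) : A.inv i y ∈ (A.chart i).source := by
  have := ((A.chart i).extend (𝓡∂ n)).map_target hy
  rwa [OpenPartialHomeomorph.extend_source] at this

theorem coord_mem_target (hx : x ∈ (A.chart i).source) : A.coord i x ∈ A.target i :=
  ((A.chart i).extend (𝓡∂ n)).map_source (by rwa [OpenPartialHomeomorph.extend_source])

theorem inv_coord (hx : x ∈ (A.chart i).source) : A.inv i (A.coord i x) = x :=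
  ((A.chart i).extend (𝓡∂ n)).left_inv (by rwa [OpenPartialHomeomorph.extend_source])

theorem coord_inv (hy : y ∈ A.target i) : A.coord i (A.inv i y) = y :=
  ((A.chart i).extend (𝓡∂ n)).right_inv hy

theorem isOpen_core : IsOpen (A.core i) := isOpen_interior

theorem core_subset_target : A.core i ⊆ A.target i := interior_subset

theorem target_mem_nhds (hy : y ∈ A.core i) : A.target i ∈ nhds y := mem_interior_iff_mem_nhds.1 hy

theorem core_mem_nhds (hy : y ∈ A.core i) : A.core i ∈ nhds y := isOpen_core.mem_nhds hy

theorem measurableSet_core : MeasurableSet (A.core i) := isOpen_core.measurableSet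

theorem contMDiffOn_coord : ContMDiffOn (𝓡∂ n) 𝓘(ℝ, EuclideanSpace ℝ (Fin n)) ∞ (A.coord i)
    (A.chart i).source :=
  (A.chart i).contMDiffOn_extend (A.chart_mem i)

theorem continuousOn_coord : ContinuousOn (A.coord i) (A.chart i).source :=
  contMDiffOn_coord.continuousOn

theorem continuousOn_inv : ContinuousOn (A.inv i) (A.target i) := (A.contMDiffOn_inv i).continuousOn

theorem contMDiffAt_inv (hy : y ∈ A.core i) :
    ContMDiffAt 𝓘(ℝ, EuclideanSpace ℝ (Fin n)) (𝓡∂ n) ∞ (A.inv i) y :=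
  (A.contMDiffOn_inv i).contMDiffAt (target_mem_nhds hy)

theorem contDiffOn_trans : ContDiffOn ℝ ∞ (A.trans i j) (A.overlap i j) := by
  rw [← contMDiffOn_iff_contDiffOn]
  exact (contMDiffOn_coord (i := j)).comp ((A.contMDiffOn_inv i).mono fun y hy => hy.1)
    fun y hy => hy.2

theorem isOpen_coreOverlap : IsOpen (A.coreOverlap i j) :=
  (continuousOn_inv.mono core_subset_target).isOpen_inter_preimage isOpen_core
    (A.chart j).open_source

theorem coreOverlap_subset_overlap : A.coreOverlap i j ⊆ A.overlap i j :=
  fun _ hy => ⟨core_subset_target hy.1, hy.2⟩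

theorem coreOverlap_subset_core : A.coreOverlap i j ⊆ A.core i := fun _ hy => hy.1

theorem coord_mem_core_iff (hx : x ∈ (A.chart i).source) :
    A.coord i x ∈ A.core i ↔ x ∈ (𝓡∂ n).interior M := by
  have hc : chartAt (EuclideanHalfSpace n) x ∈ IsManifold.maximalAtlas (𝓡∂ n) ∞ M :=
    IsManifold.chart_mem_maximalAtlas x
  have h1 : x ∈ (𝓡∂ n).interior M ↔ (chartAt (EuclideanHalfSpace n) x).extend (𝓡∂ n) x ∈
      interior ((chartAt (EuclideanHalfSpace n) x).extend (𝓡∂ n)).target :=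
    ModelWithCorners.isInteriorPoint_iff
  rw [h1]
  exact ⟨mem_interior_extend_target_of_mem_maximalAtlas (A.chart_mem i) hc hx
    (mem_chart_source _ x), mem_interior_extend_target_of_mem_maximalAtlas hc (A.chart_mem i)
    (mem_chart_source _ x) hx⟩

theorem inv_mem_interior_iff (hy : y ∈ A.target i) :
    A.inv i y ∈ (𝓡∂ n).interior M ↔ y ∈ A.core i := by
  rw [← coord_mem_core_iff (inv_mem_source hy), coord_inv hy]

theorem inv_trans (hy : y ∈ A.overlap i j) : A.inv j (A.trans i j y) = A.inv i y :=
  inv_coord hy.2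

theorem trans_trans (hy : y ∈ A.overlap i j) : A.trans j i (A.trans i j y) = y := by
  rw [trans, inv_trans hy, coord_inv hy.1]

theorem trans_mem_coreOverlap (hy : y ∈ A.coreOverlap i j) :
    A.trans i j y ∈ A.coreOverlap j i := by
  have h := coreOverlap_subset_overlap hy
  refine ⟨?_, ?_⟩
  · rw [trans, coord_mem_core_iff hy.2, inv_mem_interior_iff h.1]
    exact hy.1
  · rw [inv_trans h]
    exact inv_mem_source h.1

theorem image_trans : A.trans i j '' A.coreOverlap i j = A.coreOverlap j i := by
  refine Subset.antisymm (image_subset_iff.2 fun y hy => trans_mem_coreOverlap hy) fun z hz => ?_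
  exact ⟨A.trans j i z, trans_mem_coreOverlap hz, trans_trans (coreOverlap_subset_overlap hz)⟩

theorem injOn_trans : InjOn (A.trans i j) (A.coreOverlap i j) := fun y hy z hz h => by
  rw [← trans_trans (coreOverlap_subset_overlap hy), h, trans_trans (coreOverlap_subset_overlap hz)]

theorem contDiffAt_trans (hy : y ∈ A.coreOverlap i j) : ContDiffAt ℝ ∞ (A.trans i j) y :=
  (contDiffOn_trans.mono coreOverlap_subset_overlap).contDiffAt (isOpen_coreOverlap.mem_nhds hy)

theorem hasFDerivAt_trans (hy : y ∈ A.coreOverlap i j) :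
    HasFDerivAt (A.trans i j) (fderiv ℝ (A.trans i j) y) y :=
  ((contDiffAt_trans hy).differentiableAt (by simp)).hasFDerivAt

theorem uniqueDiffOn_overlap : UniqueDiffOn ℝ (A.overlap i j) := by
  have h : IsOpen ((𝓡∂ n).symm ⁻¹' ((A.chart i).target ∩ (A.chart i).symm ⁻¹' (A.chart j).source)) :=
    ((A.chart i).isOpen_inter_preimage_symm (A.chart j).open_source).preimage
      (𝓡∂ n).continuous_symm
  have e : A.overlap i j = (𝓡∂ n).symm ⁻¹' ((A.chart i).target ∩
      (A.chart i).symm ⁻¹' (A.chart j).source) ∩ range (𝓡∂ n) := by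
    ext y
    simp only [overlap, target, inv, OpenPartialHomeomorph.extend_target, mem_ofPred_eq, mem_inter_iff,
      mem_preimage, OpenPartialHomeomorph.extend_coe_symm, Function.comp_apply]
    tauto
  rw [e]
  exact (𝓡∂ n).uniqueDiffOn_preimage
    ((A.chart i).isOpen_inter_preimage_symm (A.chart j).open_source)

variable (A) in
/-- The Jacobian matrix `∂κ^e/∂x^b` of the coordinate change. -/
noncomputable def jac (i j : Fin A.N) (y : EuclideanSpace ℝ (Fin n)) : Matrix (Fin n) (Fin n) ℝ :=
  Matrix.of fun e b => fderivWithin ℝ (A.trans i j) (A.overlap i j) y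
    (EuclideanSpace.single b (1 : ℝ)) e

theorem overlap_mem_nhds (hy : y ∈ A.coreOverlap i j) : A.overlap i j ∈ nhds y :=
  Filter.mem_of_superset (isOpen_coreOverlap.mem_nhds hy) coreOverlap_subset_overlap

theorem contDiffOn_jac (e b : Fin n) : ContDiffOn ℝ ∞ (fun y => A.jac i j y e b)
    (A.overlap i j) := by
  have h : ContDiffOn ℝ ∞ (fun y => fderivWithin ℝ (A.trans i j) (A.overlap i j) y
      (EuclideanSpace.single b (1 : ℝ))) (A.overlap i j) :=
    (contDiffOn_trans.fderivWithin uniqueDiffOn_overlap (m := ∞) (by simp)).clm_apply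
      contDiffOn_const
  exact (EuclideanSpace.proj (𝕜 := ℝ) e).contDiff.comp_contDiffOn h

theorem jac_apply (hy : y ∈ A.coreOverlap i j) (e b : Fin n) :
    A.jac i j y e b = fderiv ℝ (A.trans i j) y (EuclideanSpace.single b (1 : ℝ)) e := by
  simp only [jac, Matrix.of_apply, fderivWithin_of_mem_nhds (overlap_mem_nhds hy)]

theorem fderiv_trans_single (hy : y ∈ A.coreOverlap i j) (b : Fin n) :
    fderiv ℝ (A.trans i j) y (EuclideanSpace.single b (1 : ℝ)) =
      ∑ e, A.jac i j y e b • EuclideanSpace.single e (1 : ℝ) := by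
  ext e
  simp [jac_apply hy, Pi.single_apply]

theorem det_fderiv_trans (hy : y ∈ A.coreOverlap i j) :
    (fderiv ℝ (A.trans i j) y).det = (A.jac i j y).det := by
  have : A.jac i j y = LinearMap.toMatrix (EuclideanSpace.basisFun (Fin n) ℝ).toBasis
      (EuclideanSpace.basisFun (Fin n) ℝ).toBasis
      (fderiv ℝ (A.trans i j) y : EuclideanSpace ℝ (Fin n) →ₗ[ℝ] EuclideanSpace ℝ (Fin n)) := by
    ext e b
    rw [LinearMap.toMatrix_apply, jac_apply hy]
    simp
  rw [this, LinearMap.det_toMatrix]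

/-- The coordinate vector fields of two charts. -/
theorem mfderivWithin_inv_eq (hy : y ∈ A.coreOverlap i j) (v : EuclideanSpace ℝ (Fin n)) :
    (mfderivWithin 𝓘(ℝ, EuclideanSpace ℝ (Fin n)) (𝓡∂ n) (A.inv i) (A.target i) y v :
      EuclideanSpace ℝ (Fin n)) =
    (mfderivWithin 𝓘(ℝ, EuclideanSpace ℝ (Fin n)) (𝓡∂ n) (A.inv j) (A.target j) (A.trans i j y)
      (fderiv ℝ (A.trans i j) y v) : EuclideanSpace ℝ (Fin n)) := by
  have hz := trans_mem_coreOverlap hy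
  rw [mfderivWithin_of_mem_nhds (target_mem_nhds hy.1),
    mfderivWithin_of_mem_nhds (target_mem_nhds hz.1)]
  have h1 : (A.inv i) =ᶠ[nhds y] A.inv j ∘ A.trans i j := by
    filter_upwards [isOpen_coreOverlap.mem_nhds hy] with z hz
    exact (inv_trans (coreOverlap_subset_overlap hz)).symm
  have h2 := h1.mfderiv_eq (I := 𝓘(ℝ, EuclideanSpace ℝ (Fin n))) (I' := 𝓡∂ n)
  have h3 : MDifferentiableAt 𝓘(ℝ, EuclideanSpace ℝ (Fin n)) (𝓡∂ n) (A.inv j) (A.trans i j y) :=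
    (contMDiffAt_inv hz.1).mdifferentiableAt (by simp)
  have h4 := mfderiv_comp y h3
    (hasFDerivAt_trans hy).differentiableAt.mdifferentiableAt
  rw [mfderiv_eq_fderiv] at h4
  exact (congrArg (fun L : EuclideanSpace ℝ (Fin n) →L[ℝ] EuclideanSpace ℝ (Fin n) => L v)
    (show _ = _ from h2)).trans (congrArg (fun L : EuclideanSpace ℝ (Fin n) →L[ℝ]
      EuclideanSpace ℝ (Fin n) => L v) (show _ = _ from h4))

/-- The components of a 1-form in two charts. -/
theorem comp_eq (u : OneForm n M) (hy : y ∈ A.coreOverlap i j) :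
    A.comp u i y = (A.jac i j y)ᵀ *ᵥ A.comp u j (A.trans i j y) := by
  let U : M → EuclideanSpace ℝ (Fin n) →L[ℝ] ℝ := fun x => u x
  ext b
  have h : A.comp u i y b = U (A.inv i y) (mfderivWithin 𝓘(ℝ, EuclideanSpace ℝ (Fin n)) (𝓡∂ n)
    (A.inv i) (A.target i) y (EuclideanSpace.single b (1 : ℝ)) : EuclideanSpace ℝ (Fin n)) := rfl
  rw [h, mfderivWithin_inv_eq hy, fderiv_trans_single hy,
    ← inv_trans (coreOverlap_subset_overlap hy)]
  let D : EuclideanSpace ℝ (Fin n) →L[ℝ] EuclideanSpace ℝ (Fin n) :=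
    mfderivWithin 𝓘(ℝ, EuclideanSpace ℝ (Fin n)) (𝓡∂ n) (A.inv j) (A.target j) (A.trans i j y)
  change U _ (D _) = _
  rw [map_sum, map_sum]
  simp only [map_smul, smul_eq_mul, Matrix.mulVec, dotProduct, Matrix.transpose_apply]
  rfl

/-- The Gram matrices of the metric in two charts. -/
theorem gram_eq (g : Metric n M) (hy : y ∈ A.coreOverlap i j) :
    A.gram g i y = (A.jac i j y)ᵀ * A.gram g j (A.trans i j y) * A.jac i j y := by
  let U : M → EuclideanSpace ℝ (Fin n) →L[ℝ] EuclideanSpace ℝ (Fin n) →L[ℝ] ℝ := fun x => g.inner x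
  ext a b
  let D : EuclideanSpace ℝ (Fin n) →L[ℝ] EuclideanSpace ℝ (Fin n) :=
    mfderivWithin 𝓘(ℝ, EuclideanSpace ℝ (Fin n)) (𝓡∂ n) (A.inv j) (A.target j) (A.trans i j y)
  have h : A.gram g i y a b = U (A.inv i y) (mfderivWithin 𝓘(ℝ, EuclideanSpace ℝ (Fin n)) (𝓡∂ n)
    (A.inv i) (A.target i) y (EuclideanSpace.single a (1 : ℝ)) : EuclideanSpace ℝ (Fin n))
    (mfderivWithin 𝓘(ℝ, EuclideanSpace ℝ (Fin n)) (𝓡∂ n)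
    (A.inv i) (A.target i) y (EuclideanSpace.single b (1 : ℝ)) : EuclideanSpace ℝ (Fin n)) := rfl
  rw [h, mfderivWithin_inv_eq hy, mfderivWithin_inv_eq hy, fderiv_trans_single hy,
    fderiv_trans_single hy, ← inv_trans (coreOverlap_subset_overlap hy)]
  change U _ (D _) (D _) = _
  rw [map_sum, map_sum]
  simp only [map_sum, map_smul, sum_apply, smul_apply, smul_eq_mul, Matrix.mul_apply,
    Matrix.transpose_apply, Finset.sum_mul, Finset.mul_sum]
  refine Finset.sum_congr rfl fun c _ => Finset.sum_congr rfl fun d _ => ?_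
  change _ * (_ * A.gram g j (A.trans i j y) d c) = _
  ring

theorem density_eq (g : Metric n M) (hy : y ∈ A.coreOverlap i j) :
    A.density g i y = |(A.jac i j y).det| * A.density g j (A.trans i j y) := by
  rw [density, density, gram_eq g hy, Matrix.det_mul, Matrix.det_mul, Matrix.det_transpose,
    show (A.jac i j y).det * (A.gram g j (A.trans i j y)).det * (A.jac i j y).det =
      (A.jac i j y).det ^ 2 * (A.gram g j (A.trans i j y)).det by ring,
    Real.sqrt_mul (sq_nonneg _), Real.sqrt_sq_eq_abs]

theorem isUnit_det_jac (hy : y ∈ A.coreOverlap i j) : IsUnit (A.jac i j y).det := by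
  have hz := trans_mem_coreOverlap hy
  have h1 : HasFDerivAt (A.trans j i ∘ A.trans i j)
      ((fderiv ℝ (A.trans j i) (A.trans i j y)).comp (fderiv ℝ (A.trans i j) y)) y :=
    (hasFDerivAt_trans hz).comp y (hasFDerivAt_trans hy)
  have h2 : (A.trans j i ∘ A.trans i j) =ᶠ[nhds y] id := by
    filter_upwards [isOpen_coreOverlap.mem_nhds hy] with z hz
    exact trans_trans (coreOverlap_subset_overlap hz)
  have h3 := h1.unique ((hasFDerivAt_id y).congr_of_eventuallyEq h2)
  have h4 := congrArg ContinuousLinearMap.det h3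
  have h5 : (fderiv ℝ (A.trans j i) (A.trans i j y)).det * (fderiv ℝ (A.trans i j) y).det = 1 := by
    have h6 := LinearMap.det_comp
      (fderiv ℝ (A.trans j i) (A.trans i j y) :
        EuclideanSpace ℝ (Fin n) →ₗ[ℝ] EuclideanSpace ℝ (Fin n))
      (fderiv ℝ (A.trans i j) y : EuclideanSpace ℝ (Fin n) →ₗ[ℝ] EuclideanSpace ℝ (Fin n))
    rw [ContinuousLinearMap.det, ContinuousLinearMap.det, ← h6]
    have h7 : (ContinuousLinearMap.id ℝ (EuclideanSpace ℝ (Fin n))).det = 1 := by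
      simp [ContinuousLinearMap.det]
    rw [← h7, ← h4]
    rfl
  rw [← det_fderiv_trans hy]
  exact IsUnit.of_mul_eq_one_right _ h5

theorem formInner_comp_eq (g : Metric n M) (u v : OneForm n M) (hy : y ∈ A.coreOverlap i j) :
    formInner (A.gram g i y) (A.comp u i y) (A.comp v i y) =
      formInner (A.gram g j (A.trans i j y)) (A.comp u j (A.trans i j y))
        (A.comp v j (A.trans i j y)) := by
  rw [comp_eq u hy, comp_eq v hy, gram_eq g hy, formInner_transpose_mulVec (isUnit_det_jac hy)]

end FiniteAtlas
end HypStokes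

/-! ### Integration in charts -/

namespace HypStokes

section
variable {E F : Type*} [NormedAddCommGroup E] [NormedSpace ℝ E] [NormedAddCommGroup F]
  [NormedSpace ℝ F]

theorem contDiff_indicator {U K : Set E} {f : E → F} {m : ℕ∞} (hU : IsOpen U) (hK : IsClosed K)
    (hKU : K ⊆ U) (hf : ContDiffOn ℝ m f U) (h0 : ∀ y ∈ U, y ∉ K → f y = 0) :
    ContDiff ℝ m (U.indicator f) := by
  refine contDiff_iff_contDiffAt.2 fun y => ?_
  by_cases hy : y ∈ U
  · refine (hf.contDiffAt (hU.mem_nhds hy)).congr_of_eventuallyEq ?_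
    filter_upwards [hU.mem_nhds hy] with z hz
    exact indicator_of_mem hz f
  · refine (contDiffAt_const (c := (0 : F))).congr_of_eventuallyEq ?_
    filter_upwards [hK.isOpen_compl.mem_nhds fun h => hy (hKU h)] with z hz
    by_cases hzU : z ∈ U
    · rw [indicator_of_mem hzU, h0 z hzU hz]
    · exact indicator_of_notMem hzU f

theorem hasCompactSupport_indicator {E F : Type*} [TopologicalSpace E] [R1Space E] [Zero F]
    {U K : Set E} {f : E → F} (hK : IsCompact K)
    (h0 : ∀ y ∈ U, y ∉ K → f y = 0) : HasCompactSupport (U.indicator f) := by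
  refine HasCompactSupport.intro hK fun y hy => ?_
  by_cases hyU : y ∈ U
  · rw [indicator_of_mem hyU, h0 y hyU hy]
  · exact indicator_of_notMem hyU f

theorem integral_fderiv_eq_zero [FiniteDimensional ℝ E] [MeasurableSpace E] [BorelSpace E]
    {μ : Measure E} [μ.IsAddHaarMeasure] {f : E → ℝ} (hf : ContDiff ℝ 1 f)
    (hc : HasCompactSupport f) (v : E) : ∫ y, fderiv ℝ f y v ∂μ = 0 := by
  have h1 : Integrable (fun y => fderiv ℝ f y v) μ :=
    ((hf.continuous_fderiv one_ne_zero).clm_apply continuous_const).integrable_of_hasCompactSupport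
      (hc.fderiv_apply ℝ v)
  have h2 : Integrable f μ := hf.continuous.integrable_of_hasCompactSupport hc
  have h := integral_mul_fderiv_eq_neg_fderiv_mul_of_integrable (μ := μ) (f := fun _ : E => (1 : ℝ))
    (g := f) (v := v) (by simp) (by simpa using h1) (by simpa using h2)
    (fun x _ => differentiableAt_const _) (fun x _ => hf.differentiable one_ne_zero x)
  simpa using h
end

namespace FiniteAtlas
variable {n : ℕ} [NeZero n] {M : Type*} [TopologicalSpace M]
  [ChartedSpace (EuclideanHalfSpace n) M] [IsManifold (𝓡∂ n) ∞ M] {A : FiniteAtlas n M}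
  {i j : Fin A.N} {a : Fin n} {x : M} {y : EuclideanSpace ℝ (Fin n)}
  {K : Set (EuclideanSpace ℝ (Fin n))} {h : EuclideanSpace ℝ (Fin n) → ℝ}

theorem pd_eq_fderiv (hy : y ∈ A.core i) :
    A.pd i a h y = fderiv ℝ h y (EuclideanSpace.single a (1 : ℝ)) := by
  rw [pd, fderivWithin_of_mem_nhds (target_mem_nhds hy)]

theorem pd_congr {k : EuclideanSpace ℝ (Fin n) → ℝ} (hk : ∀ z ∈ A.target i, h z = k z)
    (hy : y ∈ A.target i) : A.pd i a h y = A.pd i a k y := by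
  rw [pd, pd, fderivWithin_congr hk (hk y hy)]

theorem pd_eq_zero (hK : IsClosed K) (h0 : ∀ z ∈ A.target i, z ∉ K → h z = 0)
    (hy : y ∈ A.target i) (hyK : y ∉ K) : A.pd i a h y = 0 := by
  have : h =ᶠ[nhdsWithin y (A.target i)] fun _ => 0 := by
    filter_upwards [self_mem_nhdsWithin, mem_nhdsWithin_of_mem_nhds (hK.isOpen_compl.mem_nhds hyK)]
      with z hz hzK using h0 z hz hzK
  rw [pd, this.fderivWithin_eq (h0 y hy hyK)]
  simp

theorem integrableOn_of_eq_zero (hK : IsCompact K) (hKt : K ⊆ A.target i)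
    (hh : ContinuousOn h (A.target i)) (h0 : ∀ z ∈ A.target i, z ∉ K → h z = 0) :
    IntegrableOn h (A.target i) :=
  ((hh.mono hKt).integrableOn_compact hK).of_forall_sdiff_eq_zero (A.measurableSet_target i)
    fun z hz => h0 z hz.1 hz.2

theorem setIntegral_core (hKc : K ⊆ A.core i) (h0 : ∀ z ∈ A.target i, z ∉ K → h z = 0) :
    ∫ z in A.target i, h z = ∫ z in A.core i, h z :=
  (setIntegral_eq_of_subset_of_forall_sdiff_eq_zero (A.measurableSet_target i)
    core_subset_target fun z hz => h0 z hz.1 fun hzK => hz.2 (hKc hzK))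

/-- The integral of a partial derivative of a function with compact support in the interior. -/
theorem setIntegral_pd_eq_zero (hK : IsCompact K) (hKc : K ⊆ A.core i)
    (hh : ContDiffOn ℝ ∞ h (A.target i)) (h0 : ∀ z ∈ A.target i, z ∉ K → h z = 0) :
    ∫ z in A.target i, A.pd i a h z = 0 := by
  have h0' : ∀ z ∈ A.core i, z ∉ K → h z = 0 := fun z hz => h0 z (core_subset_target hz)
  have h1 : ContDiff ℝ ((1 : ℕ∞) : WithTop ℕ∞) ((A.core i).indicator h) :=
    contDiff_indicator isOpen_core hK.isClosed hKc
      ((hh.mono core_subset_target).of_le (by exact_mod_cast le_top)) h0'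
  rw [setIntegral_core hKc fun z hz hzK => pd_eq_zero hK.isClosed h0 hz hzK,
    ← integral_fderiv_eq_zero (μ := volume) h1 (hasCompactSupport_indicator hK h0')
      (EuclideanSpace.single a (1 : ℝ)), ← MeasureTheory.integral_indicator measurableSet_core]
  congr 1
  ext z
  by_cases hz : z ∈ A.core i
  · have : (A.core i).indicator h =ᶠ[nhds z] h := by
      filter_upwards [core_mem_nhds hz] with w hw
      exact indicator_of_mem hw h
    rw [indicator_of_mem hz, pd_eq_fderiv hz, this.fderiv_eq]
  · have : (A.core i).indicator h =ᶠ[nhds z] fun _ => 0 := by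
      filter_upwards [hK.isClosed.isOpen_compl.mem_nhds fun hzK => hz (hKc hzK)] with w hw
      by_cases hwc : w ∈ A.core i
      · rw [indicator_of_mem hwc, h0' w hwc hw]
      · exact indicator_of_notMem hwc h
    rw [indicator_of_notMem hz, this.fderiv_eq]
    simp

theorem contDiffOn_ρ (i : Fin A.N) (k : Fin A.N) :
    ContDiffOn ℝ ∞ (fun y => A.ρ k (A.inv i y)) (A.target i) := by
  rw [← contMDiffOn_iff_contDiffOn]
  exact (A.ρ k).contMDiff.comp_contMDiffOn (A.contMDiffOn_inv i)

theorem sum_ρ (x : M) : ∑ k, A.ρ k x = 1 := by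
  rw [← finsum_eq_sum_of_fintype]
  exact A.ρ.sum_eq_one (mem_univ x)

theorem isCompact_coord_image [CompactSpace M] {S : Set M} (hS : IsClosed S)
    (hSs : S ⊆ (A.chart i).source) : IsCompact (A.coord i '' S) :=
  hS.isCompact.image_of_continuousOn (continuousOn_coord.mono hSs)

theorem coord_image_subset_target {S : Set M} (hSs : S ⊆ (A.chart i).source) :
    A.coord i '' S ⊆ A.target i :=
  image_subset_iff.2 fun _ hx => coord_mem_target (hSs hx)

theorem coord_image_subset_core {S : Set M} (hSs : S ⊆ (A.chart i).source)
    (hSi : S ⊆ (𝓡∂ n).interior M) : A.coord i '' S ⊆ A.core i :=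
  image_subset_iff.2 fun _ hx => (coord_mem_core_iff (hSs hx)).2 (hSi hx)

theorem mem_coord_image {S : Set M} (hy : y ∈ A.target i) (h : A.inv i y ∈ S) :
    y ∈ A.coord i '' S := ⟨_, h, coord_inv hy⟩

theorem mem_coord_image_iff {S : Set M} (hSs : S ⊆ (A.chart i).source) (hy : y ∈ A.target i) :
    y ∈ A.coord i '' S ↔ A.inv i y ∈ S := by
  refine ⟨?_, mem_coord_image hy⟩
  rintro ⟨x, hx, rfl⟩
  rwa [inv_coord (hSs hx)]

/-- Change of variables between two charts. -/
theorem setIntegral_trans (h : EuclideanSpace ℝ (Fin n) → ℝ) :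
    ∫ z in A.coreOverlap j i, h z =
      ∫ y in A.coreOverlap i j, |(A.jac i j y).det| * h (A.trans i j y) := by
  have := integral_image_eq_integral_abs_det_fderiv_smul volume (f := A.trans i j)
    (f' := fderiv ℝ (A.trans i j)) (isOpen_coreOverlap (i := i) (j := j)).measurableSet
    (fun y hy => (hasFDerivAt_trans hy).hasFDerivWithinAt) injOn_trans h
  rw [image_trans] at this
  rw [this]
  exact setIntegral_congr_fun isOpen_coreOverlap.measurableSet fun y hy => by
    simp only [det_fderiv_trans hy, smul_eq_mul]

theorem integrableOn_trans_iff (h : EuclideanSpace ℝ (Fin n) → ℝ) :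
    IntegrableOn h (A.coreOverlap j i) ↔
      IntegrableOn (fun y => |(A.jac i j y).det| * h (A.trans i j y)) (A.coreOverlap i j) := by
  have := integrableOn_image_iff_integrableOn_abs_det_fderiv_smul volume (f := A.trans i j)
    (f' := fderiv ℝ (A.trans i j)) (isOpen_coreOverlap (i := i) (j := j)).measurableSet
    (fun y hy => (hasFDerivAt_trans hy).hasFDerivWithinAt) injOn_trans h
  rw [image_trans] at this
  rw [this]
  exact integrableOn_congr_fun (fun y hy => by
    simp only [det_fderiv_trans hy, smul_eq_mul]) isOpen_coreOverlap.measurableSet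

variable (g : Metric n M)

/-- The integral over `M` of a function supported in the interior of one chart can be computed in
that chart. -/
theorem integral_eq_setIntegral [CompactSpace M] {F : Fin A.N → EuclideanSpace ℝ (Fin n) → ℝ}
    {S : Set M} (hS : IsClosed S) (hSi : S ⊆ (A.chart i).source) (hSint : S ⊆ (𝓡∂ n).interior M)
    (hF : ∀ j, ∀ y ∈ A.coreOverlap i j, F i y = F j (A.trans i j y))
    (hFc : ContinuousOn (F i) (A.target i))
    (h0 : ∀ j, ∀ y ∈ A.target j, A.inv j y ∉ S → F j y = 0) :
    A.integral g F = ∫ y in A.target i, A.density g i y * F i y := by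
  have hKc : A.coord i '' S ⊆ A.core i := coord_image_subset_core hSi hSint
  have hK : IsCompact (A.coord i '' S) := isCompact_coord_image hS hSi
  have h0i : ∀ y ∈ A.target i, y ∉ A.coord i '' S → F i y = 0 := fun y hy hyK =>
    h0 i y hy fun h => hyK (mem_coord_image hy h)
  have h1 : ∀ j, ∫ z in A.target j, A.ρ j (A.inv j z) * A.density g j z * F j z =
      ∫ y in A.target i, A.ρ j (A.inv i y) * (A.density g i y * F i y) := by
    intro j
    have e1 : ∫ z in A.target j, A.ρ j (A.inv j z) * A.density g j z * F j z =
        ∫ z in A.coreOverlap j i, A.ρ j (A.inv j z) * A.density g j z * F j z := by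
      refine setIntegral_eq_of_subset_of_forall_sdiff_eq_zero (A.measurableSet_target j)
        (coreOverlap_subset_core.trans core_subset_target) fun z hz => ?_
      rw [h0 j z hz.1, mul_zero]
      exact fun hzS => hz.2 ⟨(inv_mem_interior_iff hz.1).1 (hSint hzS), hSi hzS⟩
    have e2 : ∫ y in A.target i, A.ρ j (A.inv i y) * (A.density g i y * F i y) =
        ∫ y in A.coreOverlap i j, A.ρ j (A.inv i y) * (A.density g i y * F i y) := by
      refine setIntegral_eq_of_subset_of_forall_sdiff_eq_zero (A.measurableSet_target i)
        (coreOverlap_subset_core.trans core_subset_target) fun z hz => ?_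
      by_cases hzS : A.inv i z ∈ S
      · have : A.inv i z ∉ (A.chart j).source := fun h =>
          hz.2 ⟨(inv_mem_interior_iff hz.1).1 (hSint hzS), h⟩
        rw [show A.ρ j (A.inv i z) = 0 by
          by_contra hne
          exact this (A.subordinate j (subset_tsupport _ hne)), zero_mul]
      · rw [h0 i z hz.1 hzS, mul_zero, mul_zero]
    rw [e1, e2, setIntegral_trans]
    refine setIntegral_congr_fun isOpen_coreOverlap.measurableSet fun y hy => ?_
    simp only [inv_trans (coreOverlap_subset_overlap hy), density_eq g hy, ← hF j y hy]
    ring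
  have hint : ∀ j, IntegrableOn (fun y => A.ρ j (A.inv i y) * (A.density g i y * F i y))
      (A.target i) := fun j =>
    integrableOn_of_eq_zero hK (hKc.trans core_subset_target)
      ((contDiffOn_ρ i j).continuousOn.mul ((A.contDiffOn_density g i).continuousOn.mul hFc))
      fun y hy hyK => by rw [h0i y hy hyK, mul_zero, mul_zero]
  rw [integral, Finset.sum_congr rfl fun j _ => h1 j, ← integral_finsetSum _ fun j _ => hint j]
  exact setIntegral_congr_fun (A.measurableSet_target i) fun y _ => by
    simp only [← Finset.sum_mul, sum_ρ, one_mul]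

/-- The image in the `i`-th chart of the support of the `i`-th weight. -/
def piece (A : FiniteAtlas n M) (i : Fin A.N) : Set (EuclideanSpace ℝ (Fin n)) :=
  A.coord i '' tsupport (A.ρ i)

theorem isCompact_piece [CompactSpace M] : IsCompact (A.piece i) :=
  isCompact_coord_image (isClosed_tsupport _) (A.subordinate i)

theorem piece_subset_target : A.piece i ⊆ A.target i := coord_image_subset_target (A.subordinate i)

theorem mem_piece (hy : y ∈ A.target i) (h : A.ρ i (A.inv i y) ≠ 0) : y ∈ A.piece i :=
  mem_coord_image hy (subset_tsupport _ h)

/-- Integrals over the full support of a weight are controlled by the weighted integrals. The weight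
may vanish inside its support, where the other charts have to contribute. -/
theorem exists_setIntegral_piece_le [CompactSpace M] (i : Fin A.N) (C₀ : ℝ) (hC₀ : 0 ≤ C₀) :
    ∃ C, 0 ≤ C ∧ ∀ (F : Fin A.N → EuclideanSpace ℝ (Fin n) → ℝ) (S : Set M), IsClosed S →
      S ⊆ (𝓡∂ n).interior M → (∀ j, ContinuousOn (F j) (A.target j)) →
      (∀ j, ∀ y ∈ A.target j, 0 ≤ F j y) →
      (∀ j, ∀ y ∈ A.target j, A.inv j y ∉ S → F j y = 0) →
      (∀ j, ∀ y ∈ A.coreOverlap i j, y ∈ A.piece i → A.trans i j y ∈ A.piece j →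
        F i y ≤ C₀ * F j (A.trans i j y)) →
      ∫ y in A.piece i, F i y ≤ C * A.integral g F := by
  obtain ⟨c, hc0, hc⟩ : ∃ c, 0 < c ∧ ∀ y ∈ A.piece i, c ≤ A.density g i y := by
    rcases (A.piece i).eq_empty_or_nonempty with he | hne
    · exact ⟨1, one_pos, by simp [he]⟩
    · obtain ⟨y, hy, hmin⟩ := isCompact_piece.exists_isMinOn hne
        ((A.contDiffOn_density g i).continuousOn.mono piece_subset_target)
      exact ⟨_, A.density_pos g i (piece_subset_target hy), fun z hz => hmin hz⟩
  refine ⟨C₀ / c, by positivity, fun F S hS hSint hFc hF0 h0 hF => ?_⟩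
  have hP : MeasurableSet (A.piece i) := isCompact_piece.measurableSet
  have hint : ∀ j, IntegrableOn (fun y => A.ρ j (A.inv i y) * F i y) (A.piece i) := fun j =>
    (((contDiffOn_ρ i j).continuousOn.mul (hFc i)).mono piece_subset_target).integrableOn_compact
      isCompact_piece
  have h1 : ∫ y in A.piece i, F i y = ∑ j, ∫ y in A.piece i, A.ρ j (A.inv i y) * F i y := by
    rw [← integral_finsetSum _ fun j _ => hint j]
    exact setIntegral_congr_fun hP fun y _ => by simp only [← Finset.sum_mul, sum_ρ, one_mul]
  rw [h1, integral, Finset.mul_sum]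
  refine Finset.sum_le_sum fun j _ => ?_
  have hQ : MeasurableSet (A.piece i ∩ A.coreOverlap i j) :=
    hP.inter isOpen_coreOverlap.measurableSet
  have hj : IntegrableOn (fun z => A.ρ j (A.inv j z) * A.density g j z * F j z) (A.target j) :=
    A.integrableOn g j (hFc j)
  have hj' := (integrableOn_trans_iff (i := i) (j := j) _).1
    (hj.mono_set (coreOverlap_subset_core.trans core_subset_target))
  calc ∫ y in A.piece i, A.ρ j (A.inv i y) * F i y
      = ∫ y in A.piece i ∩ A.coreOverlap i j, A.ρ j (A.inv i y) * F i y := by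
        refine setIntegral_eq_of_subset_of_forall_sdiff_eq_zero hP inter_subset_left fun y hy => ?_
        have hyt := piece_subset_target hy.1
        by_cases hyS : A.inv i y ∈ S
        · have : A.inv i y ∉ (A.chart j).source := fun h =>
            hy.2 ⟨hy.1, (inv_mem_interior_iff hyt).1 (hSint hyS), h⟩
          rw [show A.ρ j (A.inv i y) = 0 by
            by_contra hne
            exact this (A.subordinate j (subset_tsupport _ hne)), zero_mul]
        · rw [h0 i y hyt hyS, mul_zero]
    _ ≤ ∫ y in A.piece i ∩ A.coreOverlap i j, C₀ / c * (|(A.jac i j y).det| *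
          (A.ρ j (A.inv j (A.trans i j y)) * A.density g j (A.trans i j y) *
            F j (A.trans i j y))) := by
        refine setIntegral_mono_on ((hint j).mono_set inter_subset_left)
          ((hj'.mono_set inter_subset_right).const_mul _) hQ fun y hy => ?_
        have hyo := coreOverlap_subset_overlap hy.2
        have hz := trans_mem_coreOverlap hy.2
        have hzt := core_subset_target hz.1
        rw [inv_trans hyo]
        by_cases hne : A.ρ j (A.inv i y) = 0
        · simp [hne]
        have hzP : A.trans i j y ∈ A.piece j := mem_piece hzt (by rwa [inv_trans hyo])
        have e : C₀ / c * (|(A.jac i j y).det| * (A.ρ j (A.inv i y) *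
            A.density g j (A.trans i j y) * F j (A.trans i j y))) =
            A.ρ j (A.inv i y) * ((A.density g i y / c) * (C₀ * F j (A.trans i j y))) := by
          rw [density_eq g hy.2]; ring
        rw [e]
        refine mul_le_mul_of_nonneg_left ?_ (A.ρ.nonneg j _)
        have h2 : 1 ≤ A.density g i y / c := by rw [le_div_iff₀ hc0, one_mul]; exact hc y hy.1
        exact (hF j y hy.2 hy.1 hzP).trans
          (le_mul_of_one_le_left (mul_nonneg hC₀ (hF0 j _ hzt)) h2)
    _ ≤ ∫ y in A.coreOverlap i j, C₀ / c * (|(A.jac i j y).det| *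
          (A.ρ j (A.inv j (A.trans i j y)) * A.density g j (A.trans i j y) *
            F j (A.trans i j y))) := by
        refine setIntegral_mono_set (hj'.const_mul _) ?_ (Filter.Eventually.of_forall
          inter_subset_right)
        refine (ae_restrict_iff' isOpen_coreOverlap.measurableSet).2
          (Filter.Eventually.of_forall fun y hy => ?_)
        have hzt := core_subset_target (trans_mem_coreOverlap hy).1
        exact mul_nonneg (by positivity) (mul_nonneg (abs_nonneg _) (mul_nonneg (mul_nonneg
          (A.ρ.nonneg j _) (A.density_pos g j hzt).le) (hF0 j _ hzt)))
    _ = C₀ / c * ∫ z in A.coreOverlap j i, A.ρ j (A.inv j z) * A.density g j z * F j z := by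
        rw [MeasureTheory.integral_const_mul]
        exact congrArg _ (setIntegral_trans (i := i) (j := j) fun z =>
          A.ρ j (A.inv j z) * A.density g j z * F j z).symm
    _ ≤ _ := by
        refine mul_le_mul_of_nonneg_left (setIntegral_mono_set hj ?_ (Filter.Eventually.of_forall
          (coreOverlap_subset_core.trans core_subset_target))) (by positivity)
        refine (ae_restrict_iff' (A.measurableSet_target j)).2
          (Filter.Eventually.of_forall fun y hy => ?_)
        exact mul_nonneg (mul_nonneg (A.ρ.nonneg j _) (A.density_pos g j hy).le) (hF0 j _ hy)

end FiniteAtlas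
end HypStokes

/-! ### First-order estimates in charts -/

namespace HypStokes

theorem abs_sum_le_mul {n : ℕ} {f : Fin n → ℝ} {B : ℝ} (h : ∀ i, |f i| ≤ B) :
    |∑ i, f i| ≤ n * B :=
  (Finset.abs_sum_le_sum_abs _ _).trans
    ((Finset.sum_le_sum fun i _ => h i).trans (by simp))

section
variable {n : ℕ} {G : Matrix (Fin n) (Fin n) ℝ}

theorem sq_apply_le_formInner (hG : G.PosDef) (p : Fin n → ℝ) (b : Fin n) :
    p b ^ 2 ≤ formInner G p p * G b b := by
  have := sq_dotProduct_le hG p (Pi.single b 1)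
  simpa using this

theorem sq_apply_le_tensorInner (hG : G.PosDef) (T : Matrix (Fin n) (Fin n) ℝ) (a b : Fin n) :
    T a b ^ 2 ≤ tensorInner G T T * (G a a * G b b) := by
  have hdet : IsUnit G.det := hG.det_pos.ne'.isUnit
  have hGt : Gᵀ = G := by simpa using hG.isHermitian.eq
  have e : (G * Matrix.single a b 1 * G)ᵀ = G * Matrix.single b a 1 * G := by
    simp [Matrix.transpose_mul, hGt, Matrix.mul_assoc]
  have h1 : ∀ T, tensorInner G T (G * Matrix.single a b 1 * G) = T a b := fun T => by
    rw [tensorInner, e, Matrix.mul_assoc, Matrix.mul_assoc G, ← Matrix.mul_assoc G⁻¹ G,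
      Matrix.nonsing_inv_mul _ hdet, Matrix.one_mul, Matrix.mul_assoc, Matrix.trace_mul_comm,
      Matrix.mul_assoc, Matrix.mul_assoc, Matrix.mul_nonsing_inv _ hdet, Matrix.mul_one,
      Matrix.trace_mul_single]
    simp
  have h2 : tensorInner G (G * Matrix.single a b 1 * G) (G * Matrix.single a b 1 * G) =
      G a a * G b b := by
    rw [h1]
    simp [Matrix.mul_apply, Matrix.single_apply, ite_and]
  have := cauchySchwarz (tensorInner G) tensorInner_add tensorInner_smul (tensorInner_comm hG)
    (tensorInner_nonneg hG) T (G * Matrix.single a b 1 * G)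
  rwa [h1, h2] at this

/-- The quadratic form `tr(P A P A) - (tr(P A))²`. Its coefficients are antisymmetric in the two row
indices of `A ⊗ A`, which makes it a null Lagrangian when `A` is a Jacobian matrix. -/
def nullForm (P A : Matrix (Fin n) (Fin n) ℝ) : ℝ :=
  ∑ a, ∑ b, ∑ c, ∑ d, (P a b * P c d - P c b * P a d) * (A b c * A d a)

theorem nullForm_eq (P A : Matrix (Fin n) (Fin n) ℝ) :
    nullForm P A = (P * A * P * A).trace - (P * A).trace ^ 2 := by
  have h1 : (P * A * P * A).trace = ∑ a, ∑ b, ∑ c, ∑ d, P a b * P c d * (A b c * A d a) := by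
    simp only [Matrix.trace, Matrix.diag, Matrix.mul_apply, Finset.sum_mul]
    refine Finset.sum_congr rfl fun a _ => ?_
    rw [Finset.sum_congr rfl fun d _ => Finset.sum_comm, Finset.sum_comm]
    refine Finset.sum_congr rfl fun b _ => ?_
    rw [Finset.sum_comm]
    exact Finset.sum_congr rfl fun c _ => Finset.sum_congr rfl fun d _ => by ring
  have h2 : (P * A).trace ^ 2 = ∑ a, ∑ b, ∑ c, ∑ d, P c b * P a d * (A b c * A d a) := by
    have e1 : (P * A).trace = ∑ b, ∑ c, P c b * A b c := by
      simp only [Matrix.trace, Matrix.diag, Matrix.mul_apply]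
      exact Finset.sum_comm
    have e2 : (P * A).trace = ∑ a, ∑ d, P a d * A d a := by
      simp only [Matrix.trace, Matrix.diag, Matrix.mul_apply]
    rw [sq]
    nth_rw 1 [e2]
    rw [e1, Finset.sum_mul]
    refine Finset.sum_congr rfl fun a _ => ?_
    rw [Finset.mul_sum]
    refine Finset.sum_congr rfl fun b _ => ?_
    rw [Finset.mul_sum]
    refine Finset.sum_congr rfl fun c _ => ?_
    rw [Finset.sum_mul]
    exact Finset.sum_congr rfl fun d _ => by ring
  simp only [nullForm, sub_mul, Finset.sum_sub_distrib, h1, h2]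

theorem abs_nullForm_sub_le {P A D : Matrix (Fin n) (Fin n) ℝ} {B e t : ℝ} (hB : 0 ≤ B)
    (hP : ∀ a b, |P a b| ≤ B) (he : ∀ a b, |A a b - D a b| ≤ e) (hA : ∀ a b, |A a b| ≤ t)
    (hD : ∀ a b, |D a b| ≤ t) :
    |nullForm P A - nullForm P D| ≤ n * (n * (n * (n * (2 * B ^ 2 * (2 * (e * t)))))) := by
  simp only [nullForm, ← Finset.sum_sub_distrib, ← mul_sub]
  refine abs_sum_le_mul fun a => abs_sum_le_mul fun b => abs_sum_le_mul fun c =>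
    abs_sum_le_mul fun d => ?_
  rw [abs_mul]
  have he0 : 0 ≤ e := (abs_nonneg _).trans (he a b)
  have hPP : ∀ a b c d, |P a b * P c d| ≤ B * B := fun a b c d => by
    rw [abs_mul]; exact mul_le_mul (hP _ _) (hP _ _) (abs_nonneg _) hB
  refine mul_le_mul ?_ ?_ (abs_nonneg _) (by positivity)
  · calc _ ≤ |P a b * P c d| + |P c b * P a d| := abs_sub _ _
      _ ≤ B * B + B * B := add_le_add (hPP _ _ _ _) (hPP _ _ _ _)
      _ = _ := by ring
  · calc |A b c * A d a - D b c * D d a|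
        = |(A b c - D b c) * A d a + (A d a - D d a) * D b c| := by congr 1; ring
      _ ≤ |A b c - D b c| * |A d a| + |A d a - D d a| * |D b c| := by
        rw [← abs_mul, ← abs_mul]; exact abs_add_le _ _
      _ ≤ e * t + e * t := add_le_add (mul_le_mul (he _ _) (hA _ _) (abs_nonneg _) he0)
        (mul_le_mul (he _ _) (hD _ _) (abs_nonneg _) he0)
      _ = _ := by ring

theorem tensorInner_self_eq (hG : G.PosDef) (A : Matrix (Fin n) (Fin n) ℝ) :
    tensorInner G A A = (1 / 2) * tensorInner G (A - Aᵀ) (A - Aᵀ) +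
      (nullForm G⁻¹ A + (G⁻¹ * A).trace ^ 2) := by
  have h0 : nullForm G⁻¹ A + (G⁻¹ * A).trace ^ 2 = tensorInner G A Aᵀ := by
    rw [nullForm_eq, tensorInner, Matrix.transpose_transpose]; ring
  have h1 := tensorInner_transpose hG A A
  have h2 := tensorInner_comm hG A Aᵀ
  have hneg : A - Aᵀ = A + (-1 : ℝ) • Aᵀ := by simp [sub_eq_add_neg]
  rw [h0, hneg]
  simp only [tensorInner_add, tensorInner_smul, tensorInner_comm hG _ (_ + _)]
  rw [tensorInner_comm hG _ ((-1 : ℝ) • Aᵀ), tensorInner_smul,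
    tensorInner_comm hG _ ((-1 : ℝ) • Aᵀ), tensorInner_smul]
  linarith
end

section
variable {n : ℕ} [NeZero n] {M : Type*} [TopologicalSpace M]
  [ChartedSpace (EuclideanHalfSpace n) M] [IsManifold (𝓡∂ n) ∞ M]

/-- The support of a 1-form. -/
def formSupport (u : OneForm n M) : Set M := closure {x | u x ≠ 0}

namespace FiniteAtlas
variable {A : FiniteAtlas n M}
  {i j : Fin A.N} {a : Fin n} {x : M} {y : EuclideanSpace ℝ (Fin n)}
  {K : Set (EuclideanSpace ℝ (Fin n))} {h k : EuclideanSpace ℝ (Fin n) → ℝ}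

theorem pd_eq_zero_of_inv {S : Set M} (hS : IsClosed S)
    (h0 : ∀ z ∈ A.target i, A.inv i z ∉ S → h z = 0)
    (hy : y ∈ A.target i) (hyS : A.inv i y ∉ S) : A.pd i a h y = 0 := by
  have : h =ᶠ[nhdsWithin y (A.target i)] fun _ => 0 := by
    have h1 := (continuousOn_inv y hy).preimage_mem_nhdsWithin (hS.isOpen_compl.mem_nhds hyS)
    filter_upwards [self_mem_nhdsWithin, h1] with z hz hzS using h0 z hz hzS
  rw [pd, this.fderivWithin_eq (h0 y hy hyS)]
  simp

theorem comp_eq_zero {u : OneForm n M} (h : A.inv i y ∉ formSupport u) : A.comp u i y = 0 := by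
  ext b
  have : u (A.inv i y) = 0 := by
    by_contra hne
    exact h (subset_closure hne)
  rw [comp, this]
  rfl

theorem pd_comp_eq_zero {u : OneForm n M} (hy : y ∈ A.target i)
    (h : A.inv i y ∉ formSupport u) (b : Fin n) : A.pd i a (fun z => A.comp u i z b) y = 0 :=
  pd_eq_zero_of_inv isClosed_closure (fun z _ hz => by rw [comp_eq_zero hz]; rfl) hy h

/-- Integration by parts in a chart. -/
theorem setIntegral_mul_pd [CompactSpace M] {S₁ S₂ : Set M} (hS₁ : IsClosed S₁) (hS₂ : IsClosed S₂)
    (hSi : S₁ ⊆ (A.chart i).source) (hSint : S₂ ⊆ (𝓡∂ n).interior M)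
    (hk : ContDiffOn ℝ ∞ k (A.target i)) (hh : ContDiffOn ℝ ∞ h (A.target i))
    (hk0 : ∀ z ∈ A.target i, A.inv i z ∉ S₁ → k z = 0)
    (hh0 : ∀ z ∈ A.target i, A.inv i z ∉ S₂ → h z = 0) (a : Fin n) :
    ∫ z in A.target i, k z * A.pd i a h z = -∫ z in A.target i, A.pd i a k z * h z := by
  set K := A.coord i '' (S₁ ∩ S₂)
  have hKs : S₁ ∩ S₂ ⊆ (A.chart i).source := inter_subset_left.trans hSi
  have hK : IsCompact K := isCompact_coord_image (hS₁.inter hS₂) hKs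
  have hKc : K ⊆ A.core i := coord_image_subset_core hKs (inter_subset_right.trans hSint)
  have hKt := hKc.trans core_subset_target
  have hout : ∀ z ∈ A.target i, z ∉ K → A.inv i z ∉ S₁ ∨ A.inv i z ∉ S₂ := fun z hz hzK => by
    by_contra! hcon
    exact hzK (mem_coord_image hz hcon)
  have i1 : IntegrableOn (fun z => k z * A.pd i a h z) (A.target i) :=
    integrableOn_of_eq_zero hK hKt (hk.mul (A.contDiffOn_pd i a hh)).continuousOn
      fun z hz hzK => by
        rcases hout z hz hzK with h1 | h1
        · rw [hk0 z hz h1, zero_mul]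
        · rw [pd_eq_zero_of_inv hS₂ hh0 hz h1, mul_zero]
  have i2 : IntegrableOn (fun z => A.pd i a k z * h z) (A.target i) :=
    integrableOn_of_eq_zero hK hKt ((A.contDiffOn_pd i a hk).mul hh).continuousOn
      fun z hz hzK => by
        rcases hout z hz hzK with h1 | h1
        · rw [pd_eq_zero_of_inv hS₁ hk0 hz h1, zero_mul]
        · rw [hh0 z hz h1, mul_zero]
  have h0 := setIntegral_pd_eq_zero (a := a) hK hKc (hk.mul hh) fun z hz hzK => by
    rcases hout z hz hzK with h1 | h1
    · rw [hk0 z hz h1, zero_mul]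
    · rw [hh0 z hz h1, mul_zero]
  rw [eq_neg_iff_add_eq_zero, ← MeasureTheory.integral_add i1 i2, ← h0]
  exact setIntegral_congr_fun (A.measurableSet_target i) fun z hz => (A.pd_mul i a hk hh hz).symm

theorem pd_pd_comm (hh : ContDiffOn ℝ ∞ h (A.target i)) (hy : y ∈ A.core i) (a b : Fin n) :
    A.pd i a (A.pd i b h) y = A.pd i b (A.pd i a h) y := by
  have hc : ContDiffAt ℝ ∞ h y := hh.contDiffAt (target_mem_nhds hy)
  have key : ∀ a b, A.pd i a (A.pd i b h) y = fderiv ℝ (fderiv ℝ h) y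
      (EuclideanSpace.single a (1 : ℝ)) (EuclideanSpace.single b (1 : ℝ)) := by
    intro a b
    have e : A.pd i b h =ᶠ[nhds y] fun z => fderiv ℝ h z (EuclideanSpace.single b (1 : ℝ)) := by
      filter_upwards [core_mem_nhds hy] with z hz using pd_eq_fderiv hz
    have hd : DifferentiableAt ℝ (fderiv ℝ h) y :=
      (hc.fderiv_right (m := 1) (by norm_cast)).differentiableAt one_ne_zero
    rw [pd_eq_fderiv hy, e.fderiv_eq, fderiv_clm_apply hd (differentiableAt_const _)]
    simp
  rw [key, key]
  exact (hc.isSymmSndFDerivAt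
    (by rw [minSmoothness_of_isRCLikeNormedField]; exact ENat.LEInfty.out)) _ _

theorem exists_abs_le_piece [CompactSpace M] {ι : Type*} [Finite ι]
    {f : ι → EuclideanSpace ℝ (Fin n) → ℝ} (hf : ∀ l, ContinuousOn (f l) (A.target i)) :
    ∃ B, 0 ≤ B ∧ ∀ l, ∀ y ∈ A.piece i, |f l y| ≤ B := by
  cases nonempty_fintype ι
  have : ∀ l, ∃ B, ∀ y ∈ A.piece i, |f l y| ≤ B := fun l => by
    obtain ⟨B, hB⟩ := isCompact_piece.exists_bound_of_continuousOn
      ((hf l).mono (piece_subset_target (i := i)))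
    exact ⟨B, fun y hy => hB y hy⟩
  choose B hB using this
  exact ⟨∑ l, |B l|, Finset.sum_nonneg fun l _ => abs_nonneg _, fun l y hy =>
    ((hB l y hy).trans (le_abs_self _)).trans
      (Finset.single_le_sum (f := fun l => |B l|) (fun _ _ => abs_nonneg _) (Finset.mem_univ l))⟩

theorem integral_mono_of_piece [CompactSpace M] (g : Metric n M)
    {h k : Fin A.N → EuclideanSpace ℝ (Fin n) → ℝ}
    (hh : ∀ i, ContinuousOn (h i) (A.target i)) (hk : ∀ i, ContinuousOn (k i) (A.target i))
    (hhk : ∀ i, ∀ y ∈ A.piece i, h i y ≤ k i y) : A.integral g h ≤ A.integral g k :=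
  Finset.sum_le_sum fun i _ => setIntegral_mono_on (A.integrableOn g i (hh i))
    (A.integrableOn g i (hk i)) (A.measurableSet_target i) fun y hy => by
    by_cases hne : A.ρ i (A.inv i y) = 0
    · simp [hne]
    · exact mul_le_mul_of_nonneg_left (hhk i y (mem_piece hy hne))
        (mul_nonneg (A.ρ.nonneg i _) (A.density_pos g i hy).le)

variable (A) in
/-- The sum of the squares of the components of a 1-form. -/
noncomputable def sq (u : OneForm n M) (i : Fin A.N) (y : EuclideanSpace ℝ (Fin n)) : ℝ :=
  ∑ b, A.comp u i y b ^ 2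

variable (A) in
/-- The sum of the squares of the components of a 1-form and of their partial derivatives. -/
noncomputable def jet (u : OneForm n M) (i : Fin A.N) (y : EuclideanSpace ℝ (Fin n)) : ℝ :=
  A.sq u i y + ∑ a, ∑ b, A.pd i a (fun z => A.comp u i z b) y ^ 2

theorem sq_nonneg (u : OneForm n M) : 0 ≤ A.sq u i y :=
  Finset.sum_nonneg fun _ _ => _root_.sq_nonneg _

theorem sq_le_jet (u : OneForm n M) : A.sq u i y ≤ A.jet u i y :=
  le_add_of_nonneg_right (Finset.sum_nonneg fun _ _ => Finset.sum_nonneg fun _ _ =>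
    _root_.sq_nonneg _)

theorem jet_nonneg (u : OneForm n M) : 0 ≤ A.jet u i y := (sq_nonneg u).trans (sq_le_jet u)

theorem comp_sq_le (u : OneForm n M) (b : Fin n) : A.comp u i y b ^ 2 ≤ A.sq u i y :=
  Finset.single_le_sum (f := fun b => A.comp u i y b ^ 2) (fun _ _ => _root_.sq_nonneg _)
    (Finset.mem_univ b)

theorem pd_comp_sq_le (u : OneForm n M) (a b : Fin n) :
    A.pd i a (fun z => A.comp u i z b) y ^ 2 ≤ A.jet u i y := by
  refine le_add_of_nonneg_of_le (sq_nonneg u) ?_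
  refine (Finset.single_le_sum (f := fun b => A.pd i a (fun z => A.comp u i z b) y ^ 2)
    (fun _ _ => _root_.sq_nonneg _) (Finset.mem_univ b)).trans ?_
  exact Finset.single_le_sum (f := fun a => ∑ b, A.pd i a (fun z => A.comp u i z b) y ^ 2)
    (fun _ _ => Finset.sum_nonneg fun _ _ => _root_.sq_nonneg _) (Finset.mem_univ a)

theorem abs_comp_le (u : OneForm n M) (b : Fin n) : |A.comp u i y b| ≤ √(A.sq u i y) :=
  Real.abs_le_sqrt (comp_sq_le u b)

theorem abs_pd_comp_le (u : OneForm n M) (a b : Fin n) :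
    |A.pd i a (fun z => A.comp u i z b) y| ≤ √(A.jet u i y) :=
  Real.abs_le_sqrt (pd_comp_sq_le u a b)

theorem continuousOn_sq (u : OneForm n M) (i : Fin A.N) : ContinuousOn (A.sq u i) (A.target i) :=
  continuousOn_finsetSum _ fun b _ => (A.contDiffOn_comp u i b).continuousOn.pow 2

theorem continuousOn_jet (u : OneForm n M) (i : Fin A.N) : ContinuousOn (A.jet u i) (A.target i) :=
  (continuousOn_sq u i).add (continuousOn_finsetSum _ fun a _ => continuousOn_finsetSum _
    fun b _ => (A.contDiffOn_pd i a (A.contDiffOn_comp u i b)).continuousOn.pow 2)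

theorem sq_eq_zero (u : OneForm n M) (h : A.inv i y ∉ formSupport u) : A.sq u i y = 0 := by
  simp [sq, comp_eq_zero h]

theorem jet_eq_zero (u : OneForm n M) (hy : y ∈ A.target i) (h : A.inv i y ∉ formSupport u) :
    A.jet u i y = 0 := by
  simp [jet, sq_eq_zero u h, pd_comp_eq_zero hy h]

theorem sq_le_of_abs_le (u : OneForm n M) {D : ℝ} (h1 : ∀ b, |A.comp u i y b| ≤ D) :
    A.sq u i y ≤ n * D ^ 2 := by
  refine (Finset.sum_le_sum fun b _ => ?_ : _ ≤ ∑ b : Fin n, D ^ 2).trans (by simp)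
  exact sq_le_sq.2 ((h1 b).trans (le_abs_self _))

theorem jet_le_of_abs_le (u : OneForm n M) {D : ℝ} (h1 : ∀ b, |A.comp u i y b| ≤ D)
    (h2 : ∀ a b, |A.pd i a (fun z => A.comp u i z b) y| ≤ D) :
    A.jet u i y ≤ (n + n * n) * D ^ 2 := by
  have h3 := sq_le_of_abs_le u h1
  have h4 : ∑ a, ∑ b, A.pd i a (fun z => A.comp u i z b) y ^ 2 ≤ n * n * D ^ 2 := by
    refine (Finset.sum_le_sum fun a _ => Finset.sum_le_sum fun b _ => ?_ :
      _ ≤ ∑ a : Fin n, ∑ b : Fin n, D ^ 2).trans (by simp [mul_assoc])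
    exact sq_le_sq.2 ((h2 a b).trans (le_abs_self _))
  rw [jet]
  linarith

/-- The partial derivatives of the components of a 1-form in two charts. -/
theorem pd_comp_eq (u : OneForm n M) (hy : y ∈ A.coreOverlap i j) (a b : Fin n) :
    A.pd i a (fun z => A.comp u i z b) y =
      ∑ e, (fderivWithin ℝ (fun z => A.jac i j z e b) (A.overlap i j) y
          (EuclideanSpace.single a (1 : ℝ)) * A.comp u j (A.trans i j y) e +
        A.jac i j y e b * ∑ f, A.jac i j y f a *
          A.pd j f (fun z => A.comp u j z e) (A.trans i j y)) := by
  have hz := trans_mem_coreOverlap hy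
  have e1 : (fun z => A.comp u i z b) =ᶠ[nhds y]
      fun z => ∑ e, A.jac i j z e b * A.comp u j (A.trans i j z) e := by
    filter_upwards [isOpen_coreOverlap.mem_nhds hy] with z hz
    rw [comp_eq u hz]
    rfl
  have hJ : ∀ e, HasFDerivAt (fun z => A.jac i j z e b)
      (fderivWithin ℝ (fun z => A.jac i j z e b) (A.overlap i j) y) y := fun e => by
    rw [fderivWithin_of_mem_nhds (overlap_mem_nhds hy)]
    exact (((contDiffOn_jac e b).contDiffAt (overlap_mem_nhds hy)).differentiableAt
      (by simp)).hasFDerivAt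
  have hC : ∀ e, HasFDerivAt (fun z => A.comp u j (A.trans i j z) e)
      ((fderiv ℝ (fun z => A.comp u j z e) (A.trans i j y)).comp (fderiv ℝ (A.trans i j) y)) y :=
    fun e => HasFDerivAt.comp y ((((A.contDiffOn_comp u j e).contDiffAt
      (target_mem_nhds hz.1)).differentiableAt (by simp)).hasFDerivAt) (hasFDerivAt_trans hy)
  have hs := HasFDerivAt.fun_sum (u := Finset.univ) fun e _ => (hJ e).fun_mul (hC e)
  rw [pd_eq_fderiv hy.1, e1.fderiv_eq, hs.fderiv]
  simp only [sum_apply, add_apply, smul_apply, ContinuousLinearMap.comp_apply, smul_eq_mul]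
  refine Finset.sum_congr rfl fun e _ => ?_
  rw [fderiv_trans_single hy, map_sum, add_comm, mul_comm (A.comp u j _ e)]
  congr 2
  refine Finset.sum_congr rfl fun f _ => ?_
  rw [map_smul, smul_eq_mul, pd_eq_fderiv hz.1]

theorem exists_bound_jac [CompactSpace M] (i j : Fin A.N) : ∃ B, 0 ≤ B ∧
    ∀ y ∈ A.coreOverlap i j, y ∈ A.piece i → A.trans i j y ∈ A.piece j →
      (∀ e b, |A.jac i j y e b| ≤ B) ∧ ∀ a e b, |fderivWithin ℝ (fun z => A.jac i j z e b)
        (A.overlap i j) y (EuclideanSpace.single a (1 : ℝ))| ≤ B := by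
  set Q := A.coord i '' (tsupport (A.ρ i) ∩ tsupport (A.ρ j))
  have hs : tsupport (A.ρ i) ∩ tsupport (A.ρ j) ⊆ (A.chart i).source :=
    inter_subset_left.trans (A.subordinate i)
  have hQ : IsCompact Q :=
    isCompact_coord_image ((isClosed_tsupport _).inter (isClosed_tsupport _)) hs
  have hQo : Q ⊆ A.overlap i j := by
    rintro _ ⟨x, hx, rfl⟩
    exact ⟨coord_mem_target (hs hx), by rw [inv_coord (hs hx)]; exact A.subordinate j hx.2⟩
  have hb : ∀ f : EuclideanSpace ℝ (Fin n) → ℝ, ContinuousOn f (A.overlap i j) →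
      ∃ B, ∀ y ∈ Q, |f y| ≤ B := fun f hf =>
    hQ.exists_bound_of_continuousOn (hf.mono hQo)
  choose B₁ hB₁ using fun e b => hb (fun y => A.jac i j y e b) (contDiffOn_jac e b).continuousOn
  choose B₂ hB₂ using fun a e b => hb (fun y => fderivWithin ℝ (fun z => A.jac i j z e b)
    (A.overlap i j) y (EuclideanSpace.single a (1 : ℝ)))
    (((contDiffOn_jac e b).fderivWithin uniqueDiffOn_overlap (m := ∞) (by simp)).clm_apply
      contDiffOn_const).continuousOn
  refine ⟨(∑ e, ∑ b, |B₁ e b|) + ∑ a, ∑ e, ∑ b, |B₂ a e b|, by positivity, fun y hy hyP hzP => ?_⟩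
  have hyQ : y ∈ Q := by
    have hyt := core_subset_target hy.1
    refine mem_coord_image hyt ⟨(mem_coord_image_iff (A.subordinate i) hyt).1 hyP, ?_⟩
    have := (mem_coord_image_iff (A.subordinate j)
      (core_subset_target (trans_mem_coreOverlap hy).1)).1 hzP
    rwa [inv_trans (coreOverlap_subset_overlap hy)] at this
  have hle1 : ∀ e b, |B₁ e b| ≤ ∑ e, ∑ b, |B₁ e b| := fun e b =>
    (Finset.single_le_sum (f := fun b => |B₁ e b|) (fun _ _ => abs_nonneg _)
      (Finset.mem_univ b)).trans (Finset.single_le_sum (f := fun e => ∑ b, |B₁ e b|)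
      (fun _ _ => by positivity) (Finset.mem_univ e))
  have hle2 : ∀ a e b, |B₂ a e b| ≤ ∑ a, ∑ e, ∑ b, |B₂ a e b| := fun a e b =>
    ((Finset.single_le_sum (f := fun b => |B₂ a e b|) (fun _ _ => abs_nonneg _)
      (Finset.mem_univ b)).trans (Finset.single_le_sum (f := fun e => ∑ b, |B₂ a e b|)
      (fun _ _ => by positivity) (Finset.mem_univ e))).trans
      (Finset.single_le_sum (f := fun a => ∑ e, ∑ b, |B₂ a e b|)
      (fun _ _ => by positivity) (Finset.mem_univ a))
  refine ⟨fun e b => ?_, fun a e b => ?_⟩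
  · exact (((hB₁ e b y hyQ).trans (le_abs_self _)).trans (hle1 e b)).trans
      (le_add_of_nonneg_right (by positivity))
  · exact (((hB₂ a e b y hyQ).trans (le_abs_self _)).trans (hle2 a e b)).trans
      (le_add_of_nonneg_left (by positivity))

/-- The components of a 1-form and their derivatives in one chart are controlled by those in another
chart, on the supports of the weights. -/
theorem exists_sq_jet_le [CompactSpace M] (i : Fin A.N) : ∃ C, 0 ≤ C ∧ ∀ (u : OneForm n M) (j),
    ∀ y ∈ A.coreOverlap i j, y ∈ A.piece i → A.trans i j y ∈ A.piece j →
      A.sq u i y ≤ C * A.sq u j (A.trans i j y) ∧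
      A.jet u i y ≤ C * A.jet u j (A.trans i j y) := by
  choose B hB0 hB using exists_bound_jac (A := A) i
  set D : Fin A.N → ℝ := fun j => n * B j + n * (B j + B j * (n * B j))
  have hD0 : ∀ j, 0 ≤ D j := fun j => by have := hB0 j; positivity
  refine ⟨∑ j, (n + n * n) * D j ^ 2, by positivity, fun u j y hy hyP hzP => ?_⟩
  obtain ⟨hJ, hdJ⟩ := hB j y hy hyP hzP
  have hC : (n + n * n) * D j ^ 2 ≤ ∑ j, (n + n * n) * D j ^ 2 :=
    Finset.single_le_sum (f := fun j => (n + n * n) * D j ^ 2) (fun j _ => by positivity)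
      (Finset.mem_univ j)
  have hBj := hB0 j
  have hcomp : ∀ b, |A.comp u i y b| ≤ D j * √(A.sq u j (A.trans i j y)) := fun b => by
    rw [comp_eq u hy]
    refine (abs_sum_le_mul (B := B j * √(A.sq u j (A.trans i j y))) fun e => ?_).trans ?_
    · rw [abs_mul]
      exact mul_le_mul (hJ e b) (abs_comp_le u e) (abs_nonneg _) hBj
    · rw [← mul_assoc]
      exact mul_le_mul_of_nonneg_right (le_add_of_nonneg_right (by positivity)) (Real.sqrt_nonneg _)
  have hst : √(A.sq u j (A.trans i j y)) ≤ √(A.jet u j (A.trans i j y)) :=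
    Real.sqrt_le_sqrt (sq_le_jet u)
  constructor
  · refine (sq_le_of_abs_le u hcomp).trans ?_
    rw [mul_pow, Real.sq_sqrt (sq_nonneg u), ← mul_assoc]
    refine mul_le_mul_of_nonneg_right (le_trans ?_ hC) (sq_nonneg u)
    exact mul_le_mul_of_nonneg_right (le_add_of_nonneg_right (by positivity)) (by positivity)
  · refine (jet_le_of_abs_le u (D := D j * √(A.jet u j (A.trans i j y))) (fun b =>
      (hcomp b).trans (mul_le_mul_of_nonneg_left hst (hD0 j))) fun a b => ?_).trans ?_
    · set t := √(A.jet u j (A.trans i j y))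
      have ht : 0 ≤ t := Real.sqrt_nonneg _
      rw [pd_comp_eq u hy]
      refine (abs_sum_le_mul (B := B j * t + B j * (n * (B j * t))) fun e => ?_).trans ?_
      · refine (abs_add_le _ _).trans (add_le_add ?_ ?_)
        · rw [abs_mul]
          exact mul_le_mul (hdJ a e b) ((abs_comp_le u e).trans hst) (abs_nonneg _) hBj
        · rw [abs_mul]
          refine mul_le_mul (hJ e b) (abs_sum_le_mul fun f => ?_) (abs_nonneg _) hBj
          rw [abs_mul]
          exact mul_le_mul (hJ f a) (abs_pd_comp_le u f e) (abs_nonneg _) hBj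
      · have : n * (B j * t + B j * (n * (B j * t))) = n * (B j + B j * (n * B j)) * t := by ring
        rw [this]
        exact mul_le_mul_of_nonneg_right (le_add_of_nonneg_left (by positivity)) ht
    · rw [mul_pow, Real.sq_sqrt (jet_nonneg u), ← mul_assoc]
      exact mul_le_mul_of_nonneg_right hC (jet_nonneg u)

/-- Pointwise bound of the components by the Riemannian norms. -/
theorem exists_sq_jet_le_inner [CompactSpace M] (g : Metric n M) (i : Fin A.N) :
    ∃ C, 0 ≤ C ∧ ∀ (u : OneForm n M), ∀ y ∈ A.piece i,
      A.sq u i y ≤ C * formInner (A.gram g i y) (A.comp u i y) (A.comp u i y) ∧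
      A.jet u i y ≤ C * (formInner (A.gram g i y) (A.comp u i y) (A.comp u i y) +
        tensorInner (A.gram g i y) (A.covDeriv g u i y) (A.covDeriv g u i y)) := by
  obtain ⟨B, hB0, hB⟩ := exists_abs_le_piece (A := A) (i := i) (ι := Fin n)
    (f := fun b y => A.gram g i y b b) fun b => (A.contDiffOn_gram g i b b).continuousOn
  obtain ⟨B', hB'0, hB'⟩ := exists_abs_le_piece (A := A) (i := i) (ι := Fin n × Fin n × Fin n)
    (f := fun l y => A.christoffel g i l.1 l.2.1 l.2.2 y)
    fun l => (A.contDiffOn_christoffel g i _ _ _).continuousOn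
  set E := 1 + B + n * (B' * (1 + B)) with hE
  have hE0 : 0 ≤ E := by positivity
  refine ⟨(n + n * n) * E ^ 2, by positivity, fun u y hy => ?_⟩
  have hyt := piece_subset_target hy
  have hG := A.posDef_gram g i hyt
  set p := formInner (A.gram g i y) (A.comp u i y) (A.comp u i y)
  set q := tensorInner (A.gram g i y) (A.covDeriv g u i y) (A.covDeriv g u i y)
  have hp : 0 ≤ p := formInner_nonneg hG _
  have hq : 0 ≤ q := tensorInner_nonneg hG _
  have hc : ∀ b, |A.comp u i y b| ≤ (1 + B) * √p := fun b => by
    refine (abs_le_of_sq_le_sq' ?_ (by positivity) |> abs_le.2)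
    rw [mul_pow, Real.sq_sqrt hp]
    have h1 := sq_apply_le_formInner hG (A.comp u i y) b
    have h2 := (le_abs_self _).trans (hB b y hy)
    have h3 : p * A.gram g i y b b ≤ p * B := mul_le_mul_of_nonneg_left h2 hp
    nlinarith [mul_nonneg hp hB0, mul_nonneg hp (mul_nonneg hB0 hB0)]
  have hA : ∀ a b, |A.covDeriv g u i y a b| ≤ (1 + B) * √q := fun a b => by
    refine (abs_le_of_sq_le_sq' ?_ (by positivity) |> abs_le.2)
    rw [mul_pow, Real.sq_sqrt hq]
    have h1 := sq_apply_le_tensorInner hG (A.covDeriv g u i y) a b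
    have h3 : A.gram g i y a a * A.gram g i y b b ≤ B * B :=
      (le_abs_self _).trans (by
        rw [abs_mul]; exact mul_le_mul (hB a y hy) (hB b y hy) (abs_nonneg _) hB0)
    have h4 := mul_le_mul_of_nonneg_left h3 hq
    nlinarith [mul_nonneg hq hB0]
  have hsp : √p ≤ √(p + q) := Real.sqrt_le_sqrt (by linarith)
  have hsq : √q ≤ √(p + q) := Real.sqrt_le_sqrt (by linarith)
  have hBE : 1 + B ≤ E := le_add_of_nonneg_right (by positivity)
  constructor
  · refine (sq_le_of_abs_le u fun b => (hc b).trans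
      (mul_le_mul_of_nonneg_right hBE (Real.sqrt_nonneg _))).trans ?_
    rw [mul_pow, Real.sq_sqrt hp, ← mul_assoc]
    exact mul_le_mul_of_nonneg_right (mul_le_mul_of_nonneg_right
      (le_add_of_nonneg_right (by positivity)) (by positivity)) hp
  · refine (jet_le_of_abs_le u (D := E * √(p + q)) (fun b => (hc b).trans
      (mul_le_mul hBE hsp (Real.sqrt_nonneg _) hE0)) fun a b => ?_).trans ?_
    · have e : A.pd i a (fun z => A.comp u i z b) y = A.covDeriv g u i y a b +
          ∑ k, A.christoffel g i k a b y * A.comp u i y k := by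
        simp [covDeriv]
      rw [e]
      refine (abs_add_le _ _).trans ((add_le_add (hA a b) (abs_sum_le_mul
        (B := B' * ((1 + B) * √(p + q))) fun k => ?_)).trans ?_)
      · rw [abs_mul]
        exact mul_le_mul (hB' (k, a, b) y hy) ((hc k).trans
          (mul_le_mul_of_nonneg_left hsp (by positivity))) (abs_nonneg _) hB'0
      · have := mul_le_mul_of_nonneg_left hsq (show 0 ≤ 1 + B by positivity)
        rw [hE]
        linarith
    · rw [mul_pow, Real.sq_sqrt (by positivity), ← mul_assoc]

/-- The components of a test form and their derivatives are controlled by its `L²` and `H¹` norms on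
the supports of the weights. -/
theorem exists_setIntegral_sq_jet_le [CompactSpace M] (g : Metric n M) (i : Fin A.N) :
    ∃ C, 0 ≤ C ∧ ∀ u : OneForm n M, IsTestForm u →
      ∫ y in A.piece i, A.sq u i y ≤ C * A.l2Form g u u ∧
      ∫ y in A.piece i, A.jet u i y ≤ C * (A.l2Form g u u + A.gradForm g u u) := by
  obtain ⟨C₀, hC₀, h0⟩ := exists_sq_jet_le (A := A) i
  obtain ⟨C₁, hC₁, h1⟩ := exists_setIntegral_piece_le g i C₀ hC₀
  choose D hD0 hD using exists_sq_jet_le_inner (A := A) g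
  have hDS : ∀ j, D j ≤ ∑ j, D j := fun j =>
    Finset.single_le_sum (fun j _ => hD0 j) (Finset.mem_univ j)
  have hDS0 : 0 ≤ ∑ j, D j := Finset.sum_nonneg fun j _ => hD0 j
  refine ⟨C₁ * ∑ j, D j, mul_nonneg hC₁ hDS0, fun u hu => ⟨?_, ?_⟩⟩
  · refine (h1 (A.sq u) (formSupport u) isClosed_closure hu (continuousOn_sq u)
      (fun j y _ => sq_nonneg u) (fun j y _ h => sq_eq_zero u h)
      fun j y hy hyP hzP => (h0 u j y hy hyP hzP).1).trans ?_
    rw [mul_assoc]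
    refine mul_le_mul_of_nonneg_left ?_ hC₁
    rw [l2Form, ← integral_smul]
    refine integral_mono_of_piece g (continuousOn_sq u)
      (fun j => continuousOn_const.mul (A.continuousOn_l2 g u u j)) fun j y hy => ?_
    exact ((hD j u y hy).1).trans (mul_le_mul_of_nonneg_right (hDS j)
      (formInner_nonneg (A.posDef_gram g j (piece_subset_target hy)) _))
  · refine (h1 (A.jet u) (formSupport u) isClosed_closure hu (continuousOn_jet u)
      (fun j y _ => jet_nonneg u) (fun j y hy h => jet_eq_zero u hy h)
      fun j y hy hyP hzP => (h0 u j y hy hyP hzP).2).trans ?_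
    rw [mul_assoc]
    refine mul_le_mul_of_nonneg_left ?_ hC₁
    rw [l2Form, gradForm, ← A.integral_add g (A.continuousOn_l2 g u u) (A.continuousOn_grad g u u),
      ← integral_smul]
    refine integral_mono_of_piece g (continuousOn_jet u)
      (fun j => continuousOn_const.mul ((A.continuousOn_l2 g u u j).add
        (A.continuousOn_grad g u u j))) fun j y hy => ?_
    have hG := A.posDef_gram g j (piece_subset_target hy)
    exact ((hD j u y hy).2).trans (mul_le_mul_of_nonneg_right (hDS j)
      (add_nonneg (formInner_nonneg hG _) (tensorInner_nonneg hG _)))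

end FiniteAtlas
end
end HypStokes

/-! ### Gårding's inequality for test forms -/

namespace HypStokes
namespace FiniteAtlas
variable {n : ℕ} [NeZero n] {M : Type*} [TopologicalSpace M]
  [ChartedSpace (EuclideanHalfSpace n) M] [IsManifold (𝓡∂ n) ∞ M] {A : FiniteAtlas n M}
  {i j : Fin A.N} {a : Fin n} {x : M} {y : EuclideanSpace ℝ (Fin n)}

variable (A) in
/-- The weight `ρ_i √det(g)` of the integral over `M`. -/
noncomputable def weight (g : Metric n M) (i : Fin A.N) (y : EuclideanSpace ℝ (Fin n)) : ℝ :=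
  A.ρ i (A.inv i y) * A.density g i y

variable (A) in
/-- The matrix `∂_a u_b` of the partial derivatives of a 1-form. -/
noncomputable def partials (u : OneForm n M) (i : Fin A.N) (y : EuclideanSpace ℝ (Fin n)) :
    Matrix (Fin n) (Fin n) ℝ := Matrix.of fun a b => A.pd i a (fun z => A.comp u i z b) y

theorem contDiffOn_weight (g : Metric n M) (i : Fin A.N) :
    ContDiffOn ℝ ∞ (A.weight g i) (A.target i) :=
  (contDiffOn_ρ i i).mul (A.contDiffOn_density g i)

theorem weight_nonneg (g : Metric n M) (hy : y ∈ A.target i) : 0 ≤ A.weight g i y :=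
  mul_nonneg (A.ρ.nonneg i _) (A.density_pos g i hy).le

theorem weight_eq_zero (g : Metric n M) (h : A.inv i y ∉ tsupport (A.ρ i)) :
    A.weight g i y = 0 := by
  rw [weight, image_eq_zero_of_notMem_tsupport h, zero_mul]

theorem contDiffOn_partials (u : OneForm n M) (i : Fin A.N) (a b : Fin n) :
    ContDiffOn ℝ ∞ (fun y => A.partials u i y a b) (A.target i) :=
  A.contDiffOn_pd i a (A.contDiffOn_comp u i b)

theorem notMem_tsupport_of_notMem_piece (hy : y ∈ A.target i) (h : y ∉ A.piece i) :
    A.inv i y ∉ tsupport (A.ρ i) := fun h' => h (mem_coord_image hy h')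

theorem continuousOn_sqrt_mul_sqrt (u : OneForm n M) (i : Fin A.N) :
    ContinuousOn (fun y => √(A.sq u i y) * √(A.jet u i y)) (A.target i) :=
  (continuousOn_sq u i).sqrt.mul (continuousOn_jet u i).sqrt

theorem integrableOn_piece [CompactSpace M] {h : EuclideanSpace ℝ (Fin n) → ℝ}
    (hh : ContinuousOn h (A.target i)) : IntegrableOn h (A.piece i) :=
  (hh.mono piece_subset_target).integrableOn_compact isCompact_piece

theorem integrableOn_of_eq_zero_piece [CompactSpace M] {h : EuclideanSpace ℝ (Fin n) → ℝ}
    (hh : ContinuousOn h (A.target i)) (h0 : ∀ z ∈ A.target i, z ∉ A.piece i → h z = 0) :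
    IntegrableOn h (A.target i) :=
  integrableOn_of_eq_zero isCompact_piece piece_subset_target hh h0

theorem setIntegral_piece {h : EuclideanSpace ℝ (Fin n) → ℝ}
    (h0 : ∀ z ∈ A.target i, z ∉ A.piece i → h z = 0) :
    ∫ z in A.target i, h z = ∫ z in A.piece i, h z :=
  setIntegral_eq_of_subset_of_forall_sdiff_eq_zero (A.measurableSet_target i)
    piece_subset_target fun z hz => h0 z hz.1 hz.2

theorem abs_setIntegral_le [CompactSpace M] {h k : EuclideanSpace ℝ (Fin n) → ℝ}
    (hk : ContinuousOn k (A.target i)) (hhk : ∀ z ∈ A.piece i, |h z| ≤ k z)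
    (h0 : ∀ z ∈ A.target i, z ∉ A.piece i → h z = 0) :
    |∫ z in A.target i, h z| ≤ ∫ z in A.piece i, k z := by
  rw [setIntegral_piece h0]
  rw [← Real.norm_eq_abs]
  exact norm_integral_le_of_norm_le (integrableOn_piece hk)
    ((ae_restrict_iff' isCompact_piece.measurableSet).2 (Filter.Eventually.of_forall
      fun z hz => by rw [Real.norm_eq_abs]; exact hhk z hz))

theorem setIntegral_sum₄ {n : ℕ} {E : Type*} [MeasurableSpace E] {μ : Measure E} {s : Set E}
    {f : Fin n → Fin n → Fin n → Fin n → E → ℝ}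
    (hf : ∀ a b c d, IntegrableOn (f a b c d) s μ) :
    ∫ y in s, ∑ a, ∑ b, ∑ c, ∑ d, f a b c d y ∂μ =
      ∑ a, ∑ b, ∑ c, ∑ d, ∫ y in s, f a b c d y ∂μ := by
  rw [integral_finsetSum _ fun a _ => integrable_finsetSum _ fun b _ => integrable_finsetSum _
    fun c _ => integrable_finsetSum _ fun d _ => hf a b c d]
  refine Finset.sum_congr rfl fun a _ => ?_
  rw [integral_finsetSum _ fun b _ => integrable_finsetSum _ fun c _ => integrable_finsetSum _
    fun d _ => hf a b c d]
  refine Finset.sum_congr rfl fun b _ => ?_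
  rw [integral_finsetSum _ fun c _ => integrable_finsetSum _ fun d _ => hf a b c d]
  refine Finset.sum_congr rfl fun c _ => ?_
  rw [integral_finsetSum _ fun d _ => hf a b c d]

/-- The null form integrates to lower-order terms: integrating by parts, the second derivatives
cancel by symmetry. -/
theorem exists_setIntegral_nullForm_le [CompactSpace M] (g : Metric n M) (i : Fin A.N) :
    ∃ C, 0 ≤ C ∧ ∀ u : OneForm n M, IsTestForm u →
      ∫ y in A.target i, A.weight g i y * nullForm (A.gram g i y)⁻¹ (A.partials u i y) ≤
        C * ∫ y in A.piece i, √(A.sq u i y) * √(A.jet u i y) := by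
  set k : Fin n → Fin n → Fin n → Fin n → EuclideanSpace ℝ (Fin n) → ℝ := fun a b c d y =>
    A.weight g i y * ((A.gram g i y)⁻¹ a b * (A.gram g i y)⁻¹ c d -
      (A.gram g i y)⁻¹ c b * (A.gram g i y)⁻¹ a d) with hkdef
  have hP := A.contDiffOn_gramInv g i
  have hk : ∀ a b c d, ContDiffOn ℝ ∞ (k a b c d) (A.target i) := fun a b c d =>
    (contDiffOn_weight g i).mul (((hP a b).mul (hP c d)).sub ((hP c b).mul (hP a d)))
  have hk0 : ∀ a b c d y, A.inv i y ∉ tsupport (A.ρ i) → k a b c d y = 0 := fun a b c d y hy => by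
    simp only [hkdef, weight_eq_zero g hy, zero_mul]
  have hpdk0 : ∀ e a b c d, ∀ y ∈ A.target i, A.inv i y ∉ tsupport (A.ρ i) →
      A.pd i e (k a b c d) y = 0 := fun e a b c d y hy h =>
    pd_eq_zero_of_inv (isClosed_tsupport _) (fun z _ hz => hk0 a b c d z hz) hy h
  obtain ⟨B, hB0, hB⟩ := exists_abs_le_piece (A := A) (i := i)
    (ι := Fin n × Fin n × Fin n × Fin n)
    (f := fun l => A.pd i l.2.2.2 (k l.1 l.2.1 l.2.2.1 l.2.2.2))
    fun l => (A.contDiffOn_pd i _ (hk _ _ _ _)).continuousOn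
  refine ⟨n * (n * (n * (n * B))), by positivity, fun u hu => ?_⟩
  have hc := A.contDiffOn_comp u i
  have hD := contDiffOn_partials u i
  have hnot := fun y (hy : y ∈ A.target i) h => notMem_tsupport_of_notMem_piece (A := A) hy h
  -- the terms of the null form, before and after the integration by parts
  have iF : ∀ a b c d, IntegrableOn (fun y => k a b c d y * A.partials u i y b c *
      A.pd i d (fun z => A.comp u i z a) y) (A.target i) := fun a b c d =>
    integrableOn_of_eq_zero_piece
      (((hk a b c d).mul (hD b c)).mul (A.contDiffOn_pd i d (hc a))).continuousOn
      fun z hz h => by rw [hk0 a b c d z (hnot z hz h), zero_mul, zero_mul]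
  have iG : ∀ a b c d, IntegrableOn (fun y => A.pd i d (fun z => k a b c d z *
      A.partials u i z b c) y * A.comp u i y a) (A.target i) := fun a b c d =>
    integrableOn_of_eq_zero_piece
      ((A.contDiffOn_pd i d ((hk a b c d).mul (hD b c))).mul (hc a)).continuousOn
      fun z hz h => by
        rw [pd_eq_zero_of_inv (isClosed_tsupport (A.ρ i)) (fun w _ hw => by
          rw [hk0 a b c d w hw, zero_mul]) hz (hnot z hz h), zero_mul]
  have hparts : ∀ a b c d, ∫ y in A.target i, k a b c d y * A.partials u i y b c *
      A.pd i d (fun z => A.comp u i z a) y = -∫ y in A.target i, A.pd i d (fun z => k a b c d z *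
      A.partials u i z b c) y * A.comp u i y a := fun a b c d =>
    setIntegral_mul_pd (isClosed_tsupport _) isClosed_closure (A.subordinate i) hu
      ((hk a b c d).mul (hD b c)) (hc a)
      (fun z _ hz => by rw [hk0 a b c d z hz, zero_mul])
      (fun z _ hz => by rw [comp_eq_zero hz]; rfl) d
  have e1 : ∫ y in A.target i, A.weight g i y * nullForm (A.gram g i y)⁻¹ (A.partials u i y) =
      ∑ a, ∑ b, ∑ c, ∑ d, ∫ y in A.target i, k a b c d y * A.partials u i y b c *
        A.pd i d (fun z => A.comp u i z a) y := by
    rw [← setIntegral_sum₄ iF]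
    refine setIntegral_congr_fun (A.measurableSet_target i) fun y _ => ?_
    simp only [nullForm, Finset.mul_sum]
    refine Finset.sum_congr rfl fun a _ => Finset.sum_congr rfl fun b _ =>
      Finset.sum_congr rfl fun c _ => Finset.sum_congr rfl fun d _ => ?_
    simp only [hkdef]
    change _ = _ * A.partials u i y d a
    ring
  -- the second derivatives cancel
  have e2 : ∀ y ∈ A.target i, ∑ a, ∑ b, ∑ c, ∑ d, A.pd i d (fun z => k a b c d z *
      A.partials u i z b c) y * A.comp u i y a = ∑ a, ∑ b, ∑ c, ∑ d,
      A.pd i d (k a b c d) y * A.partials u i y b c * A.comp u i y a := by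
    intro y hy
    by_cases hS : A.inv i y ∈ formSupport u
    swap
    · simp [comp_eq_zero hS]
    have hyc : y ∈ A.core i := (inv_mem_interior_iff hy).1 (hu hS)
    have h1 : ∀ a b c d, A.pd i d (fun z => k a b c d z * A.partials u i z b c) y *
        A.comp u i y a = A.pd i d (k a b c d) y * A.partials u i y b c * A.comp u i y a +
        k a b c d y * A.pd i d (fun z => A.partials u i z b c) y * A.comp u i y a :=
      fun a b c d => by rw [A.pd_mul i d (hk a b c d) (hD b c) hy]; ring
    simp only [h1, Finset.sum_add_distrib]
    refine add_eq_left.2 (Finset.sum_eq_zero fun a _ => ?_)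
    rw [Finset.sum_comm]
    refine Finset.sum_eq_zero fun c _ => ?_
    have h2 : ∑ b, ∑ d, k a b c d y * A.pd i d (fun z => A.partials u i z b c) y *
        A.comp u i y a = -∑ b, ∑ d, k a b c d y * A.pd i d (fun z => A.partials u i z b c) y *
        A.comp u i y a := by
      nth_rw 1 [Finset.sum_comm]
      simp only [← Finset.sum_neg_distrib]
      refine Finset.sum_congr rfl fun b _ => Finset.sum_congr rfl fun d _ => ?_
      have h3 : A.pd i b (fun z => A.partials u i z d c) y =
          A.pd i d (fun z => A.partials u i z b c) y := pd_pd_comm (hc c) hyc b d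
      rw [h3]
      simp only [hkdef]
      ring
    linarith
  have e3 : ∑ a, ∑ b, ∑ c, ∑ d, ∫ y in A.target i, k a b c d y * A.partials u i y b c *
        A.pd i d (fun z => A.comp u i z a) y = -∫ y in A.target i, ∑ a, ∑ b, ∑ c, ∑ d,
      A.pd i d (k a b c d) y * A.partials u i y b c * A.comp u i y a := by
    rw [← setIntegral_congr_fun (A.measurableSet_target i) e2, setIntegral_sum₄ iG]
    simp only [hparts, Finset.sum_neg_distrib]
  rw [e1, e3, ← MeasureTheory.integral_const_mul]
  refine (neg_le_abs _).trans (abs_setIntegral_le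
    (continuousOn_const.mul (continuousOn_sqrt_mul_sqrt u i)) (fun y hy => ?_) fun y hy h => ?_)
  · have : n * (n * (n * (n * B))) * (√(A.sq u i y) * √(A.jet u i y)) =
        n * (n * (n * (n * (B * √(A.jet u i y) * √(A.sq u i y))))) := by ring
    rw [this]
    refine abs_sum_le_mul fun a => abs_sum_le_mul fun b => abs_sum_le_mul fun c =>
      abs_sum_le_mul fun d => ?_
    rw [abs_mul, abs_mul]
    exact mul_le_mul (mul_le_mul (hB (a, b, c, d) y hy) (abs_pd_comp_le u b c) (abs_nonneg _) hB0)
      (abs_comp_le u a) (abs_nonneg _) (by positivity)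
  · exact Finset.sum_eq_zero fun a _ => Finset.sum_eq_zero fun b _ => Finset.sum_eq_zero fun c _ =>
      Finset.sum_eq_zero fun d _ => by rw [hpdk0 d a b c d y hy (hnot y hy h), zero_mul, zero_mul]

/-- The pointwise identity behind Gårding's inequality: `|∇u|²` is `|du|²` and `|d^*u|²` up to the
null form and lower-order terms. -/
theorem exists_tensorInner_le [CompactSpace M] (g : Metric n M) (i : Fin A.N) :
    ∃ C, 0 ≤ C ∧ ∀ (u : OneForm n M), ∀ y ∈ A.piece i,
      tensorInner (A.gram g i y) (A.covDeriv g u i y) (A.covDeriv g u i y) ≤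
        (1 / 2) * tensorInner (A.gram g i y) (A.extDeriv u i y) (A.extDeriv u i y) +
        2 * (A.codiff g u i y * A.codiff g u i y) +
        nullForm (A.gram g i y)⁻¹ (A.partials u i y) + C * (√(A.sq u i y) * √(A.jet u i y)) := by
  obtain ⟨B, hB0, hB⟩ := exists_abs_le_piece (A := A) (i := i) (ι := Fin n × Fin n)
    (f := fun l y => (A.gram g i y)⁻¹ l.1 l.2)
    fun l => (A.contDiffOn_gramInv g i _ _).continuousOn
  obtain ⟨B', hB'0, hB'⟩ := exists_abs_le_piece (A := A) (i := i) (ι := Fin n × Fin n × Fin n)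
    (f := fun l y => A.christoffel g i l.1 l.2.1 l.2.2 y)
    fun l => (A.contDiffOn_christoffel g i _ _ _).continuousOn
  obtain ⟨B₃, hB₃0, hB₃⟩ := exists_abs_le_piece (A := A) (i := i) (ι := Fin n)
    (f := fun b y => A.codiffCoeff g i y b) fun b => (A.contDiffOn_codiffCoeff g i b).continuousOn
  refine ⟨n * (n * (n * (n * (2 * B ^ 2 * (2 * ((n * B') * (1 + n * B'))))))) +
    2 * (n * B₃) ^ 2, by positivity, fun u y hy => ?_⟩
  have hyt := piece_subset_target hy
  have hG := A.posDef_gram g i hyt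
  set s := √(A.sq u i y) with hs
  set t := √(A.jet u i y) with ht
  have hs0 : 0 ≤ s := Real.sqrt_nonneg _
  have ht0 : 0 ≤ t := Real.sqrt_nonneg _
  have hst : s ≤ t := Real.sqrt_le_sqrt (sq_le_jet u)
  have hAD : ∀ a b, |A.covDeriv g u i y a b - A.partials u i y a b| ≤ n * B' * s := fun a b => by
    have e : A.covDeriv g u i y a b - A.partials u i y a b =
        -∑ k, A.christoffel g i k a b y * A.comp u i y k := by simp [covDeriv, partials]
    rw [e, abs_neg, mul_assoc]
    refine abs_sum_le_mul fun k => ?_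
    rw [abs_mul]
    exact mul_le_mul (hB' (k, a, b) y hy) (abs_comp_le u k) (abs_nonneg _) hB'0
  have hD : ∀ a b, |A.partials u i y a b| ≤ (1 + n * B') * t := fun a b =>
    (abs_pd_comp_le u a b).trans (le_mul_of_one_le_left ht0 (le_add_of_nonneg_right (by positivity)))
  have hA : ∀ a b, |A.covDeriv g u i y a b| ≤ (1 + n * B') * t := fun a b => by
    have h1 := abs_pd_comp_le (A := A) (i := i) (y := y) u a b
    have h2 := abs_add_le (A.partials u i y a b) (A.covDeriv g u i y a b - A.partials u i y a b)
    rw [add_sub_cancel] at h2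
    have h3 := mul_le_mul_of_nonneg_left hst (show 0 ≤ n * B' by positivity)
    have h4 : |A.partials u i y a b| ≤ t := h1
    linarith [hAD a b]
  have h1 := abs_nullForm_sub_le hB0 (fun a b => hB (a, b) y hy) hAD hA hD
  have h2 := (le_abs_self _).trans h1
  have h3 : |A.comp u i y ⬝ᵥ A.codiffCoeff g i y| ≤ n * B₃ * s := by
    rw [mul_assoc]
    refine abs_sum_le_mul fun b => ?_
    rw [abs_mul, mul_comm]
    exact mul_le_mul (hB₃ b y hy) (abs_comp_le u b) (abs_nonneg _) hB₃0
  have h4 : (A.comp u i y ⬝ᵥ A.codiffCoeff g i y) ^ 2 ≤ (n * B₃) ^ 2 * (s * t) := by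
    rw [← sq_abs]
    calc _ ≤ (n * B₃ * s) ^ 2 := pow_le_pow_left₀ (abs_nonneg _) h3 2
      _ = (n * B₃) ^ 2 * (s * s) := by ring
      _ ≤ _ := by gcongr
  have h5 := A.codiff_eq g u i hyt
  rw [tensorInner_self_eq hG, A.extDeriv_eq g u i y]
  set r := ((A.gram g i y)⁻¹ * A.covDeriv g u i y).trace
  set q := A.comp u i y ⬝ᵥ A.codiffCoeff g i y
  have h6 : r ^ 2 ≤ 2 * (A.codiff g u i y * A.codiff g u i y) + 2 * q ^ 2 := by
    rw [h5]; nlinarith [_root_.sq_nonneg (r - 2 * q)]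
  have h7 : n * (n * (n * (n * (2 * B ^ 2 * (2 * (n * B' * s * ((1 + n * B') * t))))))) =
      n * (n * (n * (n * (2 * B ^ 2 * (2 * ((n * B') * (1 + n * B'))))))) * (s * t) := by ring
  rw [h7] at h2
  rw [add_mul]
  linarith

theorem integrableOn_weight_mul [CompactSpace M] (g : Metric n M)
    {h : EuclideanSpace ℝ (Fin n) → ℝ} (hh : ContinuousOn h (A.target i)) :
    IntegrableOn (fun y => A.weight g i y * h y) (A.target i) := A.integrableOn g i hh

theorem setIntegral_weight_add [CompactSpace M] (g : Metric n M)
    {h k : EuclideanSpace ℝ (Fin n) → ℝ} (hh : ContinuousOn h (A.target i))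
    (hk : ContinuousOn k (A.target i)) :
    ∫ y in A.target i, A.weight g i y * (h y + k y) =
      (∫ y in A.target i, A.weight g i y * h y) + ∫ y in A.target i, A.weight g i y * k y := by
  rw [← MeasureTheory.integral_add (integrableOn_weight_mul g hh) (integrableOn_weight_mul g hk)]
  simp only [mul_add]

theorem setIntegral_weight_mul_le [CompactSpace M] (g : Metric n M)
    {h k : EuclideanSpace ℝ (Fin n) → ℝ} (hh : ContinuousOn h (A.target i))
    (hk : ContinuousOn k (A.target i)) (hhk : ∀ y ∈ A.piece i, h y ≤ k y) :
    ∫ y in A.target i, A.weight g i y * h y ≤ ∫ y in A.target i, A.weight g i y * k y :=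
  setIntegral_mono_on (integrableOn_weight_mul g hh) (integrableOn_weight_mul g hk)
    (A.measurableSet_target i) fun y hy => by
      by_cases hP : y ∈ A.piece i
      · exact mul_le_mul_of_nonneg_left (hhk y hP) (weight_nonneg g hy)
      · simp [weight_eq_zero g (notMem_tsupport_of_notMem_piece hy hP)]

theorem exists_setIntegral_weight_le [CompactSpace M] (g : Metric n M) (i : Fin A.N) :
    ∃ C, 0 ≤ C ∧ ∀ h : EuclideanSpace ℝ (Fin n) → ℝ, ContinuousOn h (A.target i) →
      (∀ y, 0 ≤ h y) → ∫ y in A.target i, A.weight g i y * h y ≤ C * ∫ y in A.piece i, h y := by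
  obtain ⟨B, hB0, hB⟩ := exists_abs_le_piece (A := A) (i := i) (ι := Unit)
    (f := fun _ => A.weight g i) fun _ => (contDiffOn_weight g i).continuousOn
  refine ⟨B, hB0, fun h hh h0 => ?_⟩
  rw [← MeasureTheory.integral_const_mul]
  refine (le_abs_self _).trans (abs_setIntegral_le (continuousOn_const.mul hh) (fun y hy => ?_)
    fun y hy hP => by rw [weight_eq_zero g (notMem_tsupport_of_notMem_piece hy hP), zero_mul])
  rw [abs_mul, abs_of_nonneg (h0 y)]
  exact mul_le_mul_of_nonneg_right (hB () y hy) (h0 y)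

theorem continuousOn_nullForm (g : Metric n M) (u : OneForm n M) (i : Fin A.N) :
    ContinuousOn (fun y => nullForm (A.gram g i y)⁻¹ (A.partials u i y)) (A.target i) := by
  have hP := fun a b => (A.contDiffOn_gramInv g i a b).continuousOn
  have hD := fun a b => (contDiffOn_partials u i a b).continuousOn
  exact continuousOn_finsetSum _ fun a _ => continuousOn_finsetSum _ fun b _ =>
    continuousOn_finsetSum _ fun c _ => continuousOn_finsetSum _ fun d _ =>
    (((hP a b).mul (hP c d)).sub ((hP c b).mul (hP a d))).mul ((hD b c).mul (hD d a))

/-- Gårding's inequality (Gaffney's inequality) for test forms. -/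
theorem exists_gradForm_le [CompactSpace M] (g : Metric n M) :
    ∃ C, 0 ≤ C ∧ ∀ u : OneForm n M, IsTestForm u →
      A.gradForm g u u ≤ C * (A.dForm g u u + A.codForm g u u + A.l2Form g u u) := by
  choose C₁ hC₁ h₁ using exists_setIntegral_nullForm_le (A := A) g
  choose C₂ hC₂ h₂ using exists_tensorInner_le (A := A) g
  choose C₃ hC₃ h₃ using exists_setIntegral_weight_le (A := A) g
  choose C₄ hC₄ h₄ using exists_setIntegral_sq_jet_le (A := A) g
  set C := ∑ i, (C₁ i + C₂ i * C₃ i) * C₄ i with hC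
  have hC0 : 0 ≤ C := Finset.sum_nonneg fun i _ => by
    have := hC₁ i; have := hC₂ i; have := hC₃ i; have := hC₄ i; positivity
  -- the lower-order terms are absorbed with this weight
  set ε := (1 / 2) / (1 + C) with hε
  have hε0 : 0 < ε := by positivity
  have hεC : C * ε ≤ 1 / 2 := by
    rw [hε, ← mul_div_assoc, div_le_iff₀ (by positivity)]; linarith
  refine ⟨4 + (1 + 2 * (C / ε)), by positivity, fun u hu => ?_⟩
  have hl := A.l2Form_nonneg g u
  have hd := A.dForm_nonneg g u
  have hcod := A.codForm_nonneg g u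
  have hgr := A.gradForm_nonneg g u
  have hX : ∀ i, ∫ y in A.piece i, √(A.sq u i y) * √(A.jet u i y) ≤
      C₄ i * (ε * (A.l2Form g u u + A.gradForm g u u) + A.l2Form g u u / ε) := by
    intro i
    have := hC₄ i
    calc _ ≤ ∫ y in A.piece i, (ε * A.jet u i y + A.sq u i y / ε) := by
          refine setIntegral_mono_on (integrableOn_piece (continuousOn_sqrt_mul_sqrt u i))
            (((integrableOn_piece (continuousOn_jet u i)).const_mul ε).add
              ((integrableOn_piece (continuousOn_sq u i)).div_const ε))
            isCompact_piece.measurableSet fun y _ => ?_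
          have e1 := Real.sq_sqrt (sq_nonneg (A := A) (i := i) (y := y) u)
          have e2 := Real.sq_sqrt (jet_nonneg (A := A) (i := i) (y := y) u)
          set s := √(A.sq u i y)
          set t := √(A.jet u i y)
          rw [← e1, ← e2, ← sub_nonneg]
          have : ε * t ^ 2 + s ^ 2 / ε - s * t = (3 / 4) * (ε * t ^ 2) +
              (s - ε * t / 2) ^ 2 / ε := by field_simp; ring
          rw [this]
          positivity
      _ = ε * (∫ y in A.piece i, A.jet u i y) + (∫ y in A.piece i, A.sq u i y) / ε := by
          rw [MeasureTheory.integral_add ((integrableOn_piece (continuousOn_jet u i)).const_mul ε)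
            ((integrableOn_piece (continuousOn_sq u i)).div_const ε),
            MeasureTheory.integral_const_mul, MeasureTheory.integral_div]
      _ ≤ ε * (C₄ i * (A.l2Form g u u + A.gradForm g u u)) + C₄ i * A.l2Form g u u / ε := by
          have h := h₄ i u hu
          gcongr
          exacts [h.2, h.1]
      _ = _ := by ring
  have hgrad : A.gradForm g u u ≤ A.dForm g u u + 2 * A.codForm g u u +
      C * (ε * (A.l2Form g u u + A.gradForm g u u) + A.l2Form g u u / ε) := by
    rw [hC, Finset.sum_mul]
    have hcc : ∀ i, ContinuousOn (fun y => 2 * (A.codiff g u i y * A.codiff g u i y))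
        (A.target i) := fun i => continuousOn_const.mul (A.continuousOn_cod g u u i)
    rw [codForm, ← integral_smul, dForm, ← A.integral_add g (A.continuousOn_d g u u) hcc]
    nth_rw 1 [gradForm]
    rw [integral, integral, ← Finset.sum_add_distrib]
    refine Finset.sum_le_sum fun i _ => ?_
    have c1 := A.continuousOn_d g u u i
    have c2 := hcc i
    have c12 : ContinuousOn (fun y => (1 / 2) * tensorInner (A.gram g i y) (A.extDeriv u i y)
        (A.extDeriv u i y) + 2 * (A.codiff g u i y * A.codiff g u i y)) (A.target i) := c1.add c2
    have c3 := continuousOn_nullForm g u i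
    have c4 : ContinuousOn (fun y => C₂ i * (√(A.sq u i y) * √(A.jet u i y))) (A.target i) :=
      continuousOn_const.mul (continuousOn_sqrt_mul_sqrt u i)
    refine (setIntegral_weight_mul_le g (A.continuousOn_grad g u u i) ((c12.add c3).add c4)
      fun y hy => h₂ i u y hy).trans ?_
    have hsum : ∫ y in A.target i, A.weight g i y * ((1 / 2) * tensorInner (A.gram g i y)
        (A.extDeriv u i y) (A.extDeriv u i y) + 2 * (A.codiff g u i y * A.codiff g u i y) +
        nullForm (A.gram g i y)⁻¹ (A.partials u i y) + C₂ i * (√(A.sq u i y) * √(A.jet u i y))) =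
        (∫ y in A.target i, A.weight g i y * ((1 / 2) * tensorInner (A.gram g i y)
        (A.extDeriv u i y) (A.extDeriv u i y) + 2 * (A.codiff g u i y * A.codiff g u i y))) +
        (∫ y in A.target i, A.weight g i y * nullForm (A.gram g i y)⁻¹ (A.partials u i y)) +
        ∫ y in A.target i, A.weight g i y * (C₂ i * (√(A.sq u i y) * √(A.jet u i y))) := by
      rw [← setIntegral_weight_add g c12 c3]
      exact setIntegral_weight_add g (c12.add c3) c4
    refine hsum.le.trans ?_
    rw [add_assoc]
    refine add_le_add le_rfl ?_
    have b1 := h₁ i u hu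
    have b2 := h₃ i _ c4 fun y => mul_nonneg (hC₂ i) (by positivity)
    rw [MeasureTheory.integral_const_mul (C₂ i)] at b2
    have b3 := mul_le_mul_of_nonneg_left (hX i) (add_nonneg (hC₁ i) (mul_nonneg (hC₂ i) (hC₃ i)))
    refine (add_le_add b1 b2).trans (le_trans (le_of_eq ?_) (b3.trans (le_of_eq ?_))) <;> ring
  have h6 : C * (ε * (A.l2Form g u u + A.gradForm g u u) + A.l2Form g u u / ε) =
      (C * ε) * (A.l2Form g u u + A.gradForm g u u) + (C / ε) * A.l2Form g u u := by
    field_simp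
  have h7 := mul_le_mul_of_nonneg_right hεC (add_nonneg hl hgr)
  have h8 : 0 ≤ C / ε := by positivity
  nlinarith [mul_nonneg h8 hd, mul_nonneg h8 hcod, mul_nonneg h8 hl]

/-- For a fixed smooth form `ψ`, `⟨dφ, dψ⟩` is controlled by the `L²` norm of the test form `φ`. -/
theorem exists_abs_dForm_le [CompactSpace M] (g : Metric n M) (ψ : OneForm n M) :
    ∃ C, 0 ≤ C ∧ ∀ φ : OneForm n M, IsTestForm φ → ∀ δ > 0,
      |A.dForm g φ ψ| ≤ C * (δ + A.l2Form g φ φ / δ) := by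
  choose C₄ hC₄ h₄ using exists_setIntegral_sq_jet_le (A := A) g
  have key : ∀ i, ∃ C, 0 ≤ C ∧ ∀ φ : OneForm n M, IsTestForm φ → ∀ δ > 0,
      |∫ y in A.target i, A.weight g i y * ((1 / 2) * tensorInner (A.gram g i y)
        (A.extDeriv φ i y) (A.extDeriv ψ i y))| ≤ C * (δ + A.l2Form g φ φ / δ) := by
    intro i
    set R : EuclideanSpace ℝ (Fin n) → Matrix (Fin n) (Fin n) ℝ := fun y =>
      (A.gram g i y)⁻¹ * (A.extDeriv ψ i y)ᵀ * (A.gram g i y)⁻¹ with hR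
    have hRc : ∀ a b, ContDiffOn ℝ ∞ (fun y => R y a b) (A.target i) := fun a b => by
      simp only [hR, Matrix.mul_apply, Matrix.transpose_apply]
      exact ContDiffOn.sum fun c _ => (ContDiffOn.sum fun d _ => (A.contDiffOn_gramInv g i _ _).mul
        (A.contDiffOn_extDeriv ψ i _ _)).mul (A.contDiffOn_gramInv g i _ _)
    set k : Fin n → Fin n → EuclideanSpace ℝ (Fin n) → ℝ := fun a b y =>
      A.weight g i y * ((1 / 2) * (R y b a - R y a b)) with hkdef
    have hk : ∀ a b, ContDiffOn ℝ ∞ (k a b) (A.target i) := fun a b =>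
      (contDiffOn_weight g i).mul (contDiffOn_const.mul ((hRc b a).sub (hRc a b)))
    have hk0 : ∀ a b y, A.inv i y ∉ tsupport (A.ρ i) → k a b y = 0 := fun a b y hy => by
      simp only [hkdef, weight_eq_zero g hy, zero_mul]
    obtain ⟨B, hB0, hB⟩ := exists_abs_le_piece (A := A) (i := i) (ι := Fin n × Fin n)
      (f := fun l => A.pd i l.1 (k l.1 l.2))
      fun l => (A.contDiffOn_pd i _ (hk _ _)).continuousOn
    refine ⟨n * (n * B) * (volume.real (A.piece i) + C₄ i), by have := hC₄ i; positivity,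
      fun φ hφ δ hδ => ?_⟩
    have hl := A.l2Form_nonneg g φ
    have hc := A.contDiffOn_comp φ i
    have e1 : ∀ y ∈ A.target i, A.weight g i y * ((1 / 2) * tensorInner (A.gram g i y)
        (A.extDeriv φ i y) (A.extDeriv ψ i y)) =
        ∑ a, ∑ b, k a b y * A.pd i a (fun z => A.comp φ i z b) y := by
      intro y hy
      have h1 : tensorInner (A.gram g i y) (A.extDeriv φ i y) (A.extDeriv ψ i y) =
          ∑ a, ∑ b, A.extDeriv φ i y a b * R y b a := by
        rw [tensorInner, Matrix.mul_assoc, Matrix.mul_assoc, Matrix.trace_mul_comm,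
          Matrix.mul_assoc, Matrix.mul_assoc]
        simp only [Matrix.trace, Matrix.diag, Matrix.mul_apply (M := A.extDeriv φ i y), hR]
        simp only [Matrix.mul_assoc]
      have h2 : ∑ a, ∑ b, A.extDeriv φ i y a b * R y b a =
          ∑ a, ∑ b, A.pd i a (fun z => A.comp φ i z b) y * (R y b a - R y a b) := by
        simp only [extDeriv, Matrix.of_apply, sub_mul, mul_sub, Finset.sum_sub_distrib]
        congr 1
        exact Finset.sum_comm
      rw [h1, h2]
      simp only [Finset.mul_sum]
      refine Finset.sum_congr rfl fun a _ => Finset.sum_congr rfl fun b _ => ?_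
      simp only [hkdef]
      ring
    have hnot := fun y (hy : y ∈ A.target i) h => notMem_tsupport_of_notMem_piece (A := A) hy h
    have iF : ∀ a b, IntegrableOn (fun y => k a b y * A.pd i a (fun z => A.comp φ i z b) y)
        (A.target i) := fun a b => integrableOn_of_eq_zero_piece
      ((hk a b).mul (A.contDiffOn_pd i a (hc b))).continuousOn
      fun z hz h => by rw [hk0 a b z (hnot z hz h), zero_mul]
    have hz : ∀ a b, ∀ y ∈ A.target i, y ∉ A.piece i → A.pd i a (k a b) y * A.comp φ i y b = 0 :=
      fun a b y hy h => by
        rw [pd_eq_zero_of_inv (isClosed_tsupport (A.ρ i)) (fun z _ hz => hk0 a b z hz) hy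
          (hnot y hy h), zero_mul]
    rw [setIntegral_congr_fun (A.measurableSet_target i) e1,
      integral_finsetSum _ fun a _ => integrable_finsetSum _ fun b _ => iF a b,
      Finset.sum_congr rfl fun a _ => integral_finsetSum _ fun b _ => iF a b]
    rw [mul_assoc, mul_assoc]
    refine abs_sum_le_mul fun a => ?_
    rw [mul_assoc]
    refine abs_sum_le_mul fun b => ?_
    rw [setIntegral_mul_pd (isClosed_tsupport (A.ρ i)) isClosed_closure (A.subordinate i) hφ
      (hk a b) (hc b) (fun z _ hz => hk0 a b z hz) (fun z _ hz => by rw [comp_eq_zero hz]; rfl) a,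
      abs_neg]
    have hc5 : ContinuousOn (fun y => B * (δ + A.sq φ i y / δ)) (A.target i) :=
      continuousOn_const.mul (continuousOn_const.add ((continuousOn_sq φ i).div_const δ))
    refine (abs_setIntegral_le hc5 (fun y hy => ?_) (hz a b)).trans ?_
    · rw [abs_mul]
      refine mul_le_mul (hB (a, b) y hy) ((abs_comp_le φ b).trans ?_) (abs_nonneg _) hB0
      have e1 := Real.sq_sqrt (sq_nonneg (A := A) (i := i) (y := y) φ)
      set s := √(A.sq φ i y)
      rw [← e1, ← sub_nonneg]
      have : δ + s ^ 2 / δ - s = (3 / 4) * δ + (s - δ / 2) ^ 2 / δ := by field_simp; ring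
      rw [this]
      positivity
    · rw [MeasureTheory.integral_const_mul]
      refine mul_le_mul_of_nonneg_left ?_ hB0
      have hfin : IntegrableOn (fun _ : EuclideanSpace ℝ (Fin n) => δ) (A.piece i) :=
        integrableOn_piece continuousOn_const
      rw [MeasureTheory.integral_add hfin ((integrableOn_piece (continuousOn_sq φ i)).div_const δ),
        MeasureTheory.integral_div, setIntegral_const, smul_eq_mul]
      have h5 := (h₄ i φ hφ).1
      have h6 : (∫ y in A.piece i, A.sq φ i y) / δ ≤ C₄ i * (A.l2Form g φ φ / δ) := by
        rw [← mul_div_assoc]; gcongr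
      have h7 : 0 ≤ C₄ i * δ := mul_nonneg (hC₄ i) hδ.le
      have h8 : 0 ≤ volume.real (A.piece i) * (A.l2Form g φ φ / δ) := by positivity
      nlinarith
  choose C hC h using key
  refine ⟨∑ i, C i, Finset.sum_nonneg fun i _ => hC i, fun φ hφ δ hδ => ?_⟩
  rw [dForm, integral, Finset.sum_mul]
  exact (Finset.abs_sum_le_sum_abs _ _).trans (Finset.sum_le_sum fun i _ => h i φ hφ δ hδ)

end FiniteAtlas
end HypStokes

/-! ### The codifferential as a function on the manifold -/

namespace HypStokes
namespace FiniteAtlas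
variable {n : ℕ} [NeZero n] {M : Type*} [TopologicalSpace M]
  [ChartedSpace (EuclideanHalfSpace n) M] [IsManifold (𝓡∂ n) ∞ M] {A : FiniteAtlas n M}
  {i j : Fin A.N} {a : Fin n} {x : M} {y : EuclideanSpace ℝ (Fin n)}
  {K : Set (EuclideanSpace ℝ (Fin n))} {h k : EuclideanSpace ℝ (Fin n) → ℝ}

/-- Integration by parts against a function with compact support in the interior of a chart. -/
theorem setIntegral_mul_pd_of_isCompact (hK : IsCompact K) (hKc : K ⊆ A.core i)
    (hk : ContDiffOn ℝ ∞ k (A.target i)) (hh : ContDiffOn ℝ ∞ h (A.target i))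
    (hh0 : ∀ z ∈ A.target i, z ∉ K → h z = 0) (a : Fin n) :
    ∫ z in A.target i, k z * A.pd i a h z = -∫ z in A.target i, A.pd i a k z * h z := by
  have hKt := hKc.trans core_subset_target
  have i1 : IntegrableOn (fun z => k z * A.pd i a h z) (A.target i) :=
    integrableOn_of_eq_zero hK hKt (hk.mul (A.contDiffOn_pd i a hh)).continuousOn
      fun z hz hzK => by rw [pd_eq_zero hK.isClosed hh0 hz hzK, mul_zero]
  have i2 : IntegrableOn (fun z => A.pd i a k z * h z) (A.target i) :=
    integrableOn_of_eq_zero hK hKt ((A.contDiffOn_pd i a hk).mul hh).continuousOn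
      fun z hz hzK => by rw [hh0 z hz hzK, mul_zero]
  have h0 := setIntegral_pd_eq_zero (a := a) hK hKc (hk.mul hh) fun z hz hzK => by
    rw [hh0 z hz hzK, mul_zero]
  rw [eq_neg_iff_add_eq_zero, ← MeasureTheory.integral_add i1 i2, ← h0]
  exact setIntegral_congr_fun (A.measurableSet_target i) fun z hz => (A.pd_mul i a hk hh hz).symm

variable (A) in
/-- The component `X^a = g^{ab} u_b` of the vector field dual to a 1-form. -/
noncomputable def raised (g : Metric n M) (u : OneForm n M) (i : Fin A.N) (a : Fin n)
    (y : EuclideanSpace ℝ (Fin n)) : ℝ := ∑ b, (A.gram g i y)⁻¹ a b * A.comp u i y b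

theorem contDiffOn_raised (g : Metric n M) (u : OneForm n M) (i : Fin A.N) (a : Fin n) :
    ContDiffOn ℝ ∞ (A.raised g u i a) (A.target i) :=
  ContDiffOn.sum fun b _ => (A.contDiffOn_gramInv g i a b).mul (A.contDiffOn_comp u i b)

theorem density_mul_codiff (g : Metric n M) (u : OneForm n M) (hy : y ∈ A.target i) :
    A.density g i y * A.codiff g u i y =
      -∑ a, A.pd i a (fun z => A.density g i z * A.raised g u i a z) y := by
  have := (A.density_pos g i hy).ne'
  rw [codiff, mul_neg, ← mul_assoc, mul_inv_cancel₀ this, one_mul]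
  rfl

theorem sum_mul_raised (g : Metric n M) (u : OneForm n M) (p : Fin n → ℝ) :
    ∑ a, p a * A.raised g u i a y = formInner (A.gram g i y) p (A.comp u i y) := rfl

/-- The weak formula `∫ (d^*u) h dV = ∫ (u, dh) dV` in one chart. -/
theorem setIntegral_codiff_mul (g : Metric n M) (u : OneForm n M) (hK : IsCompact K)
    (hKc : K ⊆ A.core i) (hh : ContDiffOn ℝ ∞ h (A.target i))
    (hh0 : ∀ z ∈ A.target i, z ∉ K → h z = 0) :
    ∫ y in A.target i, A.density g i y * A.codiff g u i y * h y =
      ∫ y in A.target i, A.density g i y *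
        formInner (A.gram g i y) (fun a => A.pd i a h y) (A.comp u i y) := by
  have hKt := hKc.trans core_subset_target
  have hX : ∀ a, ContDiffOn ℝ ∞ (fun z => A.density g i z * A.raised g u i a z) (A.target i) :=
    fun a => (A.contDiffOn_density g i).mul (contDiffOn_raised g u i a)
  have i1 : ∀ a, IntegrableOn (fun y => A.pd i a (fun z => A.density g i z * A.raised g u i a z) y *
      h y) (A.target i) := fun a => integrableOn_of_eq_zero hK hKt
    ((A.contDiffOn_pd i a (hX a)).mul hh).continuousOn fun z hz hzK => by rw [hh0 z hz hzK, mul_zero]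
  have i2 : ∀ a, IntegrableOn (fun y => A.density g i y * A.raised g u i a y * A.pd i a h y)
      (A.target i) := fun a => integrableOn_of_eq_zero hK hKt
    ((hX a).mul (A.contDiffOn_pd i a hh)).continuousOn fun z hz hzK => by
      rw [pd_eq_zero hK.isClosed hh0 hz hzK, mul_zero]
  calc _ = ∫ y in A.target i, -∑ a, A.pd i a (fun z => A.density g i z * A.raised g u i a z) y *
        h y := setIntegral_congr_fun (A.measurableSet_target i) fun y hy => by
          simp only [density_mul_codiff g u hy, neg_mul, Finset.sum_mul]
    _ = ∑ a, -∫ y in A.target i, A.pd i a (fun z => A.density g i z * A.raised g u i a z) y *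
        h y := by
      rw [MeasureTheory.integral_neg, integral_finsetSum _ fun a _ => i1 a, Finset.sum_neg_distrib]
    _ = ∑ a, ∫ y in A.target i, A.density g i y * A.raised g u i a y * A.pd i a h y :=
      Finset.sum_congr rfl fun a _ =>
        (setIntegral_mul_pd_of_isCompact hK hKc (hX a) hh hh0 a).symm
    _ = ∫ y in A.target i, ∑ a, A.density g i y * A.raised g u i a y * A.pd i a h y := by
      rw [integral_finsetSum _ fun a _ => i2 a]
    _ = _ := setIntegral_congr_fun (A.measurableSet_target i) fun y hy => by
      simp only [← sum_mul_raised g u, Finset.mul_sum]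
      exact Finset.sum_congr rfl fun a _ => by ring

/-- The chain rule for a coordinate change. -/
theorem pd_comp_trans (hk : ContDiffOn ℝ ∞ k (A.core j)) (hhk : ∀ z ∈ A.coreOverlap i j,
    h z = k (A.trans i j z)) (hy : y ∈ A.coreOverlap i j) :
    (fun a => A.pd i a h y) = (A.jac i j y)ᵀ *ᵥ fun e => A.pd j e k (A.trans i j y) := by
  have hz := trans_mem_coreOverlap hy
  ext a
  have e1 : h =ᶠ[nhds y] k ∘ A.trans i j := by
    filter_upwards [isOpen_coreOverlap.mem_nhds hy] with z hz using hhk z hz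
  have hd : HasFDerivAt (k ∘ A.trans i j) ((fderiv ℝ k (A.trans i j y)).comp
      (fderiv ℝ (A.trans i j) y)) y := HasFDerivAt.comp y (((hk.contDiffAt
    (core_mem_nhds hz.1)).differentiableAt (by simp)).hasFDerivAt) (hasFDerivAt_trans hy)
  rw [pd_eq_fderiv hy.1, e1.fderiv_eq, hd.fderiv, ContinuousLinearMap.comp_apply,
    fderiv_trans_single hy, map_sum]
  simp only [map_smul, smul_eq_mul, Matrix.mulVec, dotProduct, Matrix.transpose_apply]
  exact Finset.sum_congr rfl fun e _ => by rw [pd_eq_fderiv hz.1]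

theorem formInner_pd_eq (g : Metric n M) (u : OneForm n M) (hk : ContDiffOn ℝ ∞ k (A.core j))
    (hhk : ∀ z ∈ A.coreOverlap i j, h z = k (A.trans i j z)) (hy : y ∈ A.coreOverlap i j) :
    formInner (A.gram g i y) (fun a => A.pd i a h y) (A.comp u i y) =
      formInner (A.gram g j (A.trans i j y)) (fun a => A.pd j a k (A.trans i j y))
        (A.comp u j (A.trans i j y)) := by
  rw [comp_eq u hy, pd_comp_trans hk hhk hy, gram_eq g hy,
    formInner_transpose_mulVec (isUnit_det_jac hy)]

/-- The codifferential does not depend on the chart: the weak formula characterizes it. -/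
theorem codiff_trans (g : Metric n M) (u : OneForm n M) (hy : y ∈ A.coreOverlap i j) :
    A.codiff g u i y = A.codiff g u j (A.trans i j y) := by
  set Ω := A.coreOverlap i j with hΩ
  have hΩo : IsOpen Ω := isOpen_coreOverlap
  set D : EuclideanSpace ℝ (Fin n) → ℝ := fun y => A.density g i y *
    (A.codiff g u i y - A.codiff g u j (A.trans i j y)) with hD
  have hΩt : Ω ⊆ A.target i := coreOverlap_subset_core.trans core_subset_target
  have hmaps : MapsTo (A.trans i j) Ω (A.target j) := fun z hz =>
    core_subset_target (trans_mem_coreOverlap hz).1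
  have hcj : ContinuousOn (fun y => A.codiff g u j (A.trans i j y)) Ω :=
    (A.contDiffOn_codiff g u j).continuousOn.comp
      (contDiffOn_trans.continuousOn.mono coreOverlap_subset_overlap) hmaps
  have hDc : ContinuousOn D Ω := ((A.contDiffOn_density g i).continuousOn.mono hΩt).mul
    (((A.contDiffOn_codiff g u i).continuousOn.mono hΩt).sub hcj)
  have h1 : ∀ᵐ y, y ∈ Ω → D y = 0 := by
    refine hΩo.ae_eq_zero_of_integral_contDiff_smul_eq_zero
      (hDc.locallyIntegrableOn hΩo.measurableSet) fun ψ hψ hψc hψs => ?_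
    have hψs' : ∀ z, z ∉ Ω → ψ z = 0 := fun z hz => image_eq_zero_of_notMem_tsupport
      fun h => hz (hψs h)
    -- the same function in the other chart
    set ψ' : EuclideanSpace ℝ (Fin n) → ℝ := (A.coreOverlap j i).indicator
      fun z => ψ (A.trans j i z) with hψ'
    have hK' : IsCompact (A.trans i j '' tsupport ψ) := hψc.isCompact.image_of_continuousOn
      (contDiffOn_trans.continuousOn.mono (hψs.trans coreOverlap_subset_overlap))
    have hK'o : A.trans i j '' tsupport ψ ⊆ A.coreOverlap j i :=
      image_subset_iff.2 fun z hz => trans_mem_coreOverlap (hψs hz)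
    have hψ'0 : ∀ z ∈ A.coreOverlap j i, z ∉ A.trans i j '' tsupport ψ →
        ψ (A.trans j i z) = 0 := fun z hz hzK => image_eq_zero_of_notMem_tsupport
      fun h => hzK ⟨_, h, trans_trans (coreOverlap_subset_overlap hz)⟩
    have hψ's : ContDiff ℝ ∞ ψ' := contDiff_indicator isOpen_coreOverlap hK'.isClosed hK'o
      (hψ.comp_contDiffOn (contDiffOn_trans.mono coreOverlap_subset_overlap)) hψ'0
    have hψ'K : ∀ z, z ∉ A.trans i j '' tsupport ψ → ψ' z = 0 := fun z hzK => by
      by_cases hz : z ∈ A.coreOverlap j i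
      · rw [hψ', indicator_of_mem hz, hψ'0 z hz hzK]
      · rw [hψ', indicator_of_notMem hz]
    have hψψ' : ∀ z ∈ Ω, ψ z = ψ' (A.trans i j z) := fun z hz => by
      rw [hψ', indicator_of_mem (trans_mem_coreOverlap hz),
        trans_trans (coreOverlap_subset_overlap hz)]
    have w1 := setIntegral_codiff_mul (A := A) (i := i) g u hψc.isCompact
      (hψs.trans coreOverlap_subset_core) hψ.contDiffOn
      fun z _ hz => image_eq_zero_of_notMem_tsupport hz
    have w2 := setIntegral_codiff_mul (A := A) (i := j) g u hK'
      (hK'o.trans coreOverlap_subset_core) hψ's.contDiffOn fun z _ hz => hψ'K z hz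
    -- all four integrals live on the overlap
    have r1 : ∫ y in A.target i, A.density g i y * A.codiff g u i y * ψ y =
        ∫ y in Ω, A.density g i y * A.codiff g u i y * ψ y :=
      setIntegral_eq_of_subset_of_forall_sdiff_eq_zero (A.measurableSet_target i) hΩt
        fun z hz => by rw [hψs' z hz.2, mul_zero]
    have r2 : ∫ y in A.target i, A.density g i y * formInner (A.gram g i y)
        (fun a => A.pd i a ψ y) (A.comp u i y) = ∫ y in Ω, A.density g i y *
        formInner (A.gram g i y) (fun a => A.pd i a ψ y) (A.comp u i y) :=
      setIntegral_eq_of_subset_of_forall_sdiff_eq_zero (A.measurableSet_target i) hΩt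
        fun z hz => by
          have : (fun a => A.pd i a ψ z) = 0 := funext fun a => pd_eq_zero (isClosed_tsupport ψ)
            (fun w _ hw => image_eq_zero_of_notMem_tsupport hw) hz.1 fun h => hz.2 (hψs h)
          rw [this]
          simp [formInner]
    have hjt : A.coreOverlap j i ⊆ A.target j := coreOverlap_subset_core.trans core_subset_target
    have r3 : ∫ y in A.target j, A.density g j y * A.codiff g u j y * ψ' y =
        ∫ y in A.coreOverlap j i, A.density g j y * A.codiff g u j y * ψ' y :=
      setIntegral_eq_of_subset_of_forall_sdiff_eq_zero (A.measurableSet_target j) hjt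
        fun z hz => by rw [hψ'K z fun h => hz.2 (hK'o h), mul_zero]
    have r4 : ∫ y in A.target j, A.density g j y * formInner (A.gram g j y)
        (fun a => A.pd j a ψ' y) (A.comp u j y) = ∫ y in A.coreOverlap j i, A.density g j y *
        formInner (A.gram g j y) (fun a => A.pd j a ψ' y) (A.comp u j y) :=
      setIntegral_eq_of_subset_of_forall_sdiff_eq_zero (A.measurableSet_target j) hjt
        fun z hz => by
          have : (fun a => A.pd j a ψ' z) = 0 := funext fun a => pd_eq_zero hK'.isClosed
            (fun w _ hw => hψ'K w hw) hz.1 fun h => hz.2 (hK'o h)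
          rw [this]
          simp [formInner]
    rw [r1, r2] at w1
    rw [r3, r4, setIntegral_trans (i := i) (j := j), setIntegral_trans (i := i) (j := j)] at w2
    have w3 : ∫ y in Ω, A.density g i y * A.codiff g u j (A.trans i j y) * ψ y =
        ∫ y in Ω, A.density g i y * A.codiff g u i y * ψ y := by
      rw [w1]
      refine (setIntegral_congr_fun hΩo.measurableSet fun y hy => ?_).trans (w2.trans
        (setIntegral_congr_fun hΩo.measurableSet fun y hy => ?_))
      · simp only [density_eq g hy, hψψ' y hy]
        ring
      · simp only [density_eq g hy, formInner_pd_eq g u hψ's.contDiffOn hψψ' hy]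
        ring
    have int1 : IntegrableOn (fun y => A.density g i y * A.codiff g u i y * ψ y) Ω :=
      (integrableOn_of_eq_zero hψc.isCompact (hψs.trans hΩt)
        (((A.contDiffOn_density g i).mul (A.contDiffOn_codiff g u i)).continuousOn.mul
          hψ.continuous.continuousOn) fun z _ hz => by
          change _ * ψ z = 0
          rw [image_eq_zero_of_notMem_tsupport hz, mul_zero]).mono_set hΩt
    have int2 : IntegrableOn (fun y => A.density g i y * A.codiff g u j (A.trans i j y) * ψ y) Ω :=
      ((((((A.contDiffOn_density g i).continuousOn.mono hΩt).mul hcj).mul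
        hψ.continuous.continuousOn).mono hψs).integrableOn_compact
          hψc.isCompact).of_forall_sdiff_eq_zero hΩo.measurableSet fun z hz => by
          change _ * ψ z = 0
          rw [image_eq_zero_of_notMem_tsupport hz.2, mul_zero]
    have w4 : ∫ y, ψ y • D y = ∫ y in Ω, ψ y • D y :=
      (setIntegral_eq_integral_of_forall_compl_eq_zero fun z hz => by
        rw [hψs' z hz, zero_smul]).symm
    rw [w4, ← sub_eq_zero.2 w3.symm, ← MeasureTheory.integral_sub int1 int2]
    exact setIntegral_congr_fun hΩo.measurableSet fun y _ => by
      simp only [hD, smul_eq_mul]; ring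
  have h2 : EqOn D (fun _ => 0) Ω :=
    Measure.eqOn_open_of_ae_eq ((ae_restrict_iff' hΩo.measurableSet).2 h1) hΩo hDc
      continuousOn_const
  have h3 := h2 hy
  exact sub_eq_zero.1 ((mul_eq_zero.1 h3).resolve_left (A.density_pos g i (hΩt hy)).ne')

theorem codiff_eq_zero (g : Metric n M) {u : OneForm n M} (hy : y ∈ A.target i)
    (h : A.inv i y ∉ formSupport u) : A.codiff g u i y = 0 := by
  have h1 : A.covDeriv g u i y = 0 := by
    ext a b
    simp [covDeriv, pd_comp_eq_zero hy h, comp_eq_zero h]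
  rw [A.codiff_eq g u i hy, h1, comp_eq_zero h]
  simp

variable (A) in
/-- The codifferential of a 1-form as a function on `M`. -/
noncomputable def delta (g : Metric n M) (u : OneForm n M) (x : M) : ℝ :=
  ∑ j, A.ρ j x * A.codiff g u j (A.coord j x)

theorem delta_inv (g : Metric n M) {u : OneForm n M} (hu : IsTestForm u) (hy : y ∈ A.target i) :
    A.delta g u (A.inv i y) = A.codiff g u i y := by
  have h1 : ∀ j, A.ρ j (A.inv i y) * A.codiff g u j (A.coord j (A.inv i y)) =
      A.ρ j (A.inv i y) * A.codiff g u i y := by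
    intro j
    by_cases hne : A.ρ j (A.inv i y) = 0
    · rw [hne, zero_mul, zero_mul]
    have hj : A.inv i y ∈ (A.chart j).source := A.subordinate j (subset_tsupport _ hne)
    congr 1
    by_cases hS : A.inv i y ∈ formSupport u
    · exact (codiff_trans g u ⟨(inv_mem_interior_iff hy).1 (hu hS), hj⟩).symm
    · rw [codiff_eq_zero g hy hS, codiff_eq_zero g (coord_mem_target hj)
        (by rwa [inv_coord hj])]
  rw [delta, Finset.sum_congr rfl fun j _ => h1 j, ← Finset.sum_mul, sum_ρ, one_mul]

theorem exists_mem_source (A : FiniteAtlas n M) (x : M) : ∃ i, x ∈ (A.chart i).source := by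
  by_contra! hcon
  have h0 : ∀ i, A.ρ i x = 0 := fun i => by
    by_contra hne
    exact hcon i (A.subordinate i (subset_tsupport _ hne))
  have := sum_ρ (A := A) x
  simp [h0] at this

theorem contMDiff_delta (g : Metric n M) {u : OneForm n M} (hu : IsTestForm u) :
    ContMDiff (𝓡∂ n) 𝓘(ℝ, ℝ) ∞ (A.delta g u) := by
  intro x
  obtain ⟨i, hi⟩ := exists_mem_source A x
  have h1 : ContMDiffOn (𝓡∂ n) 𝓘(ℝ, ℝ) ∞ (fun x => A.codiff g u i (A.coord i x))
      (A.chart i).source :=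
    (contMDiffOn_iff_contDiffOn.2 (A.contDiffOn_codiff g u i)).comp contMDiffOn_coord
      fun x hx => coord_mem_target hx
  refine (h1.contMDiffAt ((A.chart i).open_source.mem_nhds hi)).congr_of_eventuallyEq ?_
  filter_upwards [(A.chart i).open_source.mem_nhds hi] with z hz
  rw [← delta_inv g hu (coord_mem_target hz), inv_coord hz]

theorem delta_eq_zero (g : Metric n M) {u : OneForm n M} (hu : IsTestForm u)
    (hx : x ∉ formSupport u) : A.delta g u x = 0 := by
  obtain ⟨i, hi⟩ := exists_mem_source A x
  rw [← inv_coord hi, delta_inv g hu (coord_mem_target hi),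
    codiff_eq_zero g (coord_mem_target hi) (by rwa [inv_coord hi])]

variable (A) in
/-- The integral over `M` of a function on `M`. -/
noncomputable def mean (g : Metric n M) (q : M → ℝ) : ℝ := A.integral g fun i y => q (A.inv i y)

theorem continuousOn_comp_inv {q : M → ℝ} (hq : Continuous q) :
    ContinuousOn (fun y => q (A.inv i y)) (A.target i) := hq.comp_continuousOn continuousOn_inv

theorem contDiffOn_comp_inv {q : M → ℝ} (hq : ContMDiff (𝓡∂ n) 𝓘(ℝ, ℝ) ∞ q) :
    ContDiffOn ℝ ∞ (fun y => q (A.inv i y)) (A.target i) :=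
  contMDiffOn_iff_contDiffOn.1 (hq.comp_contMDiffOn (A.contMDiffOn_inv i))

theorem integral_finsetSum [CompactSpace M] (g : Metric n M) {ι : Type*} (s : Finset ι)
    {F : ι → Fin A.N → EuclideanSpace ℝ (Fin n) → ℝ}
    (hF : ∀ l i, ContinuousOn (F l i) (A.target i)) :
    A.integral g (fun i y => ∑ l ∈ s, F l i y) = ∑ l ∈ s, A.integral g (F l) := by
  simp only [integral]
  rw [Finset.sum_comm]
  refine Finset.sum_congr rfl fun i _ => ?_
  rw [← MeasureTheory.integral_finsetSum _ fun l _ => A.integrableOn g i (hF l i)]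
  simp only [Finset.mul_sum]

/-- The divergence theorem for test forms. -/
theorem integral_codiff_eq_zero [CompactSpace M] (g : Metric n M) {u : OneForm n M}
    (hu : IsTestForm u) : A.integral g (A.codiff g u) = 0 := by
  set F : Fin A.N → Fin A.N → EuclideanSpace ℝ (Fin n) → ℝ := fun l j y =>
    formInner (A.gram g j y) (fun a => A.pd j a (fun z => A.ρ l (A.inv j z)) y) (A.comp u j y)
    with hF
  have hFc : ∀ l j, ContinuousOn (F l j) (A.target j) := fun l j =>
    A.continuousOn_formInner g j (fun a => (A.contDiffOn_pd j a (contDiffOn_ρ j l)).continuousOn)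
      fun a => (A.contDiffOn_comp u j a).continuousOn
  have h1 : ∀ l, ∫ y in A.target l, A.ρ l (A.inv l y) * A.density g l y * A.codiff g u l y =
      A.integral g (F l) := by
    intro l
    have hS : IsClosed (tsupport (A.ρ l) ∩ formSupport u) :=
      (isClosed_tsupport _).inter isClosed_closure
    have hSs : tsupport (A.ρ l) ∩ formSupport u ⊆ (A.chart l).source :=
      inter_subset_left.trans (A.subordinate l)
    have hSi : tsupport (A.ρ l) ∩ formSupport u ⊆ (𝓡∂ n).interior M := inter_subset_right.trans hu
    have hF0 : ∀ j, ∀ y ∈ A.target j, A.inv j y ∉ tsupport (A.ρ l) ∩ formSupport u →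
        F l j y = 0 := by
      intro j y hy hyS
      by_cases h1 : A.inv j y ∈ tsupport (A.ρ l)
      · have h2 : A.comp u j y = 0 := comp_eq_zero fun h => hyS ⟨h1, h⟩
        simp only [hF, h2, formInner, Matrix.mulVec_zero, dotProduct_zero]
      · have h2 : (fun a => A.pd j a (fun z => A.ρ l (A.inv j z)) y) = 0 := funext fun a =>
          pd_eq_zero_of_inv (isClosed_tsupport _)
            (fun z _ hz => image_eq_zero_of_notMem_tsupport hz) hy h1
        simp only [hF, h2, formInner, zero_dotProduct]
    rw [integral_eq_setIntegral g hS hSs hSi (fun j y hy => formInner_pd_eq g u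
      ((contDiffOn_ρ j l).mono core_subset_target) (fun z hz => by
        rw [inv_trans (coreOverlap_subset_overlap hz)]) hy) (hFc l l) hF0]
    have hX : ∀ a, ContDiffOn ℝ ∞ (fun z => A.density g l z * A.raised g u l a z) (A.target l) :=
      fun a => (A.contDiffOn_density g l).mul (contDiffOn_raised g u l a)
    have hX0 : ∀ a, ∀ z ∈ A.target l, A.inv l z ∉ formSupport u →
        A.density g l z * A.raised g u l a z = 0 := fun a z _ hz => by
      simp [raised, comp_eq_zero hz]
    have hρ0 : ∀ z ∈ A.target l, A.inv l z ∉ tsupport (A.ρ l) → A.ρ l (A.inv l z) = 0 :=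
      fun z _ hz => image_eq_zero_of_notMem_tsupport hz
    have i1 : ∀ a, IntegrableOn (fun y => A.ρ l (A.inv l y) *
        A.pd l a (fun z => A.density g l z * A.raised g u l a z) y) (A.target l) := fun a =>
      integrableOn_of_eq_zero_piece
        ((contDiffOn_ρ l l).mul (A.contDiffOn_pd l a (hX a))).continuousOn fun z hz hP => by
          rw [hρ0 z hz (notMem_tsupport_of_notMem_piece hz hP), zero_mul]
    have i2 : ∀ a, IntegrableOn (fun y => A.pd l a (fun z => A.ρ l (A.inv l z)) y *
        (A.density g l y * A.raised g u l a y)) (A.target l) := fun a =>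
      integrableOn_of_eq_zero_piece
        ((A.contDiffOn_pd l a (contDiffOn_ρ l l)).mul (hX a)).continuousOn fun z hz hP => by
          rw [pd_eq_zero_of_inv (isClosed_tsupport _) hρ0 hz
            (notMem_tsupport_of_notMem_piece hz hP), zero_mul]
    calc _ = ∫ y in A.target l, -∑ a, A.ρ l (A.inv l y) *
          A.pd l a (fun z => A.density g l z * A.raised g u l a z) y :=
          setIntegral_congr_fun (A.measurableSet_target l) fun y hy => by
            simp only [mul_assoc, density_mul_codiff g u hy, mul_neg, Finset.mul_sum]
      _ = ∑ a, -∫ y in A.target l, A.ρ l (A.inv l y) *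
          A.pd l a (fun z => A.density g l z * A.raised g u l a z) y := by
          rw [MeasureTheory.integral_neg, MeasureTheory.integral_finsetSum _ fun a _ => i1 a,
            Finset.sum_neg_distrib]
      _ = ∑ a, ∫ y in A.target l, A.pd l a (fun z => A.ρ l (A.inv l z)) y *
          (A.density g l y * A.raised g u l a y) := Finset.sum_congr rfl fun a _ => by
          rw [setIntegral_mul_pd (isClosed_tsupport (A.ρ l)) isClosed_closure (A.subordinate l) hu
            (contDiffOn_ρ l l) (hX a) hρ0 (hX0 a) a, neg_neg]
      _ = ∫ y in A.target l, ∑ a, A.pd l a (fun z => A.ρ l (A.inv l z)) y *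
          (A.density g l y * A.raised g u l a y) := by
          rw [MeasureTheory.integral_finsetSum _ fun a _ => i2 a]
      _ = _ := setIntegral_congr_fun (A.measurableSet_target l) fun y hy => by
          simp only [hF, ← sum_mul_raised g u, Finset.mul_sum]
          exact Finset.sum_congr rfl fun a _ => by ring
  rw [integral, Finset.sum_congr rfl fun l _ => h1 l, ← integral_finsetSum g _ hFc,
    ← mul_zero (0 : ℝ), zero_mul, ← zero_mul (A.integral g fun _ _ => 0), ← integral_smul]
  refine A.integral_congr g fun j y hy => ?_
  have h2 : ∑ l, (fun a => A.pd j a (fun z => A.ρ l (A.inv j z)) y) = 0 := by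
    ext a
    rw [Finset.sum_apply, Pi.zero_apply]
    have h3 : ∑ l, A.pd j a (fun z => A.ρ l (A.inv j z)) y =
        A.pd j a (fun z => ∑ l, A.ρ l (A.inv j z)) y := by
      rw [pd, fderivWithin_fun_sum (A.uniqueDiffOn_target j y hy)
        (fun b _ => ((contDiffOn_ρ j b).differentiableOn (by simp)) y hy)]
      simp [pd]
    rw [h3]
    simp only [sum_ρ]
    simp [pd]
  have h4 : ∑ l, F l j y = formInner (A.gram g j y)
      (∑ l, fun a => A.pd j a (fun z => A.ρ l (A.inv j z)) y) (A.comp u j y) := by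
    simp only [hF, formInner, sum_dotProduct]
  rw [h4, h2]
  simp [formInner]

theorem mean_delta [CompactSpace M] (g : Metric n M) {u : OneForm n M} (hu : IsTestForm u) :
    A.mean g (A.delta g u) = 0 := by
  rw [← integral_codiff_eq_zero g hu]
  exact A.integral_congr g fun i y hy => delta_inv g hu hy

theorem codForm_eq_mean (g : Metric n M) {u : OneForm n M} (hu : IsTestForm u) :
    A.codForm g u u = A.mean g fun x => A.delta g u x ^ 2 :=
  A.integral_congr g fun i y hy => by
    change _ = A.delta g u (A.inv i y) ^ 2
    rw [delta_inv g hu hy]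
    ring

end FiniteAtlas
end HypStokes

/-! ### Functions of mean zero in a box are divergences -/

namespace HypStokes

section line
variable {E : Type*} [NormedAddCommGroup E] [NormedSpace ℝ E]

/-- Weighted integrals along lines depend smoothly on the base point. -/
theorem contDiff_integral_line {f : ℝ → ℝ} (hf : LocallyIntegrable f) {h : E → ℝ}
    (hh : ContDiff ℝ ∞ h) (hc : HasCompactSupport h) {e : E} (he : e ≠ 0) :
    ContDiff ℝ ∞ fun x => ∫ s, f s * h (x + s • e) := by
  obtain ⟨R, hR⟩ := hc.isCompact.isBounded.subset_closedBall 0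
  refine contDiff_iff_contDiffAt.2 fun x => ?_
  set s : Set E := Metric.ball 0 (‖x‖ + 1)
  have hen : 0 < ‖e‖ := norm_pos_iff.2 he
  have key := contDiffOn_convolution_right_with_param (μ := (volume : Measure ℝ)) (n := ⊤)
    (ContinuousLinearMap.mul ℝ ℝ) (f := f) (g := fun (p : E) (t : ℝ) => h (p - t • e)) (s := s)
    (k := Icc (-((‖x‖ + 1 + R) / ‖e‖)) ((‖x‖ + 1 + R) / ‖e‖)) Metric.isOpen_ball isCompact_Icc
    (fun p t hp ht => by
      by_contra hne
      apply ht
      have h1 : ‖p - t • e‖ ≤ R := by simpa using hR (subset_tsupport _ hne)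
      have h2 : ‖p‖ < ‖x‖ + 1 := by simpa [s] using hp
      have h3 : ‖t • e‖ ≤ ‖p‖ + ‖p - t • e‖ := by
        have := norm_sub_le p (p - t • e)
        rwa [sub_sub_cancel] at this
      rw [norm_smul, Real.norm_eq_abs] at h3
      rw [mem_Icc, ← abs_le, le_div_iff₀ hen]
      linarith)
    hf (by
      have : ContDiff ℝ ∞ fun q : E × ℝ => h (q.1 - q.2 • e) :=
        hh.comp (contDiff_fst.sub (contDiff_snd.smul contDiff_const))
      exact this.contDiffOn)
  have h1 : ContDiffOn ℝ ∞ (fun p : E => convolution f (fun t : ℝ => h (p - t • e))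
      (ContinuousLinearMap.mul ℝ ℝ) volume 0) s :=
    key.comp (contDiff_id.prodMk contDiff_const).contDiffOn fun p hp => ⟨hp, mem_univ _⟩
  refine (h1.contDiffAt (Metric.isOpen_ball.mem_nhds (by simp))).congr_of_eventuallyEq
    (Filter.Eventually.of_forall fun p => ?_)
  simp [convolution]

theorem hasCompactSupport_line {h : E → ℝ} (hc : HasCompactSupport h) {e : E} (he : e ≠ 0) (x : E) :
    HasCompactSupport fun s : ℝ => h (x + s • e) :=
  hc.comp_isClosedEmbedding ((Homeomorph.addLeft x).isClosedEmbedding.comp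
    (isClosedEmbedding_smul_left he))

theorem integrable_line {h : E → ℝ} (hh : Continuous h) (hc : HasCompactSupport h) {e : E}
    (he : e ≠ 0) (x : E) : Integrable fun s : ℝ => h (x + s • e) :=
  (by fun_prop : Continuous fun s : ℝ => h (x + s • e)).integrable_of_hasCompactSupport
    (hasCompactSupport_line hc he x)

theorem hasDerivAt_integral_Iic_line {h : E → ℝ} (hh : Continuous h) (hc : HasCompactSupport h)
    {e : E} (he : e ≠ 0) (x : E) :
    HasDerivAt (fun τ : ℝ => ∫ s in Iic (0 : ℝ), h (x + τ • e + s • e)) (h x) 0 := by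
  have hi := integrable_line hh hc he x
  have h1 : ∀ τ : ℝ, ∫ s in Iic (0 : ℝ), h (x + τ • e + s • e) =
      (∫ s in Iic (0 : ℝ), h (x + s • e)) + ∫ s in (0 : ℝ)..τ, h (x + s • e) := by
    intro τ
    have e1 : ∫ s in Iic (0 : ℝ), h (x + τ • e + s • e) = ∫ s in Iic τ, h (x + s • e) := by
      have := (measurePreserving_add_right (volume : Measure ℝ) τ).setIntegral_preimage_emb
        (measurableEmbedding_addRight τ) (fun s : ℝ => h (x + s • e)) (Iic τ)
      rw [← this]
      simp only [preimage_add_const_Iic, sub_self, add_smul, add_assoc, add_comm (τ • e)]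
    rw [e1, ← intervalIntegral.integral_Iic_sub_Iic hi.integrableOn hi.integrableOn]
    ring
  have h2 : HasDerivAt (fun τ : ℝ => ∫ s in (0 : ℝ)..τ, h (x + s • e)) (h (x + (0 : ℝ) • e)) 0 :=
    intervalIntegral.integral_hasDerivAt_right IntervalIntegrable.refl
      (Continuous.stronglyMeasurableAtFilter (by fun_prop) _ _)
      (Continuous.continuousAt (by fun_prop))
  simp only [h1]
  rw [zero_smul, add_zero] at h2
  exact h2.const_add _

theorem sq_integral_Icc_le {f : ℝ → ℝ} (hf : Continuous f) {L : ℝ} (hL : 0 < L) :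
    (∫ s in Icc (-L) L, f s) ^ 2 ≤ 2 * L * ∫ s in Icc (-L) L, f s ^ 2 := by
  set m := (∫ s in Icc (-L) L, f s) / (2 * L) with hm
  have i1 : IntegrableOn f (Icc (-L) L) := hf.continuousOn.integrableOn_compact isCompact_Icc
  have i2 : IntegrableOn (fun s => f s ^ 2) (Icc (-L) L) :=
    (hf.pow 2).continuousOn.integrableOn_compact isCompact_Icc
  have i3 : IntegrableOn (fun _ : ℝ => m ^ 2) (Icc (-L) L) :=
    continuousOn_const.integrableOn_compact isCompact_Icc
  have h1 : 0 ≤ ∫ s in Icc (-L) L, (f s - m) ^ 2 := integral_nonneg fun s => sq_nonneg _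
  have h2 : ∫ s in Icc (-L) L, (f s - m) ^ 2 = (∫ s in Icc (-L) L, f s ^ 2) -
      2 * m * (∫ s in Icc (-L) L, f s) + m ^ 2 * (2 * L) := by
    have e : ∀ s, (f s - m) ^ 2 = f s ^ 2 - 2 * m * f s + m ^ 2 := fun s => by ring
    simp only [e]
    have i4 : IntegrableOn (fun s => f s ^ 2 - 2 * m * f s) (Icc (-L) L) :=
      i2.sub (i1.const_mul (2 * m))
    rw [integral_add i4 i3, integral_sub i2 (i1.const_mul (2 * m)),
      integral_const_mul, setIntegral_const, Real.volume_real_Icc_of_le (by linarith), smul_eq_mul]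
    ring
  have h3 : ∫ s in Icc (-L) L, f s = 2 * L * m := by rw [hm]; field_simp
  rw [h3] at h2 ⊢
  rw [h2] at h1
  nlinarith

variable [FiniteDimensional ℝ E] [MeasurableSpace E] [BorelSpace E] {μ : Measure E}
  [μ.IsAddHaarMeasure]

/-- Averaging over segments of bounded length is bounded in `L²`. -/
theorem integral_sq_le_of_abs_le_line {h F : E → ℝ} (hh : Continuous h) (hc : HasCompactSupport h)
    {e : E} {L Θ : ℝ} (hL : 0 < L)
    (hFi : Integrable (fun x => F x ^ 2) μ)
    (hF : ∀ x, |F x| ≤ Θ * ∫ s in Icc (-L) L, |h (x + s • e)|) :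
    ∫ x, F x ^ 2 ∂μ ≤ Θ ^ 2 * (2 * L) ^ 2 * ∫ x, h x ^ 2 ∂μ := by
  obtain ⟨R, hR⟩ := hc.isCompact.isBounded.subset_closedBall 0
  set D := R + L * ‖e‖
  set G : E × ℝ → ℝ := fun q => h (q.1 + q.2 • e) ^ 2
  have hG : Continuous G := by fun_prop
  have hint : Integrable G (μ.prod (volume.restrict (Icc (-L) L))) := by
    have h1 : IntegrableOn G (univ ×ˢ Icc (-L) L) (μ.prod volume) := by
      refine (hG.continuousOn.integrableOn_compact ((isCompact_closedBall (0 : E) D).prod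
        (isCompact_Icc (a := -L) (b := L)))).of_forall_sdiff_eq_zero
        (MeasurableSet.univ.prod measurableSet_Icc) fun q hq => ?_
      by_contra hne
      refine hq.2 ⟨?_, hq.1.2⟩
      have hq2 := abs_le.2 (mem_Icc.1 hq.1.2)
      have h2 : h (q.1 + q.2 • e) ≠ 0 := fun h0 => hne (by simp [G, h0])
      have h3 : ‖q.1 + q.2 • e‖ ≤ R := by simpa using hR (subset_tsupport _ h2)
      have h4 : ‖q.1‖ ≤ ‖q.1 + q.2 • e‖ + ‖q.2 • e‖ := by
        have := norm_sub_le (q.1 + q.2 • e) (q.2 • e)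
        rwa [add_sub_cancel_right] at this
      rw [norm_smul, Real.norm_eq_abs] at h4
      have h5 := mul_le_mul_of_nonneg_right hq2 (norm_nonneg e)
      simp only [mem_closedBall_zero_iff, D]
      linarith
    rwa [IntegrableOn, ← Measure.prod_restrict, Measure.restrict_univ] at h1
  calc ∫ x, F x ^ 2 ∂μ ≤ ∫ x, Θ ^ 2 * (2 * L) * (∫ s in Icc (-L) L, G (x, s)) ∂μ := by
        refine integral_mono hFi (hint.integral_prod_left.const_mul _) fun x => ?_
        have h1 := sq_integral_Icc_le (f := fun s => |h (x + s • e)|) (by fun_prop) hL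
        simp only [sq_abs] at h1
        calc F x ^ 2 = |F x| ^ 2 := (sq_abs _).symm
          _ ≤ (Θ * ∫ s in Icc (-L) L, |h (x + s • e)|) ^ 2 :=
            pow_le_pow_left₀ (abs_nonneg _) (hF x) 2
          _ = Θ ^ 2 * (∫ s in Icc (-L) L, |h (x + s • e)|) ^ 2 := by ring
          _ ≤ Θ ^ 2 * (2 * L * ∫ s in Icc (-L) L, h (x + s • e) ^ 2) := by gcongr
          _ = _ := by ring
    _ = Θ ^ 2 * (2 * L) * ∫ s in Icc (-L) L, (∫ x, G (x, s) ∂μ) := by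
        rw [integral_const_mul, integral_integral_swap hint]
    _ = Θ ^ 2 * (2 * L) * ∫ s in Icc (-L) L, (∫ x, h x ^ 2 ∂μ) := by
        congr 2
        ext s
        exact integral_add_right_eq_self (fun x => h x ^ 2) (s • e)
    _ = _ := by
        rw [setIntegral_const, Real.volume_real_Icc_of_le (by linarith), smul_eq_mul]
        ring

end line

section box
variable {n : ℕ}

/-- The closed box with corners `a` and `b`. -/
def box (a b : Fin n → ℝ) : Set (EuclideanSpace ℝ (Fin n)) := {x | ∀ k, x k ∈ Icc (a k) (b k)}

/-- The `k`-th coordinate vector. -/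
noncomputable abbrev coordVec (k : Fin n) : EuclideanSpace ℝ (Fin n) := EuclideanSpace.single k 1

theorem isCompact_box (a b : Fin n → ℝ) : IsCompact (box a b) := by
  have : box a b = (EuclideanSpace.equiv (Fin n) ℝ).toHomeomorph ⁻¹'
      (Set.pi univ fun k => Icc (a k) (b k)) := by
    ext x
    exact ⟨fun hx k _ => hx k, fun hx k => hx k (mem_univ k)⟩
  rw [this, Homeomorph.isCompact_preimage]
  exact isCompact_univ_pi fun k => isCompact_Icc

theorem coordVec_ne_zero (k : Fin n) : coordVec k ≠ 0 := by
  simp [coordVec]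

theorem add_smul_coordVec_apply (x : EuclideanSpace ℝ (Fin n)) (s : ℝ) (k l : Fin n) :
    (x + s • coordVec k) l = x l + if l = k then s else 0 := by
  simp [coordVec]

/-- One coordinate direction: up to a derivative in the direction of the `k`-th coordinate, a function
on a box may be replaced by its integral in this direction times a fixed profile. -/
theorem exists_line_step (k : Fin n) {θ : ℝ → ℝ} (hθ : ContDiff ℝ ∞ θ) {α β : ℝ}
    (hθ0 : ∀ s, s ∉ Icc α β → θ s = 0) (hθ1 : ∫ s, θ s = 1) {L : ℝ} (hL : 0 < L) :
    ∃ C, 0 ≤ C ∧ ∀ a b : Fin n → ℝ, a k ≤ α → β ≤ b k → b k - a k ≤ L →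
      ∀ h : EuclideanSpace ℝ (Fin n) → ℝ, ContDiff ℝ ∞ h → (∀ x, x ∉ box a b → h x = 0) →
      ∃ h' B : EuclideanSpace ℝ (Fin n) → ℝ, ContDiff ℝ ∞ h' ∧ ContDiff ℝ ∞ B ∧
        (∀ x, x ∉ box a b → h' x = 0) ∧ (∀ x, x ∉ box a b → B x = 0) ∧
        (∀ x, h' x = θ (x k) * ∫ s : ℝ, h (x + s • coordVec k)) ∧
        (∀ x, h x = h' x + fderiv ℝ B x (coordVec k)) ∧
        ∫ x, h' x ^ 2 ≤ C * ∫ x, h x ^ 2 ∧ ∫ x, B x ^ 2 ≤ C * ∫ x, h x ^ 2 := by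
  have hθc : HasCompactSupport θ := HasCompactSupport.intro isCompact_Icc hθ0
  obtain ⟨Θ, hΘ⟩ := hθc.exists_bound_of_continuous hθ.continuous
  have hΘ0 : 0 ≤ Θ := (norm_nonneg _).trans (hΘ 0)
  set C₁ := Θ ^ 2 * (2 * L) ^ 2 with hC₁
  have hC₁0 : 0 ≤ C₁ := by positivity
  refine ⟨C₁ + (2 * L) ^ 2 * (2 + 2 * C₁), by positivity, fun a b ha hb hab h hh h0 => ?_⟩
  set e : EuclideanSpace ℝ (Fin n) := coordVec k with he
  have hene : e ≠ 0 := coordVec_ne_zero k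
  have hc : HasCompactSupport h := HasCompactSupport.intro (isCompact_box a b) h0
  have hle : ∀ x, x k ∈ Icc (a k) (b k) → ∀ s : ℝ, x + s • e ∈ box a b → s ∈ Icc (-L) L := by
    intro x hx s hs
    have h1 := hs k
    rw [he, add_smul_coordVec_apply, if_pos rfl] at h1
    constructor <;> linarith [h1.1, h1.2, hx.1, hx.2]
  have hoff : ∀ x, ∀ l ≠ k, x l ∉ Icc (a l) (b l) → ∀ s : ℝ, x + s • e ∉ box a b := by
    intro x l hl hx s hs
    have h1 := hs l
    rw [he, add_smul_coordVec_apply, if_neg hl, add_zero] at h1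
    exact hx h1
  set I : EuclideanSpace ℝ (Fin n) → ℝ := fun x => ∫ s : ℝ, h (x + s • e) with hI
  have hIs : ContDiff ℝ ∞ I := by
    have := contDiff_integral_line (f := fun _ => (1 : ℝ)) (continuous_const.locallyIntegrable) hh hc
      hene
    simpa using this
  have hproj : ContDiff ℝ ∞ fun x : EuclideanSpace ℝ (Fin n) => x k :=
    (EuclideanSpace.proj (𝕜 := ℝ) k).contDiff
  set h' : EuclideanSpace ℝ (Fin n) → ℝ := fun x => θ (x k) * I x with hh'
  have hh's : ContDiff ℝ ∞ h' := (hθ.comp hproj).mul hIs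
  have hθk : ∀ s, s ∉ Icc (a k) (b k) → θ s = 0 := fun s hs =>
    hθ0 s fun hs' => hs ⟨ha.trans hs'.1, hs'.2.trans hb⟩
  have hh'0 : ∀ x, x ∉ box a b → h' x = 0 := by
    intro x hx
    obtain ⟨l, hl⟩ := not_forall.1 hx
    by_cases hlk : l = k
    · subst hlk
      simp only [hh', hθk _ hl, zero_mul]
    · simp only [hh', hI, h0 _ (hoff x l hlk hl _), integral_zero, mul_zero]
  have hc' : HasCompactSupport h' := HasCompactSupport.intro (isCompact_box a b) hh'0
  have hIinv : ∀ x (s : ℝ), I (x + s • e) = I x := fun x s => by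
    have := integral_add_left_eq_self (μ := (volume : Measure ℝ)) (fun t : ℝ => h (x + t • e)) s
    simp only [hI]
    rw [← this]
    congr 1
    ext t
    rw [add_smul, add_assoc]
  set q : EuclideanSpace ℝ (Fin n) → ℝ := fun x => h x - h' x with hq
  have hqs : ContDiff ℝ ∞ q := hh.sub hh's
  have hq0 : ∀ x, x ∉ box a b → q x = 0 := fun x hx => by
    simp only [hq, h0 x hx, hh'0 x hx, sub_zero]
  have hqc : HasCompactSupport q := HasCompactSupport.intro (isCompact_box a b) hq0
  have hqI : ∀ x, ∫ s : ℝ, q (x + s • e) = 0 := by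
    intro x
    have e1 : ∀ s : ℝ, h' (x + s • e) = θ (x k + s) * I x := fun s => by
      simp only [hh']
      rw [hIinv, he, add_smul_coordVec_apply, if_pos rfl]
    simp only [hq]
    rw [integral_sub (integrable_line hh.continuous hc hene x)
      (integrable_line hh's.continuous hc' hene x)]
    simp only [e1]
    rw [integral_mul_const, integral_add_left_eq_self θ (x k), hθ1, one_mul, sub_self]
  set B : EuclideanSpace ℝ (Fin n) → ℝ := fun x => ∫ s in Iic (0 : ℝ), q (x + s • e) with hB
  have hBs : ContDiff ℝ ∞ B := by
    have := contDiff_integral_line (f := (Iic (0 : ℝ)).indicator fun _ => (1 : ℝ))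
      (continuous_const.locallyIntegrable.indicator measurableSet_Iic) hqs hqc hene
    have e1 : B = fun x => ∫ s, (Iic (0 : ℝ)).indicator (fun _ => (1 : ℝ)) s * q (x + s • e) := by
      ext x
      simp only [hB]
      rw [← integral_indicator measurableSet_Iic]
      congr 1
      ext s
      by_cases hs : s ∈ Iic (0 : ℝ) <;> simp [hs]
    rwa [e1]
  have hB0 : ∀ x, x ∉ box a b → B x = 0 := by
    intro x hx
    obtain ⟨l, hl⟩ := not_forall.1 hx
    by_cases hlk : l = k
    · subst hlk
      by_cases hlt : x l < a l
      · simp only [hB]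
        refine setIntegral_eq_zero_of_forall_eq_zero fun s hs => hq0 _ fun hbox => ?_
        have h1 := hbox l
        rw [he, add_smul_coordVec_apply, if_pos rfl] at h1
        have : s ≤ 0 := hs
        linarith [h1.1]
      · have hgt : b l < x l := by
          by_contra hcon
          exact hl ⟨not_lt.1 hlt, not_lt.1 hcon⟩
        rw [← hqI x]
        refine setIntegral_eq_integral_of_forall_compl_eq_zero fun s hs => hq0 _ fun hbox => ?_
        have h1 := hbox l
        rw [he, add_smul_coordVec_apply, if_pos rfl] at h1
        have : 0 < s := not_le.1 hs
        linarith [h1.2]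
    · simp only [hB, hq0 _ (hoff x l hlk hl _), integral_zero]
  have hBd : ∀ x, fderiv ℝ B x e = q x := by
    intro x
    have h1 := hasDerivAt_integral_Iic_line hqs.continuous hqc hene x
    have h2 : HasDerivAt (fun τ : ℝ => B (x + τ • e)) (fderiv ℝ B x e) 0 := by
      have h3 : HasFDerivAt B (fderiv ℝ B x) (x + (0 : ℝ) • e) := by
        rw [zero_smul, add_zero]
        exact (hBs.differentiable (by simp) x).hasFDerivAt
      have h4 : HasDerivAt (fun τ : ℝ => x + τ • e) e 0 := by
        simpa using ((hasDerivAt_id (0 : ℝ)).smul_const e).const_add x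
      exact h3.comp_hasDerivAt 0 h4
    exact h2.unique h1
  have hsqi : ∀ f : EuclideanSpace ℝ (Fin n) → ℝ, Continuous f → (∀ x, x ∉ box a b → f x = 0) →
      Integrable fun x => f x ^ 2 := fun f hf hf0 =>
    (hf.pow 2).integrable_of_hasCompactSupport (HasCompactSupport.intro (isCompact_box a b)
      fun x hx => by simp [hf0 x hx])
  have hcut : ∀ (f : EuclideanSpace ℝ (Fin n) → ℝ), (∀ x, x ∉ box a b → f x = 0) →
      ∀ x, x k ∈ Icc (a k) (b k) → ∀ s, s ∉ Icc (-L) L → f (x + s • e) = 0 :=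
    fun f hf0 x hx s hs => hf0 _ fun hb => hs (hle x hx s hb)
  have hn1 : ∫ x, h' x ^ 2 ≤ C₁ * ∫ x, h x ^ 2 := by
    refine integral_sq_le_of_abs_le_line hh.continuous hc (e := e) hL
      (hsqi h' hh's.continuous hh'0) fun x => ?_
    by_cases hx : x k ∈ Icc (a k) (b k)
    · simp only [hh', hI, abs_mul]
      refine mul_le_mul (hΘ _) ?_ (abs_nonneg _) hΘ0
      rw [← setIntegral_eq_integral_of_forall_compl_eq_zero (hcut h h0 x hx)]
      exact abs_integral_le_integral_abs
    · simp only [hh', hθk _ hx, zero_mul, abs_zero]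
      exact mul_nonneg hΘ0 (integral_nonneg fun _ => abs_nonneg _)
  have hn2 : ∫ x, B x ^ 2 ≤ 1 ^ 2 * (2 * L) ^ 2 * ∫ x, q x ^ 2 := by
    refine integral_sq_le_of_abs_le_line hqs.continuous hqc (e := e) hL
      (hsqi B hBs.continuous hB0) fun x => ?_
    rw [one_mul]
    by_cases hx : x k ∈ Icc (a k) (b k)
    · refine (abs_integral_le_integral_abs).trans ?_
      rw [setIntegral_eq_integral_of_forall_compl_eq_zero (s := Icc (-L) L) fun s hs => by
        rw [hcut q hq0 x hx s hs, abs_zero]]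
      exact setIntegral_le_integral (integrable_line hqs.continuous hqc hene x).abs
        (Filter.Eventually.of_forall fun _ => abs_nonneg _)
    · rw [hB0 x fun hb => hx (hb k), abs_zero]
      exact integral_nonneg fun _ => abs_nonneg _
  have hn3 : ∫ x, q x ^ 2 ≤ (2 + 2 * C₁) * ∫ x, h x ^ 2 := by
    have i1 := hsqi h hh.continuous h0
    have i2 := hsqi h' hh's.continuous hh'0
    calc ∫ x, q x ^ 2 ≤ ∫ x, (2 * h x ^ 2 + 2 * h' x ^ 2) := by
          refine integral_mono (hsqi q hqs.continuous hq0) ((i1.const_mul 2).add (i2.const_mul 2))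
            fun x => ?_
          simp only [hq]
          nlinarith [sq_nonneg (h x + h' x)]
      _ = 2 * (∫ x, h x ^ 2) + 2 * ∫ x, h' x ^ 2 := by
          rw [integral_add (i1.const_mul 2) (i2.const_mul 2), integral_const_mul,
            integral_const_mul]
      _ ≤ _ := by linarith
  have hh2 : 0 ≤ ∫ x, h x ^ 2 := integral_nonneg fun _ => sq_nonneg _
  refine ⟨h', B, hh's, hBs, hh'0, hB0, fun x => rfl, fun x => ?_, ?_, ?_⟩
  · rw [hBd x]
    simp only [hq]
    ring
  · refine hn1.trans (mul_le_mul_of_nonneg_right (le_add_of_nonneg_right (by positivity)) hh2)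
  · calc _ ≤ _ := hn2
      _ ≤ 1 ^ 2 * (2 * L) ^ 2 * ((2 + 2 * C₁) * ∫ x, h x ^ 2) := by gcongr
      _ ≤ _ := by nlinarith [mul_nonneg hC₁0 hh2]

theorem exists_profile {α β : ℝ} (h : α < β) : ∃ θ : ℝ → ℝ, ContDiff ℝ ∞ θ ∧
    (∀ s, s ∉ Icc α β → θ s = 0) ∧ ∫ s, θ s = 1 := by
  let f : ContDiffBump ((α + β) / 2) := ⟨(β - α) / 4, (β - α) / 2, by linarith, by linarith⟩
  refine ⟨f.normed volume, f.contDiff_normed, fun s hs => ?_, f.integral_normed⟩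
  by_contra hne
  have h1 : s ∈ Function.support (f.normed volume) := hne
  rw [f.support_normed_eq, Metric.mem_ball, Real.dist_eq, abs_lt] at h1
  have h2 : f.rOut = (β - α) / 2 := rfl
  rw [h2] at h1
  exact hs ⟨by linarith, by linarith⟩

theorem integral_prod_profile {θ : Fin n → ℝ → ℝ} (hθ : ∀ k, ∫ s, θ k s = 1) :
    ∫ x : EuclideanSpace ℝ (Fin n), ∏ k, θ k (x k) = 1 := by
  have h1 := (EuclideanSpace.volume_preserving_symm_measurableEquiv_toLp (Fin n)).integral_comp'
    (fun y : Fin n → ℝ => ∏ k, θ k (y k))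
  have h2 := integral_fintype_prod_volume_eq_prod θ
  simp only [hθ, Finset.prod_const_one] at h2
  exact h1.trans h2

/-- After the coordinates in `S` have been treated, the remaining function is the product of the
profiles in these coordinates and a function of the other coordinates. -/
theorem exists_box_step {θ : Fin n → ℝ → ℝ} (hθ : ∀ k, ContDiff ℝ ∞ (θ k)) {α β : Fin n → ℝ}
    (hθ0 : ∀ k s, s ∉ Icc (α k) (β k) → θ k s = 0) (hθ1 : ∀ k, ∫ s, θ k s = 1) {L : ℝ} (hL : 0 < L)
    (S : Finset (Fin n)) :
    ∃ C, 0 ≤ C ∧ ∀ a b : Fin n → ℝ, (∀ k, a k ≤ α k ∧ β k ≤ b k ∧ b k - a k ≤ L) →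
      ∀ h : EuclideanSpace ℝ (Fin n) → ℝ, ContDiff ℝ ∞ h → (∀ x, x ∉ box a b → h x = 0) →
      ∃ (h' : EuclideanSpace ℝ (Fin n) → ℝ) (B : Fin n → EuclideanSpace ℝ (Fin n) → ℝ)
        (r : EuclideanSpace ℝ (Fin n) → ℝ),
        ContDiff ℝ ∞ h' ∧ (∀ k, ContDiff ℝ ∞ (B k)) ∧ (∀ x, x ∉ box a b → h' x = 0) ∧
        (∀ k x, x ∉ box a b → B k x = 0) ∧ (∀ x, h' x = (∏ k ∈ S, θ k (x k)) * r x) ∧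
        (∀ k ∈ S, ∀ x (s : ℝ), r (x + s • coordVec k) = r x) ∧
        (∀ x, h x = h' x + ∑ k, fderiv ℝ (B k) x (coordVec k)) ∧
        ∫ x, h' x ^ 2 ≤ C * ∫ x, h x ^ 2 ∧ ∀ k, ∫ x, B k x ^ 2 ≤ C * ∫ x, h x ^ 2 := by
  induction S using Finset.induction_on with
  | empty =>
    refine ⟨1, zero_le_one, fun a b _ h hh h0 => ⟨h, fun _ _ => 0, h, hh, fun _ => contDiff_const, h0,
      fun _ _ _ => rfl, by simp, by simp, by simp, by simp, fun _ => ?_⟩⟩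
    simpa using integral_nonneg fun x => sq_nonneg (h x)
  | insert k S hkS ih =>
    obtain ⟨C, hC0, hC⟩ := ih
    obtain ⟨D, hD0, hD⟩ := exists_line_step k (hθ k) (hθ0 k) (hθ1 k) hL
    refine ⟨2 * C + 2 * (D * C), by positivity, fun a b hab h hh h0 => ?_⟩
    obtain ⟨h', B, r, hh's, hBs, hh'0, hB0, hprod, hr, hdec, hn, hnB⟩ := hC a b hab h hh h0
    obtain ⟨h'', B', hh''s, hB's, hh''0, hB'0, hdef, hdec', hn', hnB'⟩ :=
      hD a b (hab k).1 (hab k).2.1 (hab k).2.2 h' hh's hh'0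
    have hh2 : 0 ≤ ∫ x, h x ^ 2 := integral_nonneg fun _ => sq_nonneg _
    have hle : D * ∫ x, h' x ^ 2 ≤ D * C * ∫ x, h x ^ 2 := by
      rw [mul_assoc]
      exact mul_le_mul_of_nonneg_left hn hD0
    have hCh : 0 ≤ C * ∫ x, h x ^ 2 := mul_nonneg hC0 hh2
    have hDh : 0 ≤ D * C * ∫ x, h x ^ 2 := mul_nonneg (mul_nonneg hD0 hC0) hh2
    refine ⟨h'', fun l x => B l x + if l = k then B' x else 0,
      fun x => ∫ s : ℝ, r (x + s • coordVec k), hh''s, fun l => ?_, hh''0, fun l x hx => ?_,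
      fun x => ?_, fun l hl x s => ?_, fun x => ?_, ?_, fun l => ?_⟩
    · by_cases hl : l = k
      · simp only [hl, if_true]
        exact (hBs k).add hB's
      · simp only [hl, if_false, add_zero]
        exact hBs l
    · change B l x + (if l = k then B' x else 0) = 0
      rw [hB0 l x hx, hB'0 x hx]
      simp
    · rw [hdef, Finset.prod_insert hkS, mul_assoc]
      simp only
      rw [← integral_const_mul (∏ l ∈ S, θ l (x l))]
      refine congrArg (fun F : ℝ → ℝ => θ k (x k) * ∫ s, F s) (funext fun s => ?_)
      rw [hprod]
      refine congrArg (fun F : ℝ => F * r (x + s • coordVec k)) ?_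
      refine Finset.prod_congr rfl fun l hl => ?_
      rw [add_smul_coordVec_apply, if_neg fun hlk : l = k => hkS (hlk ▸ hl), add_zero]
    · rcases Finset.mem_insert.1 hl with rfl | hl
      · have := integral_add_left_eq_self (μ := (volume : Measure ℝ))
          (fun t : ℝ => r (x + t • coordVec l)) s
        simp only
        rw [← this]
        refine congrArg (fun F : ℝ → ℝ => ∫ s, F s) (funext fun t => ?_)
        rw [add_smul, add_assoc]
      · refine congrArg (fun F : ℝ → ℝ => ∫ s, F s) (funext fun t => ?_)
        rw [add_right_comm, hr l hl]
    · have e1 : ∀ l, fderiv ℝ (fun x => B l x + if l = k then B' x else 0) x (coordVec l) =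
          fderiv ℝ (B l) x (coordVec l) + if l = k then fderiv ℝ B' x (coordVec k) else 0 := by
        intro l
        by_cases hl : l = k
        · subst hl
          simp only [if_true]
          rw [fderiv_fun_add ((hBs l).differentiable (by simp) x)
            (hB's.differentiable (by simp) x)]
          rfl
        · simp only [hl, if_false, add_zero]
      simp only [e1, Finset.sum_add_distrib, Finset.sum_ite_eq', Finset.mem_univ, if_true]
      rw [hdec x, hdec' x]
      ring
    · rw [add_mul]
      linarith
    · have hsqi : ∀ f : EuclideanSpace ℝ (Fin n) → ℝ, Continuous f →
          (∀ x, x ∉ box a b → f x = 0) → Integrable fun x => f x ^ 2 := fun f hf hf0 =>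
        (hf.pow 2).integrable_of_hasCompactSupport (HasCompactSupport.intro (isCompact_box a b)
          fun x hx => by simp [hf0 x hx])
      have i1 := hsqi (B l) (hBs l).continuous (hB0 l)
      by_cases hl : l = k
      · have i2 := hsqi B' hB's.continuous hB'0
        simp only [hl, if_true]
        rw [hl] at i1
        calc ∫ x, (B k x + B' x) ^ 2 ≤ ∫ x, (2 * B k x ^ 2 + 2 * B' x ^ 2) := by
              refine integral_mono (hsqi _ ((hBs k).continuous.add hB's.continuous) fun x hx => ?_)
                ((i1.const_mul 2).add (i2.const_mul 2)) fun x => ?_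
              · simp only [hB0 k x hx, hB'0 x hx, add_zero]
              · nlinarith [sq_nonneg (B k x - B' x)]
          _ = 2 * (∫ x, B k x ^ 2) + 2 * ∫ x, B' x ^ 2 := by
              rw [integral_add (i1.const_mul 2) (i2.const_mul 2), integral_const_mul,
                integral_const_mul]
          _ ≤ _ := by linarith [hnB k]
      · simp only [hl, if_false, add_zero]
        linarith [hnB l]

/-- A smooth function of mean zero supported in a box is the divergence of a smooth vector field
supported in the same box, with a bound in `L²` that is uniform for all boxes of bounded size that
contain a given one. -/
theorem exists_div_of_integral_eq_zero {α β : Fin n → ℝ} (hαβ : ∀ k, α k < β k) {L : ℝ}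
    (hL : 0 < L) :
    ∃ C, 0 ≤ C ∧ ∀ a b : Fin n → ℝ, (∀ k, a k ≤ α k ∧ β k ≤ b k ∧ b k - a k ≤ L) →
      ∀ h : EuclideanSpace ℝ (Fin n) → ℝ, ContDiff ℝ ∞ h → (∀ x, x ∉ box a b → h x = 0) →
      ∫ x, h x = 0 →
      ∃ B : Fin n → EuclideanSpace ℝ (Fin n) → ℝ, (∀ k, ContDiff ℝ ∞ (B k)) ∧
        (∀ k x, x ∉ box a b → B k x = 0) ∧
        (∀ x, h x = ∑ k, fderiv ℝ (B k) x (coordVec k)) ∧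
        ∀ k, ∫ x, B k x ^ 2 ≤ C * ∫ x, h x ^ 2 := by
  choose θ hθ hθ0 hθ1 using fun k => exists_profile (hαβ k)
  obtain ⟨C, hC0, hC⟩ := exists_box_step hθ hθ0 hθ1 hL Finset.univ
  refine ⟨C, hC0, fun a b hab h hh h0 hint => ?_⟩
  obtain ⟨h', B, r, hh's, hBs, hh'0, hB0, hprod, hr, hdec, -, hnB⟩ := hC a b hab h hh h0
  -- the remaining factor is invariant under all translations
  have hrc : ∀ x, r x = r 0 := by
    have key : ∀ (S : Finset (Fin n)) (c : Fin n → ℝ) (x : EuclideanSpace ℝ (Fin n)),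
        r (x + ∑ k ∈ S, c k • coordVec k) = r x := by
      intro S c x
      induction S using Finset.induction_on with
      | empty => simp
      | insert k S hk ih =>
        rw [Finset.sum_insert hk, add_comm (c k • _), ← add_assoc, hr k (Finset.mem_univ k), ih]
    intro x
    have := key Finset.univ (fun k => x k) 0
    rw [zero_add] at this
    rw [← this]
    congr 1
    ext l
    simp [coordVec, Pi.single_apply]
  have hBc : ∀ k, HasCompactSupport (B k) := fun k =>
    HasCompactSupport.intro (isCompact_box a b) (hB0 k)
  have hd : ∀ k, Integrable fun x => fderiv ℝ (B k) x (coordVec k) := fun k =>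
    (((hBs k).continuous_fderiv (by simp)).clm_apply continuous_const).integrable_of_hasCompactSupport
      ((hBc k).fderiv_apply ℝ (coordVec k))
  have hh'i : Integrable h' := hh's.continuous.integrable_of_hasCompactSupport
    (HasCompactSupport.intro (isCompact_box a b) hh'0)
  have hr0 : r 0 = 0 := by
    have e1 : ∫ x, h x = ∫ x, h' x := by
      simp only [hdec]
      rw [integral_add hh'i (integrable_finsetSum _ fun k _ => hd k),
        integral_finsetSum _ fun k _ => hd k, Finset.sum_eq_zero fun k _ => ?_, add_zero]
      exact integral_fderiv_eq_zero ((hBs k).of_le (by simp)) (hBc k) _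
    have e2 : ∫ x, h' x = r 0 := by
      simp only [hprod, hrc]
      rw [integral_mul_const, integral_prod_profile hθ1, one_mul]
    rw [← e2, ← e1, hint]
  refine ⟨B, hBs, hB0, fun x => ?_, hnB⟩
  rw [hdec x, hprod, hrc, hr0, mul_zero, zero_add]

end box
end HypStokes

/-! ### Functions and forms supported in one chart -/

namespace HypStokes

theorem contMDiffAt_mfderiv_section {E H M : Type*} [NormedAddCommGroup E] [NormedSpace ℝ E]
    [TopologicalSpace H] {I : ModelWithCorners ℝ E H} [TopologicalSpace M] [ChartedSpace H M]
    [IsManifold I ∞ M] {f : M → ℝ} {x : M} (hf : ContMDiffAt I 𝓘(ℝ, ℝ) ∞ f x) :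
    ContMDiffAt I (I.prod 𝓘(ℝ, E →L[ℝ] ℝ)) ∞ (fun z => TotalSpace.mk' (E →L[ℝ] ℝ)
      (E := fun x : M => TangentSpace I x →L[ℝ] ℝ) z (mfderiv I 𝓘(ℝ, ℝ) f z)) x := by
  have h := hf.mfderiv_const (m := ∞) (by simp)
  have h1 := contMDiffAt_hom_bundle (IM := I) (n := ∞) (IB := I) (F₁ := E)
    (E₁ := fun x : M => TangentSpace I x) (F₂ := ℝ) (E₂ := Bundle.Trivial M ℝ) (M := M)
    (fun z => TotalSpace.mk' (E →L[ℝ] ℝ)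
      (E := fun x : M => TangentSpace I x →L[ℝ] Bundle.Trivial M ℝ x) z (mfderiv I 𝓘(ℝ, ℝ) f z))
    (x₀ := x)
  refine h1.2 ⟨contMDiffAt_id, ?_⟩
  refine h.congr_of_eventuallyEq (Filter.Eventually.of_forall fun z => ?_)
  ext v
  simp [inTangentCoordinates, ContinuousLinearMap.inCoordinates]
  rfl

namespace FiniteAtlas
variable {n : ℕ} [NeZero n] {M : Type*} [TopologicalSpace M]
  [ChartedSpace (EuclideanHalfSpace n) M] [IsManifold (𝓡∂ n) ∞ M] {A : FiniteAtlas n M}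
  {i j : Fin A.N} {a : Fin n} {x : M} {y : EuclideanSpace ℝ (Fin n)}
  {K : Set (EuclideanSpace ℝ (Fin n))} {h k : EuclideanSpace ℝ (Fin n) → ℝ}

variable (A) in
/-- A function of the coordinates of the `i`-th chart as a function on `M`, extended by zero. -/
noncomputable def pull (i : Fin A.N) (h : EuclideanSpace ℝ (Fin n) → ℝ) : M → ℝ :=
  (A.chart i).source.indicator fun x => h (A.coord i x)

theorem pull_inv (h : EuclideanSpace ℝ (Fin n) → ℝ) (hy : y ∈ A.target i) :
    A.pull i h (A.inv i y) = h y := by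
  rw [pull, indicator_of_mem (inv_mem_source hy), coord_inv hy]

theorem isCompact_inv_image (hK : IsCompact K) (hKc : K ⊆ A.target i) : IsCompact (A.inv i '' K) :=
  hK.image_of_continuousOn (continuousOn_inv.mono hKc)

theorem inv_image_subset_interior (hKc : K ⊆ A.core i) : A.inv i '' K ⊆ (𝓡∂ n).interior M := by
  rintro _ ⟨y, hy, rfl⟩
  exact (inv_mem_interior_iff (core_subset_target (hKc hy))).2 (hKc hy)

theorem inv_image_subset_source (hKc : K ⊆ A.target i) : A.inv i '' K ⊆ (A.chart i).source := by
  rintro _ ⟨y, hy, rfl⟩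
  exact inv_mem_source (hKc hy)

theorem pull_eq_zero (h0 : ∀ z ∈ A.target i, z ∉ K → h z = 0) (hx : x ∉ A.inv i '' K) :
    A.pull i h x = 0 := by
  by_cases hs : x ∈ (A.chart i).source
  · rw [pull, indicator_of_mem hs]
    exact h0 _ (coord_mem_target hs) fun hK => hx ⟨_, hK, inv_coord hs⟩
  · rw [pull, indicator_of_notMem hs]

theorem contMDiffAt_pull (hh : ContDiffOn ℝ ∞ h (A.target i)) (hx : x ∈ (A.chart i).source) :
    ContMDiffAt (𝓡∂ n) 𝓘(ℝ, ℝ) ∞ (A.pull i h) x := by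
  have h1 : ContMDiffOn (𝓡∂ n) 𝓘(ℝ, ℝ) ∞ (fun x => h (A.coord i x)) (A.chart i).source :=
    (contMDiffOn_iff_contDiffOn.2 hh).comp contMDiffOn_coord fun x hx => coord_mem_target hx
  have hn := (A.chart i).open_source.mem_nhds hx
  refine (h1.contMDiffAt hn).congr_of_eventuallyEq ?_
  filter_upwards [hn] with z hz
  rw [pull, indicator_of_mem hz]

theorem eventually_notMem_inv_image [T2Space M] (hK : IsCompact K) (hKt : K ⊆ A.target i)
    (hx : x ∉ A.inv i '' K) : ∀ᶠ z in nhds x, z ∉ A.inv i '' K :=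
  (isCompact_inv_image hK hKt).isClosed.isOpen_compl.mem_nhds hx

theorem contMDiff_pull [T2Space M] (hK : IsCompact K) (hKt : K ⊆ A.target i)
    (hh : ContDiffOn ℝ ∞ h (A.target i)) (h0 : ∀ z ∈ A.target i, z ∉ K → h z = 0) :
    ContMDiff (𝓡∂ n) 𝓘(ℝ, ℝ) ∞ (A.pull i h) := by
  intro x
  by_cases hx : x ∈ A.inv i '' K
  · exact contMDiffAt_pull hh (inv_image_subset_source hKt hx)
  · refine (contMDiffAt_const (c := (0 : ℝ))).congr_of_eventuallyEq ?_
    filter_upwards [eventually_notMem_inv_image hK hKt hx] with z hz using pull_eq_zero h0 hz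

variable (A) in
/-- The coordinate function `x^b` of the `i`-th chart. -/
noncomputable def coordFun (i : Fin A.N) (b : Fin n) (x : M) : ℝ := A.coord i x b

theorem contMDiffAt_coordFun (b : Fin n) (hx : x ∈ (A.chart i).source) :
    ContMDiffAt (𝓡∂ n) 𝓘(ℝ, ℝ) ∞ (A.coordFun i b) x :=
  ((EuclideanSpace.proj (𝕜 := ℝ) b).contDiff.contMDiff.contMDiffAt).comp x
    (contMDiffOn_coord.contMDiffAt ((A.chart i).open_source.mem_nhds hx))

/-- The coordinate differentials are dual to the coordinate frame. -/
theorem mfderiv_coordFun_frame (b c : Fin n) (hy : y ∈ A.target i) :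
    (mfderiv (𝓡∂ n) 𝓘(ℝ, ℝ) (A.coordFun i c) (A.inv i y) (A.frame i b y) : ℝ) =
      if b = c then 1 else 0 := by
  have hu := A.uniqueDiffOn_target i
  have h1 : MDifferentiableWithinAt 𝓘(ℝ, EuclideanSpace ℝ (Fin n)) (𝓡∂ n) (A.inv i) (A.target i) y :=
    (A.contMDiffOn_inv i y hy).mdifferentiableWithinAt (by simp)
  have h2 : MDifferentiableAt (𝓡∂ n) 𝓘(ℝ, ℝ) (A.coordFun i c) (A.inv i y) :=
    (contMDiffAt_coordFun c (inv_mem_source hy)).mdifferentiableAt (by simp)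
  have hc := mfderiv_comp_mfderivWithin y h2 h1 (hu.uniqueMDiffOn y hy)
  have e1 : mfderivWithin 𝓘(ℝ, EuclideanSpace ℝ (Fin n)) 𝓘(ℝ, ℝ) (A.coordFun i c ∘ A.inv i)
      (A.target i) y = mfderivWithin 𝓘(ℝ, EuclideanSpace ℝ (Fin n)) 𝓘(ℝ, ℝ)
        (EuclideanSpace.proj (𝕜 := ℝ) c) (A.target i) y :=
    mfderivWithin_congr (fun z hz => by simp only [Function.comp_apply, coordFun, coord_inv hz]; rfl)
      (by simp only [Function.comp_apply, coordFun, coord_inv hy]; rfl)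
  rw [e1, mfderivWithin_eq_fderivWithin, ContinuousLinearMap.fderivWithin _ (hu y hy)] at hc
  have h3 := congrArg (fun L : EuclideanSpace ℝ (Fin n) →L[ℝ] ℝ =>
    L (EuclideanSpace.single b (1 : ℝ))) hc
  have h4 : (EuclideanSpace.single b (1 : ℝ) : EuclideanSpace ℝ (Fin n)) c =
      if b = c then 1 else 0 := by simp [eq_comm]
  exact (Eq.symm h3).trans h4

/-- Components with compact support in the interior of one chart are those of a 1-form. -/
theorem exists_form [T2Space M] (hK : IsCompact K) (hKc : K ⊆ A.core i)
    {C : Fin n → EuclideanSpace ℝ (Fin n) → ℝ} (hC : ∀ b, ContDiffOn ℝ ∞ (C b) (A.target i))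
    (h0 : ∀ b, ∀ z ∈ A.target i, z ∉ K → C b z = 0) :
    ∃ u : OneForm n M, formSupport u ⊆ A.inv i '' K ∧
      ∀ y ∈ A.target i, ∀ b, A.comp u i y b = C b y := by
  have hKt := hKc.trans core_subset_target
  have hK' : IsClosed (A.inv i '' K) := (isCompact_inv_image hK hKt).isClosed
  let s : (b : Fin n) → (x : M) → TangentSpace (𝓡∂ n) x →L[ℝ] ℝ := fun b x =>
    A.pull i (C b) x • (mfderiv (𝓡∂ n) 𝓘(ℝ, ℝ) (A.coordFun i b) x)
  have hs : ∀ b x, x ∉ A.inv i '' K → s b x = 0 := fun b x hx => by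
    simp only [s, pull_eq_zero (h0 b) hx, zero_smul]
    rfl
  have hsm : ∀ b, ContMDiff (𝓡∂ n) ((𝓡∂ n).prod 𝓘(ℝ, EuclideanSpace ℝ (Fin n) →L[ℝ] ℝ)) ∞
      (fun x => TotalSpace.mk' (EuclideanSpace ℝ (Fin n) →L[ℝ] ℝ)
        (E := fun x : M => TangentSpace (𝓡∂ n) x →L[ℝ] ℝ) x (s b x)) := by
    intro b x
    by_cases hx : x ∈ A.inv i '' K
    · have hxs := inv_image_subset_source hKt hx
      exact (contMDiffAt_pull (hC b) hxs).smul_section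
        (contMDiffAt_mfderiv_section (contMDiffAt_coordFun b hxs))
    · refine (contMDiffAt_zeroSection (𝕜 := ℝ)
        (fun x : M => TangentSpace (𝓡∂ n) x →L[ℝ] ℝ)).congr_of_eventuallyEq ?_
      filter_upwards [eventually_notMem_inv_image hK hKt hx] with z hz
      rw [hs b z hz]
      rfl
  let v : Fin n → OneForm n M := fun b => ⟨s b, hsm b⟩
  have hv : ∀ b x, v b x = s b x := fun _ _ => rfl
  have hsum : ∀ x, (∑ b, v b) x = ∑ b, s b x := fun x => by
    simp only [← hv]
    exact (congrFun (map_sum (ContMDiffSection.coeAddHom (𝓡∂ n)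
      (EuclideanSpace ℝ (Fin n) →L[ℝ] ℝ) ∞ (fun x : M => TangentSpace (𝓡∂ n) x →L[ℝ] ℝ)) v
      Finset.univ) x).trans (Finset.sum_apply _ _ _)
  refine ⟨∑ b, v b, closure_minimal (fun x hx => ?_) hK', fun y hy b => ?_⟩
  · by_contra hcon
    exact hx (by rw [hsum]; exact Finset.sum_eq_zero fun b _ => hs b x hcon)
  · rw [comp, hsum]
    have : ∀ c, s c (A.inv i y) (A.frame i b y) = if b = c then C c y else 0 := by
      intro c
      have h1 := mfderiv_coordFun_frame b c hy
      change A.pull i (C c) (A.inv i y) * _ = _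
      rw [pull_inv _ hy]
      refine (congrArg (C c y * ·) h1).trans ?_
      change C c y * (if b = c then (1 : ℝ) else 0) = _
      simp only [mul_ite, mul_one, mul_zero]
    have h2 : (∑ c, s c (A.inv i y)) (A.frame i b y) = ∑ c, s c (A.inv i y) (A.frame i b y) :=
      _root_.sum_apply _ _ _
    rw [h2, Finset.sum_congr rfl fun c _ => this c]
    simp

end FiniteAtlas
end HypStokes

/-! ### Solving `d^*ζ = q` near a point -/

namespace HypStokes
namespace FiniteAtlas
variable {n : ℕ} [NeZero n] {M : Type*} [TopologicalSpace M]
  [ChartedSpace (EuclideanHalfSpace n) M] [IsManifold (𝓡∂ n) ∞ M] {A : FiniteAtlas n M}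
  {i j : Fin A.N} {a : Fin n} {x : M} {y : EuclideanSpace ℝ (Fin n)}
  {K : Set (EuclideanSpace ℝ (Fin n))} {h k : EuclideanSpace ℝ (Fin n) → ℝ}

theorem nonneg_of_mem_target (hy : y ∈ A.target i) : 0 ≤ y 0 := by
  have h1 : y ∈ range (𝓡∂ n) := (A.chart i).extend_target_subset_range hy
  rwa [range_modelWithCornersEuclideanHalfSpace] at h1

theorem mem_core_iff : y ∈ A.core i ↔ y ∈ A.target i ∧ 0 < y 0 := by
  refine ⟨fun hy => ⟨core_subset_target hy, ?_⟩, fun hy => ?_⟩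
  · have h1 := (A.chart i).interior_extend_target_subset_interior_range hy
    rwa [interior_range_modelWithCornersEuclideanHalfSpace] at h1
  · have h1 : A.target i = (𝓡∂ n).symm ⁻¹' (A.chart i).target ∩ range (𝓡∂ n) :=
      (A.chart i).extend_target
    rw [range_modelWithCornersEuclideanHalfSpace] at h1
    have ho : IsOpen ((𝓡∂ n).symm ⁻¹' (A.chart i).target ∩
        {y : EuclideanSpace ℝ (Fin n) | 0 < y 0}) :=
      ((A.chart i).open_target.preimage (𝓡∂ n).continuous_symm).inter
        (isOpen_lt continuous_const (EuclideanSpace.proj (𝕜 := ℝ) (0 : Fin n)).continuous)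
    refine mem_interior.2 ⟨_, ?_, ho, ?_⟩
    · rw [h1]
      exact inter_subset_inter_right _ fun z (hz : 0 < z 0) => hz.le
    · rw [h1] at hy
      exact ⟨hy.1.1, hy.2⟩

/-- Small closed cubes around `p`, cut off at the boundary of the half-space. -/
def halfCube (p : EuclideanSpace ℝ (Fin n)) (ε : ℝ) : Set (EuclideanSpace ℝ (Fin n)) :=
  {y | 0 ≤ y 0} ∩ box (fun k => p k - ε) fun k => p k + ε

theorem isCompact_halfCube (p : EuclideanSpace ℝ (Fin n)) (ε : ℝ) : IsCompact (halfCube p ε) :=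
  (isCompact_box _ _).inter_left
    (isClosed_le continuous_const (EuclideanSpace.proj (𝕜 := ℝ) (0 : Fin n)).continuous)

theorem exists_halfCube_subset (hx : x ∈ (A.chart i).source) {U : Set M} (hU : U ∈ nhds x) :
    ∃ ε, 0 < ε ∧ ∀ y ∈ halfCube (A.coord i x) ε, y ∈ A.target i ∧ A.inv i y ∈ U := by
  have h1 : A.coord i '' (U ∩ (A.chart i).source) ∈ nhdsWithin (A.coord i x) (range (𝓡∂ n)) := by
    have h2 : Filter.map (A.coord i) (nhds x) = nhdsWithin (A.coord i x) (range (𝓡∂ n)) :=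
      (A.chart i).map_extend_nhds hx
    rw [← h2]
    exact Filter.image_mem_map (Filter.inter_mem hU ((A.chart i).open_source.mem_nhds hx))
  obtain ⟨r, hr, hsub⟩ := Metric.mem_nhdsWithin_iff.1 h1
  set e := EuclideanSpace.equiv (Fin n) ℝ with he
  have h2 : e.symm ⁻¹' Metric.ball (A.coord i x) r ∈ nhds (e (A.coord i x)) :=
    e.symm.continuous.continuousAt.preimage_mem_nhds (by
      rw [e.symm_apply_apply]
      exact Metric.ball_mem_nhds _ hr)
  obtain ⟨ε, hε, hball⟩ := Metric.nhds_basis_closedBall.mem_iff.1 h2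
  refine ⟨ε, hε, fun y hy => ?_⟩
  have h3 : e y ∈ Metric.closedBall (e (A.coord i x)) ε := by
    rw [Metric.mem_closedBall, dist_pi_le_iff hε.le]
    intro k
    rw [Real.dist_eq, abs_le]
    have h4 := hy.2 k
    have e1 : e y k = y k := rfl
    have e2 : e (A.coord i x) k = A.coord i x k := rfl
    rw [e1, e2]
    exact ⟨by linarith [h4.1], by linarith [h4.2]⟩
  have h4 : y ∈ Metric.ball (A.coord i x) r := by
    have := hball h3
    rwa [mem_preimage, e.symm_apply_apply] at this
  obtain ⟨z, hz, rfl⟩ := hsub ⟨h4, by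
    rw [range_modelWithCornersEuclideanHalfSpace]
    exact hy.1⟩
  exact ⟨coord_mem_target hz.2, by rw [inv_coord hz.2]; exact hz.1⟩

variable [CompactSpace M]

/-- The integral over `M` of a function supported in one chart. -/
theorem mean_eq_setIntegral (g : Metric n M) {q : M → ℝ} (hq : Continuous q) {S : Set M}
    (hS : IsClosed S) (hSi : S ⊆ (A.chart i).source) (hSint : S ⊆ (𝓡∂ n).interior M)
    (h0 : ∀ x, x ∉ S → q x = 0) :
    A.mean g q = ∫ y in A.target i, A.density g i y * q (A.inv i y) :=
  integral_eq_setIntegral g (F := fun i y => q (A.inv i y)) hS hSi hSint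
    (fun j y hy => by rw [inv_trans (coreOverlap_subset_overlap hy)])
    (continuousOn_comp_inv hq) fun j y _ hyS => h0 _ hyS

variable [T2Space M]

/-- Near every point, even of the boundary, there are bump functions of integral one with support in
the interior. -/
theorem exists_unit_bump (A : FiniteAtlas n M) (g : Metric n M) {U : Set M} (hU : U ∈ nhds x) :
    ∃ (η : M → ℝ) (S : Set M), ContMDiff (𝓡∂ n) 𝓘(ℝ, ℝ) ∞ η ∧ IsClosed S ∧ S ⊆ U ∧
      S ⊆ (𝓡∂ n).interior M ∧ (∀ x, x ∉ S → η x = 0) ∧ A.mean g η = 1 := by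
  obtain ⟨i, hi⟩ := exists_mem_source A x
  obtain ⟨ε, hε, hsub⟩ := exists_halfCube_subset hi hU
  set p := A.coord i x with hp
  have hp0 : 0 ≤ p 0 := nonneg_of_mem_target (coord_mem_target hi)
  set K := box (fun k => p k + ε / 4) fun k => p k + ε / 2 with hK
  have hKcube : ∀ y ∈ K, y ∈ halfCube p ε := fun y hy =>
    ⟨by
      have := (hy 0).1
      change 0 ≤ y 0
      linarith, fun k => ⟨by linarith [(hy k).1], by linarith [(hy k).2]⟩⟩
  have hKc : K ⊆ A.core i := fun y hy => mem_core_iff.2 ⟨(hsub y (hKcube y hy)).1, by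
    linarith [(hy 0).1]⟩
  have hKcomp : IsCompact K := isCompact_box _ _
  have hKt := hKc.trans core_subset_target
  choose θ hθ hθ0 hθ1 using fun k : Fin n =>
    exists_profile (α := p k + ε / 4) (β := p k + ε / 2) (by linarith)
  set f : EuclideanSpace ℝ (Fin n) → ℝ := fun y => ∏ k, θ k (y k) with hf
  have hfs : ContDiff ℝ ∞ f := contDiff_prod fun k _ =>
    (hθ k).comp (EuclideanSpace.proj (𝕜 := ℝ) k).contDiff
  have hf0 : ∀ y, y ∉ K → f y = 0 := by
    intro y hy
    obtain ⟨k, hk⟩ := not_forall.1 hy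
    exact Finset.prod_eq_zero (Finset.mem_univ k) (hθ0 k _ hk)
  set h : EuclideanSpace ℝ (Fin n) → ℝ := fun y => (A.density g i y)⁻¹ * f y with hh
  have hhs : ContDiffOn ℝ ∞ h (A.target i) :=
    ((A.contDiffOn_density g i).inv fun _ hy => (A.density_pos g i hy).ne').mul hfs.contDiffOn
  have hh0 : ∀ y ∈ A.target i, y ∉ K → h y = 0 := fun y _ hy => by
    simp only [hh, hf0 y hy, mul_zero]
  have hη := contMDiff_pull hKcomp hKt hhs hh0
  have hS := (isCompact_inv_image hKcomp hKt).isClosed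
  refine ⟨A.pull i h, A.inv i '' K, hη, hS, ?_, inv_image_subset_interior hKc,
    fun x hx => pull_eq_zero hh0 hx, ?_⟩
  · rintro _ ⟨y, hy, rfl⟩
    exact (hsub y (hKcube y hy)).2
  · rw [mean_eq_setIntegral g hη.continuous hS (inv_image_subset_source hKt)
      (inv_image_subset_interior hKc) fun x hx => pull_eq_zero hh0 hx]
    have e1 : ∀ y ∈ A.target i, A.density g i y * A.pull i h (A.inv i y) = f y := fun y hy => by
      rw [pull_inv h hy]
      exact mul_inv_cancel_left₀ (A.density_pos g i hy).ne' _
    rw [setIntegral_congr_fun (A.measurableSet_target i) e1]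
    rw [setIntegral_eq_integral_of_forall_compl_eq_zero fun y hy => hf0 y fun hyK => hy (hKt hyK)]
    exact integral_prod_profile hθ1

/-- In the coordinates of a chart: vector fields with compact support in the interior, given by their
densities, are the vector fields dual to test forms. -/
theorem exists_form_of_flux (g : Metric n M) (hK : IsCompact K) (hKc : K ⊆ A.core i)
    {B : Fin n → EuclideanSpace ℝ (Fin n) → ℝ} (hB : ∀ a, ContDiff ℝ ∞ (B a))
    (hB0 : ∀ a y, y ∉ K → B a y = 0) :
    ∃ u : OneForm n M, formSupport u ⊆ A.inv i '' K ∧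
      (∀ y ∈ A.core i, A.density g i y * A.codiff g u i y =
        ∑ a, fderiv ℝ (B a) y (EuclideanSpace.single a (1 : ℝ))) ∧
      A.l2Form g u u = ∫ y in A.target i,
        ∑ a, ∑ b, (A.density g i y)⁻¹ * A.gram g i y a b * B b y * B a y := by
  have hKt := hKc.trans core_subset_target
  set C : Fin n → EuclideanSpace ℝ (Fin n) → ℝ := fun b y =>
    ∑ c, A.gram g i y b c * (-(A.density g i y)⁻¹ * B c y) with hC
  have hCs : ∀ b, ContDiffOn ℝ ∞ (C b) (A.target i) := fun b => ContDiffOn.sum fun c _ =>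
    (A.contDiffOn_gram g i b c).mul
      ((((A.contDiffOn_density g i).inv fun _ hy => (A.density_pos g i hy).ne').neg).mul
        (hB c).contDiffOn)
  have hC0 : ∀ b, ∀ z ∈ A.target i, z ∉ K → C b z = 0 := fun b z _ hz => by
    simp only [hC, hB0 _ z hz, mul_zero, Finset.sum_const_zero]
  obtain ⟨u, hu, hcomp⟩ := exists_form hK hKc hCs hC0
  have hraised : ∀ y ∈ A.target i, ∀ a, A.raised g u i a y = -(A.density g i y)⁻¹ * B a y := by
    intro y hy a
    have hdet : IsUnit (A.gram g i y).det := (A.posDef_gram g i hy).det_pos.ne'.isUnit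
    have e1 : A.comp u i y = A.gram g i y *ᵥ fun c => -(A.density g i y)⁻¹ * B c y :=
      funext fun b => hcomp y hy b
    have e2 : A.raised g u i a y = ((A.gram g i y)⁻¹ *ᵥ A.comp u i y) a := rfl
    rw [e2, e1, Matrix.mulVec_mulVec, Matrix.nonsing_inv_mul _ hdet, Matrix.one_mulVec]
  refine ⟨u, hu, fun y hy => ?_, ?_⟩
  · rw [density_mul_codiff g u (core_subset_target hy), ← Finset.sum_neg_distrib]
    refine Finset.sum_congr rfl fun a _ => ?_
    rw [pd_congr (k := fun z => -B a z) (fun z hz => ?_) (core_subset_target hy), pd_eq_fderiv hy,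
      fderiv_fun_neg, _root_.neg_apply, neg_neg]
    have hd := (A.density_pos g i hz).ne'
    simp only [hraised z hz a]
    field_simp
  · rw [l2Form, integral_eq_setIntegral g (isCompact_inv_image hK hKt).isClosed
      (inv_image_subset_source hKt) (inv_image_subset_interior hKc)
      (fun j y hy => formInner_comp_eq g u u hy)
      (A.continuousOn_formInner g i (fun a => (A.contDiffOn_comp u i a).continuousOn)
        fun a => (A.contDiffOn_comp u i a).continuousOn)
      (fun j y hy hyS => by
        rw [comp_eq_zero fun hmem => hyS (hu hmem)]
        simp [formInner])]
    refine setIntegral_congr_fun (A.measurableSet_target i) fun y hy => ?_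
    have hd := (A.density_pos g i hy).ne'
    refine (congrArg (A.density g i y * ·) (sum_mul_raised g u (A.comp u i y)).symm).trans ?_
    refine (Finset.mul_sum _ _ _).trans ?_
    refine Finset.sum_congr rfl fun a _ => ?_
    have e3 : C a y = ∑ c, A.gram g i y a c * (-(A.density g i y)⁻¹ * B c y) := rfl
    rw [hraised y hy, hcomp y hy, e3, Finset.sum_mul, Finset.mul_sum]
    refine Finset.sum_congr rfl fun b _ => ?_
    field_simp

/-- Every point has a neighbourhood in which functions of mean zero with compact support in the
interior are codifferentials of test forms, with a bound in `L²`. -/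
theorem exists_local_codiff (A : FiniteAtlas n M) (g : Metric n M) (x : M) :
    ∃ N : Set M, IsOpen N ∧ x ∈ N ∧ ∃ C, 0 ≤ C ∧ ∀ q : M → ℝ, ContMDiff (𝓡∂ n) 𝓘(ℝ, ℝ) ∞ q →
      ∀ S : Set M, IsClosed S → S ⊆ N → S ⊆ (𝓡∂ n).interior M → (∀ x, x ∉ S → q x = 0) →
      A.mean g q = 0 → ∃ ζ : OneForm n M, IsTestForm ζ ∧ A.delta g ζ = q ∧
        A.l2Form g ζ ζ ≤ C * A.mean g fun x => q x ^ 2 := by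
  obtain ⟨i, hi⟩ := exists_mem_source A x
  obtain ⟨ε, hε, hsub⟩ := exists_halfCube_subset hi (U := univ) Filter.univ_mem
  set p := A.coord i x with hp
  have hp0 : 0 ≤ p 0 := nonneg_of_mem_target (coord_mem_target hi)
  set Q := halfCube p ε with hQ
  have hQt : Q ⊆ A.target i := fun y hy => (hsub y hy).1
  have hQc : IsCompact Q := isCompact_halfCube p ε
  obtain ⟨κ₁, hκ₁⟩ := hQc.bddAbove_image ((A.contDiffOn_density g i).continuousOn.mono hQt)
  have hgc : ContinuousOn (fun y => ∑ a, ∑ b, |(A.density g i y)⁻¹ * A.gram g i y a b|) Q := by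
    refine ContinuousOn.mono ?_ hQt
    refine continuousOn_finsetSum _ fun a _ => continuousOn_finsetSum _ fun b _ => ?_
    exact ((((A.contDiffOn_density g i).inv fun _ hy => (A.density_pos g i hy).ne').mul
      (A.contDiffOn_gram g i a b)).continuousOn).abs
  obtain ⟨κ₂, hκ₂⟩ := hQc.bddAbove_image hgc
  have hκ₁' : ∀ y ∈ Q, A.density g i y ≤ κ₁ := fun y hy => hκ₁ ⟨y, hy, rfl⟩
  have hκ₂' : ∀ y ∈ Q, ∀ a b, |(A.density g i y)⁻¹ * A.gram g i y a b| ≤ |κ₂| := by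
    intro y hy a b
    have h1 : ∑ a, ∑ b, |(A.density g i y)⁻¹ * A.gram g i y a b| ≤ κ₂ := hκ₂ ⟨y, hy, rfl⟩
    refine le_trans ?_ (h1.trans (le_abs_self _))
    exact (Finset.single_le_sum (f := fun b => |(A.density g i y)⁻¹ * A.gram g i y a b|)
      (fun b _ => abs_nonneg _) (Finset.mem_univ b)).trans
      (Finset.single_le_sum (f := fun a => ∑ b, |(A.density g i y)⁻¹ * A.gram g i y a b|)
      (fun a _ => Finset.sum_nonneg fun b _ => abs_nonneg _) (Finset.mem_univ a))
  obtain ⟨C₀, hC₀, hdiv⟩ := exists_div_of_integral_eq_zero (α := fun k => p k + ε / 4)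
    (β := fun k => p k + ε / 2) (fun k => by linarith) (L := 2 * ε) (by linarith)
  set O : Set (EuclideanSpace ℝ (Fin n)) := {y | ∀ k, |y k - p k| < ε} with hO
  have hOo : IsOpen O := by
    have : O = ⋂ k, {y : EuclideanSpace ℝ (Fin n) | |y k - p k| < ε} := by
      ext y
      simp [hO]
    rw [this]
    exact isOpen_iInter_of_finite fun k => isOpen_lt
      (((EuclideanSpace.proj (𝕜 := ℝ) k).continuous.sub continuous_const).abs) continuous_const
  refine ⟨(A.chart i).source ∩ A.coord i ⁻¹' O,
    continuousOn_coord.isOpen_inter_preimage (A.chart i).open_source hOo, ⟨hi, fun k => ?_⟩,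
    |κ₂| * (n * (n * C₀)) * |κ₁|, by positivity, fun q hq S hS hSN hSint hq0 hmean => ?_⟩
  · change |p k - p k| < ε
    simpa using hε
  have hSs : S ⊆ (A.chart i).source := hSN.trans inter_subset_left
  set K₀ := A.coord i '' S with hK₀
  have hK₀c : IsCompact K₀ := isCompact_coord_image hS hSs
  have hK₀core : K₀ ⊆ A.core i := coord_image_subset_core hSs hSint
  -- the support keeps a positive distance from the boundary
  obtain ⟨δ, hδ, hδK⟩ := hK₀c.exists_forall_le' (f := fun y : EuclideanSpace ℝ (Fin n) => y 0)
    (EuclideanSpace.proj (𝕜 := ℝ) (0 : Fin n)).continuous.continuousOn (a := 0)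
    fun y hy => (mem_core_iff.1 (hK₀core hy)).2
  set lo : Fin n → ℝ := fun k => if k = 0 then max (p 0 - ε) (min δ (ε / 4)) else p k - ε with hlo
  set hi' : Fin n → ℝ := fun k => p k + ε with hhi
  have hlo0 : lo 0 = max (p 0 - ε) (min δ (ε / 4)) := if_pos rfl
  have hlo1 : ∀ k, p k - ε ≤ lo k := by
    intro k
    by_cases hk : k = 0
    · subst hk
      rw [hlo0]
      exact le_max_left _ _
    · simp only [hlo, hk, if_false, le_refl]
  have hlo2 : ∀ k, lo k ≤ p k + ε / 4 := by
    intro k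
    by_cases hk : k = 0
    · subst hk
      rw [hlo0]
      exact max_le (by linarith) ((min_le_right _ _).trans (by linarith))
    · simp only [hlo, hk, if_false]
      linarith
  have hlo3 : 0 < lo 0 := by
    rw [hlo0]
    exact lt_max_of_lt_right (lt_min hδ (by linarith))
  set K := box lo hi' with hK
  have hKc : IsCompact K := isCompact_box _ _
  have hKQ : K ⊆ Q := fun y hy => ⟨hlo3.le.trans (hy 0).1, fun k =>
    ⟨(hlo1 k).trans (hy k).1, (hy k).2⟩⟩
  have hKcore : K ⊆ A.core i := fun y hy => mem_core_iff.2
    ⟨hQt (hKQ hy), hlo3.trans_le (hy 0).1⟩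
  have hKt := hKcore.trans core_subset_target
  have hK₀K : K₀ ⊆ K := by
    rintro _ ⟨z, hz, rfl⟩ k
    have h1 : |A.coord i z k - p k| < ε := (hSN hz).2 k
    rw [abs_lt] at h1
    refine ⟨?_, by simp only [hhi]; linarith⟩
    by_cases hk : k = 0
    · subst hk
      rw [hlo0]
      exact max_le (by linarith) ((min_le_left _ _).trans (hδK _ ⟨z, hz, rfl⟩))
    · simp only [hlo, hk, if_false]
      linarith
  have hq0' : ∀ y ∈ A.target i, y ∉ K₀ → q (A.inv i y) = 0 := fun y hy hyK =>
    hq0 _ fun hmem => hyK (mem_coord_image hy hmem)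
  set h : EuclideanSpace ℝ (Fin n) → ℝ := (A.core i).indicator fun y =>
    A.density g i y * q (A.inv i y) with hh
  have hhs : ContDiff ℝ ∞ h := contDiff_indicator isOpen_core hK₀c.isClosed hK₀core
    (((A.contDiffOn_density g i).mul (contDiffOn_comp_inv hq)).mono core_subset_target)
    fun y hy hyK => by rw [hq0' y (core_subset_target hy) hyK, mul_zero]
  have hht : ∀ y ∈ A.target i, h y = A.density g i y * q (A.inv i y) := by
    intro y hy
    by_cases hyc : y ∈ A.core i
    · rw [hh, indicator_of_mem hyc]
    · rw [hh, indicator_of_notMem hyc, hq0' y hy fun hyK => hyc (hK₀core hyK), mul_zero]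
  have hhK : ∀ y, y ∉ K → h y = 0 := by
    intro y hy
    by_cases hyc : y ∈ A.core i
    · rw [hht y (core_subset_target hyc), hq0' y (core_subset_target hyc) fun hyK =>
        hy (hK₀K hyK), mul_zero]
    · rw [hh, indicator_of_notMem hyc]
  have hint : ∫ y, h y = 0 := by
    rw [← setIntegral_eq_integral_of_forall_compl_eq_zero (s := A.target i) fun y hy =>
      hhK y fun hyK => hy (hKt hyK), setIntegral_congr_fun (A.measurableSet_target i) hht,
      ← mean_eq_setIntegral g hq.continuous hS hSs hSint hq0, hmean]
  obtain ⟨B, hBs, hB0, hdec, hBn⟩ := hdiv lo hi'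
    (fun k => ⟨hlo2 k, by simp only [hhi]; linarith, by linarith [hlo1 k]⟩) h hhs hhK hint
  obtain ⟨ζ, hζ, hcod, hl2⟩ := exists_form_of_flux g hKc hKcore hBs hB0
  have hζt : IsTestForm ζ := hζ.trans (inv_image_subset_interior hKcore)
  refine ⟨ζ, hζt, funext fun z => ?_, ?_⟩
  · by_cases hz : z ∈ formSupport ζ
    · obtain ⟨y, hy, rfl⟩ := hζ hz
      have hyc := hKcore hy
      rw [delta_inv g hζt (hKt hy)]
      have h1 := hcod y hyc
      rw [← hdec y, hht y (hKt hy)] at h1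
      exact mul_left_cancel₀ (A.density_pos g i (hKt hy)).ne' h1
    · rw [delta_eq_zero g hζt hz]
      by_contra hne
      have hzS : z ∈ S := by
        by_contra hcon
        exact hne (hq0 z hcon).symm
      have hyt := coord_mem_target (hSs hzS)
      have hyc : A.coord i z ∈ A.core i := hK₀core ⟨z, hzS, rfl⟩
      have h1 := hcod _ hyc
      rw [← hdec, hht _ hyt, ← delta_inv g hζt hyt, inv_coord (hSs hzS),
        delta_eq_zero g hζt hz] at h1
      exact hne (mul_left_cancel₀ (A.density_pos g i hyt).ne' h1)
  · have hBi : ∀ a, Integrable fun y => B a y ^ 2 := fun a =>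
      ((hBs a).continuous.pow 2).integrable_of_hasCompactSupport (HasCompactSupport.intro hKc
        fun y hy => by simp [hB0 a y hy])
    have hsum : Integrable fun y => |κ₂| * (n * ∑ a, B a y ^ 2) :=
      ((integrable_finsetSum _ fun a _ => hBi a).const_mul _).const_mul _
    have hh2 : ∫ y, h y ^ 2 ≤ |κ₁| * A.mean g fun x => q x ^ 2 := by
      rw [mean_eq_setIntegral g (q := fun x => q x ^ 2) (hq.continuous.pow 2) hS hSs hSint
        (fun x hx => by simp [hq0 x hx]), ← integral_const_mul,
        ← setIntegral_eq_integral_of_forall_compl_eq_zero (s := A.target i) fun y hy => by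
          simp [hhK y fun hyK => hy (hKt hyK)]]
      have c1 : ContinuousOn (fun y => h y ^ 2) (A.target i) := (hhs.continuous.pow 2).continuousOn
      have c2 : ContinuousOn (fun y => |κ₁| * (A.density g i y * q (A.inv i y) ^ 2))
          (A.target i) := continuousOn_const.mul ((A.contDiffOn_density g i).continuousOn.mul
            ((continuousOn_comp_inv hq.continuous).pow 2))
      refine setIntegral_mono_on
        (integrableOn_of_eq_zero hKc hKt c1 fun y hy hyK => by simp [hhK y hyK])
        (integrableOn_of_eq_zero hKc hKt c2 fun y hy hyK => by
          simp [hq0' y hy fun hmem => hyK (hK₀K hmem)])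
        (A.measurableSet_target i) fun y hy => ?_
      by_cases hyK : y ∈ K
      · rw [hht y hy]
        have hd := A.density_pos g i hy
        have h1 : A.density g i y ≤ |κ₁| := (hκ₁' y (hKQ hyK)).trans (le_abs_self _)
        have h2 := mul_le_mul_of_nonneg_right h1
          (mul_nonneg hd.le (_root_.sq_nonneg (q (A.inv i y))))
        linarith [h2]
      · rw [hhK y hyK]
        have hd := A.density_pos g i hy
        simp only [ne_eq, OfNat.ofNat_ne_zero, not_false_eq_true, zero_pow]
        positivity
    rw [hl2]
    calc _ ≤ ∫ y in A.target i, |κ₂| * (n * ∑ a, B a y ^ 2) := by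
          have c1 : ContinuousOn (fun y => ∑ a, ∑ b, (A.density g i y)⁻¹ * A.gram g i y a b *
              B b y * B a y) (A.target i) :=
            continuousOn_finsetSum _ fun a _ => continuousOn_finsetSum _ fun b _ =>
              ((((A.contDiffOn_density g i).inv fun _ hy => (A.density_pos g i hy).ne').mul
                (A.contDiffOn_gram g i a b)).continuousOn.mul
                (hBs b).continuous.continuousOn).mul (hBs a).continuous.continuousOn
          refine setIntegral_mono_on
            (integrableOn_of_eq_zero hKc hKt c1 fun y _ hyK => by simp [hB0 _ y hyK])
            hsum.integrableOn (A.measurableSet_target i) fun y hy => ?_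
          by_cases hyK : y ∈ K
          · have h1 : ∀ a b, (A.density g i y)⁻¹ * A.gram g i y a b * B b y * B a y ≤
                |κ₂| * ((B b y ^ 2 + B a y ^ 2) / 2) := by
              intro a b
              rw [mul_assoc]
              have h2 : |B b y * B a y| ≤ (B b y ^ 2 + B a y ^ 2) / 2 := by
                rw [abs_le]
                constructor <;> nlinarith [_root_.sq_nonneg (B b y + B a y),
                  _root_.sq_nonneg (B b y - B a y)]
              refine (le_abs_self _).trans ?_
              rw [abs_mul]
              exact mul_le_mul (hκ₂' y (hKQ hyK) a b) h2 (abs_nonneg _) (abs_nonneg _)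
            refine (Finset.sum_le_sum fun a _ => Finset.sum_le_sum fun b _ => h1 a b).trans
              (le_of_eq ?_)
            simp only [← Finset.mul_sum, add_div, Finset.sum_add_distrib, Finset.sum_const,
              Finset.card_univ, Fintype.card_fin, nsmul_eq_mul, ← Finset.sum_div]
            ring
          · simp [hB0 _ y hyK]
      _ ≤ ∫ y, |κ₂| * (n * ∑ a, B a y ^ 2) := setIntegral_le_integral hsum
          (Filter.Eventually.of_forall fun y => by
            have := Finset.sum_nonneg fun a (_ : a ∈ Finset.univ) => _root_.sq_nonneg (B a y)
            simp only [Pi.zero_apply]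
            positivity)
      _ = |κ₂| * (n * ∑ a, ∫ y, B a y ^ 2) := by
          rw [integral_const_mul, integral_const_mul,
            MeasureTheory.integral_finsetSum _ fun a _ => hBi a]
      _ ≤ |κ₂| * (n * ∑ _a : Fin n, C₀ * ∫ y, h y ^ 2) := by
          gcongr with a _
          exact hBn a
      _ = |κ₂| * (n * (n * C₀)) * ∫ y, h y ^ 2 := by
          simp only [Finset.sum_const, Finset.card_univ, Fintype.card_fin, nsmul_eq_mul]
          ring
      _ ≤ |κ₂| * (n * (n * C₀)) * (|κ₁| * A.mean g fun x => q x ^ 2) := by gcongr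
      _ = _ := by ring

end FiniteAtlas
end HypStokes

/-! ### Solving `d^*ζ = d^*φ` with an `L²` bound -/

namespace HypStokes
namespace FiniteAtlas
variable {n : ℕ} [NeZero n] {M : Type*} [TopologicalSpace M]
  [ChartedSpace (EuclideanHalfSpace n) M] [IsManifold (𝓡∂ n) ∞ M] {A : FiniteAtlas n M}
  {i j : Fin A.N} {a : Fin n} {x : M} {y : EuclideanSpace ℝ (Fin n)}

variable (M) in
/-- The linear space `C₀^∞Ω¹(M)` of test forms. -/
noncomputable def testForms : Submodule ℝ (OneForm n M) where
  carrier := {u | IsTestForm u}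
  add_mem' {u v} hu hv := by
    refine Subset.trans (closure_minimal (t := formSupport u ∪ formSupport v) (fun x hx => ?_)
      (isClosed_closure.union isClosed_closure)) (union_subset hu hv)
    by_contra hcon
    rw [mem_union, not_or] at hcon
    have h1 : u x = 0 := by
      by_contra hne
      exact hcon.1 (subset_closure hne)
    have h2 : v x = 0 := by
      by_contra hne
      exact hcon.2 (subset_closure hne)
    exact hx ((congrArg₂ (· + ·) h1 h2).trans (add_zero _))
  zero_mem' := by
    have h1 : {x : M | (0 : OneForm n M) x ≠ 0} = ∅ := eq_empty_of_forall_notMem fun x hx => hx rfl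
    change closure {x : M | (0 : OneForm n M) x ≠ 0} ⊆ _
    rw [h1, closure_empty]
    exact empty_subset _
  smul_mem' r u hu := by
    refine Subset.trans (closure_mono fun x hx => ?_) hu
    intro h0
    exact hx ((congrArg (r • ·) h0).trans (smul_zero r))

variable (A) in
/-- The codifferential as a linear map. -/
noncomputable def deltaL (g : Metric n M) : OneForm n M →ₗ[ℝ] M → ℝ where
  toFun := A.delta g
  map_add' u v := by
    ext x
    simp only [delta, Pi.add_apply, ← Finset.sum_add_distrib, ← mul_add]
    refine Finset.sum_congr rfl fun j _ => ?_
    by_cases hne : A.ρ j x = 0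
    · rw [hne, zero_mul, zero_mul]
    · rw [A.codiff_add g u v j (coord_mem_target (A.subordinate j (subset_tsupport _ hne)))]
  map_smul' r u := by
    ext x
    simp only [delta, Pi.smul_apply, smul_eq_mul, Finset.mul_sum, RingHom.id_apply]
    refine Finset.sum_congr rfl fun j _ => ?_
    by_cases hne : A.ρ j x = 0
    · rw [hne, zero_mul, zero_mul, mul_zero]
    · rw [A.codiff_smul g r u j (coord_mem_target (A.subordinate j (subset_tsupport _ hne)))]
      ring

theorem deltaL_apply (g : Metric n M) (u : OneForm n M) : A.deltaL g u = A.delta g u := rfl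

theorem mean_const_mul (g : Metric n M) (r : ℝ) (q : M → ℝ) :
    A.mean g (fun x => r * q x) = r * A.mean g q := A.integral_smul g r _

theorem mean_nonneg (g : Metric n M) {q : M → ℝ} (hq : ∀ x, 0 ≤ q x) : 0 ≤ A.mean g q :=
  A.integral_nonneg g fun _ _ _ => hq _

section
variable [CompactSpace M]

theorem mean_add (g : Metric n M) {p q : M → ℝ} (hp : Continuous p) (hq : Continuous q) :
    A.mean g (fun x => p x + q x) = A.mean g p + A.mean g q :=
  A.integral_add g (fun _ => continuousOn_comp_inv hp) fun _ => continuousOn_comp_inv hq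

theorem mean_sub (g : Metric n M) {p q : M → ℝ} (hp : Continuous p) (hq : Continuous q) :
    A.mean g (fun x => p x - q x) = A.mean g p - A.mean g q := by
  have h1 := mean_add (A := A) g hp (q := fun x => (-1) * q x) (continuous_const.mul hq)
  rw [mean_const_mul] at h1
  simp only [neg_one_mul, ← sub_eq_add_neg] at h1
  exact h1

theorem mean_mono (g : Metric n M) {p q : M → ℝ} (hp : Continuous p) (hq : Continuous q)
    (hpq : ∀ x, p x ≤ q x) : A.mean g p ≤ A.mean g q :=
  A.integral_mono g (fun _ => continuousOn_comp_inv hp) (fun _ => continuousOn_comp_inv hq)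
    fun _ _ _ => hpq _

theorem mean_sum (g : Metric n M) {ι : Type*} (s : Finset ι) {q : ι → M → ℝ}
    (hq : ∀ l, Continuous (q l)) :
    A.mean g (fun x => ∑ l ∈ s, q l x) = ∑ l ∈ s, A.mean g (q l) :=
  integral_finsetSum g s fun l _ => continuousOn_comp_inv (hq l)

theorem sq_mean_le (g : Metric n M) {q : M → ℝ} (hq : Continuous q) :
    A.mean g q ^ 2 ≤ A.mean g (fun _ => 1) * A.mean g fun x => q x ^ 2 := by
  have h := cauchySchwarz (fun p q : C(M, ℝ) => A.mean g fun x => p x * q x)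
    (fun p q r => by
      simp only [ContinuousMap.add_apply, add_mul]
      exact mean_add g (by fun_prop) (by fun_prop))
    (fun r p q => by
      simp only [ContinuousMap.smul_apply, smul_eq_mul, mul_assoc]
      exact mean_const_mul g _ _)
    (fun p q => by simp only [mul_comm])
    (fun p => mean_nonneg g fun x => mul_self_nonneg _) (1 : C(M, ℝ)) ⟨q, hq⟩
  simp only [ContinuousMap.one_apply, ContinuousMap.coe_mk, one_mul, ← pow_two] at h
  simpa using h

theorem l2Form_sum_le (g : Metric n M) {ι : Type*} (s : Finset ι) (u : ι → OneForm n M) :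
    A.l2Form g (∑ l ∈ s, u l) (∑ l ∈ s, u l) ≤ s.card * ∑ l ∈ s, A.l2Form g (u l) (u l) := by
  let v : ι → PreL2 A g := u
  have h1 : ‖∑ l ∈ s, v l‖ ^ 2 ≤ s.card * ∑ l ∈ s, ‖v l‖ ^ 2 :=
    (pow_le_pow_left₀ (norm_nonneg _) (norm_sum_le _ _) 2).trans sq_sum_le_card_mul_sum_sq
  simp only [norm_sq_preL2] at h1
  exact h1

theorem l2Form_add_le (g : Metric n M) (u v : OneForm n M) :
    A.l2Form g (u + v) (u + v) ≤ 2 * A.l2Form g u u + 2 * A.l2Form g v v := by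
  let u' : PreL2 A g := u
  let v' : PreL2 A g := v
  have h1 : ‖u' + v'‖ ^ 2 ≤ 2 * ‖u'‖ ^ 2 + 2 * ‖v'‖ ^ 2 :=
    (pow_le_pow_left₀ (norm_nonneg _) (norm_add_le _ _) 2).trans
      (by nlinarith [_root_.sq_nonneg (‖u'‖ - ‖v'‖)])
  simp only [norm_sq_preL2] at h1
  exact h1

theorem l2Form_smul_self (g : Metric n M) (r : ℝ) (u : OneForm n M) :
    A.l2Form g (r • u) (r • u) = r ^ 2 * A.l2Form g u u := by
  rw [l2Form_smul, l2Form_comm, l2Form_smul]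
  ring

end

/-- `q` is a smooth function with compact support in the interior of `M` and in `U`. -/
def IsTestFun (n : ℕ) [NeZero n] {M : Type*} [TopologicalSpace M]
    [ChartedSpace (EuclideanHalfSpace n) M] (U : Set M) (q : M → ℝ) : Prop :=
  ContMDiff (𝓡∂ n) 𝓘(ℝ, ℝ) ∞ q ∧ ∃ S : Set M, IsClosed S ∧ S ⊆ U ∧ S ⊆ (𝓡∂ n).interior M ∧
    ∀ x, x ∉ S → q x = 0

theorem IsTestFun.mono {U U' : Set M} {q : M → ℝ} (hq : IsTestFun n U q) (h : U ⊆ U') :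
    IsTestFun n U' q := by
  obtain ⟨h1, S, hS, hSU, hSi, h0⟩ := hq
  exact ⟨h1, S, hS, hSU.trans h, hSi, h0⟩

theorem IsTestFun.sub {U : Set M} {p q : M → ℝ} (hp : IsTestFun n U p) (hq : IsTestFun n U q) :
    IsTestFun n U fun x => p x - q x := by
  obtain ⟨h1, S, hS, hSU, hSi, h0⟩ := hp
  obtain ⟨h1', S', hS', hSU', hSi', h0'⟩ := hq
  refine ⟨h1.sub h1', S ∪ S', hS.union hS', union_subset hSU hSU', union_subset hSi hSi',
    fun x hx => ?_⟩
  rw [mem_union, not_or] at hx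
  simp only [h0 x hx.1, h0' x hx.2, sub_zero]

theorem IsTestFun.const_mul {U : Set M} {q : M → ℝ} (r : ℝ) (hq : IsTestFun n U q) :
    IsTestFun n U fun x => r * q x := by
  obtain ⟨h1, S, hS, hSU, hSi, h0⟩ := hq
  exact ⟨contMDiff_const.mul h1, S, hS, hSU, hSi, fun x hx => by simp only [h0 x hx, mul_zero]⟩

variable [CompactSpace M] [T2Space M] [ConnectedSpace M]

/-- On a connected manifold, mass can be moved from one place to another by a codifferential. -/
theorem exists_mass_transfer (A : FiniteAtlas n M) (g : Metric n M) {N : M → Set M}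
    (hN : ∀ x, IsOpen (N x)) (hxN : ∀ x, x ∈ N x)
    (hloc : ∀ x q, IsTestFun n (N x) q → A.mean g q = 0 →
      ∃ ζ : OneForm n M, IsTestForm ζ ∧ A.delta g ζ = q) (x y : M) {p q : M → ℝ}
    (hp : IsTestFun n (N x) p) (hp1 : A.mean g p = 1) (hq : IsTestFun n (N y) q)
    (hq1 : A.mean g q = 1) :
    ∃ ξ : OneForm n M, IsTestForm ξ ∧ A.delta g ξ = fun z => p z - q z := by
  have hbump : ∀ (z : M) (U : Set M), U ∈ nhds z → ∃ η, IsTestFun n U η ∧ A.mean g η = 1 := by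
    intro z U hU
    obtain ⟨η, S, h1, h2, h3, h4, h5, h6⟩ := exists_unit_bump A g hU
    exact ⟨η, ⟨h1, S, h2, h3, h4, h5⟩, h6⟩
  have hadd : ∀ {p q r : M → ℝ}, (∃ ξ : OneForm n M, IsTestForm ξ ∧ A.delta g ξ = fun z => p z - q z) →
      (∃ ξ : OneForm n M, IsTestForm ξ ∧ A.delta g ξ = fun z => q z - r z) →
      ∃ ξ : OneForm n M, IsTestForm ξ ∧ A.delta g ξ = fun z => p z - r z := by
    rintro p q r ⟨ξ, hξ, h1⟩ ⟨ξ', hξ', h2⟩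
    refine ⟨ξ + ξ', (testForms M).add_mem hξ hξ', ?_⟩
    rw [← deltaL_apply, map_add, deltaL_apply, deltaL_apply, h1, h2]
    ext z
    simp
  have hsub : ∀ z p q, IsTestFun n (N z) p → A.mean g p = 1 → IsTestFun n (N z) q →
      A.mean g q = 1 → ∃ ξ : OneForm n M, IsTestForm ξ ∧ A.delta g ξ = fun z => p z - q z := by
    intro z p q hp hp1 hq hq1
    refine hloc z _ (hp.sub hq) ?_
    rw [mean_sub g hp.1.continuous hq.1.continuous, hp1, hq1, sub_self]
  have key := isPreconnected_univ.induction₂ (s := (univ : Set M))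
    (fun x y => ∀ p q, IsTestFun n (N x) p → A.mean g p = 1 → IsTestFun n (N y) q →
      A.mean g q = 1 → ∃ ξ : OneForm n M, IsTestForm ξ ∧ A.delta g ξ = fun z => p z - q z)
    (fun x _ => by
      rw [nhdsWithin_univ]
      filter_upwards [(hN x).mem_nhds (hxN x)] with y hy p q hp hp1 hq hq1
      obtain ⟨η, hη, hη1⟩ := hbump y (N x ∩ N y)
        (Filter.inter_mem ((hN x).mem_nhds hy) ((hN y).mem_nhds (hxN y)))
      exact hadd (hsub x p η hp hp1 (hη.mono inter_subset_left) hη1)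
        (hsub y η q (hη.mono inter_subset_right) hη1 hq hq1))
    (fun x y z _ _ _ hxy hyz p q hp hp1 hq hq1 => by
      obtain ⟨η, hη, hη1⟩ := hbump y (N y) ((hN y).mem_nhds (hxN y))
      exact hadd (hxy p η hp hp1 hη hη1) (hyz η q hη hη1 hq hq1))
    (fun x y _ _ hxy p q hp hp1 hq hq1 => by
      obtain ⟨ξ, hξ, h1⟩ := hxy q p hq hq1 hp hp1
      refine ⟨-ξ, (testForms M).neg_mem hξ, ?_⟩
      rw [← deltaL_apply, map_neg, deltaL_apply, h1]
      ext z
      simp)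
    (mem_univ x) (mem_univ y)
  exact key p q hp hp1 hq hq1

/-- The codifferential of a test form is that of a test form which is bounded by it in `L²`. -/
theorem exists_corrector (A : FiniteAtlas n M) (g : Metric n M) :
    ∃ C, 0 ≤ C ∧ ∀ φ : OneForm n M, IsTestForm φ → ∃ ζ : OneForm n M, IsTestForm ζ ∧
      A.delta g ζ = A.delta g φ ∧ A.l2Form g ζ ζ ≤ C * A.codForm g φ φ := by
  choose N hN hxN C hC hloc using exists_local_codiff A g
  have hloc' : ∀ x q, IsTestFun n (N x) q → A.mean g q = 0 → ∃ ζ : OneForm n M, IsTestForm ζ ∧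
      A.delta g ζ = q ∧ A.l2Form g ζ ζ ≤ C x * A.mean g fun x => q x ^ 2 := by
    rintro x q ⟨h1, S, hS, hSU, hSi, h0⟩ hm
    exact hloc x q h1 S hS hSU hSi h0 hm
  obtain ⟨t, ht⟩ := isCompact_univ.elim_nhds_subcover N fun x _ => (hN x).mem_nhds (hxN x)
  obtain ⟨χ, hχ⟩ := SmoothPartitionOfUnity.exists_isSubordinate (𝓡∂ n) (s := (univ : Set M))
    isClosed_univ (fun l : t => N l) (fun l => hN l) (fun x hx => by
      obtain ⟨z, hz, hxz⟩ := mem_iUnion₂.1 (ht.2 hx)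
      exact mem_iUnion.2 ⟨⟨z, hz⟩, hxz⟩)
  have hχ1 : ∀ x, ∑ l, χ l x = 1 := fun x => by
    rw [← finsum_eq_sum_of_fintype]
    exact χ.sum_eq_one (mem_univ x)
  have hbump : ∀ l : t, ∃ η, IsTestFun n (N l) η ∧ A.mean g η = 1 := fun l => by
    obtain ⟨η, S, h1, h2, h3, h4, h5, h6⟩ :=
      exists_unit_bump A g ((hN (l : M)).mem_nhds (hxN l))
    exact ⟨η, ⟨h1, S, h2, h3, h4, h5⟩, h6⟩
  choose η hη hη1 using hbump
  obtain ⟨z₀⟩ : Nonempty M := inferInstance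
  obtain ⟨l₀, hl₀, -⟩ := mem_iUnion₂.1 (ht.2 (mem_univ z₀))
  choose ξ hξ hξδ using fun l : t => exists_mass_transfer A g hN hxN
    (fun x q hq hm => by
      obtain ⟨ζ, h1, h2, -⟩ := hloc' x q hq hm
      exact ⟨ζ, h1, h2⟩) l l₀ (hη l) (hη1 l) (hη ⟨l₀, hl₀⟩) (hη1 _)
  set Vol := A.mean g fun _ => 1 with hVol
  have hVol0 : 0 ≤ Vol := mean_nonneg g fun _ => zero_le_one
  set κ : t → ℝ := fun l => A.mean g fun x => η l x ^ 2 with hκ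
  have hκ0 : ∀ l, 0 ≤ κ l := fun l => mean_nonneg g fun _ => _root_.sq_nonneg _
  refine ⟨(Finset.univ : Finset t).card * ∑ l : t, (2 * (C l * (2 + 2 * (Vol * κ l))) +
    2 * (Vol * A.l2Form g (ξ l) (ξ l))), ?_, fun φ hφ => ?_⟩
  · refine mul_nonneg (Nat.cast_nonneg _) (Finset.sum_nonneg fun l _ => ?_)
    have h1 := hC l
    have h2 := hκ0 l
    have h3 := A.l2Form_nonneg g (ξ l)
    positivity
  set h := A.delta g φ with hh
  have hs : ContMDiff (𝓡∂ n) 𝓘(ℝ, ℝ) ∞ h := contMDiff_delta g hφ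
  have hcod : A.codForm g φ φ = A.mean g fun x => h x ^ 2 := codForm_eq_mean g hφ
  set E := A.codForm g φ φ with hE
  have hE0 : 0 ≤ E := A.codForm_nonneg g φ
  set m : t → ℝ := fun l => A.mean g fun x => χ l x * h x with hm
  have hχh : ∀ l : t, IsTestFun n (N l) fun x => χ l x * h x := fun l =>
    ⟨(χ l).contMDiff.mul hs, tsupport (χ l) ∩ formSupport φ,
      (isClosed_tsupport _).inter isClosed_closure, inter_subset_left.trans (hχ l),
      inter_subset_right.trans hφ, fun x hx => by
        by_cases h1 : x ∈ tsupport (χ l)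
        · have h2 : h x = 0 := delta_eq_zero g hφ fun h2 => hx ⟨h1, h2⟩
          simp only [h2, mul_zero]
        · simp only [image_eq_zero_of_notMem_tsupport h1, zero_mul]⟩
  have hχE : ∀ l, A.mean g (fun x => (χ l x * h x) ^ 2) ≤ E := fun l => by
    rw [hcod]
    refine mean_mono g (((hχh l).1.continuous).pow 2) (hs.continuous.pow 2) fun x => ?_
    have h1 := χ.nonneg l x
    have h2 := χ.le_one l x
    rw [mul_pow]
    exact mul_le_of_le_one_left (_root_.sq_nonneg _) (pow_le_one₀ h1 h2)
  have hm2 : ∀ l, m l ^ 2 ≤ Vol * E := fun l =>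
    (sq_mean_le g (hχh l).1.continuous).trans (mul_le_mul_of_nonneg_left (hχE l) hVol0)
  have hmsum : ∑ l, m l = 0 := by
    rw [hm, ← mean_sum g Finset.univ fun l => (hχh l).1.continuous]
    simp only [← Finset.sum_mul, hχ1, one_mul]
    exact mean_delta g hφ
  set q : t → M → ℝ := fun l x => χ l x * h x - m l * η l x with hq
  have hqt : ∀ l : t, IsTestFun n (N l) (q l) := fun l => (hχh l).sub ((hη l).const_mul (m l))
  have hq0 : ∀ l, A.mean g (q l) = 0 := fun l => by
    rw [hq, mean_sub g (hχh l).1.continuous ((hη l).const_mul (m l)).1.continuous, mean_const_mul,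
      hη1, mul_one, sub_self]
  choose ζ hζ hζδ hζl using fun l : t => hloc' l (q l) (hqt l) (hq0 l)
  have hqE : ∀ l, A.mean g (fun x => q l x ^ 2) ≤ (2 + 2 * (Vol * κ l)) * E := by
    intro l
    have c1 : Continuous fun x => 2 * (χ l x * h x) ^ 2 :=
      continuous_const.mul ((hχh l).1.continuous.pow 2)
    have c2 : Continuous fun x => 2 * m l ^ 2 * η l x ^ 2 :=
      continuous_const.mul ((hη l).1.continuous.pow 2)
    calc A.mean g (fun x => q l x ^ 2)
        ≤ A.mean g fun x => 2 * (χ l x * h x) ^ 2 + 2 * m l ^ 2 * η l x ^ 2 := by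
          refine mean_mono g ((hqt l).1.continuous.pow 2) (c1.add c2) fun x => ?_
          simp only [hq]
          nlinarith [_root_.sq_nonneg (χ l x * h x + m l * η l x)]
      _ = 2 * A.mean g (fun x => (χ l x * h x) ^ 2) + 2 * m l ^ 2 * κ l := by
          rw [mean_add g c1 c2, mean_const_mul, mean_const_mul]
      _ ≤ _ := by nlinarith [hχE l, mul_le_mul_of_nonneg_right (hm2 l) (hκ0 l)]
  refine ⟨∑ l, (ζ l + m l • ξ l), (testForms M).sum_mem fun l _ =>
    (testForms M).add_mem (hζ l) ((testForms M).smul_mem _ (hξ l)), ?_, ?_⟩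
  · rw [← deltaL_apply, map_sum]
    simp only [map_add, map_smul, deltaL_apply, hζδ, hξδ]
    ext x
    rw [Finset.sum_apply]
    have e1 : ∀ l, (q l + m l • fun z => η l z - η ⟨l₀, hl₀⟩ z) x =
        χ l x * h x - m l * η ⟨l₀, hl₀⟩ x := fun l => by
      simp only [hq, Pi.add_apply, Pi.smul_apply, smul_eq_mul]
      ring
    simp only [e1, Finset.sum_sub_distrib, ← Finset.sum_mul, hχ1, hmsum, one_mul, zero_mul,
      sub_zero]
  · refine (l2Form_sum_le g _ _).trans ?_
    rw [mul_assoc, Finset.sum_mul]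
    refine mul_le_mul_of_nonneg_left (Finset.sum_le_sum fun l _ => ?_) (Nat.cast_nonneg _)
    refine (l2Form_add_le g _ _).trans ?_
    rw [l2Form_smul_self]
    have h1 := (hζl l).trans (mul_le_mul_of_nonneg_left (hqE l) (hC l))
    have h2 := mul_le_mul_of_nonneg_right (hm2 l) (A.l2Form_nonneg g (ξ l))
    nlinarith

end FiniteAtlas
end HypStokes

/-! ### The energy triple of the hyperbolic Stokes problem -/

namespace HypStokes
variable {n : ℕ} [NeZero n] {M : Type*} [TopologicalSpace M]
  [ChartedSpace (EuclideanHalfSpace n) M] [IsManifold (𝓡∂ n) ∞ M] [CompactSpace M]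
  (A : FiniteAtlas n M) (g : Metric n M)

/-- The embedding of the smooth 1-forms in `H¹Ω¹(M)` as a linear map. -/
noncomputable def formH1L : OneForm n M →ₗ[ℝ] H1 A g :=
  (UniformSpace.Completion.toComplL (𝕜 := ℝ) (E := PreH1 A g)).toLinearMap

/-- The embedding of the smooth 1-forms in `L²Ω¹(M)` as a linear map. -/
noncomputable def formL2L : OneForm n M →ₗ[ℝ] L2 A g :=
  (UniformSpace.Completion.toComplL (𝕜 := ℝ) (E := PreL2 A g)).toLinearMap

theorem norm_sq_formH1 (u : OneForm n M) :
    ‖formH1 A g u‖ ^ 2 = A.l2Form g u u + A.gradForm g u u :=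
  (congrArg (· ^ 2) (UniformSpace.Completion.norm_coe (E := PreH1 A g) u)).trans (norm_sq_preH1 A g u)

theorem norm_sq_formL2 (u : OneForm n M) : ‖formL2 A g u‖ ^ 2 = A.l2Form g u u :=
  (congrArg (· ^ 2) (UniformSpace.Completion.norm_coe (E := PreL2 A g) u)).trans (norm_sq_preL2 A g u)

theorem mem_H10_iff (v : H1 A g) : v ∈ H10 A g ↔ v ∈ closure (formH1 A g '' {u | IsTestForm u}) := by
  have h1 : Submodule.span ℝ (formH1 A g '' {u | IsTestForm u}) =
      (FiniteAtlas.testForms M).map (formH1L A g) :=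
    le_antisymm (Submodule.span_le.2 (image_subset_iff.2 fun u hu => ⟨u, hu, rfl⟩))
      (by rintro _ ⟨u, hu, rfl⟩; exact Submodule.subset_span ⟨u, hu, rfl⟩)
  rw [H10, h1, ← SetLike.mem_coe, Submodule.topologicalClosure_coe, Submodule.map_coe]
  rfl

theorem exists_seq_of_mem_H10 {v : H1 A g} (hv : v ∈ H10 A g) : ∃ φ : ℕ → OneForm n M,
    (∀ k, IsTestForm (φ k)) ∧ Filter.Tendsto (fun k => formH1 A g (φ k)) Filter.atTop (nhds v) := by
  obtain ⟨x, hx, hlim⟩ := mem_closure_iff_seq_limit.1 ((mem_H10_iff A g v).1 hv)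
  choose φ hφ hφx using hx
  exact ⟨φ, hφ, by simpa only [hφx] using hlim⟩

theorem codForm_eq_zero_of_mem_W {u : OneForm n M} (hu : u ∈ W A g) : A.codForm g u u = 0 := by
  rw [FiniteAtlas.codForm_eq_mean g hu.1, ← zero_mul (A.mean g fun _ => 0),
    ← FiniteAtlas.mean_const_mul]
  refine A.integral_congr g fun i y hy => ?_
  simp only [FiniteAtlas.delta_inv g hu.1 hy, hu.2 i y hy, zero_pow two_ne_zero, mul_zero]

theorem formH1_mem_V {u : OneForm n M} (hu : u ∈ W A g) : formH1 A g u ∈ V A g := by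
  refine (mem_V_iff A g _).2 ⟨(mem_H10_iff A g _).2 (subset_closure ⟨u, hu.1, rfl⟩), ?_⟩
  rw [codInner_formH1, codForm_eq_zero_of_mem_W A g hu]

theorem dInner_comm (u v : H1 A g) : dInner A g u v = dInner A g v u := by
  refine UniformSpace.Completion.induction_on₂ u v (isClosed_eq (by fun_prop) (by fun_prop))
    fun u v => ?_
  have h1 := dInner_formH1 A g u v
  have h2 := dInner_formH1 A g v u
  exact h1.trans ((A.dForm_comm g u v).trans h2.symm)

theorem codInner_comm (u v : H1 A g) : codInner A g u v = codInner A g v u := by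
  refine UniformSpace.Completion.induction_on₂ u v (isClosed_eq (by fun_prop) (by fun_prop))
    fun u v => ?_
  have h1 := codInner_formH1 A g u v
  have h2 := codInner_formH1 A g v u
  exact h1.trans ((A.codForm_comm g u v).trans h2.symm)

theorem dInner_nonneg (u : H1 A g) : 0 ≤ dInner A g u u := by
  refine UniformSpace.Completion.induction_on u (isClosed_le (by fun_prop) (by fun_prop)) fun u => ?_
  exact (A.dForm_nonneg g u).trans_eq (dInner_formH1 A g u u).symm

theorem codInner_nonneg (u : H1 A g) : 0 ≤ codInner A g u u := by
  refine UniformSpace.Completion.induction_on u (isClosed_le (by fun_prop) (by fun_prop)) fun u => ?_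
  exact (A.codForm_nonneg g u).trans_eq (codInner_formH1 A g u u).symm

/-- Gaffney's inequality on `H₀¹Ω¹(M)`. -/
theorem exists_gaffney : ∃ c, 0 < c ∧ ∀ v ∈ H10 A g,
    c * ‖v‖ ^ 2 ≤ dInner A g v v + codInner A g v v + ‖incl A g v‖ ^ 2 := by
  obtain ⟨C, hC, h⟩ := FiniteAtlas.exists_gradForm_le (A := A) g
  refine ⟨(1 + C)⁻¹, by positivity, fun v hv => ?_⟩
  refine closure_minimal (s := formH1 A g '' {u | IsTestForm u})
    (t := {v | (1 + C)⁻¹ * ‖v‖ ^ 2 ≤ dInner A g v v + codInner A g v v + ‖incl A g v‖ ^ 2}) ?_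
    (isClosed_le (by fun_prop) (by fun_prop)) ((mem_H10_iff A g v).1 hv)
  rintro _ ⟨u, hu, rfl⟩
  change (1 + C)⁻¹ * ‖formH1 A g u‖ ^ 2 ≤ _
  rw [dInner_formH1, codInner_formH1, incl_formH1, norm_sq_formH1, norm_sq_formL2,
    inv_mul_le_iff₀ (by positivity)]
  have h1 := h u hu
  have h2 := A.dForm_nonneg g u
  have h3 := A.codForm_nonneg g u
  nlinarith

/-- An element of `H₀¹Ω¹(M)` with vanishing image in `L²Ω¹(M)` has vanishing exterior derivative. -/
theorem dInner_eq_zero_of_incl_eq_zero {v : H1 A g} (hv : v ∈ H10 A g) (h0 : incl A g v = 0)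
    (w : H1 A g) : dInner A g v w = 0 := by
  refine UniformSpace.Completion.induction_on w (isClosed_eq (by fun_prop) (by fun_prop)) fun ψ => ?_
  obtain ⟨C, hC, h⟩ := FiniteAtlas.exists_abs_dForm_le (A := A) g ψ
  obtain ⟨φ, hφ, hlim⟩ := exists_seq_of_mem_H10 A g hv
  have l1 : Filter.Tendsto (fun k => |A.dForm g (φ k) ψ|) Filter.atTop
      (nhds |dInner A g v (formH1 A g ψ)|) := by
    have hc : Continuous fun v => |dInner A g v (formH1 A g ψ)| := by fun_prop
    have := (hc.tendsto v).comp hlim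
    exact this.congr fun k => congrArg abs (dInner_formH1 A g (φ k) ψ)
  have l2 : Filter.Tendsto (fun k => A.l2Form g (φ k) (φ k)) Filter.atTop (nhds 0) := by
    have hc : Continuous fun v => ‖incl A g v‖ ^ 2 := by fun_prop
    have := (hc.tendsto v).comp hlim
    rw [h0, norm_zero, zero_pow two_ne_zero] at this
    refine this.congr fun k => ?_
    simp only [Function.comp_apply, incl_formH1, norm_sq_formL2]
  have key : ∀ δ > 0, |dInner A g v (formH1 A g ψ)| ≤ C * δ := by
    intro δ hδ
    have l3 := (tendsto_const_nhds (x := δ)).add (l2.div_const δ) |>.const_mul C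
    rw [zero_div, add_zero] at l3
    exact le_of_tendsto_of_tendsto' l1 l3 fun k => h (φ k) (hφ k) δ hδ
  have hz : |dInner A g v (formH1 A g ψ)| ≤ 0 := by
    refine le_of_forall_pos_le_add fun ε hε => ?_
    have h1 := key (ε / (C + 1)) (by positivity)
    have h2 : C * (ε / (C + 1)) ≤ ε := by
      rw [← mul_div_assoc, div_le_iff₀ (by positivity)]
      nlinarith
    linarith
  exact abs_eq_zero.1 (le_antisymm hz (abs_nonneg _))

theorem eq_zero_of_incl_eq_zero {v : H1 A g} (hv : v ∈ V A g) (h0 : incl A g v = 0) : v = 0 := by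
  obtain ⟨hv1, hv2⟩ := (mem_V_iff A g v).1 hv
  obtain ⟨c, hc, h⟩ := exists_gaffney A g
  have h1 := h v hv1
  rw [dInner_eq_zero_of_incl_eq_zero A g hv1 h0, hv2, h0, norm_zero] at h1
  have h2 : ‖v‖ ^ 2 ≤ 0 := by nlinarith [_root_.sq_nonneg ‖v‖]
  exact norm_eq_zero.1 (pow_eq_zero_iff two_ne_zero |>.1 (le_antisymm h2 (_root_.sq_nonneg _)))

theorem isClosed_V : IsClosed (V A g : Set (H1 A g)) :=
  (Submodule.isClosed_topologicalClosure _).inter (codInner A g).isClosed_ker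

instance : CompleteSpace (V A g) := (isClosed_V A g).completeSpace_coe

instance : CompleteSpace (H A g) := (Submodule.isClosed_topologicalClosure _).completeSpace_coe

section
variable [T2Space M] [ConnectedSpace M]

/-- `V ⊆ H` in `L²Ω¹(M)`: test forms close to an element of `V` have small codifferential, so that
a correction which is small in `L²` brings them into `W`. -/
theorem incl_mem_H {v : H1 A g} (hv : v ∈ V A g) : incl A g v ∈ H A g := by
  obtain ⟨hv1, hv2⟩ := (mem_V_iff A g v).1 hv
  obtain ⟨φ, hφ, hlim⟩ := exists_seq_of_mem_H10 A g hv1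
  obtain ⟨C, hC, hcor⟩ := FiniteAtlas.exists_corrector A g
  choose ζ hζ hζδ hζl using fun k => hcor (φ k) (hφ k)
  have l1 : Filter.Tendsto (fun k => C * A.codForm g (φ k) (φ k)) Filter.atTop (nhds 0) := by
    have hc : Continuous fun v => C * codInner A g v v := by fun_prop
    have := (hc.tendsto v).comp hlim
    rw [hv2, mul_zero] at this
    refine this.congr fun k => ?_
    simp only [Function.comp_apply, codInner_formH1]
  have l2 : Filter.Tendsto (fun k => formL2 A g (ζ k)) Filter.atTop (nhds 0) := by
    have l3 : Filter.Tendsto (fun k => ‖formL2 A g (ζ k)‖ ^ 2) Filter.atTop (nhds 0) :=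
      squeeze_zero (fun k => _root_.sq_nonneg _) (fun k => by
        rw [norm_sq_formL2]
        exact hζl k) l1
    have l4 := l3.sqrt
    simp only [Real.sqrt_sq (norm_nonneg _), Real.sqrt_zero] at l4
    exact tendsto_zero_iff_norm_tendsto_zero.2 l4
  have l5 : Filter.Tendsto (fun k => formL2 A g (φ k - ζ k)) Filter.atTop (nhds (incl A g v)) := by
    have := (((incl A g).continuous.tendsto v).comp hlim).sub l2
    rw [sub_zero] at this
    refine this.congr fun k => ?_
    simp only [Function.comp_apply, incl_formH1]
    exact (map_sub (formL2L A g) (φ k) (ζ k)).symm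
  refine mem_closure_of_tendsto l5 (Filter.Eventually.of_forall fun k => Submodule.subset_span
    ⟨φ k - ζ k, ?_, rfl⟩)
  have ht : IsTestForm (φ k - ζ k) := (FiniteAtlas.testForms M).sub_mem (hφ k) (hζ k)
  refine ⟨ht, fun i y hy => ?_⟩
  rw [← FiniteAtlas.delta_inv g ht hy, ← FiniteAtlas.deltaL_apply, map_sub,
    FiniteAtlas.deltaL_apply, FiniteAtlas.deltaL_apply, hζδ, sub_self]
  rfl

/-- The embedding of `V` in `H`. -/
noncomputable def inclVH : V A g →L[ℝ] H A g :=
  ((incl A g).comp (V A g).subtypeL).codRestrict (H A g) fun v => incl_mem_H A g v.2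

theorem denseRange_inclVH : DenseRange (inclVH A g) := by
  have hspan : ∀ x ∈ Submodule.span ℝ (formL2 A g '' W A g), ∃ v : V A g, incl A g v = x := by
    intro x hx
    induction hx using Submodule.span_induction with
    | mem x hx =>
      obtain ⟨u, hu, rfl⟩ := hx
      exact ⟨⟨formH1 A g u, formH1_mem_V A g hu⟩, incl_formH1 A g u⟩
    | zero => exact ⟨0, by simp⟩
    | add x y _ _ hx hy =>
      obtain ⟨v, rfl⟩ := hx
      obtain ⟨w, rfl⟩ := hy
      exact ⟨v + w, by simp⟩
    | smul r x _ hx =>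
      obtain ⟨v, rfl⟩ := hx
      exact ⟨r • v, by simp⟩
  intro x
  have hx : (x : L2 A g) ∈ closure (Submodule.span ℝ (formL2 A g '' W A g) : Set (L2 A g)) := x.2
  rw [closure_subtype]
  refine closure_mono (fun y hy => ?_) hx
  obtain ⟨v, hv⟩ := hspan y hy
  exact ⟨inclVH A g v, ⟨v, rfl⟩, hv⟩

/-- The spaces `V` and `H` with the form `⟨du, dv⟩ + ⟨d^*u, d^*v⟩`. -/
noncomputable def energyTriple : EnergyTriple (V A g) (H A g) where
  j := inclVH A g
  a := (dInner A g + codInner A g).bilinearComp (V A g).subtypeL (V A g).subtypeL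
  symm u v := by
    change dInner A g u v + codInner A g u v = dInner A g v u + codInner A g v u
    rw [dInner_comm, codInner_comm]
  nonneg u := add_nonneg (dInner_nonneg A g u) (codInner_nonneg A g u)
  inj := by
    refine (injective_iff_map_eq_zero _).2 fun v hv => Subtype.ext ?_
    exact eq_zero_of_incl_eq_zero A g v.2 (congrArg (Subtype.val) hv)
  dense := denseRange_inclVH A g
  coercive := by
    obtain ⟨c, hc, h⟩ := exists_gaffney A g
    exact ⟨c, hc, fun u => h u ((mem_V_iff A g u).1 u.2).1⟩

/-- Only the projection of the right-hand side to `H` matters for the weak equation. -/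
theorem isWeakSolution_iff (T : ℝ) (f : ℝ → L2 A g) (u₀ : V A g) (u₁ : H A g) (u : ℝ → V A g) :
    IsWeakSolution A g T f u₀ u₁ u ↔ (energyTriple A g).IsWeakWave T
      (fun t => (H A g).orthogonalProjectionOnto (f t)) u₀ u₁ u := by
  have h1 : ∀ (x : L2 A g) (v : V A g), inner ℝ ((H A g).orthogonalProjectionOnto x)
      ((energyTriple A g).j v) = inner ℝ x (incl A g v) := fun x v =>
    (H A g).inner_orthogonalProjectionOnto_eq_of_mem_right (inclVH A g v) x
  have h2 : (fun t => (energyTriple A g).toDualV ((energyTriple A g).j (u t))) =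
      fun t => toDual A g (u t) := rfl
  constructor
  · rintro ⟨hc, h0, ⟨w, hw, hw1, hw2⟩, z, hz, he⟩
    refine ⟨hc, h0, ⟨w, fun t ht => Subtype.ext (hw t ht), hw1, hw2⟩, z, hz, ?_⟩
    filter_upwards [he] with t ht v
    rw [h1]
    exact ht v
  · rintro ⟨hc, h0, ⟨w, hw, hw1, hw2⟩, z, hz, he⟩
    refine ⟨hc, h0, ⟨w, fun t ht => congrArg Subtype.val (hw t ht), hw1, hw2⟩, z, hz, ?_⟩
    filter_upwards [he] with t ht v
    rw [← h1]
    exact ht v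

end
end HypStokes

theorem mainTheorem12 {n : ℕ} [NeZero n] (hn : 2 ≤ n)
    {M : Type*} [TopologicalSpace M] [T2Space M] [CompactSpace M] [ConnectedSpace M]
    [ChartedSpace (EuclideanHalfSpace n) M] [IsManifold (𝓡∂ n) ∞ M]
    (g : HypStokes.Metric n M) (A : HypStokes.FiniteAtlas n M)
    (T : ℝ) (hT : 0 < T)
    (f : ℝ → HypStokes.L2 A g) (hf : MemLp f 2 (volume.restrict (Icc 0 T)))
    (u₀ : HypStokes.V A g) (u₁ : HypStokes.H A g) :
    ∃ u : ℝ → HypStokes.V A g, HypStokes.IsWeakSolution A g T f u₀ u₁ u ∧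
      ∀ w : ℝ → HypStokes.V A g, HypStokes.IsWeakSolution A g T f u₀ u₁ w →
        EqOn w u (Icc 0 T) := by
  simp only [HypStokes.isWeakSolution_iff]
  obtain ⟨u, hu⟩ := (HypStokes.energyTriple A g).exists_isWeakWave hT
    ((HypStokes.H A g).orthogonalProjectionOnto.comp_memLp' hf) u₀ u₁
  exact ⟨u, hu, fun w hw => hw.eqOn hT hu⟩
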